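/- **Setting.** Let $\Lambda=\{n_1\tau_1+n_2\tau_2: n_1,n_2\in\mathbf Z\}\subset\mathbf R^2$ contain $2\pi\mathbf Z^2$, and assume that $\Lambda$ is contained neither in $\{\mu_1+\mu_2\equiv 0\ [2\pi]\}$ nor in $\{\mu_1-\mu_2\equiv 0\ [2\pi]\}$. Write $d(\mu)=\mathrm{dist}(\mu,\Lambda)$, and use on $S^3\subset\mathbf C^2$ the toroidal coordinates $$\Xi(\mu,t)=\Big(\sqrt{\tfrac{1+\sin(\sqrt2 t)}{2}}\,e^{i\mu_1},\ \sqrt{\tfrac{1-\sin(\sqrt2 t)}{2}}\,e^{i\mu_2}\Big).$$ For $a\in(0,1)$ the Clifford torus $C_{a}=\{|z_1|^2=\frac{1+a}2,\ |z_2|^2=\frac{1-a}2\}$ is $\{t=t_a\}$ with $\sin(\sqrt2\,t_a)=a$, and has mean curvature $H_a=\frac{2a}{\sqrt{1-a^2}}$. *Green function.* Let $C_0=\{|z_1|=|z_2|\}\cong\mathbf R^2/2\pi\mathbf Z^2$ be the minimal Clifford torus, with area element $\frac12 d\mu_1d\mu_2$, and let $\mathcal L_{C_0}=2\partial_{\mu_1}^2+2\partial_{\mu_2}^2+4$.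 Let $\Gamma_\Lambda$ be the $\Lambda$-periodic, even function, continuous off $\Lambda$ and integrable on $C_0$, that solves $\mathcal L_{C_0}\Gamma_\Lambda=-2\pi\sum_{p\in\Lambda/2\pi\mathbf Z^2}\delta_p$ weakly on $C_0$; thus $\Gamma_\Lambda(\mu)=-\log|\mu|+\gamma_\Lambda+o(1)$ as $\mu\to0$, with a constant $\gamma_\Lambda$. *Neck size.* For small $a>0$ let $\varepsilon_a$ be the smallest positive solution of $t_a=-\varepsilon_a\log\varepsilon_a+\varepsilon_a(\gamma_\Lambda+\log2)$. *Approximate solution.* Fix a smooth $\eta:\mathbf R^2\to[0,1]$ with $\eta=0$ on $B_{1/2}(0)$ and $\eta=1$ outside $B_2(0)$. Let $T_a=t_a-\varepsilon_a\Gamma_\Lambda$ where $d\ge2\sqrt{\varepsilon_a}$; if $\nu\in\Lambda$ and $\frac12\sqrt{\varepsilon_a}\le|\mu-\nu|\le2\sqrt{\varepsilon_a}$ let $$T_a(\mu)=\eta\big(\tfrac{\mu-\nu}{\sqrt{\varepsilon_a}}\big)\big(t_a-\varepsilon_a\Gamma_\Lambda(\mu)\big)+\Big(1-\eta\big(\tfrac{\mu-\nu}{\sqrt{\varepsilon_a}}\big)\Big)\varepsilon_a\,\mathrm{arcosh}\frac{|\mu-\nu|}{\varepsilon_a}.$$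 Let $\tilde S_a\subset S^3$ be the union of the two graphs $\{\Xi(\mu,\pm T_a(\mu)): d(\mu)\ge\frac12\sqrt{\varepsilon_a}\}$ and, for each $\nu\in\Lambda$, the catenoidal piece $\{\Xi(\nu+\varepsilon_a\cosh s\,(\cos\theta,\sin\theta),\varepsilon_as): \varepsilon_a\cosh s\le\frac12\sqrt{\varepsilon_a}\}$. Let $H$ be the mean curvature (sum of the principal curvatures) of $\tilde S_a$ in $S^3$ with respect to the unit normal that points away from $C_0$ (extended by continuity to $\tilde S_a\cap C_0$), with the sign for which $C_a$ has mean curvature $H_a$. Let $\nabla H$ and $\|\nabla H\|$ be taken with respect to the induced metric. **Proposition.** There are constants $C>0$ and $a_0>0$, depending only on $\Lambda$ (with its generators) and $\eta$, such that for all $0<a<a_0$ the set $\tilde S_a$ is a smooth embedded surface, and at each of its points the following hold. 1. (Torus pieces.) At $\Xi(\mu,t)\in\tilde S_a$ with $d(\mu)\ge\sqrt{\varepsilon_a}$, $$|H-H_a|+d(\mu)\,\|\nabla H\|\le C\,\varepsilon_a^2\log(1/\varepsilon_a)\,d(\mu)^{-2}.$$ 2. (Transition annuli.) At $\Xi(\mu,t)\in\tilde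 S_a$ with $\frac12\sqrt{\varepsilon_a}\le d(\mu)\le2\sqrt{\varepsilon_a}$, $$|H-H_a|+d(\mu)\,\|\nabla H\|\le C\,\varepsilon_a\log(1/\varepsilon_a).$$ 3. (Necks.) At $\Xi(\nu+\varepsilon_a\cosh s\,(\cos\theta,\sin\theta),t)\in\tilde S_a$ with $\nu\in\Lambda$ and $\varepsilon_a\cosh s\le\sqrt{\varepsilon_a}$ (where $t=\pm\varepsilon_a s$ as soon as $\varepsilon_a\cosh s\le\frac12\sqrt{\varepsilon_a}$), $$|H-H_a|+\varepsilon_a\cosh s\,\|\nabla H\|\le C\,\log(1/\varepsilon_a)\,(\cosh s)^{-2}.$$ -/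

import Mathlib

open Set Filter Topology MeasureTheory
open scoped ContDiff

noncomputable section

/-! ### Oriented surfaces in the unit sphere of `ℝ⁴ = ℂ²`

A point `(z₁, z₂)` of `ℂ²` is stored as `(Re z₁, Im z₁, Re z₂, Im z₂)`. -/

/-- The plane, with its Euclidean norm. -/
abbrev Plane : Type := EuclideanSpace ℝ (Fin 2)

/-- `ℝ⁴ = ℂ²`, with its Euclidean norm. -/
abbrev Space4 : Type := EuclideanSpace ℝ (Fin 4)

/-- The partial derivative in the `i`-th coordinate direction of the plane. -/
def pd {F : Type*} [NormedAddCommGroup F] [NormedSpace ℝ F] (i : Fin 2) (f : Plane → F)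
    (q : Plane) : F :=
  fderiv ℝ f q (EuclideanSpace.single i 1)

/-- The induced metric `g_{ij} = ⟨∂ᵢX, ∂ⱼX⟩` of a parametrized surface. -/
def firstForm (X : Plane → Space4) (q : Plane) : Matrix (Fin 2) (Fin 2) ℝ :=
  Matrix.of fun i j => inner ℝ (pd i X q) (pd j X q)

/-- The vector `n` with `⟨n, w⟩ = det (X, ∂₁X, ∂₂X, w)` for all `w`. If `X` takes values in the
unit sphere then `n` is tangent to the sphere and orthogonal to the surface. -/
def normalVector (X : Plane → Space4) (q : Plane) : Space4 :=
  WithLp.toLp 2 fun k : Fin 4 =>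
    Matrix.det (Matrix.of
      ![(X q).ofLp, (pd 0 X q).ofLp, (pd 1 X q).ofLp, (Pi.single k 1 : Fin 4 → ℝ)])

/-- The unit normal (within the sphere) of a parametrized surface in the unit sphere. -/
def unitNormal (X : Plane → Space4) (q : Plane) : Space4 :=
  ‖normalVector X q‖⁻¹ • normalVector X q

/-- The second fundamental form `B_{ij} = g(∇_{∂ᵢ} ∂ⱼ, N)`. Since `N` is tangent to the sphere, the
Levi-Civita connection of the sphere may be replaced by the derivative in `ℝ⁴`. -/
def secondForm (X : Plane → Space4) (q : Plane) : Matrix (Fin 2) (Fin 2) ℝ :=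
  Matrix.of fun i j => inner ℝ (pd i (pd j X) q) (unitNormal X q)

/-- The mean curvature, normalized as the trace of the second fundamental form with respect to the
induced metric (the sum of the principal curvatures). -/
def meanCurvature (X : Plane → Space4) (q : Plane) : ℝ :=
  ((firstForm X q)⁻¹ * secondForm X q).trace

/-- `‖∇H‖`, the norm of the gradient of the mean curvature, both with respect to the induced
metric: `‖∇H‖² = g^{ij} ∂ᵢH ∂ⱼH`. -/
def meanCurvatureGradNorm (X : Plane → Space4) (q : Plane) : ℝ :=
  Real.sqrt (∑ i, ∑ j,
    (firstForm X q)⁻¹ i j * pd i (meanCurvature X) q * pd j (meanCurvature X) q)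

/-- The function `|z₁|² - |z₂|²`, which is `sin (√2 t)` in toroidal coordinates; it vanishes
exactly on the minimal Clifford torus. -/
def height (x : Space4) : ℝ := x 0 ^ 2 + x 1 ^ 2 - x 2 ^ 2 - x 3 ^ 2

/-- `X` is, near `p`, a smooth regular parametrization of a neighbourhood of `X p` in the surface
`S`, whose unit normal `N` points away from the minimal Clifford torus `height = 0` (at points of
this torus itself, `N` is determined by continuity). -/
structure IsOrientedChart (S : Set Space4) (X : Plane → Space4) (p : Plane) : Prop where
  smooth : ContDiffAt ℝ ∞ X p
  immersion : Function.Injective (fderiv ℝ X p)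
  onto_nhds : map X (𝓝 p) = 𝓝[S] (X p)
  orientation : ∀ᶠ q in 𝓝 p, height (X q) ≠ 0 →
    0 < height (X q) * fderiv ℝ height (X q) (unitNormal X q)

/-! ### Clifford tori, toroidal coordinates, and the Green function of the lattice -/

/-- Toroidal coordinates
`Ξ(μ, t) = (√((1 + sin (√2 t))/2) e^{iμ₁}, √((1 - sin (√2 t))/2) e^{iμ₂})`. -/
def toroidal (μ : Plane) (t : ℝ) : Space4 :=
  !₂[Real.sqrt ((1 + Real.sin (Real.sqrt 2 * t)) / 2) * Real.cos (μ 0),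
     Real.sqrt ((1 + Real.sin (Real.sqrt 2 * t)) / 2) * Real.sin (μ 0),
     Real.sqrt ((1 - Real.sin (Real.sqrt 2 * t)) / 2) * Real.cos (μ 1),
     Real.sqrt ((1 - Real.sin (Real.sqrt 2 * t)) / 2) * Real.sin (μ 1)]

/-- The mean curvature `H_a` of the Clifford torus `C_a`. -/
def cliffordH (a : ℝ) : ℝ := 2 * a / Real.sqrt (1 - a ^ 2)

/-- The number `t_a` with `sin (√2 t_a) = a`, so that `C_a` is the torus `t = t_a`. -/
def cliffordHeight (a : ℝ) : ℝ := Real.arcsin a / Real.sqrt 2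

/-- The group `Λ = {n₁ τ₁ + n₂ τ₂ : n₁, n₂ ∈ ℤ}`. -/
def planeLattice (τ₁ τ₂ : Plane) : Set Plane :=
  {μ | ∃ n₁ n₂ : ℤ, μ = (n₁ : ℝ) • τ₁ + (n₂ : ℝ) • τ₂}

/-- The square `[0, 2π)²`, a fundamental domain of the torus `C₀ = ℝ² / 2πℤ²`. -/
def torusCell : Set Plane := {μ | ∀ i, μ i ∈ Ico 0 (2 * Real.pi)}

/-- The Jacobi operator `2 ∂₁² + 2 ∂₂² + 4` of the minimal Clifford torus `C₀`. -/
def cliffordJacobi (φ : Plane → ℝ) (μ : Plane) : ℝ :=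
  2 * pd 0 (pd 0 φ) μ + 2 * pd 1 (pd 1 φ) μ + 4 * φ μ

/-- `Γ` is a weak solution on the torus `C₀` of `L_{C₀} Γ = - 2π ∑_p δ_p`, with a Dirac mass at
each point of `Λ` modulo `2πℤ²`, which is `Λ`-periodic and even, and continuous off `Λ` (this
fixes its values off `Λ`). The area element of `C₀` is `(1/2) dμ₁ dμ₂`. -/
structure IsGreenFunction (Λ : Set Plane) (Γ : Plane → ℝ) : Prop where
  periodic : ∀ ν ∈ Λ, ∀ μ, Γ (μ + ν) = Γ μ
  even : ∀ μ, Γ (-μ) = Γ μ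
  continuousOn : ContinuousOn Γ Λᶜ
  integrableOn : IntegrableOn Γ torusCell
  weak_equation : ∀ φ : Plane → ℝ, ContDiff ℝ ∞ φ →
    (∀ i μ, φ (μ + EuclideanSpace.single i (2 * Real.pi)) = φ μ) →
    ∫ μ in torusCell, Γ μ * cliffordJacobi φ μ * (1 / 2)
      = -(2 * Real.pi) * ∑ᶠ p ∈ Λ ∩ torusCell, φ p

/-- The Green function `Γ_Λ`. -/
def greenFunction (Λ : Set Plane) : Plane → ℝ := Classical.epsilon (IsGreenFunction Λ)

/-- The constant `γ_Λ` in the expansion `Γ_Λ(μ) = - log |μ| + γ_Λ + o(1)` at the origin. -/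
def greenConstant (Λ : Set Plane) : ℝ :=
  limUnder (𝓝[≠] (0 : Plane)) fun μ => greenFunction Λ μ + Real.log ‖μ‖

/-- The neck size `ε_a`: the smallest positive solution `ε` of
`t_a = - ε log ε + ε (γ_Λ + log 2)`. -/
def neckSize (Λ : Set Plane) (a : ℝ) : ℝ :=
  sInf {ε | 0 < ε ∧
    cliffordHeight a = -ε * Real.log ε + ε * (greenConstant Λ + Real.log 2)}

/-! ### The approximate solution -/

/-- A cut-off function which vanishes on `B_{1/2}(0)` and equals `1` outside `B_2(0)`. -/
structure IsCutoff (η : Plane → ℝ) : Prop where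
  smooth : ContDiff ℝ ∞ η
  mem_Icc : ∀ x, η x ∈ Icc (0 : ℝ) 1
  eq_zero : ∀ x, ‖x‖ < 1 / 2 → η x = 0
  eq_one : ∀ x, 2 ≤ ‖x‖ → η x = 1

/-- The perturbed torus `t = t_a - ε_a Γ_Λ(μ)`. -/
def torusGraph (Λ : Set Plane) (a : ℝ) (μ : Plane) : ℝ :=
  cliffordHeight a - neckSize Λ a * greenFunction Λ μ

/-- The upper half `t = ε_a s`, `|μ| = ε_a cosh s`, `s ≥ 0`, of the rescaled catenoid. -/
def catenoidGraph (Λ : Set Plane) (a : ℝ) (μ : Plane) : ℝ :=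
  neckSize Λ a * Real.arcosh (‖μ‖ / neckSize Λ a)

/-- The glued function `T_a`. As soon as the discs of radius `2 √ε_a` around the points of `Λ` are
disjoint, at most one term of the sum is non-zero; then
`T_a(μ) = η((μ - ν)/√ε_a) (t_a - ε_a Γ_Λ(μ)) + (1 - η((μ - ν)/√ε_a)) ε_a s(μ - ν)`
in the disc around `ν ∈ Λ`, and `T_a = t_a - ε_a Γ_Λ` outside these discs. -/
def gluedGraph (Λ : Set Plane) (η : Plane → ℝ) (a : ℝ) (μ : Plane) : ℝ :=
  torusGraph Λ a μ + ∑ᶠ ν ∈ Λ, (1 - η ((Real.sqrt (neckSize Λ a))⁻¹ • (μ - ν))) *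
    (catenoidGraph Λ a (μ - ν) - torusGraph Λ a μ)

/-- The point `ν + ε_a cosh s (cos θ, sin θ)` of the plane. -/
def neckBase (Λ : Set Plane) (a : ℝ) (ν : Plane) (s θ : ℝ) : Plane :=
  ν + (neckSize Λ a * Real.cosh s) • !₂[Real.cos θ, Real.sin θ]

/-- The approximate solution: the two graphs `t = ± T_a(μ)` at distance at least `√ε_a / 2` from
`Λ`, together with the rescaled catenoids `t = ε_a s`, `|μ - ν| = ε_a cosh s ≤ √ε_a / 2`, centred
at the points `ν` of `Λ`. -/
def approxSolution (Λ : Set Plane) (η : Plane → ℝ) (a : ℝ) : Set Space4 :=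
  {x | ∃ μ t, Real.sqrt (neckSize Λ a) / 2 ≤ Metric.infDist μ Λ ∧
      (t = gluedGraph Λ η a μ ∨ t = -gluedGraph Λ η a μ) ∧ x = toroidal μ t} ∪
  {x | ∃ ν ∈ Λ, ∃ s θ : ℝ, neckSize Λ a * Real.cosh s ≤ Real.sqrt (neckSize Λ a) / 2 ∧
      x = toroidal (neckBase Λ a ν s θ) (neckSize Λ a * s)}

end

/-! All three regimes follow from one estimate. With d the distance of μ to Λ and ε the neck size,
|H - H_a| + d‖∇H‖ ≤ C ε² log(1/ε) / d² on the whole surface. On the annuli d ≥ √ε/2 makes the right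
side a multiple of ε log(1/ε); on the necks d = ε cosh s makes it log(1/ε) / cosh² s. Since H and
‖∇H‖ do not depend on the oriented chart (`IsOrientedChart.meanCurvature_congr`), one good chart at
each point suffices.

Graphs. For t = u(μ) the mean curvature is √2 (Δu + 2u) plus products such as u D²u, |∇u|² and u³.
For u = t_a - εΓ the linear part is the constant 2√2 t_a, because (Δ + 2)Γ = 0 off Λ, and it differs
from H_a = 2 tan(√2 t_a) by O(t_a³). As u = O(ε log(1/ε)), ∇u = O(ε/d) and D²u = O(ε/d²), every
error has size ε² log(1/ε) / d² (`UB.graph`). In the annuli, where d² is comparable to ε, the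
equation for ε says that the logarithm and the constant of the torus graph agree with those of the
catenoid. The difference that is cut off is then only O(ε² log(1/ε)) (`UB.gluing`), so it adds no
larger error.

Necks. The Euclidean catenoid is minimal, so the leading terms of the numerator of H cancel. What
remains contains a factor sin(√2 t) = O(ε log(1/ε)) or a gain cosh⁻² s (`UB.neck`).

Green function. What is needed is smoothness off Λ, the equation there, and the expansion -log|x|
A(|x|²) + W(x) at 0, with W smooth and even and A(|x|²) the entire radial solution of (Δ + 2)A = 0,
A(0) = 1. The singular term is cut off and periodized. The source left over is smooth, because A
solves the equation near 0, and it is removed by a Fourier series solution of (Δ + 2)u = F. The only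
obstruction comes from the frequencies (±1, ±1), which the two hypotheses on Λ exclude. Since
`greenFunction` is an arbitrary choice among solutions, uniqueness off Λ is proved too, by duality
with the solvable equation (`IsGreenFunction.eq_of_notMem`).

All estimates are carried out with `UB`: bounds on derivatives at chosen points, each derivative
costing one factor of the local scale, and stable under sums, products and compositions.
Topologically, the surface is the image of the single periodic set |t| = T_a(μ), d ≥ ε, under
toroidal coordinates (`GoodParameter.approxSolution_eq`), which are a covering; this yields charts
onto full neighbourhoods in the surface, hence embeddedness. -/

noncomputable section

/-! ### Volume forms and the mean curvature -/

/-- The determinant of four vectors of `ℝ⁴`. -/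
def vol4 (a b c d : Space4) : ℝ := Matrix.det (Matrix.of ![a.ofLp, b.ofLp, c.ofLp, d.ofLp])

lemma vol4_eq (a b c d : Space4) : vol4 a b c d =
    a 0 * (b 1 * (c 2 * d 3 - c 3 * d 2) - b 2 * (c 1 * d 3 - c 3 * d 1)
      + b 3 * (c 1 * d 2 - c 2 * d 1))
    - a 1 * (b 0 * (c 2 * d 3 - c 3 * d 2) - b 2 * (c 0 * d 3 - c 3 * d 0)
      + b 3 * (c 0 * d 2 - c 2 * d 0))
    + a 2 * (b 0 * (c 1 * d 3 - c 3 * d 1) - b 1 * (c 0 * d 3 - c 3 * d 0)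
      + b 3 * (c 0 * d 1 - c 1 * d 0))
    - a 3 * (b 0 * (c 1 * d 2 - c 2 * d 1) - b 1 * (c 0 * d 2 - c 2 * d 0)
      + b 2 * (c 0 * d 1 - c 1 * d 0)) := by
  simp [vol4, Matrix.det_succ_row_zero, Fin.sum_univ_succ, Fin.succAbove]
  ring

lemma inner_space4 (a b : Space4) :
    inner ℝ a b = a 0 * b 0 + a 1 * b 1 + a 2 * b 2 + a 3 * b 3 := by
  simp [PiLp.inner_apply, Fin.sum_univ_succ]
  ring

lemma normalVector_apply (X : Plane → Space4) (q : Plane) (k : Fin 4) :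
    normalVector X q k = vol4 (X q) (pd 0 X q) (pd 1 X q) (EuclideanSpace.single k 1) := by
  simp [normalVector, vol4]

lemma inner_normalVector (X : Plane → Space4) (q : Plane) (w : Space4) :
    inner ℝ (normalVector X q) w = vol4 (X q) (pd 0 X q) (pd 1 X q) w := by
  rw [inner_space4]
  simp only [normalVector_apply, vol4_eq]
  simp
  ring

/-- A generalized cross product has squared length equal to the Gram determinant of its three
arguments. Here X is a unit vector orthogonal to the tangent vectors, so the 3×3 determinant, which
`e` writes out, reduces to that of the metric. -/
lemma norm_sq_normalVector (X : Plane → Space4) (q : Plane) (h1 : inner ℝ (X q) (X q) = 1)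
    (h0 : ∀ i, inner ℝ (X q) (pd i X q) = 0) :
    ‖normalVector X q‖ ^ 2 = (firstForm X q).det := by
  rw [← real_inner_self_eq_norm_sq, inner_normalVector]
  have e : (firstForm X q).det = inner ℝ (X q) (X q) *
      (inner ℝ (pd 0 X q) (pd 0 X q) * inner ℝ (pd 1 X q) (pd 1 X q)
        - inner ℝ (pd 0 X q) (pd 1 X q) ^ 2)
      - inner ℝ (X q) (pd 0 X q) * (inner ℝ (X q) (pd 0 X q) * inner ℝ (pd 1 X q) (pd 1 X q)
        - inner ℝ (pd 0 X q) (pd 1 X q) * inner ℝ (X q) (pd 1 X q))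
      + inner ℝ (X q) (pd 1 X q) * (inner ℝ (X q) (pd 0 X q) * inner ℝ (pd 0 X q) (pd 1 X q)
        - inner ℝ (pd 0 X q) (pd 0 X q) * inner ℝ (X q) (pd 1 X q)) := by
    rw [h1, h0 0, h0 1, Matrix.det_fin_two]
    simp [firstForm]
    rw [real_inner_comm (pd 0 X q) (pd 1 X q)]
    ring
  rw [e, vol4_eq]
  simp only [normalVector_apply, vol4_eq, inner_space4]
  simp
  ring

/-- The second derivatives paired with the non-normalized normal. -/
def volForm (X : Plane → Space4) (q : Plane) (i j : Fin 2) : ℝ :=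
  vol4 (X q) (pd 0 X q) (pd 1 X q) (pd i (pd j X) q)

/-- Avoids normalizing the normal: the inverse metric contributes one factor det⁻¹, the
normalization det^(-1/2), and together they form the cube. -/
lemma meanCurvature_eq (X : Plane → Space4) (q : Plane) (h1 : inner ℝ (X q) (X q) = 1)
    (h0 : ∀ i, inner ℝ (X q) (pd i X q) = 0) :
    meanCurvature X q = ((firstForm X q) 1 1 * volForm X q 0 0
      - (firstForm X q) 0 1 * (volForm X q 0 1 + volForm X q 1 0)
      + (firstForm X q) 0 0 * volForm X q 1 1) / Real.sqrt (firstForm X q).det ^ 3 := by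
  have hn : ‖normalVector X q‖ = Real.sqrt (firstForm X q).det := by
    rw [← norm_sq_normalVector X q h1 h0, Real.sqrt_sq (norm_nonneg _)]
  have hd : (firstForm X q).det = Real.sqrt (firstForm X q).det ^ 2 := by
    rw [← hn, norm_sq_normalVector X q h1 h0]
  have hs : ∀ i j, secondForm X q i j
      = (Real.sqrt (firstForm X q).det)⁻¹ * volForm X q i j := by
    intro i j
    simp only [secondForm, Matrix.of_apply, unitNormal, inner_smul_right, volForm,
      ← inner_normalVector, hn]
    rw [real_inner_comm]
  have hsymm : firstForm X q 1 0 = firstForm X q 0 1 := by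
    simp [firstForm, real_inner_comm]
  rw [meanCurvature, Matrix.inv_def, Matrix.adjugate_fin_two, Ring.inverse_eq_inv']
  simp only [Matrix.trace_fin_two, Matrix.mul_apply, Fin.sum_univ_two, Matrix.smul_apply,
    smul_eq_mul, hs, hsymm]
  set R := Real.sqrt (firstForm X q).det with hR
  rw [hd]
  simp
  -- For a degenerate metric both sides are 0 by the conventions for inverses, so no immersion
  -- hypothesis is required.
  by_cases h : R = 0
  · simp [h]
  · field_simp
    ring

/-! ### The gradient norm -/

/-- The hypotheses say that g - l is positive semidefinite, through its diagonal and its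
determinant; hence g⁻¹ ≤ l⁻¹. -/
lemma gradSq_le {g : Matrix (Fin 2) (Fin 2) ℝ} {l : ℝ} (hl : 0 < l) (hs : g 1 0 = g 0 1)
    (h0 : l ≤ g 0 0) (h1 : l ≤ g 1 1) (hd : g 0 1 ^ 2 ≤ (g 0 0 - l) * (g 1 1 - l)) (v : Fin 2 → ℝ) :
    ∑ i, ∑ j, g⁻¹ i j * v i * v j ≤ (v 0 ^ 2 + v 1 ^ 2) / l := by
  have hdet : 0 < g 0 0 * g 1 1 - g 0 1 * g 0 1 := by nlinarith
  rw [Matrix.inv_def, Matrix.adjugate_fin_two, Ring.inverse_eq_inv', Matrix.det_fin_two]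
  simp only [Fin.sum_univ_two, Matrix.smul_apply, smul_eq_mul, hs]
  simp
  rw [le_div_iff₀ hl]
  set a := g 0 0
  set b := g 0 1
  set c := g 1 1
  have key : l * (c * v 0 ^ 2 - 2 * b * v 0 * v 1 + a * v 1 ^ 2)
      ≤ (v 0 ^ 2 + v 1 ^ 2) * (a * c - b * b) := by
    -- With A = g - l, the difference of the two sides of `key` is det A · |v|² + l · ⟨v, Av⟩,
    -- because tr A - adj A = A in dimension two. This is the second summand.
    have h2 : 0 ≤ (a - l) * v 0 ^ 2 + 2 * b * (v 0 * v 1) + (c - l) * v 1 ^ 2 := by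
      rcases (sub_nonneg.2 h0).eq_or_lt with h | h
      · have hb : b = 0 := by
          have : b ^ 2 ≤ 0 := by rw [← h] at hd; simpa using hd
          nlinarith [sq_nonneg b]
        rw [← h, hb]; nlinarith [sq_nonneg (v 1)]
      · have : 0 ≤ (a - l) * ((a - l) * v 0 ^ 2 + 2 * b * (v 0 * v 1) + (c - l) * v 1 ^ 2) := by
          nlinarith [sq_nonneg ((a - l) * v 0 + b * v 1), sq_nonneg (v 1),
            mul_nonneg (sub_nonneg.2 hd) (sq_nonneg (v 1))]
        exact nonneg_of_mul_nonneg_right this h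
    nlinarith [mul_nonneg (sub_nonneg.2 hd) (sq_nonneg (v 0)),
      mul_nonneg (sub_nonneg.2 hd) (sq_nonneg (v 1)), mul_nonneg hl.le h2]
  have : (a * c - b * b)⁻¹ * (l * (c * v 0 ^ 2 - 2 * b * v 0 * v 1 + a * v 1 ^ 2))
      ≤ v 0 ^ 2 + v 1 ^ 2 := by
    rw [inv_mul_le_iff₀ hdet]; linarith
  calc _ = (a * c - b * b)⁻¹ * (l * (c * v 0 ^ 2 - 2 * b * v 0 * v 1 + a * v 1 ^ 2)) := by ring
    _ ≤ _ := this

/-- Here l is a length: the metric dominates l² times the flat one, so coordinate derivatives lose a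
factor 1/l. The 2 absorbs the √2 from two components. -/
lemma meanCurvatureGradNorm_le {X : Plane → Space4} {q : Plane} {l B : ℝ} (hl : 0 < l)
    (hB : 0 ≤ B) (h0 : l ^ 2 ≤ firstForm X q 0 0) (h1 : l ^ 2 ≤ firstForm X q 1 1)
    (hd : firstForm X q 0 1 ^ 2 ≤ (firstForm X q 0 0 - l ^ 2) * (firstForm X q 1 1 - l ^ 2))
    (hH : ∀ i, |pd i (meanCurvature X) q| ≤ B) :
    meanCurvatureGradNorm X q ≤ 2 * B / l := by
  have hs : firstForm X q 1 0 = firstForm X q 0 1 := by simp [firstForm, real_inner_comm]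
  rw [meanCurvatureGradNorm]
  refine Real.sqrt_le_iff.2 ⟨by positivity, ?_⟩
  refine (gradSq_le (by positivity) hs h0 h1 hd fun i => pd i (meanCurvature X) q).trans ?_
  rw [div_pow]
  gcongr
  have a0 := sq_le_sq' (neg_le_of_abs_le (hH 0)) (le_of_abs_le (hH 0))
  have a1 := sq_le_sq' (neg_le_of_abs_le (hH 1)) (le_of_abs_le (hH 1))
  nlinarith [sq_nonneg B]

lemma plane_eq_sum (v : Plane) :
    v = v 0 • EuclideanSpace.single (0 : Fin 2) (1 : ℝ) + v 1 • EuclideanSpace.single 1 1 := by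
  ext i; fin_cases i <;> simp

lemma fderiv_eq_pd {F : Type*} [NormedAddCommGroup F] [NormedSpace ℝ F] (f : Plane → F)
    (q v : Plane) : fderiv ℝ f q v = v 0 • pd 0 f q + v 1 • pd 1 f q := by
  conv_lhs => rw [plane_eq_sum v]
  simp [pd]

lemma Filter.EventuallyEq.pd {F : Type*} [NormedAddCommGroup F] [NormedSpace ℝ F] {f g : Plane → F}
    {q : Plane} (h : f =ᶠ[𝓝 q] g) (i : Fin 2) : pd i f =ᶠ[𝓝 q] pd i g := by
  filter_upwards [h.fderiv (𝕜 := ℝ)] with x hx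
  simp [_root_.pd, hx]

lemma pd_apply_coord {n : ℕ} {f : Plane → EuclideanSpace ℝ (Fin n)} {q : Plane}
    (hf : DifferentiableAt ℝ f q) (i : Fin 2) (k : Fin n) :
    pd i f q k = pd i (fun x => f x k) q := by
  have := ((EuclideanSpace.proj (𝕜 := ℝ) k).hasFDerivAt.comp q hf.hasFDerivAt).fderiv
  simp only [pd]
  have h2 : (fun x => f x k) = (EuclideanSpace.proj (𝕜 := ℝ) k) ∘ f := by ext; simp
  rw [h2, this]; simp

lemma ContDiffAt.pd {F : Type*} [NormedAddCommGroup F] [NormedSpace ℝ F] {f : Plane → F}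
    {q : Plane} (h : ContDiffAt ℝ ∞ f q) (i : Fin 2) : ContDiffAt ℝ ∞ (pd i f) q :=
  (h.fderiv_right (m := ∞) (by simp)).clm_apply contDiffAt_const

lemma injective_fderiv_of_det {X : Plane → Space4} {q : Plane} (h : (firstForm X q).det ≠ 0) :
    Function.Injective (fderiv ℝ X q) := by
  refine (injective_iff_map_eq_zero _).2 fun v hv => ?_
  have e : ∀ i, inner ℝ (pd i X q) (fderiv ℝ X q v) = (firstForm X q).mulVec v i := by
    intro i
    rw [fderiv_eq_pd]
    simp [Matrix.mulVec, dotProduct, firstForm, inner_add_right, inner_smul_right, mul_comm]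
  have h0 : (firstForm X q).mulVec v = 0 := by
    ext i; rw [← e, hv]; simp
  have := Matrix.eq_zero_of_mulVec_eq_zero h h0
  ext i; exact congrFun this i

/-! ### Invariance under reparametrization -/

/-- The Jacobian matrix of a map of the plane. -/
def jac (φ : Plane → Plane) (q : Plane) : Matrix (Fin 2) (Fin 2) ℝ :=
  Matrix.of fun k i => pd i φ q k

lemma pd_comp {F : Type*} [NormedAddCommGroup F] [NormedSpace ℝ F] {Y : Plane → F}
    {φ : Plane → Plane} {q : Plane} (hY : DifferentiableAt ℝ Y (φ q))
    (hφ : DifferentiableAt ℝ φ q) (i : Fin 2) :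
    pd i (Y ∘ φ) q = jac φ q 0 i • pd 0 Y (φ q) + jac φ q 1 i • pd 1 Y (φ q) := by
  rw [pd, fderiv_comp q hY hφ, ContinuousLinearMap.comp_apply, fderiv_eq_pd]
  rfl

lemma firstForm_comp {Y : Plane → Space4} {φ : Plane → Plane} {q : Plane}
    (hY : DifferentiableAt ℝ Y (φ q)) (hφ : DifferentiableAt ℝ φ q) :
    firstForm (Y ∘ φ) q = (jac φ q).transpose * firstForm Y (φ q) * jac φ q := by
  ext i j
  simp [firstForm, pd_comp hY hφ, Matrix.mul_apply, inner_add_left, inner_add_right,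
    inner_smul_left, inner_smul_right]
  ring

lemma normalVector_comp {Y : Plane → Space4} {φ : Plane → Plane} {q : Plane}
    (hY : DifferentiableAt ℝ Y (φ q)) (hφ : DifferentiableAt ℝ φ q) :
    normalVector (Y ∘ φ) q = (jac φ q).det • normalVector Y (φ q) := by
  refine ext_inner_right ℝ fun w => ?_
  rw [inner_normalVector, inner_smul_left, inner_normalVector, vol4_eq, vol4_eq,
    Matrix.det_fin_two]
  simp [pd_comp hY hφ]
  ring

/-- The normal scales by the Jacobian determinant, of which normalization leaves only the sign. -/
lemma unitNormal_comp {Y : Plane → Space4} {φ : Plane → Plane} {q : Plane}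
    (hY : DifferentiableAt ℝ Y (φ q)) (hφ : DifferentiableAt ℝ φ q) :
    unitNormal (Y ∘ φ) q = (SignType.sign (jac φ q).det : ℝ) • unitNormal Y (φ q) := by
  rw [unitNormal, normalVector_comp hY hφ, unitNormal, norm_smul, mul_inv, smul_smul, smul_smul]
  congr 1
  rcases lt_trichotomy (jac φ q).det 0 with h | h | h
  · rw [sign_neg h, Real.norm_of_nonpos h.le]
    have := h.ne
    field_simp
    simp [neg_div]
  · simp [h]
  · rw [sign_pos h, Real.norm_of_nonneg h.le]
    have := h.ne'
    field_simp
    simp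

lemma inner_pd_unitNormal (Y : Plane → Space4) (q : Plane) (k : Fin 2) :
    inner ℝ (pd k Y q) (unitNormal Y q) = 0 := by
  rw [unitNormal, inner_smul_right, real_inner_comm, inner_normalVector, vol4_eq]
  fin_cases k <;> simp <;> right <;> ring

lemma ContDiffAt.pd_of_two {F : Type*} [NormedAddCommGroup F] [NormedSpace ℝ F] {f : Plane → F}
    {q : Plane} (h : ContDiffAt ℝ 2 f q) (i : Fin 2) : ContDiffAt ℝ 1 (_root_.pd i f) q :=
  (h.fderiv_right (m := 1) (by norm_num)).clm_apply contDiffAt_const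

lemma pd_pd_comp {Y : Plane → Space4} {φ : Plane → Plane} {q : Plane}
    (hY : ContDiffAt ℝ 2 Y (φ q)) (hφ : ContDiffAt ℝ 2 φ q) (i j : Fin 2) :
    pd i (pd j (Y ∘ φ)) q =
      ∑ k, (pd i (fun x => jac φ x k j) q • pd k Y (φ q)
        + jac φ q k j • ∑ l, jac φ q l i • pd l (pd k Y) (φ q)) := by
  have e : pd j (Y ∘ φ) =ᶠ[𝓝 q] fun x => ∑ k, jac φ x k j • (pd k Y ∘ φ) x := by
    have h1 : ∀ᶠ x in 𝓝 q, ContDiffAt ℝ 1 Y (φ x) :=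
      hφ.continuousAt.eventually ((hY.of_le (by norm_num)).eventually (by norm_num))
    have h2 : ∀ᶠ x in 𝓝 q, ContDiffAt ℝ 1 φ x := (hφ.of_le (by norm_num)).eventually (by norm_num)
    filter_upwards [h1, h2] with x hx1 hx2
    rw [pd_comp (hx1.differentiableAt (by norm_num)) (hx2.differentiableAt (by norm_num))]
    simp
  have hd : ∀ k, DifferentiableAt ℝ (fun x => jac φ x k j) q := fun k =>
    ((EuclideanSpace.proj (𝕜 := ℝ) k).differentiableAt).comp q
      ((hφ.pd_of_two j).differentiableAt (by norm_num))
  have hk : ∀ k, DifferentiableAt ℝ (pd k Y ∘ φ) q := fun k =>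
    ((hY.pd_of_two k).differentiableAt (by norm_num)).comp q (hφ.differentiableAt (by norm_num))
  rw [show pd i (pd j (Y ∘ φ)) q = pd i (fun x => ∑ k, jac φ x k j • (pd k Y ∘ φ) x) q by
    simp only [pd]; rw [e.fderiv_eq]]
  have hsum : HasFDerivAt (fun x => ∑ k, jac φ x k j • (pd k Y ∘ φ) x)
      (∑ k, (jac φ q k j • fderiv ℝ (pd k Y ∘ φ) q
        + (fderiv ℝ (fun x => jac φ x k j) q).smulRight ((pd k Y ∘ φ) q))) q :=
    HasFDerivAt.fun_sum fun k _ => (hd k).hasFDerivAt.smul (hk k).hasFDerivAt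
  rw [pd, hsum.fderiv]
  have hc : ∀ k, fderiv ℝ (pd k Y ∘ φ) q (EuclideanSpace.single i 1)
      = ∑ l, jac φ q l i • pd l (pd k Y) (φ q) := fun k => by
    rw [← pd, pd_comp ((hY.pd_of_two k).differentiableAt (by norm_num))
      (hφ.differentiableAt (by norm_num))]
    simp
  rw [_root_.sum_apply]
  refine Finset.sum_congr rfl fun k _ => ?_
  simp only [_root_.add_apply, _root_.smul_apply, hc,
    ContinuousLinearMap.smulRight_apply, Function.comp]
  rw [add_comm]
  rfl

/-- The second derivatives of φ multiply first derivatives of Y only. These are tangential and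
vanish against the normal, so the second form is a tensor up to orientation. -/
lemma secondForm_comp {Y : Plane → Space4} {φ : Plane → Plane} {q : Plane}
    (hY : ContDiffAt ℝ 2 Y (φ q)) (hφ : ContDiffAt ℝ 2 φ q) :
    secondForm (Y ∘ φ) q = (SignType.sign (jac φ q).det : ℝ) •
      ((jac φ q).transpose * secondForm Y (φ q) * jac φ q) := by
  ext i j
  simp only [secondForm, Matrix.of_apply, pd_pd_comp hY hφ,
    unitNormal_comp (hY.differentiableAt (by norm_num)) (hφ.differentiableAt (by norm_num))]
  simp [Matrix.mul_apply, inner_add_left, inner_smul_left, inner_smul_right,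
    inner_pd_unitNormal, mul_add, add_mul]
  ring

lemma meanCurvature_comp {Y : Plane → Space4} {φ : Plane → Plane} {q : Plane}
    (hY : ContDiffAt ℝ 2 Y (φ q)) (hφ : ContDiffAt ℝ 2 φ q) (hdet : (jac φ q).det ≠ 0) :
    meanCurvature (Y ∘ φ) q = (SignType.sign (jac φ q).det : ℝ) * meanCurvature Y (φ q) := by
  have hu : IsUnit (jac φ q).det := isUnit_iff_ne_zero.2 hdet
  have hu' : IsUnit (jac φ q).transpose.det := by rwa [Matrix.det_transpose]
  rw [meanCurvature, firstForm_comp (hY.differentiableAt (by norm_num))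
    (hφ.differentiableAt (by norm_num)), secondForm_comp hY hφ, Matrix.mul_smul, Matrix.trace_smul,
    smul_eq_mul, meanCurvature]
  congr 1
  rw [Matrix.mul_inv_rev, Matrix.mul_inv_rev]
  have : (jac φ q)⁻¹ * ((firstForm Y (φ q))⁻¹ * (jac φ q).transpose⁻¹) *
      ((jac φ q).transpose * secondForm Y (φ q) * jac φ q)
      = (jac φ q)⁻¹ * (((firstForm Y (φ q))⁻¹ * secondForm Y (φ q)) * jac φ q) := by
    simp only [Matrix.mul_assoc]
    rw [Matrix.nonsing_inv_mul_cancel_left _ _ hu']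
  rw [this, Matrix.trace_mul_comm, Matrix.mul_assoc, Matrix.mul_nonsing_inv _ hu, Matrix.mul_one]

/-- A gradient transforms as a covector, by Jᵀ, and the metric by Jᵀ g J; the Jacobians cancel in
the contraction. -/
lemma gradForm_comp (g J : Matrix (Fin 2) (Fin 2) ℝ) (hJ : J.det ≠ 0) (v : Fin 2 → ℝ) :
    ∑ i, ∑ j, (J.transpose * g * J)⁻¹ i j * (J.transpose.mulVec v) i * (J.transpose.mulVec v) j
      = ∑ i, ∑ j, g⁻¹ i j * v i * v j := by
  have gen : ∀ (A : Matrix (Fin 2) (Fin 2) ℝ) (w : Fin 2 → ℝ),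
      ∑ i, ∑ j, A i j * w i * w j = dotProduct w (A.mulVec w) := by
    intro A w
    simp [dotProduct, Matrix.mulVec]; ring
  have hu : IsUnit J.det := isUnit_iff_ne_zero.2 hJ
  have hu' : IsUnit J.transpose.det := by rwa [Matrix.det_transpose]
  rw [gen, gen, Matrix.mul_inv_rev, Matrix.mul_inv_rev, Matrix.mulVec_mulVec]
  have e : J⁻¹ * (g⁻¹ * J.transpose⁻¹) * J.transpose = J⁻¹ * g⁻¹ := by
    simp only [Matrix.mul_assoc]
    rw [Matrix.nonsing_inv_mul _ hu', Matrix.mul_one]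
  rw [e, Matrix.mulVec_transpose, ← Matrix.dotProduct_mulVec, Matrix.mulVec_mulVec,
    Matrix.mul_nonsing_inv_cancel_left _ _ hu]

/-! ### Comparing two oriented charts at the same point. -/

lemma two_le_infty : (2 : WithTop ℕ∞) ≤ ∞ :=
  WithTop.coe_le_coe.2 (le_top : (2 : ℕ∞) ≤ ⊤)

lemma firstForm_eq_of_eventuallyEq {X Y : Plane → Space4} {q : Plane} (h : X =ᶠ[𝓝 q] Y) :
    firstForm X q = firstForm Y q := by
  ext i j
  simp [firstForm, (h.pd _).self_of_nhds]

lemma unitNormal_eq_of_eventuallyEq {X Y : Plane → Space4} {q : Plane} (h : X =ᶠ[𝓝 q] Y) :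
    unitNormal X q = unitNormal Y q := by
  simp [unitNormal, normalVector, (h.pd _).self_of_nhds, h.self_of_nhds]

lemma meanCurvature_eq_of_eventuallyEq {X Y : Plane → Space4} {q : Plane} (h : X =ᶠ[𝓝 q] Y) :
    meanCurvature X q = meanCurvature Y q := by
  have : secondForm X q = secondForm Y q := by
    ext i j
    simp [secondForm, unitNormal_eq_of_eventuallyEq h, ((h.pd j).pd i).self_of_nhds]
  rw [meanCurvature, meanCurvature, this, firstForm_eq_of_eventuallyEq h]

/-- A linear left inverse L' of dY makes L' ∘ Y a local diffeomorphism at q. If ψ is its local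
inverse, then ψ ∘ L' recovers the parameter of a point Y y, so φ = ψ ∘ L' ∘ X is the transition map.
-/
lemma exists_reparam {S : Set Space4} {X Y : Plane → Space4} {p q : Plane}
    (hX : IsOrientedChart S X p) (hY : IsOrientedChart S Y q) (hpq : X p = Y q) :
    ∃ φ : Plane → Plane, φ p = q ∧ ContDiffAt ℝ ∞ φ p ∧ X =ᶠ[𝓝 p] Y ∘ φ := by
  obtain ⟨L, hL⟩ := LinearMap.exists_leftInverse_of_injective (fderiv ℝ Y q : Plane →ₗ[ℝ] Space4)
    (LinearMap.ker_eq_bot.2 hY.immersion)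
  set L' : Space4 →L[ℝ] Plane := LinearMap.toContinuousLinearMap L with hL'
  have hcomp : ContDiffAt ℝ ∞ (L' ∘ Y) q := L'.contDiff.contDiffAt.comp q hY.smooth
  have hder : HasFDerivAt (L' ∘ Y) ((ContinuousLinearEquiv.refl ℝ Plane : Plane →L[ℝ] Plane)) q := by
    have h := (L'.hasFDerivAt (x := Y q)).comp q
      (hY.smooth.differentiableAt (by norm_num)).hasFDerivAt
    have e : (ContinuousLinearEquiv.refl ℝ Plane : Plane →L[ℝ] Plane) = L'.comp (fderiv ℝ Y q) := by
      ext1 v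
      exact (LinearMap.congr_fun hL v).symm
    rw [e]; exact h
  set ψ := hcomp.localInverse hder (by norm_num) with hψ
  have hψ1 : ContDiffAt ℝ ∞ ψ (L' (Y q)) := hcomp.to_localInverse hder (by norm_num)
  have hψ2 : ∀ᶠ y in 𝓝 q, ψ (L' (Y y)) = y := by
    have hs := hcomp.hasStrictFDerivAt' hder (by norm_num)
    exact hs.eventually_left_inverse
  refine ⟨ψ ∘ L' ∘ X, ?_, ?_, ?_⟩
  · have := hψ2.self_of_nhds
    simpa [hpq] using this
  · refine ContDiffAt.comp p ?_ (L'.contDiff.contDiffAt.comp p hX.smooth)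
    simpa [hpq] using hψ1
  -- Both charts map onto the same neighbourhood filter in S, so X x is a point Y y with y as close
  -- to q as desired. Smoothness of X and Y alone would not give this.
  · have h1 : ∀ᶠ x in map X (𝓝 p), ∃ y, ψ (L' (Y y)) = y ∧ Y y = x := by
      rw [hX.onto_nhds, hpq, ← hY.onto_nhds]
      exact hψ2.mono fun y hy => ⟨y, hy, rfl⟩
    filter_upwards [eventually_map.1 h1] with x ⟨y, hy, hyx⟩
    simp only [Function.comp]
    rw [← hyx, hy]

lemma jac_det_continuousAt {φ : Plane → Plane} {p : Plane} (hφ : ContDiffAt ℝ ∞ φ p) :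
    ContinuousAt (fun x => (jac φ x).det) p := by
  have h : ∀ k i, ContinuousAt (fun x => jac φ x k i) p := fun k i =>
    ((EuclideanSpace.proj (𝕜 := ℝ) k).continuous.continuousAt).comp (hφ.pd i).continuousAt
  simp only [Matrix.det_fin_two]
  exact ((h 0 0).mul (h 1 1)).sub ((h 0 1).mul (h 1 0))

/-- Mean curvature and its gradient do not depend on the oriented chart. -/
theorem IsOrientedChart.meanCurvature_congr {S : Set Space4} {X Y : Plane → Space4} {p q : Plane}
    (hX : IsOrientedChart S X p) (hY : IsOrientedChart S Y q) (hpq : X p = Y q)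
    (hne : ∃ᶠ y in 𝓝 q, height (Y y) ≠ 0) (hd : DifferentiableAt ℝ (meanCurvature Y) q) :
    meanCurvature X p = meanCurvature Y q ∧
      meanCurvatureGradNorm X p = meanCurvatureGradNorm Y q := by
  obtain ⟨φ, hφq, hφ, he⟩ := exists_reparam hX hY hpq
  subst hφq
  have hφd := hφ.differentiableAt (by norm_num)
  have hYd := hY.smooth.differentiableAt (by norm_num)
  -- X is an immersion and factors through φ, so no vector is killed by dφ.
  have hdet : (jac φ p).det ≠ 0 := by
    intro h0
    obtain ⟨v, hv0, hv⟩ := Matrix.exists_mulVec_eq_zero_iff.2 h0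
    refine hv0 ?_
    have hz : fderiv ℝ X p (WithLp.toLp 2 v) = 0 := by
      rw [he.fderiv_eq, fderiv_comp p hYd hφd, ContinuousLinearMap.comp_apply]
      have : fderiv ℝ φ p (WithLp.toLp 2 v) = 0 := by
        rw [fderiv_eq_pd]
        ext k
        have := congrFun hv k
        simpa [Matrix.mulVec, dotProduct, jac, mul_comm] using this
      rw [this, map_zero]
    have := hX.immersion (hz.trans (map_zero _).symm)
    simpa using congrArg WithLp.ofLp this
  have hφe : ∀ᶠ x in 𝓝 p, ContDiffAt ℝ 2 φ x :=
    (hφ.of_le two_le_infty).eventually (by norm_num)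
  have hYe : ∀ᶠ x in 𝓝 p, ContDiffAt ℝ 2 Y (φ x) :=
    hφ.continuousAt.eventually
      ((hY.smooth.of_le two_le_infty).eventually (by norm_num))
  have hXe := he.eventuallyEq_nhds
  have hcont := jac_det_continuousAt hφ
  rcases lt_or_gt_of_ne hdet with hneg | hpos
  -- A negative Jacobian makes the two unit normals opposite near p. At a nearby point of nonzero
  -- height both should point away from C₀, a contradiction; `hne` supplies such a point even if p
  -- itself lies on C₀.
  · exfalso
    have hfr : ∃ᶠ x in 𝓝 p, height (X x) ≠ 0 := by
      have h1 : ∃ᶠ z in map Y (𝓝 (φ p)), height z ≠ 0 := by simpa using! hne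
      rw [hY.onto_nhds, ← hpq, ← hX.onto_nhds] at h1
      simpa using! h1
    have ho : ∀ᶠ x in 𝓝 p, height (Y (φ x)) ≠ 0 →
        0 < height (Y (φ x)) * fderiv ℝ height (Y (φ x)) (unitNormal Y (φ x)) :=
      hφ.continuousAt.eventually hY.orientation
    obtain ⟨x, hx, h1, h2, h3, h4, h5, h6⟩ := (hfr.and_eventually (hX.orientation.and (ho.and
      (hφe.and (hYe.and (hXe.and (hcont.eventually (gt_mem_nhds hneg)))))))).exists
    have hxe := h5.self_of_nhds
    have hn : unitNormal X x = -unitNormal Y (φ x) := by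
      rw [unitNormal_eq_of_eventuallyEq h5, unitNormal_comp (h4.differentiableAt (by norm_num))
        (h3.differentiableAt (by norm_num)), sign_neg h6]
      simp
    have h7 := h1 hx
    rw [hn, hxe] at h7
    rw [hxe] at hx
    have h8 := h2 hx
    simp only [Function.comp, map_neg] at h7
    linarith
  · have hm : meanCurvature X =ᶠ[𝓝 p] meanCurvature Y ∘ φ := by
      filter_upwards [hφe, hYe, hXe, hcont.eventually (lt_mem_nhds hpos)] with x h3 h4 h5 h6
      rw [meanCurvature_eq_of_eventuallyEq h5, meanCurvature_comp h4 h3 (ne_of_gt h6), sign_pos h6]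
      simp
    refine ⟨hm.self_of_nhds, ?_⟩
    rw [meanCurvatureGradNorm, meanCurvatureGradNorm, firstForm_eq_of_eventuallyEq he,
      firstForm_comp hYd hφd,
      ← gradForm_comp (firstForm Y (φ p)) _ hdet fun k => pd k (meanCurvature Y) (φ p)]
    have hv : ∀ i, pd i (meanCurvature X) p
        = (jac φ p).transpose.mulVec (fun k => pd k (meanCurvature Y) (φ p)) i := by
      intro i
      rw [(hm.pd i).self_of_nhds, pd_comp hd hφd]
      simp [Matrix.mulVec, dotProduct]
    simp only [hv]

/-! ### Partial derivatives of real functions -/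

section pd
variable {f g : Plane → ℝ} {q : Plane} (i : Fin 2)

lemma pd_add (hf : DifferentiableAt ℝ f q) (hg : DifferentiableAt ℝ g q) :
    pd i (fun x => f x + g x) q = pd i f q + pd i g q := by
  simp [pd, fderiv_fun_add hf hg]

lemma pd_sub (hf : DifferentiableAt ℝ f q) (hg : DifferentiableAt ℝ g q) :
    pd i (fun x => f x - g x) q = pd i f q - pd i g q := by
  simp [pd, fderiv_fun_sub hf hg]

lemma pd_mul (hf : DifferentiableAt ℝ f q) (hg : DifferentiableAt ℝ g q) :
    pd i (fun x => f x * g x) q = pd i f q * g q + f q * pd i g q := by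
  simp [pd, fderiv_fun_mul hf hg]
  ring

lemma pd_const (c : ℝ) : pd i (fun _ => c) q = 0 := by simp [pd]

lemma pd_const_mul (c : ℝ) (f : Plane → ℝ) : pd i (fun x => c * f x) q = c * pd i f q := by
  have : (fun x => c * f x) = c • f := rfl
  rw [pd, this, fderiv_const_smul_field]; simp [pd]

lemma pd_neg (f : Plane → ℝ) : pd i (fun x => - f x) q = - pd i f q := by
  simp [pd]

lemma pd_real_comp {h : ℝ → ℝ} {h' : ℝ} (hh : HasDerivAt h h' (f q))
    (hf : DifferentiableAt ℝ f q) : pd i (fun x => h (f x)) q = h' * pd i f q := by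
  have := (hh.comp_hasFDerivAt q hf.hasFDerivAt).fderiv
  simp only [pd]
  rw [show (fun x => h (f x)) = h ∘ f from rfl, this]
  simp

lemma pd_coord (j : Fin 2) : pd i (fun x : Plane => x j) q = if i = j then 1 else 0 := by
  have : HasFDerivAt (fun x : Plane => x j) (EuclideanSpace.proj (𝕜 := ℝ) j : Plane →L[ℝ] ℝ) q :=
    (EuclideanSpace.proj (𝕜 := ℝ) j : Plane →L[ℝ] ℝ).hasFDerivAt
  rw [pd, this.fderiv]
  simp [eq_comm]

end pd

/-! ### Surfaces in toroidal coordinates -/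

/-- The point of the sphere with toroidal coordinates `(m₀, m₁, t)`, written without roots. -/
def torusPoint (m₀ m₁ t : ℝ) : Space4 :=
  !₂[Real.cos (Real.pi / 4 - t / Real.sqrt 2) * Real.cos m₀,
     Real.cos (Real.pi / 4 - t / Real.sqrt 2) * Real.sin m₀,
     Real.sin (Real.pi / 4 - t / Real.sqrt 2) * Real.cos m₁,
     Real.sin (Real.pi / 4 - t / Real.sqrt 2) * Real.sin m₁]

lemma two_mul_div_sqrt_two (t : ℝ) : 2 * (t / Real.sqrt 2) = Real.sqrt 2 * t := by
  have h : Real.sqrt 2 * Real.sqrt 2 = 2 := Real.mul_self_sqrt (by norm_num)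
  have h0 : Real.sqrt 2 ≠ 0 := by positivity
  field_simp
  linear_combination -t * h

lemma sq_cos_toroidal (t : ℝ) : Real.cos (Real.pi / 4 - t / Real.sqrt 2) ^ 2
    = (1 + Real.sin (Real.sqrt 2 * t)) / 2 := by
  rw [Real.cos_sq, ← two_mul_div_sqrt_two, ← Real.cos_pi_div_two_sub]
  ring_nf

lemma sq_sin_toroidal (t : ℝ) : Real.sin (Real.pi / 4 - t / Real.sqrt 2) ^ 2
    = (1 - Real.sin (Real.sqrt 2 * t)) / 2 := by
  rw [Real.sin_sq, sq_cos_toroidal]; ring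

lemma cos_mul_sin_toroidal (t : ℝ) : Real.cos (Real.pi / 4 - t / Real.sqrt 2) *
    Real.sin (Real.pi / 4 - t / Real.sqrt 2) = Real.cos (Real.sqrt 2 * t) / 2 := by
  have : Real.sin (2 * (Real.pi / 4 - t / Real.sqrt 2)) = Real.cos (Real.sqrt 2 * t) := by
    rw [← two_mul_div_sqrt_two, ← Real.sin_pi_div_two_sub]; ring_nf
  rw [← this, Real.sin_two_mul]; ring

lemma sqrt_two_lt : Real.sqrt 2 < 3 / 2 := by
  rw [Real.sqrt_lt' (by norm_num)]; norm_num

lemma abs_sqrt_two_mul_lt {t : ℝ} (ht : |t| ≤ 1) : |Real.sqrt 2 * t| < Real.pi / 2 := by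
  rw [abs_mul, abs_of_pos (by positivity : (0 : ℝ) < Real.sqrt 2)]
  nlinarith [sqrt_two_lt, Real.pi_gt_three, abs_nonneg t, Real.sqrt_nonneg 2]

lemma toroidal_angle_mem {t : ℝ} (ht : |t| ≤ 1) :
    0 < Real.pi / 4 - t / Real.sqrt 2 ∧ Real.pi / 4 - t / Real.sqrt 2 < Real.pi / 2 := by
  have h := abs_lt.1 (abs_sqrt_two_mul_lt ht)
  rw [← two_mul_div_sqrt_two] at h
  constructor <;> linarith [h.1, h.2]

lemma cos_toroidal_pos {t : ℝ} (ht : |t| ≤ 1) : 0 < Real.cos (Real.pi / 4 - t / Real.sqrt 2) :=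
  Real.cos_pos_of_mem_Ioo ⟨by linarith [(toroidal_angle_mem ht).1, Real.pi_pos],
    (toroidal_angle_mem ht).2⟩

lemma sin_toroidal_pos {t : ℝ} (ht : |t| ≤ 1) : 0 < Real.sin (Real.pi / 4 - t / Real.sqrt 2) :=
  Real.sin_pos_of_mem_Ioo ⟨(toroidal_angle_mem ht).1,
    by linarith [(toroidal_angle_mem ht).2, Real.pi_pos]⟩

/-- Half-angle formulas remove the roots. For |t| ≤ 1 the angle π/4 - t/√2 stays in (0, π/2), so
sine and cosine are the positive roots. -/
lemma toroidal_eq_torusPoint {μ : Plane} {t : ℝ} (ht : |t| ≤ 1) :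
    toroidal μ t = torusPoint (μ 0) (μ 1) t := by
  rw [toroidal, torusPoint, ← sq_cos_toroidal, ← sq_sin_toroidal,
    Real.sqrt_sq (cos_toroidal_pos ht).le, Real.sqrt_sq (sin_toroidal_pos ht).le]

/-- Rotation of the two complex coordinates by the angles `m₀` and `m₁`. -/
def rot (m₀ m₁ : ℝ) (w : Fin 4 → ℝ) : Space4 :=
  !₂[w 0 * Real.cos m₀ - w 1 * Real.sin m₀, w 0 * Real.sin m₀ + w 1 * Real.cos m₀,
     w 2 * Real.cos m₁ - w 3 * Real.sin m₁, w 2 * Real.sin m₁ + w 3 * Real.cos m₁]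

lemma inner_rot (m₀ m₁ : ℝ) (v w : Fin 4 → ℝ) : inner ℝ (rot m₀ m₁ v) (rot m₀ m₁ w)
    = v 0 * w 0 + v 1 * w 1 + v 2 * w 2 + v 3 * w 3 := by
  rw [inner_space4]
  simp [rot]
  linear_combination (v 0 * w 0 + v 1 * w 1) * Real.sin_sq_add_cos_sq m₀
    + (v 2 * w 2 + v 3 * w 3) * Real.sin_sq_add_cos_sq m₁

/-- The rotation has determinant one. Keeping the factors sin² + cos² explicit turns the claim into
a polynomial identity. -/
lemma vol4_rot (m₀ m₁ : ℝ) (a b c d : Fin 4 → ℝ) :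
    vol4 (rot m₀ m₁ a) (rot m₀ m₁ b) (rot m₀ m₁ c) (rot m₀ m₁ d)
      = vol4 (WithLp.toLp 2 a) (WithLp.toLp 2 b) (WithLp.toLp 2 c) (WithLp.toLp 2 d) := by
  have h : vol4 (rot m₀ m₁ a) (rot m₀ m₁ b) (rot m₀ m₁ c) (rot m₀ m₁ d)
      = (Real.sin m₀ ^ 2 + Real.cos m₀ ^ 2) * (Real.sin m₁ ^ 2 + Real.cos m₁ ^ 2) *
        vol4 (WithLp.toLp 2 a) (WithLp.toLp 2 b) (WithLp.toLp 2 c) (WithLp.toLp 2 d) := by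
    simp only [vol4_eq, rot]
    generalize Real.cos m₀ = c₀
    generalize Real.sin m₀ = s₀
    generalize Real.cos m₁ = c₁
    generalize Real.sin m₁ = s₁
    simp
    ring
  rw [h, Real.sin_sq_add_cos_sq, Real.sin_sq_add_cos_sq]; ring

/-- The surface with toroidal coordinates `m₀`, `m₁`, `t`. -/
def torusParam (m₀ m₁ t : Plane → ℝ) (q : Plane) : Space4 := torusPoint (m₀ q) (m₁ q) (t q)

section torusParam
variable {m₀ m₁ t : Plane → ℝ} {q : Plane}

lemma contDiffAt_space4 {X : Plane → Space4} {n : WithTop ℕ∞}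
    (h : ∀ k, ContDiffAt ℝ n (fun x => X x k) q) : ContDiffAt ℝ n X q :=
  contDiffAt_euclidean.2 h

lemma contDiffAt_torusParam {n : WithTop ℕ∞} (h₀ : ContDiffAt ℝ n m₀ q) (h₁ : ContDiffAt ℝ n m₁ q)
    (ht : ContDiffAt ℝ n t q) : ContDiffAt ℝ n (torusParam m₀ m₁ t) q := by
  have hb : ContDiffAt ℝ n (fun x => Real.pi / 4 - t x / Real.sqrt 2) q :=
    contDiffAt_const.sub (ht.div_const _)
  refine contDiffAt_space4 fun k => ?_
  fin_cases k
  · exact hb.cos.mul h₀.cos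
  · exact hb.cos.mul h₀.sin
  · exact hb.sin.mul h₁.cos
  · exact hb.sin.mul h₁.sin

lemma pd_mul_cos {A m : Plane → ℝ} (hA : DifferentiableAt ℝ A q) (hm : DifferentiableAt ℝ m q)
    (i : Fin 2) : pd i (fun x => A x * Real.cos (m x)) q
      = pd i A q * Real.cos (m q) - A q * pd i m q * Real.sin (m q) := by
  rw [pd_mul i hA hm.cos, pd_real_comp i (Real.hasDerivAt_cos _) hm]; ring

lemma pd_mul_sin {A m : Plane → ℝ} (hA : DifferentiableAt ℝ A q) (hm : DifferentiableAt ℝ m q)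
    (i : Fin 2) : pd i (fun x => A x * Real.sin (m x)) q
      = pd i A q * Real.sin (m q) + A q * pd i m q * Real.cos (m q) := by
  rw [pd_mul i hA hm.sin, pd_real_comp i (Real.hasDerivAt_sin _) hm]; ring

lemma pd_pd_mul_trig {A m : Plane → ℝ} (hA : ContDiffAt ℝ 2 A q) (hm : ContDiffAt ℝ 2 m q)
    (i j : Fin 2) :
    pd i (pd j fun x => A x * Real.cos (m x)) q
      = (pd i (pd j A) q - A q * pd i m q * pd j m q) * Real.cos (m q)
        - (pd j A q * pd i m q + pd i A q * pd j m q + A q * pd i (pd j m) q) * Real.sin (m q) ∧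
    pd i (pd j fun x => A x * Real.sin (m x)) q
      = (pd i (pd j A) q - A q * pd i m q * pd j m q) * Real.sin (m q)
        + (pd j A q * pd i m q + pd i A q * pd j m q + A q * pd i (pd j m) q)
          * Real.cos (m q) := by
  have eA : ∀ᶠ x in 𝓝 q, DifferentiableAt ℝ A x :=
    (hA.eventually (by norm_num)).mono fun x hx => hx.differentiableAt (by norm_num)
  have em : ∀ᶠ x in 𝓝 q, DifferentiableAt ℝ m x :=
    (hm.eventually (by norm_num)).mono fun x hx => hx.differentiableAt (by norm_num)
  have dA := eA.self_of_nhds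
  have dm := em.self_of_nhds
  have dA' := (hA.pd_of_two j).differentiableAt (by norm_num)
  have dm' := (hm.pd_of_two j).differentiableAt (by norm_num)
  constructor
  · have e : (pd j fun x => A x * Real.cos (m x)) =ᶠ[𝓝 q]
        fun x => pd j A x * Real.cos (m x) - (A x * pd j m x) * Real.sin (m x) := by
      filter_upwards [eA, em] with x h1 h2 using pd_mul_cos h1 h2 j
    rw [(e.pd i).self_of_nhds, pd_sub i (dA'.fun_mul dm.cos) ((dA.fun_mul dm').fun_mul dm.sin),
      pd_mul_cos dA' dm, pd_mul_sin (dA.fun_mul dm') dm, pd_mul i dA dm']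
    ring
  · have e : (pd j fun x => A x * Real.sin (m x)) =ᶠ[𝓝 q]
        fun x => pd j A x * Real.sin (m x) + (A x * pd j m x) * Real.cos (m x) := by
      filter_upwards [eA, em] with x h1 h2 using pd_mul_sin h1 h2 j
    rw [(e.pd i).self_of_nhds, pd_add i (dA'.fun_mul dm.sin) ((dA.fun_mul dm').fun_mul dm.cos),
      pd_mul_sin dA' dm, pd_mul_cos (dA.fun_mul dm') dm, pd_mul i dA dm']
    ring

lemma pd_toroidal_cos (ht : DifferentiableAt ℝ t q) (i : Fin 2) :
    pd i (fun x => Real.cos (Real.pi / 4 - t x / Real.sqrt 2)) q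
      = Real.sin (Real.pi / 4 - t q / Real.sqrt 2) * pd i t q / Real.sqrt 2 := by
  have h : HasDerivAt (fun y : ℝ => Real.cos (Real.pi / 4 - y / Real.sqrt 2))
      (-Real.sin (Real.pi / 4 - t q / Real.sqrt 2) * -(1 / Real.sqrt 2)) (t q) :=
    (((hasDerivAt_id (t q)).div_const _).const_sub _).cos
  rw [pd_real_comp i h ht]; ring

lemma pd_toroidal_sin (ht : DifferentiableAt ℝ t q) (i : Fin 2) :
    pd i (fun x => Real.sin (Real.pi / 4 - t x / Real.sqrt 2)) q
      = -(Real.cos (Real.pi / 4 - t q / Real.sqrt 2) * pd i t q / Real.sqrt 2) := by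
  have h : HasDerivAt (fun y : ℝ => Real.sin (Real.pi / 4 - y / Real.sqrt 2))
      (Real.cos (Real.pi / 4 - t q / Real.sqrt 2) * -(1 / Real.sqrt 2)) (t q) :=
    (((hasDerivAt_id (t q)).div_const _).const_sub _).sin
  rw [pd_real_comp i h ht]; ring

lemma pd_pd_toroidal (ht : ContDiffAt ℝ 2 t q) (i j : Fin 2) :
    pd i (pd j fun x => Real.cos (Real.pi / 4 - t x / Real.sqrt 2)) q
      = Real.sin (Real.pi / 4 - t q / Real.sqrt 2) * pd i (pd j t) q / Real.sqrt 2
        - Real.cos (Real.pi / 4 - t q / Real.sqrt 2) * pd i t q * pd j t q / 2 ∧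
    pd i (pd j fun x => Real.sin (Real.pi / 4 - t x / Real.sqrt 2)) q
      = -(Real.cos (Real.pi / 4 - t q / Real.sqrt 2) * pd i (pd j t) q / Real.sqrt 2)
        - Real.sin (Real.pi / 4 - t q / Real.sqrt 2) * pd i t q * pd j t q / 2 := by
  have h2 : Real.sqrt 2 * Real.sqrt 2 = 2 := Real.mul_self_sqrt (by norm_num)
  have h0 : Real.sqrt 2 ≠ 0 := by positivity
  have hi : (Real.sqrt 2)⁻¹ * (Real.sqrt 2)⁻¹ = 1 / 2 := by rw [← mul_inv, h2]; norm_num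
  have et : ∀ᶠ x in 𝓝 q, DifferentiableAt ℝ t x :=
    (ht.eventually (by norm_num)).mono fun x hx => hx.differentiableAt (by norm_num)
  have dt := et.self_of_nhds
  have db : DifferentiableAt ℝ (fun x => Real.pi / 4 - t x / Real.sqrt 2) q :=
    (differentiableAt_const _).sub (dt.mul_const _)
  have dt' := (ht.pd_of_two j).differentiableAt (by norm_num)
  constructor
  · have e : (pd j fun x => Real.cos (Real.pi / 4 - t x / Real.sqrt 2)) =ᶠ[𝓝 q] fun x =>
        (Real.sqrt 2)⁻¹ * (Real.sin (Real.pi / 4 - t x / Real.sqrt 2) * pd j t x) := by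
      filter_upwards [et] with x hx
      rw [pd_toroidal_cos hx]; ring
    rw [(e.pd i).self_of_nhds, pd_const_mul, pd_mul i db.sin dt', pd_toroidal_sin dt]
    linear_combination (-Real.cos (Real.pi / 4 - t q / Real.sqrt 2) * pd i t q * pd j t q) * hi
  · have e : (pd j fun x => Real.sin (Real.pi / 4 - t x / Real.sqrt 2)) =ᶠ[𝓝 q] fun x =>
        (-(Real.sqrt 2)⁻¹) * (Real.cos (Real.pi / 4 - t x / Real.sqrt 2) * pd j t x) := by
      filter_upwards [et] with x hx
      rw [pd_toroidal_sin hx]; ring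
    rw [(e.pd i).self_of_nhds, pd_const_mul, pd_mul i db.cos dt', pd_toroidal_cos dt]
    linear_combination (-Real.sin (Real.pi / 4 - t q / Real.sqrt 2) * pd i t q * pd j t q) * hi

lemma torusParam_eq_rot : torusParam m₀ m₁ t q = rot (m₀ q) (m₁ q)
    ![Real.cos (Real.pi / 4 - t q / Real.sqrt 2), 0,
      Real.sin (Real.pi / 4 - t q / Real.sqrt 2), 0] := by
  simp [torusParam, torusPoint, rot]

/-- In the frame turning with the angles, the derivative of r e^{im} has radial part r' and angular
part r m'. All inner products and determinants can then be computed without the angles, by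
`inner_rot` and `vol4_rot`. -/
lemma pd_torusParam (h₀ : DifferentiableAt ℝ m₀ q) (h₁ : DifferentiableAt ℝ m₁ q)
    (ht : DifferentiableAt ℝ t q) (i : Fin 2) :
    pd i (torusParam m₀ m₁ t) q = rot (m₀ q) (m₁ q)
      ![Real.sin (Real.pi / 4 - t q / Real.sqrt 2) * pd i t q / Real.sqrt 2,
        Real.cos (Real.pi / 4 - t q / Real.sqrt 2) * pd i m₀ q,
        -(Real.cos (Real.pi / 4 - t q / Real.sqrt 2) * pd i t q / Real.sqrt 2),
        Real.sin (Real.pi / 4 - t q / Real.sqrt 2) * pd i m₁ q] := by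
  have db : DifferentiableAt ℝ (fun x => Real.pi / 4 - t x / Real.sqrt 2) q :=
    (differentiableAt_const _).sub (ht.mul_const _)
  have hX : DifferentiableAt ℝ (torusParam m₀ m₁ t) q := by
    rw [differentiableAt_euclidean]
    intro k
    fin_cases k
    · exact db.cos.mul h₀.cos
    · exact db.cos.mul h₀.sin
    · exact db.sin.mul h₁.cos
    · exact db.sin.mul h₁.sin
  ext k
  rw [pd_apply_coord hX]
  fin_cases k
  · exact (pd_mul_cos db.cos h₀ i).trans (by rw [pd_toroidal_cos ht]; simp [rot])
  · exact (pd_mul_sin db.cos h₀ i).trans (by rw [pd_toroidal_cos ht]; simp [rot])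
  · exact (pd_mul_cos db.sin h₁ i).trans (by rw [pd_toroidal_sin ht]; simp [rot])
  · exact (pd_mul_sin db.sin h₁ i).trans (by rw [pd_toroidal_sin ht]; simp [rot])

lemma pd_pd_torusParam (h₀ : ContDiffAt ℝ 2 m₀ q) (h₁ : ContDiffAt ℝ 2 m₁ q)
    (ht : ContDiffAt ℝ 2 t q) (i j : Fin 2) :
    pd i (pd j (torusParam m₀ m₁ t)) q = rot (m₀ q) (m₁ q)
      ![Real.sin (Real.pi / 4 - t q / Real.sqrt 2) * pd i (pd j t) q / Real.sqrt 2
          - Real.cos (Real.pi / 4 - t q / Real.sqrt 2) * pd i t q * pd j t q / 2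
          - Real.cos (Real.pi / 4 - t q / Real.sqrt 2) * pd i m₀ q * pd j m₀ q,
        Real.sin (Real.pi / 4 - t q / Real.sqrt 2) * pd j t q / Real.sqrt 2 * pd i m₀ q
          + Real.sin (Real.pi / 4 - t q / Real.sqrt 2) * pd i t q / Real.sqrt 2 * pd j m₀ q
          + Real.cos (Real.pi / 4 - t q / Real.sqrt 2) * pd i (pd j m₀) q,
        -(Real.cos (Real.pi / 4 - t q / Real.sqrt 2) * pd i (pd j t) q / Real.sqrt 2)
          - Real.sin (Real.pi / 4 - t q / Real.sqrt 2) * pd i t q * pd j t q / 2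
          - Real.sin (Real.pi / 4 - t q / Real.sqrt 2) * pd i m₁ q * pd j m₁ q,
        -(Real.cos (Real.pi / 4 - t q / Real.sqrt 2) * pd j t q / Real.sqrt 2) * pd i m₁ q
          + -(Real.cos (Real.pi / 4 - t q / Real.sqrt 2) * pd i t q / Real.sqrt 2) * pd j m₁ q
          + Real.sin (Real.pi / 4 - t q / Real.sqrt 2) * pd i (pd j m₁) q] := by
  have hX := contDiffAt_torusParam h₀ h₁ ht
  have eX : ∀ᶠ x in 𝓝 q, DifferentiableAt ℝ (torusParam m₀ m₁ t) x :=
    (hX.eventually (by norm_num)).mono fun x hx => hx.differentiableAt (by norm_num)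
  have dt := ht.differentiableAt (by norm_num)
  have hb : ContDiffAt ℝ 2 (fun x => Real.pi / 4 - t x / Real.sqrt 2) q :=
    contDiffAt_const.sub (ht.div_const _)
  ext k
  rw [pd_apply_coord ((hX.pd_of_two j).differentiableAt (by norm_num))]
  have e : (fun x => pd j (torusParam m₀ m₁ t) x k) =ᶠ[𝓝 q]
      pd j (fun x => torusParam m₀ m₁ t x k) := by
    filter_upwards [eX] with x hx using pd_apply_coord hx j k
  rw [(e.pd i).self_of_nhds]
  fin_cases k
  · exact (pd_pd_mul_trig hb.cos h₀ i j).1.trans (by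
      rw [pd_toroidal_cos dt, pd_toroidal_cos dt, (pd_pd_toroidal ht i j).1]; simp [rot])
  · exact (pd_pd_mul_trig hb.cos h₀ i j).2.trans (by
      rw [pd_toroidal_cos dt, pd_toroidal_cos dt, (pd_pd_toroidal ht i j).1]; simp [rot])
  · exact (pd_pd_mul_trig hb.sin h₁ i j).1.trans (by
      rw [pd_toroidal_sin dt, pd_toroidal_sin dt, (pd_pd_toroidal ht i j).2]; simp [rot])
  · exact (pd_pd_mul_trig hb.sin h₁ i j).2.trans (by
      rw [pd_toroidal_sin dt, pd_toroidal_sin dt, (pd_pd_toroidal ht i j).2]; simp [rot])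

lemma inner_torusParam_self : inner ℝ (torusParam m₀ m₁ t q) (torusParam m₀ m₁ t q) = 1 := by
  rw [torusParam_eq_rot, inner_rot]
  simp
  linear_combination Real.sin_sq_add_cos_sq (Real.pi / 4 - t q / Real.sqrt 2)

lemma inner_torusParam_pd (h₀ : DifferentiableAt ℝ m₀ q) (h₁ : DifferentiableAt ℝ m₁ q)
    (ht : DifferentiableAt ℝ t q) (i : Fin 2) :
    inner ℝ (torusParam m₀ m₁ t q) (pd i (torusParam m₀ m₁ t) q) = 0 := by
  rw [torusParam_eq_rot, pd_torusParam h₀ h₁ ht, inner_rot]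
  simp
  ring

lemma firstForm_torusParam (h₀ : DifferentiableAt ℝ m₀ q) (h₁ : DifferentiableAt ℝ m₁ q)
    (ht : DifferentiableAt ℝ t q) (i j : Fin 2) :
    firstForm (torusParam m₀ m₁ t) q i j = (pd i t q * pd j t q
      + (1 + Real.sin (Real.sqrt 2 * t q)) * (pd i m₀ q * pd j m₀ q)
      + (1 - Real.sin (Real.sqrt 2 * t q)) * (pd i m₁ q * pd j m₁ q)) / 2 := by
  have h2 : Real.sqrt 2 * Real.sqrt 2 = 2 := Real.mul_self_sqrt (by norm_num)
  have hi : (Real.sqrt 2)⁻¹ * (Real.sqrt 2)⁻¹ = 1 / 2 := by rw [← mul_inv, h2]; norm_num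
  rw [firstForm, Matrix.of_apply, pd_torusParam h₀ h₁ ht, pd_torusParam h₀ h₁ ht, inner_rot]
  simp
  linear_combination (pd i m₀ q * pd j m₀ q) * sq_cos_toroidal (t q)
    + (pd i m₁ q * pd j m₁ q) * sq_sin_toroidal (t q)
    + ((Real.sqrt 2)⁻¹ * (Real.sqrt 2)⁻¹ * pd i t q * pd j t q)
      * Real.sin_sq_add_cos_sq (Real.pi / 4 - t q / Real.sqrt 2)
    + (pd i t q * pd j t q) * hi

lemma volForm_torusParam (h₀ : ContDiffAt ℝ 2 m₀ q) (h₁ : ContDiffAt ℝ 2 m₁ q)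
    (ht : ContDiffAt ℝ 2 t q) (i j : Fin 2) :
    Real.sqrt 2 * volForm (torusParam m₀ m₁ t) q i j =
      (pd 0 m₁ q * pd 1 t q - pd 0 t q * pd 1 m₁ q) *
        (Real.cos (Real.sqrt 2 * t q) / 2 * pd i (pd j m₀) q
          + (1 - Real.sin (Real.sqrt 2 * t q)) / 2 / Real.sqrt 2
            * (pd j t q * pd i m₀ q + pd i t q * pd j m₀ q))
      + (pd 0 t q * pd 1 m₀ q - pd 0 m₀ q * pd 1 t q) *
        (Real.cos (Real.sqrt 2 * t q) / 2 * pd i (pd j m₁) q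
          - (1 + Real.sin (Real.sqrt 2 * t q)) / 2 / Real.sqrt 2
            * (pd j t q * pd i m₁ q + pd i t q * pd j m₁ q))
      + (pd 0 m₀ q * pd 1 m₁ q - pd 0 m₁ q * pd 1 m₀ q) *
        (Real.cos (Real.sqrt 2 * t q) / 2 * pd i (pd j t) q
          - Real.sqrt 2 * (Real.cos (Real.sqrt 2 * t q) / 2) ^ 2
            * (pd i m₀ q * pd j m₀ q - pd i m₁ q * pd j m₁ q)) := by
  have h2 : Real.sqrt 2 * Real.sqrt 2 = 2 := Real.mul_self_sqrt (by norm_num)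
  have h0 : Real.sqrt 2 ≠ 0 := by positivity
  rw [volForm, torusParam_eq_rot, pd_torusParam (h₀.differentiableAt (by norm_num))
    (h₁.differentiableAt (by norm_num)) (ht.differentiableAt (by norm_num)),
    pd_torusParam (h₀.differentiableAt (by norm_num))
    (h₁.differentiableAt (by norm_num)) (ht.differentiableAt (by norm_num)),
    pd_pd_torusParam h₀ h₁ ht, vol4_rot, vol4_eq, ← sq_cos_toroidal, ← sq_sin_toroidal,
    ← cos_mul_sin_toroidal]
  simp
  have hcs := Real.sin_sq_add_cos_sq (Real.pi / 4 - t q / Real.sqrt 2)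
  set C := Real.cos (Real.pi / 4 - t q / Real.sqrt 2)
  set S := Real.sin (Real.pi / 4 - t q / Real.sqrt 2)
  have hr : Real.sqrt 2 = 2 * (Real.sqrt 2)⁻¹ := by field_simp; linarith
  have hk : (Real.sqrt 2)⁻¹ * (Real.sqrt 2)⁻¹ = 1 / 2 := by rw [← mul_inv, h2]; norm_num
  simp only [div_eq_mul_inv]
  generalize (Real.sqrt 2)⁻¹ = k at hr hk ⊢
  rw [hr]
  -- Two relations are used: C² + S² = 1, for the factor which the determinant leaves on the terms
  -- linear in the last slot, and k² = 1/2 for k = 1/√2.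
  linear_combination (2 * k ^ 2 * (
      (pd 0 m₁ q * pd 1 t q - pd 0 t q * pd 1 m₁ q) * S *
        (S * k * (pd j t q * pd i m₀ q + pd i t q * pd j m₀ q) + C * pd i (pd j m₀) q)
      + (pd 0 t q * pd 1 m₀ q - pd 0 m₀ q * pd 1 t q) * C *
        (-C * k * (pd j t q * pd i m₁ q + pd i t q * pd j m₁ q) + S * pd i (pd j m₁) q)
      + (pd 0 m₀ q * pd 1 m₁ q - pd 0 m₁ q * pd 1 m₀ q) * C * S * pd i (pd j t) q)) * hcs
    + 2 * (
      (pd 0 m₁ q * pd 1 t q - pd 0 t q * pd 1 m₁ q) * S *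
        (S * k * (pd j t q * pd i m₀ q + pd i t q * pd j m₀ q) + C * pd i (pd j m₀) q)
      + (pd 0 t q * pd 1 m₀ q - pd 0 m₀ q * pd 1 t q) * C *
        (-C * k * (pd j t q * pd i m₁ q + pd i t q * pd j m₁ q) + S * pd i (pd j m₁) q)
      + (pd 0 m₀ q * pd 1 m₁ q - pd 0 m₁ q * pd 1 m₀ q) * C * S * pd i (pd j t) q) * hk

end torusParam

/-! ### The mean curvature of graphs over the Clifford torus -/

/-- The graph `t = u(μ)` in toroidal coordinates. -/
def graphChart (u : Plane → ℝ) : Plane → Space4 := torusParam (fun q => q 0) (fun q => q 1) u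

/-- Four times the determinant of the metric of a graph. -/
def graphDet (u : Plane → ℝ) (q : Plane) : ℝ :=
  (1 - Real.sin (Real.sqrt 2 * u q)) * pd 0 u q ^ 2
    + (1 + Real.sin (Real.sqrt 2 * u q)) * pd 1 u q ^ 2
    + Real.cos (Real.sqrt 2 * u q) ^ 2

/-- The numerator in the mean curvature of a graph. -/
def graphNum (u : Plane → ℝ) (q : Plane) : ℝ :=
  (pd 1 u q ^ 2 + (1 - Real.sin (Real.sqrt 2 * u q))) *
      (Real.cos (Real.sqrt 2 * u q) * pd 0 (pd 0 u) q
        - Real.sqrt 2 * (1 - Real.sin (Real.sqrt 2 * u q)) * pd 0 u q ^ 2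
        - Real.sqrt 2 * Real.cos (Real.sqrt 2 * u q) ^ 2 / 2)
    - pd 0 u q * pd 1 u q *
      (Real.cos (Real.sqrt 2 * u q) * (pd 0 (pd 1 u) q + pd 1 (pd 0 u) q)
        + 2 * Real.sqrt 2 * Real.sin (Real.sqrt 2 * u q) * (pd 0 u q * pd 1 u q))
    + (pd 0 u q ^ 2 + (1 + Real.sin (Real.sqrt 2 * u q))) *
      (Real.cos (Real.sqrt 2 * u q) * pd 1 (pd 1 u) q
        + Real.sqrt 2 * (1 + Real.sin (Real.sqrt 2 * u q)) * pd 1 u q ^ 2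
        + Real.sqrt 2 * Real.cos (Real.sqrt 2 * u q) ^ 2 / 2)

lemma pd_pd_coord (i j k : Fin 2) (q : Plane) : pd i (pd j fun x : Plane => x k) q = 0 := by
  have : (pd j fun x : Plane => x k) = fun _ => if j = k then 1 else 0 := by
    ext x; exact pd_coord j k
  rw [this, pd_const]

lemma contDiff_coord {n : WithTop ℕ∞} (k : Fin 2) : ContDiff ℝ n fun x : Plane => x k :=
  (EuclideanSpace.proj (𝕜 := ℝ) k : Plane →L[ℝ] ℝ).contDiff

lemma differentiableAt_coord (k : Fin 2) (q : Plane) :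
    DifferentiableAt ℝ (fun x : Plane => x k) q :=
  (contDiff_coord (n := 1) k).contDiffAt.differentiableAt (by norm_num)

lemma sin_sqrt_two_sq (t : ℝ) : Real.sin (Real.sqrt 2 * t) ^ 2
    = 1 - Real.cos (Real.sqrt 2 * t) ^ 2 := Real.sin_sq _

section graph
variable {u : Plane → ℝ} {q : Plane}

lemma firstForm_graphChart (hu : DifferentiableAt ℝ u q) :
    firstForm (graphChart u) q 0 0 = (pd 0 u q ^ 2 + (1 + Real.sin (Real.sqrt 2 * u q))) / 2 ∧
    firstForm (graphChart u) q 0 1 = pd 0 u q * pd 1 u q / 2 ∧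
    firstForm (graphChart u) q 1 1
      = (pd 1 u q ^ 2 + (1 - Real.sin (Real.sqrt 2 * u q))) / 2 := by
  refine ⟨?_, ?_, ?_⟩ <;>
  · rw [graphChart, firstForm_torusParam (differentiableAt_coord 0 q) (differentiableAt_coord 1 q)
      hu]
    simp [pd_coord]
    try ring

lemma det_firstForm_graphChart (hu : DifferentiableAt ℝ u q) :
    (firstForm (graphChart u) q).det = graphDet u q / 4 := by
  have hs : firstForm (graphChart u) q 1 0 = firstForm (graphChart u) q 0 1 := by
    simp [firstForm, real_inner_comm]
  obtain ⟨h1, h2, h3⟩ := firstForm_graphChart hu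
  rw [Matrix.det_fin_two, hs, h1, h2, h3, graphDet]
  linear_combination (-1 / 4) * sin_sqrt_two_sq (u q)

lemma meanCurvature_graphChart (hu : ContDiffAt ℝ 2 u q) :
    meanCurvature (graphChart u) q
      = Real.sqrt 2 * graphNum u q / Real.sqrt (graphDet u q) ^ 3 := by
  have h2 : Real.sqrt 2 * Real.sqrt 2 = 2 := Real.mul_self_sqrt (by norm_num)
  have hd := hu.differentiableAt (by norm_num)
  have c0 := (contDiff_coord (n := 2) 0).contDiffAt (x := q)
  have c1 := (contDiff_coord (n := 2) 1).contDiffAt (x := q)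
  rw [meanCurvature_eq (graphChart u) _ inner_torusParam_self
    (inner_torusParam_pd (differentiableAt_coord 0 q) (differentiableAt_coord 1 q) hd),
    det_firstForm_graphChart hd]
  obtain ⟨g0, g01, g1⟩ := firstForm_graphChart hd
  rw [g0, g01, g1]
  have v : ∀ i j, volForm (graphChart u) q i j
      = Real.sqrt 2 / 2 * (Real.sqrt 2 * volForm (graphChart u) q i j) := by
    intro i j; linear_combination (-volForm (graphChart u) q i j / 2) * h2
  rw [v 0 0, v 0 1, v 1 0, v 1 1, graphChart]
  simp only [volForm_torusParam c0 c1 hu, pd_pd_coord, pd_coord]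
  rw [Real.sqrt_div' _ (by norm_num), show Real.sqrt 4 = 2 by
    rw [show (4 : ℝ) = 2 ^ 2 by norm_num, Real.sqrt_sq (by norm_num)], graphNum]
  have hr : (Real.sqrt 2)⁻¹ = Real.sqrt 2 / 2 := by
    rw [inv_eq_iff_eq_inv, inv_div]; field_simp; linarith
  simp only [div_eq_mul_inv _ (Real.sqrt 2), hr]
  simp
  rw [div_pow (Real.sqrt (graphDet u q)), div_div_eq_mul_div]
  congr 1
  ring

end graph

/-! ### The neck chart -/

/-- The neck `|μ - ν| = ε cosh s`, `t = ε s`, parametrized by `(s, θ)`. -/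
def neckChart (ν : Plane) (ε : ℝ) : Plane → Space4 :=
  torusParam (fun q => ν 0 + ε * (Real.cosh (q 0) * Real.cos (q 1)))
    (fun q => ν 1 + ε * (Real.cosh (q 0) * Real.sin (q 1))) (fun q => ε * q 0)

lemma pd_prod_fun {f g : ℝ → ℝ} {f' g' : ℝ} {q : Plane} (c ε : ℝ) (hf : HasDerivAt f f' (q 0))
    (hg : HasDerivAt g g' (q 1)) :
    pd 0 (fun x => c + ε * (f (x 0) * g (x 1))) q = ε * (f' * g (q 1)) ∧
    pd 1 (fun x => c + ε * (f (x 0) * g (x 1))) q = ε * (f (q 0) * g') := by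
  have hf' : HasFDerivAt (fun x : Plane => f (x 0)) _ q :=
    hf.comp_hasFDerivAt q (differentiableAt_coord 0 q).hasFDerivAt
  have hg' : HasFDerivAt (fun x : Plane => g (x 1)) _ q :=
    hg.comp_hasFDerivAt q (differentiableAt_coord 1 q).hasFDerivAt
  have d := (hf'.differentiableAt.fun_mul hg'.differentiableAt)
  constructor
  all_goals
    rw [pd_add _ (differentiableAt_const c) (d.const_mul ε), pd_const, pd_const_mul,
      pd_mul _ hf'.differentiableAt hg'.differentiableAt,
      pd_real_comp _ hf (differentiableAt_coord 0 q), pd_real_comp _ hg (differentiableAt_coord 1 q),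
      pd_coord, pd_coord]
    simp

lemma pd_prod_fun' {f g f' g' : ℝ → ℝ} (c ε : ℝ) (hf : ∀ x, HasDerivAt f (f' x) x)
    (hg : ∀ x, HasDerivAt g (g' x) x) :
    (pd 0 fun x : Plane => c + ε * (f (x 0) * g (x 1))) = (fun x => 0 + ε * (f' (x 0) * g (x 1))) ∧
    (pd 1 fun x : Plane => c + ε * (f (x 0) * g (x 1)))
      = (fun x => 0 + ε * (f (x 0) * g' (x 1))) := by
  constructor
  · ext x; rw [(pd_prod_fun c ε (hf _) (hg _)).1]; simp
  · ext x; rw [(pd_prod_fun c ε (hf _) (hg _)).2]; simp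

section neck
variable {ν : Plane} {ε : ℝ} {q : Plane}

lemma contDiff_neck (ν : Plane) (ε : ℝ) {n : WithTop ℕ∞} :
    ContDiff ℝ n (fun q : Plane => ν 0 + ε * (Real.cosh (q 0) * Real.cos (q 1))) ∧
    ContDiff ℝ n (fun q : Plane => ν 1 + ε * (Real.cosh (q 0) * Real.sin (q 1))) ∧
    ContDiff ℝ n (fun q : Plane => ε * q 0) := by
  have c0 := contDiff_coord (n := n) 0
  have c1 := contDiff_coord (n := n) 1
  exact ⟨contDiff_const.add (contDiff_const.mul ((Real.contDiff_cosh.comp c0).mul c1.cos)),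
    contDiff_const.add (contDiff_const.mul ((Real.contDiff_cosh.comp c0).mul c1.sin)),
    contDiff_const.mul c0⟩

/-- The first form of the neck, in units of `ε² / 2`. -/
def neckG (ε : ℝ) (q : Plane) (i : Fin 3) : ℝ :=
  ![Real.cosh (q 0) ^ 2 + Real.sin (Real.sqrt 2 * (ε * q 0)) * Real.sinh (q 0) ^ 2
      * Real.cos (2 * q 1),
    -(Real.sin (Real.sqrt 2 * (ε * q 0)) * Real.sinh (q 0) * Real.cosh (q 0)
      * Real.sin (2 * q 1)),
    Real.cosh (q 0) ^ 2 * (1 - Real.sin (Real.sqrt 2 * (ε * q 0)) * Real.cos (2 * q 1))] i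

/-- The second form of the neck with respect to a non-normalized normal. -/
def neckB (ε : ℝ) (q : Plane) (i : Fin 3) : ℝ :=
  ![-(Real.cos (Real.sqrt 2 * (ε * q 0)) / 2 * Real.cosh (q 0))
      - Real.sqrt 2 / 2 * ε * Real.sinh (q 0)
        * (Real.cos (2 * q 1) - Real.sin (Real.sqrt 2 * (ε * q 0)))
      - Real.sqrt 2 / 4 * Real.cos (Real.sqrt 2 * (ε * q 0)) ^ 2 * ε * Real.sinh (q 0) ^ 3
        * Real.cos (2 * q 1),
    Real.sqrt 2 / 4 * ε * Real.cosh (q 0) * Real.sin (2 * q 1)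
      * (1 + Real.cos (Real.sqrt 2 * (ε * q 0)) ^ 2 * Real.sinh (q 0) ^ 2),
    Real.cos (Real.sqrt 2 * (ε * q 0)) / 2 * Real.cosh (q 0)
      + Real.sqrt 2 / 4 * Real.cos (Real.sqrt 2 * (ε * q 0)) ^ 2 * ε * Real.sinh (q 0)
        * Real.cosh (q 0) ^ 2 * Real.cos (2 * q 1)] i

lemma pd_neck (ν : Plane) (ε : ℝ) :
    (pd 0 fun q : Plane => ν 0 + ε * (Real.cosh (q 0) * Real.cos (q 1)))
      = (fun q => 0 + ε * (Real.sinh (q 0) * Real.cos (q 1))) ∧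
    (pd 1 fun q : Plane => ν 0 + ε * (Real.cosh (q 0) * Real.cos (q 1)))
      = (fun q => 0 + ε * (Real.cosh (q 0) * -Real.sin (q 1))) ∧
    (pd 0 fun q : Plane => ν 1 + ε * (Real.cosh (q 0) * Real.sin (q 1)))
      = (fun q => 0 + ε * (Real.sinh (q 0) * Real.sin (q 1))) ∧
    (pd 1 fun q : Plane => ν 1 + ε * (Real.cosh (q 0) * Real.sin (q 1)))
      = (fun q => 0 + ε * (Real.cosh (q 0) * Real.cos (q 1))) ∧
    (pd 0 fun q : Plane => ε * q 0) = (fun _ => ε) ∧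
    (pd 1 fun q : Plane => ε * q 0) = (fun _ => 0) := by
  have a := pd_prod_fun' (ν 0) ε Real.hasDerivAt_cosh Real.hasDerivAt_cos
  have b := pd_prod_fun' (ν 1) ε Real.hasDerivAt_cosh Real.hasDerivAt_sin
  refine ⟨a.1, a.2, b.1, b.2, ?_, ?_⟩ <;> ext x <;> rw [pd_const_mul, pd_coord] <;> simp

lemma pd_pd_neck (ν : Plane) (ε : ℝ) :
    (pd 0 (pd 0 fun q : Plane => ν 0 + ε * (Real.cosh (q 0) * Real.cos (q 1)))
      = (fun q => 0 + ε * (Real.cosh (q 0) * Real.cos (q 1)))) ∧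
    (pd 1 (pd 0 fun q : Plane => ν 0 + ε * (Real.cosh (q 0) * Real.cos (q 1)))
      = (fun q => 0 + ε * (Real.sinh (q 0) * -Real.sin (q 1)))) ∧
    (pd 0 (pd 1 fun q : Plane => ν 0 + ε * (Real.cosh (q 0) * Real.cos (q 1)))
      = (fun q => 0 + ε * (Real.sinh (q 0) * -Real.sin (q 1)))) ∧
    (pd 1 (pd 1 fun q : Plane => ν 0 + ε * (Real.cosh (q 0) * Real.cos (q 1)))
      = (fun q => 0 + ε * (Real.cosh (q 0) * -Real.cos (q 1)))) ∧
    (pd 0 (pd 0 fun q : Plane => ν 1 + ε * (Real.cosh (q 0) * Real.sin (q 1)))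
      = (fun q => 0 + ε * (Real.cosh (q 0) * Real.sin (q 1)))) ∧
    (pd 1 (pd 0 fun q : Plane => ν 1 + ε * (Real.cosh (q 0) * Real.sin (q 1)))
      = (fun q => 0 + ε * (Real.sinh (q 0) * Real.cos (q 1)))) ∧
    (pd 0 (pd 1 fun q : Plane => ν 1 + ε * (Real.cosh (q 0) * Real.sin (q 1)))
      = (fun q => 0 + ε * (Real.sinh (q 0) * Real.cos (q 1)))) ∧
    (pd 1 (pd 1 fun q : Plane => ν 1 + ε * (Real.cosh (q 0) * Real.sin (q 1)))
      = (fun q => 0 + ε * (Real.cosh (q 0) * -Real.sin (q 1)))) := by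
  obtain ⟨a0, a1, b0, b1, -, -⟩ := pd_neck ν ε
  have hns : ∀ x, HasDerivAt (fun x => -Real.sin x) (-Real.cos x) x := fun x =>
    (Real.hasDerivAt_sin x).neg
  have a00 := pd_prod_fun' 0 ε Real.hasDerivAt_sinh Real.hasDerivAt_cos
  have a11 := pd_prod_fun' 0 ε Real.hasDerivAt_cosh hns
  have b00 := pd_prod_fun' 0 ε Real.hasDerivAt_sinh Real.hasDerivAt_sin
  have b11 := pd_prod_fun' 0 ε Real.hasDerivAt_cosh Real.hasDerivAt_cos
  rw [a0, a1, b0, b1]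
  exact ⟨a00.1, a00.2, a11.1, a11.2, b00.1, b00.2, b11.1, b11.2⟩

lemma firstForm_neckChart :
    firstForm (neckChart ν ε) q 0 0 = ε ^ 2 / 2 * neckG ε q 0 ∧
    firstForm (neckChart ν ε) q 0 1 = ε ^ 2 / 2 * neckG ε q 1 ∧
    firstForm (neckChart ν ε) q 1 1 = ε ^ 2 / 2 * neckG ε q 2 := by
  obtain ⟨a0, a1, b0, b1, t0, t1⟩ := pd_neck ν ε
  obtain ⟨c0, c1, c2⟩ := contDiff_neck ν ε (n := 1)
  have d0 := c0.contDiffAt (x := q).differentiableAt (by norm_num)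
  have d1 := c1.contDiffAt (x := q).differentiableAt (by norm_num)
  have d2 := c2.contDiffAt (x := q).differentiableAt (by norm_num)
  have hs := Real.sin_sq_add_cos_sq (q 1)
  have hc := Real.cosh_sq (q 0)
  refine ⟨?_, ?_, ?_⟩ <;> rw [neckChart, firstForm_torusParam d0 d1 d2] <;>
    simp only [a0, a1, b0, b1, t0, t1, neckG, Real.cos_two_mul', Real.sin_two_mul] <;> simp
  · linear_combination (ε ^ 2 / 2 * Real.sinh (q 0) ^ 2) * hs - (ε ^ 2 / 2) * hc
  · ring
  · linear_combination (ε ^ 2 / 2 * Real.cosh (q 0) ^ 2) * hs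

lemma volForm_neckChart :
    Real.sqrt 2 * volForm (neckChart ν ε) q 0 0 = ε ^ 3 * Real.cosh (q 0) * neckB ε q 0 ∧
    Real.sqrt 2 * volForm (neckChart ν ε) q 0 1 = ε ^ 3 * Real.cosh (q 0) * neckB ε q 1 ∧
    Real.sqrt 2 * volForm (neckChart ν ε) q 1 0 = ε ^ 3 * Real.cosh (q 0) * neckB ε q 1 ∧
    Real.sqrt 2 * volForm (neckChart ν ε) q 1 1 = ε ^ 3 * Real.cosh (q 0) * neckB ε q 2 := by
  obtain ⟨a0, a1, b0, b1, t0, t1⟩ := pd_neck ν ε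
  obtain ⟨a00, a10, a01, a11, b00, b10, b01, b11⟩ := pd_pd_neck ν ε
  obtain ⟨c0, c1, c2⟩ := contDiff_neck ν ε (n := 2)
  have d0 := c0.contDiffAt (x := q)
  have d1 := c1.contDiffAt (x := q)
  have d2 := c2.contDiffAt (x := q)
  have h2 : Real.sqrt 2 * Real.sqrt 2 = 2 := Real.mul_self_sqrt (by norm_num)
  have hr : (Real.sqrt 2)⁻¹ = Real.sqrt 2 / 2 := by
    rw [inv_eq_iff_eq_inv, inv_div]; field_simp; linarith
  have hs := Real.sin_sq_add_cos_sq (q 1)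
  refine ⟨?_, ?_, ?_, ?_⟩ <;> rw [neckChart, volForm_torusParam d0 d1 d2] <;>
    simp only [a00, a10, a01, a11, b00, b10, b01, b11] <;>
    simp only [a0, a1, b0, b1, t0, t1, neckB, pd_const,
      Real.cos_two_mul', Real.sin_two_mul, div_eq_mul_inv _ (Real.sqrt 2), hr] <;> simp <;>
    generalize Real.sqrt 2 = r at * <;>
    generalize Real.cosh (q 0) = ch <;> generalize Real.sinh (q 0) = sh <;>
    generalize Real.cos (r * (ε * q 0)) = c <;> generalize Real.sin (r * (ε * q 0)) = σ <;>
    generalize Real.cos (q 1) = C at * <;> generalize Real.sin (q 1) = S at *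
  · linear_combination (-(ε ^ 3 * ch * (c / 2 * ch - r / 2 * ε * sh * σ
      + r / 4 * c ^ 2 * ε * sh ^ 3 * (C ^ 2 - S ^ 2)))) * hs
  · linear_combination (r / 2 * ε ^ 4 * ch ^ 2 * C * S * c ^ 2 * sh ^ 2) * hs
  · linear_combination (r / 2 * ε ^ 4 * ch ^ 2 * C * S * c ^ 2 * sh ^ 2) * hs
  · linear_combination (ε ^ 3 * ch * (c / 2 * ch
      + r / 4 * c ^ 2 * ε * sh * ch ^ 2 * (C ^ 2 - S ^ 2))) * hs

/-- The determinant of the first form of the neck, in units of `ε⁴ / 4`. -/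
def neckDet (ε : ℝ) (q : Plane) : ℝ := neckG ε q 0 * neckG ε q 2 - neckG ε q 1 ^ 2

/-- The numerator in the mean curvature of the neck. -/
def neckNum (ε : ℝ) (q : Plane) : ℝ :=
  neckG ε q 2 * neckB ε q 0 - 2 * neckG ε q 1 * neckB ε q 1 + neckG ε q 0 * neckB ε q 2

lemma det_firstForm_neckChart :
    (firstForm (neckChart ν ε) q).det = (ε ^ 2 / 2) ^ 2 * neckDet ε q := by
  have hs : firstForm (neckChart ν ε) q 1 0 = firstForm (neckChart ν ε) q 0 1 := by
    simp [firstForm, real_inner_comm]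
  obtain ⟨h1, h2, h3⟩ := firstForm_neckChart (ν := ν) (ε := ε) (q := q)
  rw [Matrix.det_fin_two, hs, h1, h2, h3, neckDet]
  ring

/-- Counting powers: the metric gives ε² and the volume form ε³ in the numerator, against ε⁶ in the
denominator. One factor 1/ε survives, so the cancellation in `neckNum` is essential. -/
lemma meanCurvature_neckChart (hε : 0 < ε) :
    meanCurvature (neckChart ν ε) q
      = 2 * Real.sqrt 2 * (Real.cosh (q 0) * neckNum ε q) / (ε * Real.sqrt (neckDet ε q) ^ 3) := by
  have h2 : Real.sqrt 2 * Real.sqrt 2 = 2 := Real.mul_self_sqrt (by norm_num)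
  obtain ⟨c0, c1, c2⟩ := contDiff_neck ν ε (n := 1)
  have d0 := c0.contDiffAt (x := q).differentiableAt (by norm_num)
  have d1 := c1.contDiffAt (x := q).differentiableAt (by norm_num)
  have d2 := c2.contDiffAt (x := q).differentiableAt (by norm_num)
  rw [meanCurvature_eq (neckChart ν ε) _ inner_torusParam_self (inner_torusParam_pd d0 d1 d2),
    det_firstForm_neckChart]
  obtain ⟨g0, g01, g1⟩ := firstForm_neckChart (ν := ν) (ε := ε) (q := q)
  obtain ⟨b0, b01, b10, b1⟩ := volForm_neckChart (ν := ν) (ε := ε) (q := q)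
  have v : ∀ i j, volForm (neckChart ν ε) q i j
      = Real.sqrt 2 / 2 * (Real.sqrt 2 * volForm (neckChart ν ε) q i j) := by
    intro i j; linear_combination (-volForm (neckChart ν ε) q i j / 2) * h2
  rw [g0, g01, g1, v 0 0, v 0 1, v 1 0, v 1 1, b0, b01, b10, b1,
    Real.sqrt_mul (by positivity), Real.sqrt_sq (by positivity), neckNum]
  by_cases h : Real.sqrt (neckDet ε q) = 0
  · simp [h]
  · field_simp
    ring

end neck

/-! ### Uniform weighted bounds for families of functions -/

/-- A family of functions `f i`, smooth at the points `x i`, whose derivatives of order `k ≤ n` at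
`x i` are bounded by a constant times `w i / ρ i ^ k`, uniformly for `i ∈ s`. -/
def UB {ι : Type*} (s : Set ι) (x : ι → Plane) (ρ : ι → ℝ) :
    ℕ → (ι → ℝ) → (ι → Plane → ℝ) → Prop
  | 0, w, f => (∀ i ∈ s, ContDiffAt ℝ ∞ (f i) (x i)) ∧ ∃ C, ∀ i ∈ s, |f i (x i)| ≤ C * w i
  | n + 1, w, f => ((∀ i ∈ s, ContDiffAt ℝ ∞ (f i) (x i)) ∧ ∃ C, ∀ i ∈ s, |f i (x i)| ≤ C * w i) ∧
      ∀ j, UB s x ρ n (fun i => w i / ρ i) fun i => pd j (f i)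

namespace UB
variable {ι : Type*} {s : Set ι} {x : ι → Plane} {ρ : ι → ℝ} {n : ℕ} {w v : ι → ℝ}
  {f g : ι → Plane → ℝ}

lemma smooth (h : UB s x ρ n w f) : ∀ i ∈ s, ContDiffAt ℝ ∞ (f i) (x i) := by
  cases n with
  | zero => exact h.1
  | succ n => exact h.1.1

lemma bound (h : UB s x ρ n w f) : ∃ C, ∀ i ∈ s, |f i (x i)| ≤ C * w i := by
  cases n with
  | zero => exact h.2
  | succ n => exact h.1.2

lemma succ_iff : UB s x ρ (n + 1) w f ↔ UB s x ρ 0 w f ∧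
    ∀ j, UB s x ρ n (fun i => w i / ρ i) fun i => pd j (f i) := Iff.rfl

lemma congr (h : UB s x ρ n w f) (hfg : ∀ i ∈ s, g i =ᶠ[𝓝 (x i)] f i) : UB s x ρ n w g := by
  induction n generalizing w f g with
  | zero =>
    obtain ⟨C, hC⟩ := h.2
    exact ⟨fun i hi => (h.1 i hi).congr_of_eventuallyEq (hfg i hi), C, fun i hi => by
      rw [(hfg i hi).self_of_nhds]; exact hC i hi⟩
  | succ n ih =>
    obtain ⟨C, hC⟩ := h.1.2
    exact ⟨⟨fun i hi => (h.1.1 i hi).congr_of_eventuallyEq (hfg i hi), C, fun i hi => by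
      rw [(hfg i hi).self_of_nhds]; exact hC i hi⟩, fun j => ih (h.2 j) fun i hi => (hfg i hi).pd j⟩

lemma mono (hρ : ∀ i ∈ s, 0 < ρ i) (h : UB s x ρ n w f) (hw : ∀ i ∈ s, 0 ≤ w i)
    (hwv : ∃ K, ∀ i ∈ s, w i ≤ K * v i) : UB s x ρ n v f := by
  obtain ⟨K, hK⟩ := hwv
  have base : ∀ {w v : ι → ℝ} {f : ι → Plane → ℝ}, (∀ i ∈ s, 0 ≤ w i) → (∀ i ∈ s, w i ≤ K * v i) →
      (∃ C, ∀ i ∈ s, |f i (x i)| ≤ C * w i) → ∃ C, ∀ i ∈ s, |f i (x i)| ≤ C * v i := by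
    rintro w v f hw hwv ⟨C, hC⟩
    refine ⟨|C| * K, fun i hi => (hC i hi).trans ?_⟩
    calc C * w i ≤ |C| * w i := mul_le_mul_of_nonneg_right (le_abs_self C) (hw i hi)
      _ ≤ |C| * (K * v i) := mul_le_mul_of_nonneg_left (hwv i hi) (abs_nonneg C)
      _ = |C| * K * v i := by ring
  induction n generalizing w v f with
  | zero => exact ⟨h.1, base hw hK h.2⟩
  | succ n ih =>
    refine ⟨⟨h.1.1, base hw hK h.1.2⟩, fun j => ih (h.2 j)
      (fun i hi => div_nonneg (hw i hi) (hρ i hi).le) fun i hi => ?_⟩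
    rw [← mul_div_assoc]
    exact div_le_div_of_nonneg_right (hK i hi) (hρ i hi).le

lemma weaken (h : UB s x ρ (n + 1) w f) : UB s x ρ n w f := by
  induction n generalizing w f with
  | zero => exact h.1
  | succ n ih => exact ⟨h.1, fun j => ih (h.2 j)⟩

lemma of_le {m : ℕ} (h : UB s x ρ n w f) (hm : m ≤ n) : UB s x ρ m w f := by
  induction n with
  | zero => rwa [Nat.le_zero.1 hm]
  | succ n ih =>
    rcases Nat.lt_or_eq_of_le hm with h1 | h1
    · exact ih h.weaken (Nat.lt_succ_iff.1 h1)
    · rwa [h1]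

lemma subset {t : Set ι} (h : UB s x ρ n w f) (ht : t ⊆ s) : UB t x ρ n w f := by
  induction n generalizing w f with
  | zero =>
    obtain ⟨C, hC⟩ := h.2
    exact ⟨fun i hi => h.1 i (ht hi), C, fun i hi => hC i (ht hi)⟩
  | succ n ih =>
    obtain ⟨C, hC⟩ := h.1.2
    exact ⟨⟨fun i hi => h.1.1 i (ht hi), C, fun i hi => hC i (ht hi)⟩, fun j => ih (h.2 j)⟩

lemma union {t : Set ι} (hw : ∀ i ∈ s ∪ t, 0 ≤ w i) (hρ : ∀ i ∈ s ∪ t, 0 < ρ i)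
    (h : UB s x ρ n w f) (h' : UB t x ρ n w f) : UB (s ∪ t) x ρ n w f := by
  have base : ∀ {w : ι → ℝ} {f : ι → Plane → ℝ}, (∀ i ∈ s ∪ t, 0 ≤ w i) →
      (∃ C, ∀ i ∈ s, |f i (x i)| ≤ C * w i) → (∃ C, ∀ i ∈ t, |f i (x i)| ≤ C * w i) →
      ∃ C, ∀ i ∈ s ∪ t, |f i (x i)| ≤ C * w i := by
    rintro w f hw ⟨C, hC⟩ ⟨C', hC'⟩
    refine ⟨max C C', fun i hi => ?_⟩
    rcases id hi with hi' | hi'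
    · exact (hC i hi').trans (mul_le_mul_of_nonneg_right (le_max_left _ _) (hw i hi))
    · exact (hC' i hi').trans (mul_le_mul_of_nonneg_right (le_max_right _ _) (hw i hi))
  induction n generalizing w f with
  | zero => exact ⟨fun i hi => Or.elim hi (h.1 i) (h'.1 i), base hw h.2 h'.2⟩
  | succ n ih =>
    exact ⟨⟨fun i hi => Or.elim hi (h.1.1 i) (h'.1.1 i), base hw h.1.2 h'.1.2⟩, fun j => ih
      (fun i hi => div_nonneg (hw i hi) (hρ i hi).le) (h.2 j) (h'.2 j)⟩

lemma add (hw : ∀ i ∈ s, 0 ≤ w i) (hv : ∀ i ∈ s, 0 ≤ v i) (hρ : ∀ i ∈ s, 0 < ρ i)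
    (hf : UB s x ρ n w f) (hg : UB s x ρ n v g) :
    UB s x ρ n (fun i => w i + v i) fun i y => f i y + g i y := by
  have base : ∀ {w v : ι → ℝ} {f g : ι → Plane → ℝ}, (∀ i ∈ s, 0 ≤ w i) → (∀ i ∈ s, 0 ≤ v i) →
      (∃ C, ∀ i ∈ s, |f i (x i)| ≤ C * w i) → (∃ C, ∀ i ∈ s, |g i (x i)| ≤ C * v i) →
      ∃ C, ∀ i ∈ s, |f i (x i) + g i (x i)| ≤ C * (w i + v i) := by
    rintro w v f g hw hv ⟨C, hC⟩ ⟨C', hC'⟩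
    refine ⟨max C C', fun i hi => (abs_add_le _ _).trans ?_⟩
    rw [mul_add]
    exact add_le_add ((hC i hi).trans (mul_le_mul_of_nonneg_right (le_max_left _ _) (hw i hi)))
      ((hC' i hi).trans (mul_le_mul_of_nonneg_right (le_max_right _ _) (hv i hi)))
  induction n generalizing w v f g with
  | zero => exact ⟨fun i hi => (hf.1 i hi).add (hg.1 i hi), base hw hv hf.2 hg.2⟩
  | succ n ih =>
    refine ⟨⟨fun i hi => (hf.1.1 i hi).add (hg.1.1 i hi), base hw hv hf.1.2 hg.1.2⟩, fun j => ?_⟩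
    have h1 := ih (fun i hi => div_nonneg (hw i hi) (hρ i hi).le)
      (fun i hi => div_nonneg (hv i hi) (hρ i hi).le) (hf.2 j) (hg.2 j)
    have h2 := h1.congr (g := fun i => pd j fun y => f i y + g i y) fun i hi => by
      have ef := ((hf.1.1 i hi).of_le two_le_infty).eventually (by norm_num)
      have eg := ((hg.1.1 i hi).of_le two_le_infty).eventually (by norm_num)
      filter_upwards [ef, eg] with y h3 h4
      exact pd_add j (h3.differentiableAt (by norm_num)) (h4.differentiableAt (by norm_num))
    simpa only [add_div] using h2

/-- Leibniz' rule: a derivative costs the same factor 1/ρ on whichever factor it falls, so weights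
simply multiply. -/
lemma mul (hρ : ∀ i ∈ s, 0 < ρ i) (hw : ∀ i ∈ s, 0 ≤ w i) (hv : ∀ i ∈ s, 0 ≤ v i)
    (hf : UB s x ρ n w f) (hg : UB s x ρ n v g) :
    UB s x ρ n (fun i => w i * v i) fun i y => f i y * g i y := by
  have base : ∀ {w v : ι → ℝ} {f g : ι → Plane → ℝ}, (∀ i ∈ s, 0 ≤ w i) → (∀ i ∈ s, 0 ≤ v i) →
      (∃ C, ∀ i ∈ s, |f i (x i)| ≤ C * w i) → (∃ C, ∀ i ∈ s, |g i (x i)| ≤ C * v i) →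
      ∃ C, ∀ i ∈ s, |f i (x i) * g i (x i)| ≤ C * (w i * v i) := by
    rintro w v f g hw hv ⟨C, hC⟩ ⟨C', hC'⟩
    refine ⟨|C| * |C'|, fun i hi => ?_⟩
    rw [abs_mul, mul_mul_mul_comm]
    exact mul_le_mul ((hC i hi).trans (mul_le_mul_of_nonneg_right (le_abs_self _) (hw i hi)))
      ((hC' i hi).trans (mul_le_mul_of_nonneg_right (le_abs_self _) (hv i hi))) (abs_nonneg _)
      (mul_nonneg (abs_nonneg _) (hw i hi))
  induction n generalizing w v f g with
  | zero => exact ⟨fun i hi => (hf.1 i hi).mul (hg.1 i hi), base hw hv hf.2 hg.2⟩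
  | succ n ih =>
    refine ⟨⟨fun i hi => (hf.1.1 i hi).mul (hg.1.1 i hi), base hw hv hf.1.2 hg.1.2⟩, fun j => ?_⟩
    have hw' : ∀ i ∈ s, 0 ≤ w i / ρ i := fun i hi => div_nonneg (hw i hi) (hρ i hi).le
    have hv' : ∀ i ∈ s, 0 ≤ v i / ρ i := fun i hi => div_nonneg (hv i hi) (hρ i hi).le
    have h1 := ih hw' hv (hf.2 j) hg.weaken
    have h2 := ih hw hv' hf.weaken (hg.2 j)
    have h3 := add (fun i hi => mul_nonneg (hw' i hi) (hv i hi))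
      (fun i hi => mul_nonneg (hw i hi) (hv' i hi)) hρ h1 h2
    have h4 := h3.congr (g := fun i => pd j fun y => f i y * g i y) fun i hi => by
      have ef := ((hf.1.1 i hi).of_le two_le_infty).eventually (by norm_num)
      have eg := ((hg.1.1 i hi).of_le two_le_infty).eventually (by norm_num)
      filter_upwards [ef, eg] with y h3 h4
      exact pd_mul j (h3.differentiableAt (by norm_num)) (h4.differentiableAt (by norm_num))
    refine h4.mono hρ (fun i hi => add_nonneg (mul_nonneg (hw' i hi) (hv i hi))
      (mul_nonneg (hw i hi) (hv' i hi))) ⟨2, fun i hi => le_of_eq ?_⟩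
    ring

lemma of_const {c : ι → ℝ} (hc : ∃ C, ∀ i ∈ s, |c i| ≤ C * w i) :
    UB s x ρ n w fun i _ => c i := by
  induction n generalizing w c with
  | zero => exact ⟨fun i _ => contDiffAt_const, hc⟩
  | succ n ih =>
    refine ⟨⟨fun i _ => contDiffAt_const, hc⟩, fun j => ?_⟩
    have : (fun i : ι => pd j fun _ : Plane => c i) = fun _ _ => (0 : ℝ) := by
      ext i y; exact pd_const j (c i)
    rw [this]
    exact ih ⟨0, fun i _ => by simp⟩

lemma const_self {c : ι → ℝ} (hc : ∀ i ∈ s, 0 ≤ c i) : UB s x ρ n c fun i _ => c i :=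
  of_const ⟨1, fun i hi => by rw [abs_of_nonneg (hc i hi), one_mul]⟩

lemma const_one (c : ℝ) : UB s x ρ n (fun _ => 1) fun _ _ => c := of_const ⟨|c|, by simp⟩

lemma const_mul (hf : UB s x ρ n w f) (c : ℝ) : UB s x ρ n w fun i y => c * f i y := by
  induction n generalizing w f with
  | zero =>
    obtain ⟨C, hC⟩ := hf.2
    refine ⟨fun i hi => contDiffAt_const.mul (hf.1 i hi), |c| * C, fun i hi => ?_⟩
    rw [abs_mul, mul_assoc]
    exact mul_le_mul_of_nonneg_left (hC i hi) (abs_nonneg c)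
  | succ n ih =>
    obtain ⟨C, hC⟩ := hf.1.2
    refine ⟨⟨fun i hi => contDiffAt_const.mul (hf.1.1 i hi), |c| * C, fun i hi => ?_⟩, fun j => ?_⟩
    · rw [abs_mul, mul_assoc]
      exact mul_le_mul_of_nonneg_left (hC i hi) (abs_nonneg c)
    · have : (fun i => pd j fun y => c * f i y) = fun i y => c * pd j (f i) y := by
        ext i y; exact pd_const_mul j c (f i)
      rw [this]; exact ih (hf.2 j)

lemma neg (hf : UB s x ρ n w f) : UB s x ρ n w fun i y => -f i y := by
  simpa using hf.const_mul (-1)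

/-- Sums with a common weight. -/
lemma add_same (hw : ∀ i ∈ s, 0 ≤ w i) (hρ : ∀ i ∈ s, 0 < ρ i) (hf : UB s x ρ n w f)
    (hg : UB s x ρ n w g) : UB s x ρ n w fun i y => f i y + g i y :=
  (add hw hw hρ hf hg).mono hρ (fun i hi => add_nonneg (hw i hi) (hw i hi))
    ⟨2, fun i _ => le_of_eq (by ring)⟩

lemma sub_same (hw : ∀ i ∈ s, 0 ≤ w i) (hρ : ∀ i ∈ s, 0 < ρ i) (hf : UB s x ρ n w f)
    (hg : UB s x ρ n w g) : UB s x ρ n w fun i y => f i y - g i y := by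
  simpa [sub_eq_add_neg] using add_same hw hρ hf hg.neg

/-- Products, with a given weight of the result. -/
lemma mul_to {τ : ι → ℝ} (hρ : ∀ i ∈ s, 0 < ρ i) (hw : ∀ i ∈ s, 0 ≤ w i) (hv : ∀ i ∈ s, 0 ≤ v i)
    (hf : UB s x ρ n w f) (hg : UB s x ρ n v g) (h : ∃ K, ∀ i ∈ s, w i * v i ≤ K * τ i) :
    UB s x ρ n τ fun i y => f i y * g i y :=
  (mul hρ hw hv hf hg).mono hρ (fun i hi => mul_nonneg (hw i hi) (hv i hi)) h

/-- Multiplication by functions of weight `1`. -/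
lemma mul_one_left (hρ : ∀ i ∈ s, 0 < ρ i) (hv : ∀ i ∈ s, 0 ≤ v i)
    (hf : UB s x ρ n (fun _ => 1) f) (hg : UB s x ρ n v g) :
    UB s x ρ n v fun i y => f i y * g i y :=
  mul_to hρ (fun _ _ => zero_le_one) hv hf hg ⟨1, fun _ _ => le_of_eq rfl⟩

/-- Composition with a fixed function of one real variable. -/
lemma comp (hρ : ∀ i ∈ s, 0 < ρ i) (hw : ∀ i ∈ s, 0 ≤ w i) {K : Set ℝ} (hK : IsCompact K)
    {h : ℝ → ℝ} (hh : ∀ z ∈ K, ContDiffAt ℝ ∞ h z) (hfK : ∀ i ∈ s, f i (x i) ∈ K)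
    (hf : UB s x ρ n w f) (hw1 : ∃ C, ∀ i ∈ s, w i ≤ C) (hwv : ∃ C, ∀ i ∈ s, w i ≤ C * v i)
    (hb : ∃ C, ∀ i ∈ s, |h (f i (x i))| ≤ C * v i) : UB s x ρ n v fun i y => h (f i y) := by
  induction n generalizing h v with
  | zero => exact ⟨fun i hi => (hh _ (hfK i hi)).comp _ (hf.1 i hi), hb⟩
  | succ n ih =>
    refine ⟨⟨fun i hi => (hh _ (hfK i hi)).comp _ (hf.1.1 i hi), hb⟩, fun j => ?_⟩
    have hh' : ∀ z ∈ K, ContDiffAt ℝ ∞ (deriv h) z := fun z hz =>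
      ((hh z hz).fderiv_right (m := ∞) (by simp)).clm_apply contDiffAt_const
    -- Compactness of K makes the bound on h' uniform in i.
    obtain ⟨B, hB⟩ := hK.exists_bound_of_continuousOn
      (fun z hz => (hh' z hz).continuousAt.continuousWithinAt)
    obtain ⟨C, hC⟩ := hw1
    obtain ⟨D, hD⟩ := hwv
    -- Chain rule: h' ∘ f has weight 1 by induction at one order less, and the factor ∂f carries the
    -- weight w / ρ.
    have h1 := ih (v := fun _ => 1) hh' hf.weaken ⟨C, by simpa using hC⟩
      ⟨B, fun i hi => by simpa using hB _ (hfK i hi)⟩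
    have hw' : ∀ i ∈ s, 0 ≤ w i / ρ i := fun i hi => div_nonneg (hw i hi) (hρ i hi).le
    have h2 := (mul_one_left hρ hw' h1 (hf.2 j)).mono hρ hw' (v := fun i => v i / ρ i)
      ⟨D, fun i hi => by
        rw [← mul_div_assoc]; exact div_le_div_of_nonneg_right (hD i hi) (hρ i hi).le⟩
    refine h2.congr fun i hi => ?_
    have e1 := ((hf.1.1 i hi).of_le two_le_infty).eventually (by norm_num)
    have e2 := (hf.1.1 i hi).continuousAt.eventually
      (((hh _ (hfK i hi)).of_le two_le_infty).eventually (by norm_num))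
    filter_upwards [e1, e2] with y h3 h4
    exact pd_real_comp j (h4.differentiableAt (by norm_num)).hasDerivAt
      (h3.differentiableAt (by norm_num))

/-- Composition with a bounded result. -/
lemma comp_one (hρ : ∀ i ∈ s, 0 < ρ i) (hw : ∀ i ∈ s, 0 ≤ w i) {K : Set ℝ} (hK : IsCompact K)
    {h : ℝ → ℝ} (hh : ∀ z ∈ K, ContDiffAt ℝ ∞ h z) (hfK : ∀ i ∈ s, f i (x i) ∈ K)
    (hf : UB s x ρ n w f) (hw1 : ∃ C, ∀ i ∈ s, w i ≤ C) :
    UB s x ρ n (fun _ => 1) fun i y => h (f i y) := by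
  obtain ⟨B, hB⟩ := hK.exists_bound_of_continuousOn
    (fun z hz => (hh z hz).continuousAt.continuousWithinAt)
  exact comp hρ hw hK hh hfK hf hw1 (by simpa using hw1)
    ⟨B, fun i hi => by simpa using hB _ (hfK i hi)⟩

/-- Composition with a function that vanishes at the origin. -/
lemma comp_zero (hρ : ∀ i ∈ s, 0 < ρ i) (hw : ∀ i ∈ s, 0 ≤ w i) {α β : ℝ} (hα : α ≤ 0)
    (hβ : 0 ≤ β) {h : ℝ → ℝ} (hh : ∀ z ∈ Icc α β, ContDiffAt ℝ ∞ h z) (h0 : h 0 = 0)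
    (hfK : ∀ i ∈ s, f i (x i) ∈ Icc α β) (hf : UB s x ρ n w f) (hw1 : ∃ C, ∀ i ∈ s, w i ≤ C) :
    UB s x ρ n w fun i y => h (f i y) := by
  have hh' : ∀ z ∈ Icc α β, ContDiffAt ℝ ∞ (deriv h) z := fun z hz =>
    ((hh z hz).fderiv_right (m := ∞) (by simp)).clm_apply contDiffAt_const
  obtain ⟨B, hB⟩ := isCompact_Icc.exists_bound_of_continuousOn
    (fun z hz => (hh' z hz).continuousAt.continuousWithinAt)
  obtain ⟨C, hC⟩ := hf.bound
  refine comp hρ hw isCompact_Icc hh hfK hf hw1 ⟨1, fun i _ => by simp⟩ ⟨|B| * |C|, fun i hi => ?_⟩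
  -- Since h 0 = 0, the mean value inequality on [α, β] bounds h by a multiple of its argument, so
  -- the composition keeps the weight w.
  have h1 := (convex_Icc α β).norm_image_sub_le_of_norm_deriv_le (f := h)
    (fun z hz => (hh z hz).differentiableAt (by norm_num)) hB ⟨hα, hβ⟩ (hfK i hi)
  rw [h0, sub_zero, sub_zero, Real.norm_eq_abs, Real.norm_eq_abs] at h1
  calc |h (f i (x i))| ≤ B * |f i (x i)| := h1
    _ ≤ |B| * (|C| * w i) := mul_le_mul (le_abs_self B)
        ((hC i hi).trans (mul_le_mul_of_nonneg_right (le_abs_self C) (hw i hi)))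
        (abs_nonneg _) (abs_nonneg B)
    _ = |B| * |C| * w i := by ring

/-- Translated coordinate functions. -/
lemma coord (hρ : ∀ i ∈ s, 0 < ρ i) (c : ι → Plane) (k : Fin 2)
    (hc : ∃ C, ∀ i ∈ s, |x i k - c i k| ≤ C * ρ i) :
    UB s x ρ n ρ fun i y => y k - c i k := by
  have hs : ∀ i, ContDiffAt ℝ ∞ (fun y : Plane => y k - c i k) (x i) := fun i =>
    ((contDiff_coord k).sub contDiff_const).contDiffAt
  cases n with
  | zero => exact ⟨fun i _ => hs i, hc⟩
  | succ n =>
    refine ⟨⟨fun i _ => hs i, hc⟩, fun j => ?_⟩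
    have : (fun i : ι => pd j fun y : Plane => y k - c i k)
        = fun _ _ => if j = k then (1 : ℝ) else 0 := by
      ext i y
      rw [pd_sub j (differentiableAt_coord k y) (differentiableAt_const _), pd_coord, pd_const,
        sub_zero]
    rw [this]
    refine of_const ⟨1, fun i hi => ?_⟩
    rw [div_self (hρ i hi).ne']
    split_ifs <;> simp

/-- Rescaled and translated copies of a fixed smooth function. -/
lemma scaled (hρ : ∀ i ∈ s, 0 < ρ i) {K : Set Plane} (hK : IsCompact K) {θ : Plane → ℝ}
    (hθ : ∀ z ∈ K, ContDiffAt ℝ ∞ θ z) (c : ι → Plane) (l : ι → ℝ)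
    (hxK : ∀ i ∈ s, l i • (x i - c i) ∈ K) (hl : ∃ C, ∀ i ∈ s, |l i| ≤ C * (1 / ρ i)) :
    UB s x ρ n (fun _ => 1) fun i y => θ (l i • (y - c i)) := by
  induction n generalizing θ with
  | zero =>
    obtain ⟨B, hB⟩ := hK.exists_bound_of_continuousOn
      (fun z hz => (hθ z hz).continuousAt.continuousWithinAt)
    exact ⟨fun i hi => (hθ _ (hxK i hi)).comp (x i)
      (contDiff_const.fun_smul (contDiff_id.sub contDiff_const)).contDiffAt, B, fun i hi => by
      simpa using hB _ (hxK i hi)⟩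
  | succ n ih =>
    refine ⟨(ih hθ).of_le (Nat.zero_le n), fun j => ?_⟩
    have h1 := ih fun z hz => (hθ z hz).pd j
    have h2 : UB s x ρ n (fun i => 1 / ρ i) fun i _ => l i := of_const hl
    have h3 := mul hρ (fun i hi => (one_div_pos.2 (hρ i hi)).le)
      (fun _ _ => zero_le_one) h2 h1
    simp only [mul_one] at h3
    refine h3.congr fun i hi => ?_
    have e : ∀ᶠ y in 𝓝 (x i), ContDiffAt ℝ 2 θ (l i • (y - c i)) := by
      have hc : ContinuousAt (fun y => l i • (y - c i)) (x i) := by fun_prop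
      exact hc.eventually (((hθ _ (hxK i hi)).of_le two_le_infty).eventually (by norm_num))
    filter_upwards [e] with y hy
    have hd : HasFDerivAt (fun y => l i • (y - c i)) (l i • ContinuousLinearMap.id ℝ Plane) y :=
      ((hasFDerivAt_id y).sub_const _).fun_const_smul _
    have := ((hy.differentiableAt (by norm_num)).hasFDerivAt.comp y hd).fderiv
    simp only [pd]
    rw [show (fun y => θ (l i • (y - c i))) = θ ∘ fun y => l i • (y - c i) from rfl, this]
    simp

end UB

/-! ### The mean curvature of graphs with small slope -/

/-- From |sin y - y| ≤ |y|³ at y = √2 z; the constant is √2 · (√2)³ = 4. -/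
lemma abs_sin_sub_le (z : ℝ) : |Real.sqrt 2 * Real.sin (Real.sqrt 2 * z) - 2 * z| ≤ 4 * |z| ^ 3 := by
  have h2 : Real.sqrt 2 * Real.sqrt 2 = 2 := Real.mul_self_sqrt (by norm_num)
  have key : ∀ y : ℝ, 0 ≤ y → |Real.sin y - y| ≤ y ^ 3 := by
    intro y hy
    rcases hy.eq_or_lt with h0 | h0
    · simp [← h0]
    · have h3 := Real.sin_gt_sub_cube h0
      have h4 := Real.sin_le hy
      rw [abs_le]; constructor <;> nlinarith [pow_pos h0 3]
  have key' : ∀ y : ℝ, |Real.sin y - y| ≤ |y| ^ 3 := by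
    intro y
    rcases le_total 0 y with h | h
    · rw [abs_of_nonneg h]
      exact key y h
    · rw [abs_of_nonpos h]
      have h3 := key (-y) (by linarith)
      rwa [Real.sin_neg, show -Real.sin y - -y = -(Real.sin y - y) by ring, abs_neg] at h3
  have e : Real.sqrt 2 * Real.sin (Real.sqrt 2 * z) - 2 * z
      = Real.sqrt 2 * (Real.sin (Real.sqrt 2 * z) - Real.sqrt 2 * z) := by
    linear_combination z * h2
  rw [e, abs_mul, abs_of_nonneg (Real.sqrt_nonneg 2)]
  calc Real.sqrt 2 * |Real.sin (Real.sqrt 2 * z) - Real.sqrt 2 * z|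
      ≤ Real.sqrt 2 * |Real.sqrt 2 * z| ^ 3 :=
        mul_le_mul_of_nonneg_left (key' _) (Real.sqrt_nonneg 2)
    _ = (Real.sqrt 2 * Real.sqrt 2) ^ 2 * |z| ^ 3 := by
        rw [abs_mul, abs_of_nonneg (Real.sqrt_nonneg 2)]; ring
    _ = 4 * |z| ^ 3 := by rw [h2]; norm_num

lemma contDiffAt_inv_sqrt_cube {z : ℝ} (hz : 0 < 1 + z) :
    ContDiffAt ℝ ∞ (fun z => (Real.sqrt (1 + z) ^ 3)⁻¹ - 1) z := by
  have h1 : ContDiffAt ℝ ∞ (fun z : ℝ => 1 + z) z := contDiffAt_const.add contDiffAt_id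
  exact (((h1.sqrt hz.ne').pow 3).inv (by have := Real.sqrt_pos.2 hz; positivity)).sub
    contDiffAt_const

namespace UB
variable {ι : Type*} {s : Set ι} {x : ι → Plane} {ρ : ι → ℝ} {n : ℕ} {w v : ι → ℝ}
  {f g : ι → Plane → ℝ}

lemma one_mul (hρ : ∀ i ∈ s, 0 < ρ i) (hf : UB s x ρ n (fun _ => 1) f)
    (hg : UB s x ρ n (fun _ => 1) g) : UB s x ρ n (fun _ => 1) fun i y => f i y * g i y :=
  mul_one_left hρ (fun _ _ => zero_le_one) hf hg

lemma one_add (hρ : ∀ i ∈ s, 0 < ρ i) (hf : UB s x ρ n (fun _ => 1) f)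
    (hg : UB s x ρ n (fun _ => 1) g) : UB s x ρ n (fun _ => 1) fun i y => f i y + g i y :=
  add_same (fun _ _ => zero_le_one) hρ hf hg

lemma one_sub (hρ : ∀ i ∈ s, 0 < ρ i) (hf : UB s x ρ n (fun _ => 1) f)
    (hg : UB s x ρ n (fun _ => 1) g) : UB s x ρ n (fun _ => 1) fun i y => f i y - g i y :=
  sub_same (fun _ _ => zero_le_one) hρ hf hg

/-- The numerator is Δu + 2u plus errors, and the determinant is 1 plus errors. With weights εL,
ε/ρ, ε/ρ² for u, ∇u, D²u, the products |∇u|² and u D²u are bounded by τ = ε²L/ρ². A cubic term is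
too, since εL² and ρ are bounded. The linear part is compared with the constant 2 ta, at the cost w,
and ta with Ha by hypothesis. -/
theorem graph {u : ι → Plane → ℝ} {ε L ta Ha w : ι → ℝ} {R : ℝ} (hρ : ∀ i ∈ s, 0 < ρ i)
    (hε : ∀ i ∈ s, 0 < ε i) (hL : ∀ i ∈ s, 1 ≤ L i) (hρR : ∀ i ∈ s, ρ i ≤ R)
    (h1 : ∀ i ∈ s, ε i / ρ i ^ 2 ≤ R) (h2 : ∀ i ∈ s, ε i * L i ^ 2 ≤ R)
    (hu : UB s x ρ 1 (fun i => ε i * L i) u)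
    (hu1 : ∀ j, UB s x ρ 1 (fun i => ε i / ρ i) fun i => pd j (u i))
    (hu2 : ∀ j k, UB s x ρ 1 (fun i => ε i / ρ i ^ 2) fun i => pd j (pd k (u i)))
    (hw : ∀ i ∈ s, 0 ≤ w i)
    (hlap : UB s x ρ 1 w fun i y => pd 0 (pd 0 (u i)) y + pd 1 (pd 1 (u i)) y + 2 * u i y - 2 * ta i)
    (hu4 : ∀ i ∈ s, |u i (x i)| ≤ 1 / 4)
    (hHa : ∃ C, ∀ i ∈ s, |2 * Real.sqrt 2 * ta i - Ha i| ≤ C * (ε i ^ 2 * L i / ρ i ^ 2)) :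
    UB s x ρ 1 (fun i => ε i ^ 2 * L i / ρ i ^ 2 + w i)
      fun i y => Real.sqrt 2 * graphNum (u i) y / Real.sqrt (graphDet (u i) y) ^ 3 - Ha i := by
  have wa : ∀ i ∈ s, 0 ≤ ε i * L i := fun i hi => by
    have := hε i hi; have := hL i hi; positivity
  have wb : ∀ i ∈ s, 0 ≤ ε i / ρ i := fun i hi => (div_pos (hε i hi) (hρ i hi)).le
  have wc : ∀ i ∈ s, 0 ≤ ε i / ρ i ^ 2 := fun i hi =>
    (div_pos (hε i hi) (pow_pos (hρ i hi) 2)).le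
  have wt : ∀ i ∈ s, 0 ≤ ε i ^ 2 * L i / ρ i ^ 2 := fun i hi => by
    have := hε i hi; have := hL i hi; positivity
  have ba : ∀ i ∈ s, ε i * L i ≤ R := fun i hi => by
    have h3 := hε i hi
    have h4 := hL i hi
    refine le_trans (mul_le_mul_of_nonneg_left ?_ h3.le) (h2 i hi)
    nlinarith
  have hR : ∀ i ∈ s, 0 ≤ R := fun i hi => (wa i hi).trans (ba i hi)
  have bb : ∀ i ∈ s, ε i / ρ i * (ε i / ρ i) ≤ 1 * (ε i ^ 2 * L i / ρ i ^ 2) := fun i hi => by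
    have e : ε i / ρ i * (ε i / ρ i) = ε i ^ 2 / ρ i ^ 2 := by ring
    have e2 : ε i ^ 2 * L i / ρ i ^ 2 = ε i ^ 2 / ρ i ^ 2 * L i := by ring
    rw [e, e2, _root_.one_mul]
    exact le_mul_of_one_le_right (by positivity) (hL i hi)
  have e3 : ∀ i, ε i ^ 2 * L i / ρ i ^ 2 = ε i / ρ i ^ 2 * (ε i * L i) := fun i => by ring
  have bt : ∀ i ∈ s, ε i ^ 2 * L i / ρ i ^ 2 ≤ R * R := fun i hi => by
    rw [e3]; exact mul_le_mul (h1 i hi) (ba i hi) (wa i hi) (hR i hi)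
  -- (εL)³ = (εL²) ρ² · ε²L/ρ²: the hypothesis on εL² serves to absorb cubic terms in u.
  have baaa : ∀ i ∈ s, ε i * L i * (ε i * L i) * (ε i * L i)
      ≤ R ^ 3 * (ε i ^ 2 * L i / ρ i ^ 2) := fun i hi => by
    have hp := hρ i hi
    have e4 : ε i * L i * (ε i * L i) * (ε i * L i)
        = (ε i * L i ^ 2) * ρ i ^ 2 * (ε i ^ 2 * L i / ρ i ^ 2) := by field_simp
    rw [e4]
    refine mul_le_mul_of_nonneg_right ?_ (wt i hi)
    have h5 : ρ i ^ 2 ≤ R ^ 2 := pow_le_pow_left₀ hp.le (hρR i hi) 2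
    calc ε i * L i ^ 2 * ρ i ^ 2 ≤ R * R ^ 2 :=
          mul_le_mul (h2 i hi) h5 (by positivity) (hR i hi)
      _ = R ^ 3 := by ring
  have hK : ∀ i ∈ s, u i (x i) ∈ Icc (-(1 / 4) : ℝ) (1 / 4) := fun i hi => abs_le.1 (hu4 i hi)
  have hba : ∃ C, ∀ i ∈ s, ε i * L i ≤ C := ⟨R, ba⟩
  -- elementary functions of `u`
  have c1 : ContDiff ℝ ∞ fun z : ℝ => Real.sqrt 2 * z := contDiff_const.mul contDiff_id
  have hσ : UB s x ρ 1 (fun i => ε i * L i) fun i y => Real.sin (Real.sqrt 2 * u i y) :=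
    comp_zero (h := fun z => Real.sin (Real.sqrt 2 * z)) hρ wa (by norm_num) (by norm_num)
      (fun z _ => c1.sin.contDiffAt) (by simp) hK hu hba
  have hs : UB s x ρ 1 (fun i => ε i * L i) fun i y => Real.sin (Real.sqrt 2 / 2 * u i y) :=
    comp_zero (h := fun z => Real.sin (Real.sqrt 2 / 2 * z)) hρ wa (by norm_num) (by norm_num)
      (fun z _ => (contDiff_const.mul contDiff_id).sin.contDiffAt) (by simp) hK hu hba
  have hc : UB s x ρ 1 (fun _ => 1) fun i y => Real.cos (Real.sqrt 2 * u i y) :=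
    comp_one (h := fun z => Real.cos (Real.sqrt 2 * z)) hρ wa isCompact_Icc
      (fun z _ => c1.cos.contDiffAt) hK hu hba
  have oσ : UB s x ρ 1 (fun _ => 1) fun i y => Real.sin (Real.sqrt 2 * u i y) :=
    hσ.mono hρ wa ⟨R, by simpa using ba⟩
  have os : UB s x ρ 1 (fun _ => 1) fun i y => Real.sin (Real.sqrt 2 / 2 * u i y) :=
    hs.mono hρ wa ⟨R, by simpa using ba⟩
  have o2 : ∀ j k, UB s x ρ 1 (fun _ => 1) fun i => pd j (pd k (u i)) := fun j k =>
    (hu2 j k).mono hρ wc ⟨R, by simpa using h1⟩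
  have hpp : ∀ j k, UB s x ρ 1 (fun i => ε i ^ 2 * L i / ρ i ^ 2)
      fun i y => pd j (u i) y * pd k (u i) y := fun j k =>
    mul_to hρ wb wb (hu1 j) (hu1 k) ⟨1, bb⟩
  have opp : ∀ j k, UB s x ρ 1 (fun _ => 1) fun i y => pd j (u i) y * pd k (u i) y := fun j k =>
    (hpp j k).mono hρ wt ⟨R * R, by simpa using bt⟩
  have hac : ∀ {a b : ι → Plane → ℝ}, UB s x ρ 1 (fun i => ε i * L i) a →
      UB s x ρ 1 (fun i => ε i / ρ i ^ 2) b →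
      UB s x ρ 1 (fun i => ε i ^ 2 * L i / ρ i ^ 2) fun i y => a i y * b i y := fun ha hb =>
    mul_to hρ wa wc ha hb ⟨1, fun i _ => le_of_eq (by rw [e3]; ring)⟩
  have one1 : UB s x ρ 1 (fun _ => 1) fun _ _ => (1 : ℝ) := const_one 1
  -- the cubic error in `√2 cos² σ - 2 u`
  have hsin : UB s x ρ 1 (fun i => ε i ^ 2 * L i / ρ i ^ 2)
      fun i y => Real.sqrt 2 * Real.sin (Real.sqrt 2 * u i y) - 2 * u i y := by
    have hd : ∀ i ∈ s, ContDiffAt ℝ ∞ (fun y => Real.sqrt 2 * Real.sin (Real.sqrt 2 * u i y)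
        - 2 * u i y) (x i) := fun i hi => by
      have := hu.smooth i hi
      exact (contDiffAt_const.mul (contDiffAt_const.mul this).sin).sub (contDiffAt_const.mul this)
    refine succ_iff.2 ⟨⟨hd, ?_⟩, fun j => ?_⟩
    · obtain ⟨C, hC⟩ := hu.bound
      refine ⟨4 * |C| ^ 3 * R ^ 3, fun i hi => (abs_sin_sub_le _).trans ?_⟩
      have h5 : |u i (x i)| ≤ |C| * (ε i * L i) :=
        (hC i hi).trans (mul_le_mul_of_nonneg_right (le_abs_self C) (wa i hi))
      calc 4 * |u i (x i)| ^ 3 ≤ 4 * (|C| * (ε i * L i)) ^ 3 := by gcongr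
        _ = 4 * |C| ^ 3 * (ε i * L i * (ε i * L i) * (ε i * L i)) := by ring
        _ ≤ 4 * |C| ^ 3 * (R ^ 3 * (ε i ^ 2 * L i / ρ i ^ 2)) :=
            mul_le_mul_of_nonneg_left (baaa i hi) (by positivity)
        _ = _ := by ring
    -- The derivative is (2 cos(√2 u) - 2) ∂u = -4 sin²(u/√2) ∂u, which is visibly cubic.
    · have h5 : UB s x ρ 0 (fun i => ε i * L i * (ε i * L i) * (ε i / ρ i)) fun i y =>
          Real.sin (Real.sqrt 2 / 2 * u i y) * Real.sin (Real.sqrt 2 / 2 * u i y)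
            * pd j (u i) y :=
        mul hρ (fun i hi => mul_nonneg (wa i hi) (wa i hi)) wb
          (mul hρ wa wa (hs.of_le zero_le_one) (hs.of_le zero_le_one)) ((hu1 j).of_le zero_le_one)
      refine ((h5.const_mul (-4)).mono hρ (fun i hi => mul_nonneg (mul_nonneg (wa i hi) (wa i hi))
        (wb i hi)) ⟨R ^ 3, fun i hi => ?_⟩).congr fun i hi => ?_
      · have hp := hρ i hi
        have e4 : ε i * L i * (ε i * L i) * (ε i / ρ i)
            = (ε i * L i ^ 2) * ρ i ^ 2 * (ε i ^ 2 / ρ i ^ 2 / ρ i) := by field_simp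
        rw [e4]
        have h6 : ρ i ^ 2 ≤ R ^ 2 := pow_le_pow_left₀ hp.le (hρR i hi) 2
        have h7 : ε i * L i ^ 2 * ρ i ^ 2 ≤ R ^ 3 := by
          calc ε i * L i ^ 2 * ρ i ^ 2 ≤ R * R ^ 2 :=
                mul_le_mul (h2 i hi) h6 (by positivity) (hR i hi)
            _ = R ^ 3 := by ring
        refine mul_le_mul h7 ?_ (by positivity) (by have := hR i hi; positivity)
        gcongr
        exact le_mul_of_one_le_right (by positivity) (hL i hi)
      · have e1 := ((hu.smooth i hi).of_le two_le_infty).eventually (by norm_num)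
        filter_upwards [e1] with y hy
        have hdu := hy.differentiableAt (by norm_num : (2 : WithTop ℕ∞) ≠ 0)
        have hh : HasDerivAt (fun z : ℝ => Real.sqrt 2 * Real.sin (Real.sqrt 2 * z) - 2 * z)
            (Real.sqrt 2 * (Real.cos (Real.sqrt 2 * u i y) * (Real.sqrt 2 * 1)) - 2 * 1) (u i y) :=
          (((((hasDerivAt_id (u i y)).const_mul _).sin).const_mul _).sub
            ((hasDerivAt_id (u i y)).const_mul 2))
        rw [pd_real_comp j hh hdu]
        have h8 : Real.sqrt 2 * Real.sqrt 2 = 2 := Real.mul_self_sqrt (by norm_num)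
        have h9 : Real.cos (Real.sqrt 2 * u i y)
            = 1 - 2 * Real.sin (Real.sqrt 2 / 2 * u i y) ^ 2 := by
          rw [show Real.sqrt 2 * u i y = 2 * (Real.sqrt 2 / 2 * u i y) by ring, Real.cos_two_mul,
            Real.cos_sq']; ring
        rw [h9]
        linear_combination (pd j (u i) y * (1 - 2 * Real.sin (Real.sqrt 2 / 2 * u i y) ^ 2)) * h8
  have hσ3 : UB s x ρ 1 (fun i => ε i ^ 2 * L i / ρ i ^ 2) fun i y =>
      Real.sin (Real.sqrt 2 * u i y) * Real.sin (Real.sqrt 2 * u i y)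
        * Real.sin (Real.sqrt 2 * u i y) :=
    mul_to hρ (fun i hi => mul_nonneg (wa i hi) (wa i hi)) wa (mul hρ wa wa hσ hσ) hσ
      ⟨R ^ 3, baaa⟩
  -- the determinant
  have hP : UB s x ρ 1 (fun i => ε i ^ 2 * L i / ρ i ^ 2 + ε i * L i * (ε i * L i))
      fun i y => graphDet (u i) y - 1 := by
    have h5 := add wt (fun i hi => mul_nonneg (wa i hi) (wa i hi)) hρ
      (add_same wt hρ (mul_one_left hρ wt (one_sub hρ one1 oσ) (hpp 0 0))
        (mul_one_left hρ wt (one_add hρ one1 oσ) (hpp 1 1))) (mul hρ wa wa hσ hσ).neg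
    refine h5.congr fun i _ => Eventually.of_forall fun y => ?_
    simp only [graphDet]
    linear_combination sin_sqrt_two_sq (u i y)
  have wκ : ∀ i ∈ s, 0 ≤ ε i ^ 2 * L i / ρ i ^ 2 + ε i * L i * (ε i * L i) := fun i hi =>
    add_nonneg (wt i hi) (mul_nonneg (wa i hi) (wa i hi))
  have bκ : ∀ i ∈ s, ε i ^ 2 * L i / ρ i ^ 2 + ε i * L i * (ε i * L i) ≤ R * R + R * R :=
    fun i hi => add_le_add (bt i hi) (mul_le_mul (ba i hi) (ba i hi) (wa i hi) (hR i hi))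
  have hk : UB s x ρ 1 (fun i => ε i ^ 2 * L i / ρ i ^ 2 + ε i * L i * (ε i * L i))
      fun i y => (Real.sqrt (1 + (graphDet (u i) y - 1)) ^ 3)⁻¹ - 1 := by
    obtain ⟨C, hC⟩ := hP.bound
    refine comp_zero (h := fun z => (Real.sqrt (1 + z) ^ 3)⁻¹ - 1) (α := -(1 / 2))
      (β := |C| * (R * R + R * R)) hρ wκ (by norm_num)
      (mul_nonneg (abs_nonneg C) (add_nonneg (mul_self_nonneg R) (mul_self_nonneg R)))
      (fun z hz => contDiffAt_inv_sqrt_cube (by linarith [hz.1])) (by simp)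
      (fun i hi => ⟨?_, ?_⟩) hP ⟨_, bκ⟩
    -- The gradient terms are nonnegative, so the determinant can drop below 1 only by sin²(√2 u) ≤
    -- 1/4. Hence it stays away from the singularity of z ↦ (1 + z)^(-3/2).
    · have h5 : Real.sin (Real.sqrt 2 * u i (x i)) ^ 2 ≤ 1 / 4 := by
        have h6 := Real.abs_sin_le_abs (x := Real.sqrt 2 * u i (x i))
        have h7 : |Real.sqrt 2 * u i (x i)| ≤ 1 / 2 := by
          rw [abs_mul, abs_of_nonneg (Real.sqrt_nonneg 2)]
          nlinarith [sqrt_two_lt, hu4 i hi, Real.sqrt_nonneg 2, abs_nonneg (u i (x i))]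
        have h8 := sq_le_sq' (by linarith [abs_nonneg (Real.sin (Real.sqrt 2 * u i (x i)))])
          (h6.trans h7)
        rw [sq_abs] at h8
        linarith
      have h6 := abs_le_of_sq_le_sq' (h5.trans (by norm_num : (1 / 4 : ℝ) ≤ (1 / 2) ^ 2))
        (by norm_num)
      have h7 : 0 ≤ (1 - Real.sin (Real.sqrt 2 * u i (x i))) * pd 0 (u i) (x i) ^ 2 :=
        mul_nonneg (by linarith [h6.2]) (sq_nonneg _)
      have h8 : 0 ≤ (1 + Real.sin (Real.sqrt 2 * u i (x i))) * pd 1 (u i) (x i) ^ 2 :=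
        mul_nonneg (by linarith [h6.1]) (sq_nonneg _)
      have h9 := sin_sqrt_two_sq (u i (x i))
      simp only [graphDet]
      linarith
    · calc graphDet (u i) (x i) - 1 ≤ |graphDet (u i) (x i) - 1| := le_abs_self _
        _ ≤ C * (ε i ^ 2 * L i / ρ i ^ 2 + ε i * L i * (ε i * L i)) := hC i hi
        _ ≤ |C| * (ε i ^ 2 * L i / ρ i ^ 2 + ε i * L i * (ε i * L i)) :=
            mul_le_mul_of_nonneg_right (le_abs_self C) (wκ i hi)
        _ ≤ |C| * (R * R + R * R) := mul_le_mul_of_nonneg_left (bκ i hi) (abs_nonneg C)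
  -- the numerator
  have hM0 : UB s x ρ 1 (fun i => ε i ^ 2 * L i / ρ i ^ 2) fun i y =>
      graphNum (u i) y - (pd 0 (pd 0 (u i)) y + pd 1 (pd 1 (u i)) y + 2 * u i y) := by
    have hcc := one_mul hρ hc hc
    have k1 := one_add hρ one1 oσ
    have k2 := one_sub hρ one1 oσ
    have hA := one_add hρ (one_sub hρ (one_sub hρ (one_mul hρ hc (o2 0 0))
      ((one_mul hρ k2 (opp 0 0)).const_mul (Real.sqrt 2))) (hcc.const_mul (Real.sqrt 2 / 2)))
      ((one_mul hρ k1 (one_add hρ (opp 0 0) k1)).const_mul (Real.sqrt 2))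
    have hB := one_add hρ (one_sub hρ (one_mul hρ hc (o2 1 1))
      ((one_mul hρ k2 k2).const_mul (Real.sqrt 2))) (hcc.const_mul (Real.sqrt 2 / 2))
    have hD := (one_add hρ (one_mul hρ hc (one_add hρ (o2 0 1) (o2 1 0)))
      ((one_mul hρ oσ (opp 0 1)).const_mul (2 * Real.sqrt 2))).neg
    -- Writing σ = sin(√2 u) and c = cos(√2 u), the terms free of ∇u are c Δu + σ c (∂₁²u - ∂₀²u) +
    -- √2 σ c². The three error terms `t1`, `t2`, `t3` are (c - 1)Δu, the middle term, and √2 σ c² -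
    -- 2u; `t4` collects everything with ∇u.
    have t1 := (mul_one_left hρ wt os (hac hs (add_same wc hρ (hu2 0 0) (hu2 1 1)))).const_mul (-2)
    have t2 := mul_one_left hρ wt hc (hac hσ (sub_same wc hρ (hu2 1 1) (hu2 0 0)))
    have t3 := sub_same wt hρ hsin (hσ3.const_mul (Real.sqrt 2))
    have t4 := add_same wt hρ (add_same wt hρ (mul_one_left hρ wt hA (hpp 1 1))
      (mul_one_left hρ wt hB (hpp 0 0))) (mul_one_left hρ wt hD (hpp 0 1))
    refine (add_same wt hρ (add_same wt hρ t1 t2) (add_same wt hρ t3 t4)).congr fun i _ =>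
      Eventually.of_forall fun y => ?_
    have h9 : Real.cos (Real.sqrt 2 * u i y)
        = 1 - 2 * Real.sin (Real.sqrt 2 / 2 * u i y) ^ 2 := by
      rw [show Real.sqrt 2 * u i y = 2 * (Real.sqrt 2 / 2 * u i y) by ring, Real.cos_two_mul,
        Real.cos_sq']; ring
    have h10 := sin_sqrt_two_sq (u i y)
    simp only [graphNum]
    linear_combination (pd 0 (pd 0 (u i)) y + pd 1 (pd 1 (u i)) y) * h9
      + Real.sqrt 2 * Real.sin (Real.sqrt 2 * u i y) * h10
  have hM : UB s x ρ 1 (fun i => ε i / ρ i ^ 2 + ε i * L i + ε i ^ 2 * L i / ρ i ^ 2)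
      fun i => graphNum (u i) := by
    refine (add (fun i hi => add_nonneg (wc i hi) (wa i hi)) wt hρ (add wc wa hρ
      (add_same wc hρ (hu2 0 0) (hu2 1 1)) (hu.const_mul 2)) hM0).congr fun i _ =>
      Eventually.of_forall fun y => ?_
    simp only
    ring
  have hkM : UB s x ρ 1 (fun i => ε i ^ 2 * L i / ρ i ^ 2) fun i y =>
      ((Real.sqrt (1 + (graphDet (u i) y - 1)) ^ 3)⁻¹ - 1) * graphNum (u i) y := by
    refine mul_to hρ wκ (fun i hi => add_nonneg (add_nonneg (wc i hi) (wa i hi)) (wt i hi)) hk hM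
      ⟨R + R + R * R + (R + R ^ 3) + R * R, fun i hi => ?_⟩
    have b3 := baaa i hi
    have b4 := bt i hi
    have b5 := ba i hi
    have b6 := h1 i hi
    have p1 := wt i hi
    have p2 := wa i hi
    have p3 := wc i hi
    have p0 := hR i hi
    -- With a = εL, c = ε/ρ² and t the target weight, c a = t. This handles a²c, the only mixed
    -- product not already containing t or a³.
    have e4 : ε i / ρ i ^ 2 * (ε i * L i) = ε i ^ 2 * L i / ρ i ^ 2 := (e3 i).symm
    generalize ε i ^ 2 * L i / ρ i ^ 2 = t at *
    generalize ε i * L i = a at *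
    generalize ε i / ρ i ^ 2 = c at *
    have q1 : t * c ≤ R * t := by nlinarith
    have q2 : a * a * c ≤ R * t := by
      calc a * a * c = a * (c * a) := by ring
        _ = a * t := by rw [e4]
        _ ≤ R * t := mul_le_mul_of_nonneg_right b5 p1
    have q3 : t * a ≤ R * t := by nlinarith
    have q4 : t * t ≤ R * R * t := mul_le_mul_of_nonneg_right b4 p1
    have q5 : a * a * t ≤ R * R * t :=
      mul_le_mul_of_nonneg_right (mul_le_mul b5 b5 p2 p0) p1
    calc (t + a * a) * (c + a + t)
        = t * c + a * a * c + t * a + a * a * a + t * t + a * a * t := by ring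
      _ ≤ R * t + R * t + R * t + R ^ 3 * t + R * R * t + R * R * t := by linarith
      _ = _ := by ring
  have hfin := add wt hw hρ (add_same wt hρ (add_same wt hρ hkM hM0 |>.const_mul (Real.sqrt 2))
    (of_const (n := 1) (x := x) (ρ := ρ) hHa)) (hlap.const_mul (Real.sqrt 2))
  refine hfin.congr fun i _ => Eventually.of_forall fun y => ?_
  simp only [add_sub_cancel]
  ring

end UB

/-! ### The mean curvature of the necks -/

namespace UB
variable {ι : Type*} {s : Set ι} {x : ι → Plane} {n : ℕ}

lemma real_coord {f f' : ℝ → ℝ} (hf : ∀ z, HasDerivAt f (f' z) z) (k j : Fin 2) :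
    (fun _ : ι => pd j fun y : Plane => f (y k))
      = fun _ y => (if j = k then (1 : ℝ) else 0) * f' (y k) := by
  ext i y
  rw [pd_real_comp j (hf _) (differentiableAt_coord k y), pd_coord, mul_comm]

/-- cosh and sinh are exchanged by differentiation and both bounded by cosh, so no derivative costs
anything at scale 1. -/
lemma hyperbolic : UB s x (fun _ => 1) n (fun i => Real.cosh (x i 0)) (fun _ y => Real.cosh (y 0)) ∧
    UB s x (fun _ => 1) n (fun i => Real.cosh (x i 0)) (fun _ y => Real.sinh (y 0)) := by
  have b1 : ∃ C, ∀ i ∈ s, |Real.cosh (x i 0)| ≤ C * Real.cosh (x i 0) :=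
    ⟨1, fun i _ => by rw [abs_of_pos (Real.cosh_pos _), _root_.one_mul]⟩
  have b2 : ∃ C, ∀ i ∈ s, |Real.sinh (x i 0)| ≤ C * Real.cosh (x i 0) :=
    ⟨1, fun i _ => by rw [Real.abs_sinh, ← Real.cosh_abs (x i 0), _root_.one_mul]; exact (Real.sinh_lt_cosh _).le⟩
  have s1 : ∀ i ∈ s, ContDiffAt ℝ ∞ (fun y : Plane => Real.cosh (y 0)) (x i) := fun i _ =>
    (Real.contDiff_cosh.comp (contDiff_coord 0)).contDiffAt
  have s2 : ∀ i ∈ s, ContDiffAt ℝ ∞ (fun y : Plane => Real.sinh (y 0)) (x i) := fun i _ =>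
    (Real.contDiff_sinh.comp (contDiff_coord 0)).contDiffAt
  induction n with
  | zero => exact ⟨⟨s1, b1⟩, ⟨s2, b2⟩⟩
  | succ n ih =>
    refine ⟨⟨⟨s1, b1⟩, fun j => ?_⟩, ⟨⟨s2, b2⟩, fun j => ?_⟩⟩
    · rw [real_coord Real.hasDerivAt_cosh]; simpa only [div_one] using ih.2.const_mul (if j = 0 then (1 : ℝ) else 0)
    · rw [real_coord Real.hasDerivAt_sinh]; simpa only [div_one] using ih.1.const_mul (if j = 0 then (1 : ℝ) else 0)

lemma trigonometric : UB s x (fun _ => 1) n (fun _ => 1) (fun _ y => Real.cos (2 * y 1)) ∧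
    UB s x (fun _ => 1) n (fun _ => 1) (fun _ y => Real.sin (2 * y 1)) := by
  have b1 : ∃ C, ∀ i ∈ s, |Real.cos (2 * x i 1)| ≤ C * 1 :=
    ⟨1, fun i _ => by simpa using Real.abs_cos_le_one _⟩
  have b2 : ∃ C, ∀ i ∈ s, |Real.sin (2 * x i 1)| ≤ C * 1 :=
    ⟨1, fun i _ => by simpa using Real.abs_sin_le_one _⟩
  have s1 : ∀ i ∈ s, ContDiffAt ℝ ∞ (fun y : Plane => Real.cos (2 * y 1)) (x i) := fun i _ =>
    (contDiff_const.mul (contDiff_coord 1)).cos.contDiffAt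
  have s2 : ∀ i ∈ s, ContDiffAt ℝ ∞ (fun y : Plane => Real.sin (2 * y 1)) (x i) := fun i _ =>
    (contDiff_const.mul (contDiff_coord 1)).sin.contDiffAt
  have d1 : ∀ z : ℝ, HasDerivAt (fun z => Real.cos (2 * z)) (-2 * Real.sin (2 * z)) z := fun z => by
    have := ((hasDerivAt_id z).const_mul 2).cos
    simpa [mul_comm] using this
  have d2 : ∀ z : ℝ, HasDerivAt (fun z => Real.sin (2 * z)) (2 * Real.cos (2 * z)) z := fun z => by
    have := ((hasDerivAt_id z).const_mul 2).sin
    simpa [mul_comm] using this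
  induction n with
  | zero => exact ⟨⟨s1, b1⟩, ⟨s2, b2⟩⟩
  | succ n ih =>
    refine ⟨⟨⟨s1, b1⟩, fun j => ?_⟩, ⟨⟨s2, b2⟩, fun j => ?_⟩⟩
    · rw [real_coord d1]
      simpa only [div_one] using (ih.2.const_mul (-2)).const_mul (if j = 1 then (1 : ℝ) else 0)
    · rw [real_coord d2]
      simpa only [div_one] using (ih.1.const_mul 2).const_mul (if j = 1 then (1 : ℝ) else 0)

/-- Dividing by the value at the base point makes the argument of z ↦ z⁻¹ equal to 1 there, so the
compact set in the composition rule is {1}, however large cosh is. -/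
lemma inv_cosh : UB s x (fun _ => 1) n (fun i => 1 / Real.cosh (x i 0))
    (fun _ y => (Real.cosh (y 0))⁻¹) := by
  have h1 : UB s x (fun _ => 1) n (fun i => 1 / Real.cosh (x i 0))
      fun i _ => 1 / Real.cosh (x i 0) :=
    const_self fun i _ => (one_div_pos.2 (Real.cosh_pos _)).le
  have w1 : ∀ i ∈ s, 0 ≤ 1 / Real.cosh (x i 0) := fun i _ => (one_div_pos.2 (Real.cosh_pos _)).le
  have h2 : UB s x (fun _ => 1) n (fun _ => 1) fun i y => 1 / Real.cosh (x i 0) * Real.cosh (y 0) :=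
    mul_to (fun _ _ => zero_lt_one) w1 (fun i _ => (Real.cosh_pos _).le) h1 hyperbolic.1
      ⟨1, fun i _ => by have := (Real.cosh_pos (x i 0)).ne'; simp [this]⟩
  have h3 : UB s x (fun _ => 1) n (fun _ => 1)
      fun i y => (1 / Real.cosh (x i 0) * Real.cosh (y 0))⁻¹ :=
    comp_one (h := fun z => z⁻¹) (fun _ _ => zero_lt_one) (fun _ _ => zero_le_one)
      (isCompact_singleton (x := (1 : ℝ))) (fun z hz => contDiffAt_inv ℝ (by rw [hz]; norm_num))
      (fun i _ => by have := (Real.cosh_pos (x i 0)).ne'; simp [this]) h2 ⟨1, fun _ _ => le_rfl⟩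
  refine (mul_one_left (fun _ _ => zero_lt_one) w1 h3 h1).congr fun i _ =>
    Eventually.of_forall fun y => ?_
  have := (Real.cosh_pos (x i 0)).ne'
  have := (Real.cosh_pos (y 0)).ne'
  simp only
  field_simp

end UB

/-- This is the determinant of the neck metric divided by cosh⁴ s, with t = tanh s. The lower bound
is (1 - 3/8)² - (3/8)² = 1/4. -/
lemma neckDet_pos_of {σ t κ τ : ℝ} (hσ : |σ| ≤ 3 / 8) (ht : t ^ 2 ≤ 1) (hκ : κ ^ 2 + τ ^ 2 = 1) :
    (1 + σ * t ^ 2 * κ) * (1 - σ * κ) - σ ^ 2 * t ^ 2 * τ ^ 2 ∈ Icc (1 / 4 : ℝ) 2 := by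
  have h1 := abs_le.1 hσ
  have hk : |κ| ≤ 1 := abs_le_one_iff_mul_self_le_one.2 (by nlinarith)
  have h3 : |σ * κ| ≤ 3 / 8 := by
    rw [abs_mul]; nlinarith [abs_nonneg σ, abs_nonneg κ]
  have h4 := abs_le.1 h3
  have h5 : |σ * κ * t ^ 2| ≤ 3 / 8 := by
    rw [abs_mul, abs_of_nonneg (sq_nonneg t)]; nlinarith [abs_nonneg (σ * κ), sq_nonneg t]
  have h6 := abs_le.1 h5
  have h7 : σ ^ 2 ≤ 9 / 64 := by nlinarith
  have h8 : t ^ 2 * τ ^ 2 ≤ 1 := by nlinarith [sq_nonneg κ, sq_nonneg τ, sq_nonneg t]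
  have h9 : σ ^ 2 * (t ^ 2 * τ ^ 2) ≤ 9 / 64 := by
    calc σ ^ 2 * (t ^ 2 * τ ^ 2) ≤ σ ^ 2 * 1 := mul_le_mul_of_nonneg_left h8 (sq_nonneg σ)
      _ ≤ 9 / 64 := by linarith
  have h10 : 0 ≤ σ ^ 2 * (t ^ 2 * τ ^ 2) := by positivity
  constructor <;> nlinarith

/-- Minimality of the catenoid: the terms ∓ c/2 · D³ cancel, leaving σ κ (D² + S²). Likewise D² - S²
= 1 collapses the two largest terms in e. The rest is sorted into products of S/D and D⁻², each
multiplied by σ, by σ/e or by one more D⁻². -/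
lemma neckNum_identity {σ c κ τ S D e r a k : ℝ} (hD : D ≠ 0) (he : e ≠ 0) (hS : D ^ 2 = S ^ 2 + 1) :
    a * (D * (D ^ 2 * (1 - σ * κ) * (-(c / 2 * D) - r / 2 * e * S * (κ - σ)
          - r / 4 * c ^ 2 * e * S ^ 3 * κ) -
        2 * -(σ * S * D * τ) * (r / 4 * e * D * τ * (1 + c ^ 2 * S ^ 2)) +
        (D ^ 2 + σ * S ^ 2 * κ) * (c / 2 * D + r / 4 * c ^ 2 * e * S * D ^ 2 * κ))) /
      (e * (D ^ 2 * k) ^ 3) =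
    a * ((k ^ 3)⁻¹ *
        (1 / 2 * (c * κ * (S * D⁻¹ * (S * D⁻¹) + 1) * (1 / e * σ * (D⁻¹ * D⁻¹))) +
          -(r / 2) * ((1 - σ * κ) * (S * D⁻¹) * (κ - σ) * (D⁻¹ * D⁻¹)) +
          (r / 4 * (c * c * κ * (S * D⁻¹) * (D⁻¹ * D⁻¹)) +
            r / 2 * (κ * κ * (c * c * (S * D⁻¹ * (S * D⁻¹ * (S * D⁻¹)))) * σ)) +
          r / 2 * (S * D⁻¹ * (τ * τ) * (D⁻¹ * D⁻¹ + c * c * (S * D⁻¹ * (S * D⁻¹))) * σ))) := by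
  have key : D * (D ^ 2 * (1 - σ * κ) * (-(c / 2 * D) - r / 2 * e * S * (κ - σ)
          - r / 4 * c ^ 2 * e * S ^ 3 * κ) -
        2 * -(σ * S * D * τ) * (r / 4 * e * D * τ * (1 + c ^ 2 * S ^ 2)) +
        (D ^ 2 + σ * S ^ 2 * κ) * (c / 2 * D + r / 4 * c ^ 2 * e * S * D ^ 2 * κ))
      = D * (c / 2 * D * σ * κ * (D ^ 2 + S ^ 2) - D ^ 2 * (1 - σ * κ) * (r / 2 * e * S * (κ - σ))
        + r / 4 * c ^ 2 * S * κ * D ^ 2 * e * (1 + 2 * σ * κ * S ^ 2)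
        + r / 2 * σ * e * S * D ^ 2 * τ ^ 2 * (1 + c ^ 2 * S ^ 2)) := by
    linear_combination D * (r / 4 * c ^ 2 * S * κ * D ^ 2 * e) * hS
  rcases eq_or_ne k 0 with rfl | hk
  · simp
  rw [key]
  field_simp
  ring

/-- After the cancellation each term contains sin(√2 εs)/(ε cosh² s), which is O(L / cosh² s), or
cosh⁻² s, or sin(√2 εs) = O(εL). The last, like Ha, is acceptable because ε cosh² s ≤ 1. The scale
is 1 since (s, θ) are already logarithmic coordinates. -/
theorem UB.neck {ι : Type*} {s : Set ι} {x : ι → Plane} {ε L Ha : ι → ℝ} {R : ℝ}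
    (hε : ∀ i ∈ s, 0 < ε i) (hL : ∀ i ∈ s, 1 ≤ L i) (hx : ∀ i ∈ s, |x i 0| ≤ L i)
    (hεL : ∀ i ∈ s, ε i * L i ≤ 1 / 4) (hK : ∀ i ∈ s, ε i * Real.cosh (x i 0) ^ 2 ≤ 1)
    (hHa : ∀ i ∈ s, |Ha i| ≤ R * (ε i * L i)) :
    UB s x (fun _ => 1) 1 (fun i => L i / Real.cosh (x i 0) ^ 2) fun i y =>
      2 * Real.sqrt 2 * (Real.cosh (y 0) * neckNum (ε i) y)
        / (ε i * Real.sqrt (neckDet (ε i) y) ^ 3) - Ha i := by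
  have hρ : ∀ i ∈ s, (0 : ℝ) < (fun _ : ι => (1 : ℝ)) i := fun _ _ => zero_lt_one
  have zo : ∀ i ∈ s, (0 : ℝ) ≤ (fun _ : ι => (1 : ℝ)) i := fun _ _ => zero_le_one
  have wa : ∀ i ∈ s, 0 ≤ ε i * L i := fun i hi => by
    have := hε i hi; have := hL i hi; positivity
  have wK : ∀ i ∈ s, 0 ≤ 1 / Real.cosh (x i 0) := fun i _ => (one_div_pos.2 (Real.cosh_pos _)).le
  have wt : ∀ i ∈ s, 0 ≤ L i / Real.cosh (x i 0) ^ 2 := fun i hi => by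
    have := hL i hi; positivity
  have baτ : ∀ i ∈ s, ε i * L i ≤ 1 * (L i / Real.cosh (x i 0) ^ 2) := fun i hi => by
    have h1 := hK i hi
    have h2 := hL i hi
    have h3 := Real.cosh_pos (x i 0)
    rw [_root_.one_mul, le_div_iff₀ (by positivity)]
    nlinarith
  have bKτ : ∀ i ∈ s, 1 / Real.cosh (x i 0) * (1 / Real.cosh (x i 0))
      ≤ 1 * (L i / Real.cosh (x i 0) ^ 2) := fun i hi => by
    rw [_root_.one_mul, div_mul_div_comm, _root_.one_mul, ← sq]
    exact div_le_div_of_nonneg_right (hL i hi) (sq_nonneg _)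
  have ba : ∀ i ∈ s, ε i * L i ≤ 1 := fun i hi => (hεL i hi).trans (by norm_num)
  have hy : UB s x (fun _ => 1) 1 (fun i => ε i * L i) fun i y => ε i * y 0 := by
    refine UB.succ_iff.2 ⟨⟨fun i _ => (contDiff_const.mul (contDiff_coord 0)).contDiffAt, 1,
      fun i hi => ?_⟩, fun j => ?_⟩
    · rw [abs_mul, abs_of_pos (hε i hi), _root_.one_mul]
      exact mul_le_mul_of_nonneg_left (hx i hi) (hε i hi).le
    · have : (fun i => pd j fun y : Plane => ε i * y 0)
          = fun i _ => ε i * if j = 0 then 1 else 0 := by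
        ext i y; rw [pd_const_mul, pd_coord]
      rw [this]
      refine UB.of_const ⟨1, fun i hi => ?_⟩
      have h1 := hε i hi
      have h2 := hL i hi
      rw [abs_mul, abs_of_pos h1, _root_.one_mul, div_one]
      refine mul_le_mul_of_nonneg_left ?_ h1.le
      split_ifs <;> simp <;> linarith
  have hy4 : ∀ i ∈ s, ε i * x i 0 ∈ Icc (-(1 / 4) : ℝ) (1 / 4) := fun i hi => by
    refine abs_le.1 ?_
    rw [abs_mul, abs_of_pos (hε i hi)]
    exact (mul_le_mul_of_nonneg_left (hx i hi) (hε i hi).le).trans (hεL i hi)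
  have c1 : ContDiff ℝ ∞ fun z : ℝ => Real.sqrt 2 * z := contDiff_const.mul contDiff_id
  have hσ : UB s x (fun _ => 1) 1 (fun i => ε i * L i)
      fun i y => Real.sin (Real.sqrt 2 * (ε i * y 0)) :=
    UB.comp_zero (h := fun z => Real.sin (Real.sqrt 2 * z)) hρ wa (by norm_num) (by norm_num)
      (fun z _ => c1.sin.contDiffAt) (by simp) hy4 hy ⟨1, ba⟩
  have hc : UB s x (fun _ => 1) 1 (fun _ => 1) fun i y => Real.cos (Real.sqrt 2 * (ε i * y 0)) :=
    UB.comp_one (h := fun z => Real.cos (Real.sqrt 2 * z)) hρ wa isCompact_Icc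
      (fun z _ => c1.cos.contDiffAt) hy4 hy ⟨1, ba⟩
  have oσ : UB s x (fun _ => 1) 1 (fun _ => 1) fun i y => Real.sin (Real.sqrt 2 * (ε i * y 0)) :=
    hσ.mono hρ wa ⟨1, by simpa using ba⟩
  have hk := (UB.trigonometric (s := s) (x := x) (n := 1)).1
  have hτ := (UB.trigonometric (s := s) (x := x) (n := 1)).2
  have hI := UB.inv_cosh (s := s) (x := x) (n := 1)
  have ht : UB s x (fun _ => 1) 1 (fun _ => 1) fun _ y => Real.sinh (y 0) * (Real.cosh (y 0))⁻¹ :=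
    UB.mul_to hρ (fun i _ => (Real.cosh_pos _).le) wK UB.hyperbolic.2 hI
      ⟨1, fun i _ => by have := (Real.cosh_pos (x i 0)).ne'; simp [this]⟩
  have hII : UB s x (fun _ => 1) 1 (fun i => L i / Real.cosh (x i 0) ^ 2)
      fun _ y => (Real.cosh (y 0))⁻¹ * (Real.cosh (y 0))⁻¹ := UB.mul_to hρ wK wK hI hI ⟨1, bKτ⟩
  have oII : UB s x (fun _ => 1) 1 (fun _ => 1)
      fun _ y => (Real.cosh (y 0))⁻¹ * (Real.cosh (y 0))⁻¹ := by
    refine UB.mul_to hρ wK wK hI hI ⟨1, fun i _ => ?_⟩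
    have h1 : 1 / Real.cosh (x i 0) ≤ 1 := (div_le_one (Real.cosh_pos _)).2 (Real.one_le_cosh _)
    have h2 := wK i ‹_›
    nlinarith
  have hσε : UB s x (fun _ => 1) 1 (fun i => L i / Real.cosh (x i 0) ^ 2) fun i y =>
      (1 / ε i * Real.sin (Real.sqrt 2 * (ε i * y 0)))
        * ((Real.cosh (y 0))⁻¹ * (Real.cosh (y 0))⁻¹) := by
    have w1 : ∀ i ∈ s, 0 ≤ 1 / ε i := fun i hi => (one_div_pos.2 (hε i hi)).le
    refine UB.mul_to hρ (fun i hi => mul_nonneg (w1 i hi) (wa i hi))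
      (fun i hi => mul_nonneg (wK i hi) (wK i hi))
      (UB.mul hρ w1 wa (UB.const_self w1) hσ) (UB.mul hρ wK wK hI hI) ⟨1, fun i hi => ?_⟩
    have := (hε i hi).ne'
    have := (Real.cosh_pos (x i 0)).ne'
    refine le_of_eq ?_
    field_simp
  have hστ : ∀ {g : ι → Plane → ℝ}, UB s x (fun _ => 1) 1 (fun _ => 1) g →
      UB s x (fun _ => 1) 1 (fun i => L i / Real.cosh (x i 0) ^ 2)
        fun i y => g i y * Real.sin (Real.sqrt 2 * (ε i * y 0)) := fun hg =>
    (UB.mul_one_left hρ wa hg hσ).mono hρ wa ⟨1, baτ⟩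
  have one1 : UB s x (fun _ => 1) 1 (fun _ => 1) fun _ _ => (1 : ℝ) := UB.const_one 1
  -- the determinant
  have htt := UB.one_mul hρ ht ht
  have hσk := UB.one_mul hρ oσ hk
  have hP := UB.one_sub hρ (UB.one_mul hρ (UB.one_add hρ one1 (UB.one_mul hρ hσk htt))
    (UB.one_sub hρ one1 hσk))
    (UB.one_mul hρ (UB.one_mul hρ (UB.one_mul hρ oσ oσ) htt) (UB.one_mul hρ hτ hτ))
  have hPk := UB.comp_one (h := fun z => (Real.sqrt (1 + (z - 1)) ^ 3)⁻¹ - 1)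
    (K := Icc (1 / 4) 2) hρ zo isCompact_Icc
    (fun z hz => (contDiffAt_inv_sqrt_cube (z := z - 1) (by linarith [hz.1])).comp z
      (contDiffAt_id.sub contDiffAt_const)) (fun i hi => by
      have h1 := neckDet_pos_of (σ := Real.sin (Real.sqrt 2 * (ε i * x i 0)))
        (t := Real.sinh (x i 0) * (Real.cosh (x i 0))⁻¹) (κ := Real.cos (2 * x i 1))
        (τ := Real.sin (2 * x i 1)) ?_ ?_ (Real.cos_sq_add_sin_sq _)
      · convert h1 using 1; ring
      · refine Real.abs_sin_le_abs.trans ?_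
        rw [abs_mul, abs_of_nonneg (Real.sqrt_nonneg 2)]
        have := abs_le.2 (hy4 i hi)
        nlinarith [sqrt_two_lt, Real.sqrt_nonneg 2, abs_nonneg (ε i * x i 0)]
      · have h2 := Real.cosh_pos (x i 0)
        rw [mul_pow, inv_pow, ← div_eq_mul_inv, div_le_one (by positivity), Real.cosh_sq]
        linarith) hP ⟨1, fun _ _ => le_rfl⟩
  -- the numerator
  have hcc := UB.one_mul hρ hc hc
  have m1 := (UB.mul_one_left hρ wt (UB.one_mul hρ (UB.one_mul hρ hc hk) (UB.one_add hρ htt one1))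
    hσε).const_mul (1 / 2)
  have m2 := (UB.mul_one_left hρ wt (UB.one_mul hρ (UB.one_mul hρ (UB.one_sub hρ one1 hσk) ht)
    (UB.one_sub hρ hk oσ)) hII).const_mul (-(Real.sqrt 2 / 2))
  have m3 := (UB.mul_one_left hρ wt (UB.one_mul hρ (UB.one_mul hρ hcc hk) ht) hII).const_mul
    (Real.sqrt 2 / 4)
  have m4 := (hστ (UB.one_mul hρ (UB.one_mul hρ hk hk) (UB.one_mul hρ hcc
    (UB.one_mul hρ ht htt)))).const_mul (Real.sqrt 2 / 2)
  have m5 := (hστ (UB.one_mul hρ (UB.one_mul hρ ht (UB.one_mul hρ hτ hτ))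
    (UB.one_add hρ oII (UB.one_mul hρ hcc htt)))).const_mul (Real.sqrt 2 / 2)
  have hN := UB.add_same wt hρ (UB.add_same wt hρ (UB.add_same wt hρ m1 m2)
    (UB.add_same wt hρ m3 m4)) m5
  have hHa' : UB s x (fun _ => 1) 1 (fun i => L i / Real.cosh (x i 0) ^ 2) fun i _ => Ha i :=
    (UB.of_const (w := fun i => ε i * L i) ⟨R, hHa⟩).mono hρ wa ⟨1, baτ⟩
  refine (UB.sub_same wt hρ ((UB.mul_one_left hρ wt (UB.one_add hρ hPk one1) hN).const_mul
    (2 * Real.sqrt 2)) hHa').congr fun i hi => Eventually.of_forall fun y => ?_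
  have hch := Real.cosh_pos (y 0)
  have hε0 := (hε i hi).ne'
  have hdet : neckDet (ε i) y = (Real.cosh (y 0) ^ 2) ^ 2 *
      ((1 + Real.sin (Real.sqrt 2 * (ε i * y 0)) * Real.cos (2 * y 1) *
          (Real.sinh (y 0) * (Real.cosh (y 0))⁻¹ * (Real.sinh (y 0) * (Real.cosh (y 0))⁻¹))) *
        (1 - Real.sin (Real.sqrt 2 * (ε i * y 0)) * Real.cos (2 * y 1)) -
      Real.sin (Real.sqrt 2 * (ε i * y 0)) * Real.sin (Real.sqrt 2 * (ε i * y 0)) *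
          (Real.sinh (y 0) * (Real.cosh (y 0))⁻¹ * (Real.sinh (y 0) * (Real.cosh (y 0))⁻¹)) *
        (Real.sin (2 * y 1) * Real.sin (2 * y 1))) := by
    simp [neckDet, neckG]
    field_simp
  simp only
  rw [hdet, Real.sqrt_mul (by positivity), Real.sqrt_sq (by positivity), add_sub_cancel,
    sub_add_cancel]
  generalize (1 + Real.sin (Real.sqrt 2 * (ε i * y 0)) * Real.cos (2 * y 1) *
          (Real.sinh (y 0) * (Real.cosh (y 0))⁻¹ * (Real.sinh (y 0) * (Real.cosh (y 0))⁻¹))) *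
        (1 - Real.sin (Real.sqrt 2 * (ε i * y 0)) * Real.cos (2 * y 1)) -
      Real.sin (Real.sqrt 2 * (ε i * y 0)) * Real.sin (Real.sqrt 2 * (ε i * y 0)) *
          (Real.sinh (y 0) * (Real.cosh (y 0))⁻¹ * (Real.sinh (y 0) * (Real.cosh (y 0))⁻¹)) *
        (Real.sin (2 * y 1) * Real.sin (2 * y 1)) = P
  have hS := Real.cosh_sq (y 0)
  simp only [neckNum, neckG, neckB, Matrix.cons_val_zero, Matrix.cons_val_one, Matrix.cons_val]
  exact congrArg (· - Ha i) (neckNum_identity hch.ne' hε0 hS)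

/-! ### Lattices in the plane -/

section lattice
variable {τ₁ τ₂ : Plane}

lemma zero_mem_planeLattice : (0 : Plane) ∈ planeLattice τ₁ τ₂ := ⟨0, 0, by simp⟩

lemma add_mem_planeLattice {μ ν : Plane} (hμ : μ ∈ planeLattice τ₁ τ₂)
    (hν : ν ∈ planeLattice τ₁ τ₂) : μ + ν ∈ planeLattice τ₁ τ₂ := by
  obtain ⟨m, n, rfl⟩ := hμ
  obtain ⟨k, l, rfl⟩ := hν
  exact ⟨m + k, n + l, by push_cast; module⟩

lemma neg_mem_planeLattice {μ : Plane} (hμ : μ ∈ planeLattice τ₁ τ₂) :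
    -μ ∈ planeLattice τ₁ τ₂ := by
  obtain ⟨m, n, rfl⟩ := hμ
  exact ⟨-m, -n, by push_cast; module⟩

lemma abs_coord_le (μ : Plane) (i : Fin 2) : |μ i| ≤ ‖μ‖ := by
  simpa using PiLp.norm_apply_le μ i

/-- The determinant D of the generators is nonzero because the lattice contains two independent
period vectors. By Cramer's rule ν ∧ τ is an integer multiple of D for τ one of the generators,
nonzero for one choice, which bounds |ν| below. -/
lemma planeLattice_separated
    (hperiod : ∀ i, EuclideanSpace.single i (2 * Real.pi) ∈ planeLattice τ₁ τ₂) :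
    ∃ r > 0, ∀ ν ∈ planeLattice τ₁ τ₂, ν ≠ 0 → r ≤ ‖ν‖ := by
  set D := τ₁ 0 * τ₂ 1 - τ₁ 1 * τ₂ 0 with hD
  have hD0 : D ≠ 0 := by
    intro h0
    obtain ⟨m, n, h⟩ := hperiod 0
    obtain ⟨k, l, h'⟩ := hperiod 1
    have a0 := congrArg (fun v : Plane => v 0) h
    have a1 := congrArg (fun v : Plane => v 1) h
    have b0 := congrArg (fun v : Plane => v 0) h'
    have b1 := congrArg (fun v : Plane => v 1) h'
    simp at a0 a1 b0 b1
    have : (2 * Real.pi) * (2 * Real.pi) = 0 := by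
      linear_combination (2 * Real.pi) * a0 + (m * τ₁ 0 + n * τ₂ 0) * b1
        - (m * τ₁ 1 + n * τ₂ 1) * b0 + (m * l - n * k : ℝ) * (hD.symm.trans h0)
    have := Real.pi_pos
    nlinarith
  set M := 2 * (‖τ₁‖ + ‖τ₂‖ + 1) with hM
  have hM0 : 0 < M := by positivity
  refine ⟨|D| / M, div_pos (abs_pos.2 hD0) hM0, ?_⟩
  rintro ν ⟨m, n, hν⟩ hne
  have a0 : ν 0 = m * τ₁ 0 + n * τ₂ 0 := by rw [hν]; simp
  have a1 : ν 1 = m * τ₁ 1 + n * τ₂ 1 := by rw [hν]; simp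
  have key : ∀ (k : ℤ) (τ : Plane), ‖τ‖ ≤ ‖τ₁‖ + ‖τ₂‖ → |(k : ℝ) * D| = |ν 0 * τ 1 - ν 1 * τ 0| →
      k ≠ 0 → |D| / M ≤ ‖ν‖ := by
    intro k τ hτ h hk
    rw [div_le_iff₀ hM0]
    have h1 : (1 : ℝ) ≤ |(k : ℝ)| := by exact_mod_cast Int.one_le_abs hk
    have h2 : |(k : ℝ) * D| ≤ 2 * (‖ν‖ * ‖τ‖) := by
      rw [h]
      refine (abs_sub _ _).trans ?_
      rw [abs_mul, abs_mul, two_mul]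
      exact add_le_add (mul_le_mul (abs_coord_le _ _) (abs_coord_le _ _) (abs_nonneg _)
        (norm_nonneg _)) (mul_le_mul (abs_coord_le _ _) (abs_coord_le _ _) (abs_nonneg _)
        (norm_nonneg _))
    rw [abs_mul] at h2
    nlinarith [abs_nonneg D, norm_nonneg ν, mul_le_mul_of_nonneg_left hτ (norm_nonneg ν)]
  by_cases hm : m = 0
  · by_cases hn : n = 0
    · exact absurd (by rw [hν, hm, hn]; simp) hne
    · refine key n τ₁ (by linarith [norm_nonneg τ₂]) ?_ hn
      rw [a0, a1, ← abs_neg, hD]; congr 1; ring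
  · refine key m τ₂ (by linarith [norm_nonneg τ₁]) ?_ hm
    rw [a0, a1, hD]; congr 1; ring

/-- The plane lattices that contain `2πℤ²`, with a lower bound for the distances of their points. -/
structure IsPeriodLattice (Λ : Set Plane) (r : ℝ) : Prop where
  pos : 0 < r
  zero_mem : (0 : Plane) ∈ Λ
  add_mem : ∀ μ ∈ Λ, ∀ ν ∈ Λ, μ + ν ∈ Λ
  neg_mem : ∀ μ ∈ Λ, -μ ∈ Λ
  period : ∀ i, EuclideanSpace.single i (2 * Real.pi) ∈ Λ
  separated : ∀ ν ∈ Λ, ν ≠ 0 → r ≤ ‖ν‖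

lemma isPeriodLattice_planeLattice
    (hperiod : ∀ i, EuclideanSpace.single i (2 * Real.pi) ∈ planeLattice τ₁ τ₂) :
    ∃ r, IsPeriodLattice (planeLattice τ₁ τ₂) r := by
  obtain ⟨r, h1, h2⟩ := planeLattice_separated hperiod
  exact ⟨r, h1, zero_mem_planeLattice, fun _ h _ => add_mem_planeLattice h,
    fun _ => neg_mem_planeLattice, hperiod, h2⟩

end lattice

namespace IsPeriodLattice
variable {Λ : Set Plane} {r : ℝ}

lemma sub_mem (hΛ : IsPeriodLattice Λ r) {μ ν : Plane} (hμ : μ ∈ Λ) (hν : ν ∈ Λ) : μ - ν ∈ Λ :=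
  sub_eq_add_neg μ ν ▸ hΛ.add_mem _ hμ _ (hΛ.neg_mem _ hν)

lemma le_dist (hΛ : IsPeriodLattice Λ r) {μ ν : Plane} (hμ : μ ∈ Λ) (hν : ν ∈ Λ) (h : μ ≠ ν) :
    r ≤ dist μ ν := by
  rw [dist_eq_norm]
  exact hΛ.separated _ (hΛ.sub_mem hμ hν) (sub_ne_zero.2 h)

lemma isClosed (hΛ : IsPeriodLattice Λ r) : IsClosed Λ :=
  Metric.isClosed_of_pairwise_le_dist hΛ.pos fun _ hμ _ hν h => hΛ.le_dist hμ hν h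

lemma nonempty (hΛ : IsPeriodLattice Λ r) : Λ.Nonempty := ⟨0, hΛ.zero_mem⟩

lemma exists_dist_eq (hΛ : IsPeriodLattice Λ r) (μ : Plane) :
    ∃ ν ∈ Λ, Metric.infDist μ Λ = ‖μ - ν‖ := by
  obtain ⟨ν, h1, h2⟩ := hΛ.isClosed.exists_infDist_eq_dist hΛ.nonempty μ
  exact ⟨ν, h1, by rw [h2, dist_eq_norm]⟩

lemma infDist_add (hΛ : IsPeriodLattice Λ r) {ν : Plane} (hν : ν ∈ Λ) (μ : Plane) :
    Metric.infDist (μ + ν) Λ = Metric.infDist μ Λ := by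
  obtain ⟨a, ha, h1⟩ := hΛ.exists_dist_eq (μ + ν)
  obtain ⟨b, hb, h2⟩ := hΛ.exists_dist_eq μ
  refine le_antisymm ?_ ?_
  · refine (Metric.infDist_le_dist_of_mem (hΛ.add_mem _ hb _ hν)).trans (le_of_eq ?_)
    rw [dist_eq_norm, h2]; congr 1; abel
  · refine (Metric.infDist_le_dist_of_mem (hΛ.sub_mem ha hν)).trans (le_of_eq ?_)
    rw [dist_eq_norm, h1]; congr 1; abel

/-- Near a lattice point, the distance to the lattice is the distance to this point. -/
lemma infDist_eq (hΛ : IsPeriodLattice Λ r) {μ ν : Plane} (hν : ν ∈ Λ) (h : ‖μ - ν‖ ≤ r / 2) :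
    Metric.infDist μ Λ = ‖μ - ν‖ := by
  obtain ⟨b, hb, h2⟩ := hΛ.exists_dist_eq μ
  refine le_antisymm ((Metric.infDist_le_dist_of_mem hν).trans_eq (dist_eq_norm _ _)) ?_
  rw [h2]
  by_cases hbν : b = ν
  · rw [hbν]
  · have h3 := hΛ.le_dist hb hν hbν
    have h4 := dist_triangle_left b ν μ
    rw [dist_eq_norm μ b, dist_eq_norm μ ν] at h4
    linarith

lemma eq_of_norm_sub_lt (hΛ : IsPeriodLattice Λ r) {μ ν ν' : Plane} (hν : ν ∈ Λ) (hν' : ν' ∈ Λ)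
    (h : ‖μ - ν‖ < r / 2) (h' : ‖μ - ν'‖ ≤ r / 2) : ν = ν' := by
  by_contra hne
  have h3 := hΛ.le_dist hν hν' hne
  have h4 := dist_triangle_left ν ν' μ
  rw [dist_eq_norm μ ν, dist_eq_norm μ ν'] at h4
  linarith

lemma finite_inter_closedBall (hΛ : IsPeriodLattice Λ r) (c : Plane) (R : ℝ) :
    (Λ ∩ Metric.closedBall c R).Finite := by
  have hd : DiscreteTopology Λ := by
    refine DiscreteTopology.of_forall_le_dist hΛ.pos fun x y hxy => ?_
    exact hΛ.le_dist x.2 y.2 (fun h => hxy (Subtype.ext h))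
  exact (((isCompact_closedBall c R).inter_left hΛ.isClosed).finite
    ((isDiscrete_iff_discreteTopology.2 hd).mono inter_subset_left))

lemma zsmul_mem (hΛ : IsPeriodLattice Λ r) (n : ℤ) {ν : Plane} (hν : ν ∈ Λ) :
    n • ν ∈ Λ := by
  let H : AddSubgroup Plane :=
    { carrier := Λ, zero_mem' := hΛ.zero_mem, add_mem' := fun h h' => hΛ.add_mem _ h _ h',
      neg_mem' := fun h => hΛ.neg_mem _ h }
  exact H.zsmul_mem (x := ν) hν n

end IsPeriodLattice

/-! ### The neck size -/

/-- The function `ε ↦ - ε log ε + ε κ`. -/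
def neckEq (κ ε : ℝ) : ℝ := -ε * Real.log ε + ε * κ

lemma continuous_neckEq (κ : ℝ) : Continuous (neckEq κ) :=
  Real.continuous_negMulLog.add (continuous_id.mul continuous_const)

/-- The derivative -log ε - 1 + κ is positive exactly below e^{κ-1}. -/
lemma neckEq_strictMonoOn (κ : ℝ) : StrictMonoOn (neckEq κ) (Icc 0 (Real.exp (κ - 1))) := by
  have hc := continuous_neckEq κ
  refine strictMonoOn_of_deriv_pos (convex_Icc _ _) hc.continuousOn fun x hx => ?_
  rw [interior_Icc] at hx
  have h1 : HasDerivAt (neckEq κ) (-Real.log x - 1 + 1 * κ) x :=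
    (Real.hasDerivAt_negMulLog hx.1.ne').add ((hasDerivAt_id x).mul_const κ)
  rw [h1.deriv]
  have := (Real.log_lt_iff_lt_exp hx.1).2 hx.2
  linarith

/-- On the increasing branch starting at 0 there is exactly one root for small t, and it lies below
any other positive root. The infimum is therefore attained, positive and as small as wanted. -/
lemma sInf_neckEq (κ : ℝ) {δ : ℝ} (hδ : 0 < δ) : ∃ t₀ > 0, ∀ t, 0 < t → t < t₀ →
    0 < sInf {ε | 0 < ε ∧ t = neckEq κ ε} ∧ sInf {ε | 0 < ε ∧ t = neckEq κ ε} < δ ∧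
      t = neckEq κ (sInf {ε | 0 < ε ∧ t = neckEq κ ε}) := by
  set m := min δ (Real.exp (κ - 1)) with hm
  have hm0 : 0 < m := lt_min hδ (Real.exp_pos _)
  have mono : StrictMonoOn (neckEq κ) (Icc 0 m) :=
    (neckEq_strictMonoOn κ).mono (Icc_subset_Icc_right (min_le_right _ _))
  have h00 : neckEq κ 0 = 0 := by simp [neckEq]
  refine ⟨neckEq κ m, ?_, fun t ht htm => ?_⟩
  · rw [← h00]
    exact mono ⟨le_rfl, hm0.le⟩ ⟨hm0.le, le_rfl⟩ hm0
  · have hc := continuous_neckEq κ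
    obtain ⟨e, ⟨he0, hem⟩, he⟩ := intermediate_value_Ioo hm0.le hc.continuousOn
      (show t ∈ Ioo (neckEq κ 0) (neckEq κ m) from ⟨by rwa [h00], htm⟩)
    have hl : IsLeast {ε | 0 < ε ∧ t = neckEq κ ε} e := by
      refine ⟨⟨he0, he.symm⟩, fun x hx => ?_⟩
      by_contra hlt
      have h1 := mono ⟨hx.1.le, ((not_le.1 hlt).trans hem).le⟩ ⟨he0.le, hem.le⟩ (not_le.1 hlt)
      rw [← hx.2, he] at h1
      exact lt_irrefl _ h1
    rw [hl.csInf_eq]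
    exact ⟨he0, hem.trans_le (min_le_left _ _), he.symm⟩

lemma cliffordHeight_pos {a : ℝ} (ha : 0 < a) : 0 < cliffordHeight a :=
  div_pos (Real.arcsin_pos.2 ha) (by positivity)

lemma neckSize_spec (Λ : Set Plane) {δ : ℝ} (hδ : 0 < δ) : ∃ a₀ > 0, ∀ a, 0 < a → a < a₀ →
    0 < neckSize Λ a ∧ neckSize Λ a < δ ∧
      cliffordHeight a = neckEq (greenConstant Λ + Real.log 2) (neckSize Λ a) ∧ a < 1 := by
  obtain ⟨t₀, h0, h⟩ := sInf_neckEq (greenConstant Λ + Real.log 2) hδ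
  have hc : Tendsto cliffordHeight (𝓝 0) (𝓝 0) := by
    have : Continuous cliffordHeight := Real.continuous_arcsin.div_const _
    simpa [cliffordHeight] using this.tendsto 0
  obtain ⟨b, hb0, hb⟩ := Metric.eventually_nhds_iff.1 (hc.eventually (gt_mem_nhds h0))
  refine ⟨min b 1, lt_min hb0 one_pos, fun a ha hab => ?_⟩
  obtain ⟨h1, h2, h3⟩ := h _ (cliffordHeight_pos ha) (hb (by
    rw [dist_zero_right, Real.norm_eq_abs, abs_of_pos ha]
    exact hab.trans_le (min_le_left _ _)))
  exact ⟨h1, h2, h3, hab.trans_le (min_le_right _ _)⟩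

lemma abs_tan_sub_le {y : ℝ} (h0 : 0 ≤ y) (h1 : y ≤ 1) : |Real.tan y - y| ≤ y ^ 3 := by
  rcases h0.eq_or_lt with rfl | h0
  · simp
  have hc : 1 / 2 ≤ Real.cos y := by
    have := Real.one_sub_sq_div_two_le_cos (x := y)
    nlinarith
  have h2 := Real.one_sub_sq_div_two_le_cos (x := y)
  have h3 := Real.sin_le h0.le
  have h4 : y < Real.tan y := Real.lt_tan h0 (by linarith [Real.pi_gt_three])
  rw [abs_of_pos (by linarith), Real.tan_eq_sin_div_cos, sub_le_iff_le_add,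
    div_le_iff₀ (by linarith)]
  nlinarith [pow_pos h0 3, mul_le_mul_of_nonneg_left hc (pow_pos h0 3).le,
    mul_le_mul_of_nonneg_left h2 h0.le]

/-- H_a = 2 tan(√2 t_a), and 2√2 t_a is its linear part at 0; the error is cubic. -/
lemma abs_cliffordH_sub_le {a : ℝ} (ha : 0 < a) (ha1 : a < 1) (h : cliffordHeight a ≤ 1 / 2) :
    |2 * Real.sqrt 2 * cliffordHeight a - cliffordH a| ≤ 8 * cliffordHeight a ^ 3 := by
  have h2 : Real.sqrt 2 * Real.sqrt 2 = 2 := Real.mul_self_sqrt (by norm_num)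
  have hs : 0 < Real.sqrt 2 := by positivity
  have ht := cliffordHeight_pos ha
  have e : Real.sqrt 2 * cliffordHeight a = Real.arcsin a := by
    rw [cliffordHeight]; field_simp
  have eH : cliffordH a = 2 * Real.tan (Real.sqrt 2 * cliffordHeight a) := by
    rw [e, Real.tan_arcsin, cliffordH, mul_div_assoc]
  have h3 := abs_tan_sub_le (y := Real.sqrt 2 * cliffordHeight a) (by positivity)
    (by nlinarith [sqrt_two_lt])
  rw [eH, show 2 * Real.sqrt 2 * cliffordHeight a - 2 * Real.tan (Real.sqrt 2 * cliffordHeight a)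
    = -2 * (Real.tan (Real.sqrt 2 * cliffordHeight a) - Real.sqrt 2 * cliffordHeight a) by ring,
    abs_mul]
  have h4 : (Real.sqrt 2 * cliffordHeight a) ^ 3 = 2 * Real.sqrt 2 * cliffordHeight a ^ 3 := by
    linear_combination Real.sqrt 2 * cliffordHeight a ^ 3 * h2
  rw [h4] at h3
  have := sqrt_two_lt
  norm_num
  nlinarith [pow_pos ht 3]

/-! ### Integrals of periodic functions over the cell -/

/-- The point `2πn` of the lattice `2πℤ²`. -/
def periodVec (n : Fin 2 → ℤ) : Plane := WithLp.toLp 2 fun i => (n i : ℝ) * (2 * Real.pi)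

@[simp] lemma periodVec_apply (n : Fin 2 → ℤ) (i : Fin 2) :
    periodVec n i = (n i : ℝ) * (2 * Real.pi) := rfl

/-- The lattice `2πℤ²`. -/
def periods : AddSubgroup Plane where
  carrier := range periodVec
  zero_mem' := ⟨0, by ext i; simp⟩
  add_mem' := by rintro _ _ ⟨m, rfl⟩ ⟨n, rfl⟩; exact ⟨m + n, by ext i; simp [add_mul]⟩
  neg_mem' := by rintro _ ⟨m, rfl⟩; exact ⟨-m, by ext i; simp⟩

instance : Countable periods := (countable_range periodVec).to_subtype

/-- Functions on the plane with periods `2πℤ²`. -/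
def IsPeriodic {E : Type*} (φ : Plane → E) : Prop := ∀ ν ∈ periods, ∀ μ, φ (μ + ν) = φ μ

lemma single_mem_periods (i : Fin 2) : EuclideanSpace.single i (2 * Real.pi) ∈ periods :=
  ⟨Pi.single i 1, by ext j; by_cases h : j = i <;> simp [h]⟩

lemma periodVec_eq (n : Fin 2 → ℤ) :
    periodVec n = ∑ i, n i • (EuclideanSpace.single i (2 * Real.pi) : Plane) := by
  ext j; fin_cases j <;> simp [Fin.sum_univ_two]

lemma isPeriodic_of_single {E : Type*} {φ : Plane → E}
    (h : ∀ i μ, φ (μ + EuclideanSpace.single i (2 * Real.pi)) = φ μ) : IsPeriodic φ := by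
  let H : AddSubgroup Plane :=
    { carrier := {v | ∀ μ, φ (μ + v) = φ μ}
      zero_mem' := fun μ => by simp
      add_mem' := fun {a b} ha hb μ => by rw [← add_assoc, hb, ha]
      neg_mem' := fun {a} ha μ => by rw [← ha (μ + -a)]; simp }
  rintro _ ⟨n, rfl⟩
  have : periodVec n ∈ H := by
    rw [periodVec_eq]
    exact H.sum_mem fun i _ => H.zsmul_mem (h i) _
  exact this

lemma IsPeriodLattice.periods_subset {Λ : Set Plane} {r : ℝ} (hΛ : IsPeriodLattice Λ r) :
    (periods : Set Plane) ⊆ Λ := by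
  rintro _ ⟨n, rfl⟩
  rw [periodVec_eq, Fin.sum_univ_two]
  exact hΛ.add_mem _ (hΛ.zsmul_mem _ (hΛ.period _)) _ (hΛ.zsmul_mem _ (hΛ.period _))

lemma isPeriodLattice_periods : IsPeriodLattice (periods : Set Plane) 1 where
  pos := one_pos
  zero_mem := periods.zero_mem
  add_mem _ h _ h' := periods.add_mem h h'
  neg_mem _ h := periods.neg_mem h
  period := single_mem_periods
  separated := by
    rintro _ ⟨n, rfl⟩ hne
    obtain ⟨i, hi⟩ : ∃ i, n i ≠ 0 := by
      by_contra! h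
      exact hne (by ext i; simp [h i])
    refine le_trans ?_ (abs_coord_le _ i)
    have h1 : (1 : ℝ) ≤ |(n i : ℝ)| := by exact_mod_cast Int.one_le_abs hi
    rw [periodVec_apply, abs_mul, abs_of_pos Real.two_pi_pos]
    nlinarith [Real.pi_gt_three]

lemma existsUnique_add_mem_torusCell (x : Plane) : ∃! g : periods, g +ᵥ x ∈ torusCell := by
  have h := fun i => existsUnique_add_zsmul_mem_Ico Real.two_pi_pos (x i) 0
  choose n h1 h2 using h
  refine ⟨⟨periodVec n, n, rfl⟩, fun i => ?_, ?_⟩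
  · have := h1 i
    simp only [zsmul_eq_mul, zero_add] at this
    simpa [AddSubgroup.vadd_def, add_comm] using this
  · rintro ⟨_, m, rfl⟩ hm
    have : m = n := funext fun i => h2 i _ (by
      have := hm i
      simpa [AddSubgroup.vadd_def, add_comm] using this)
    simp [this]

lemma measurableSet_torusCell : MeasurableSet torusCell := by
  have : torusCell = ⋂ i, (fun μ : Plane => μ i) ⁻¹' Ico 0 (2 * Real.pi) := by
    ext; simp [torusCell]
  rw [this]
  exact MeasurableSet.iInter fun i => (contDiff_coord (n := 0) i).continuous.measurable
    measurableSet_Ico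

lemma torusCell_subset : torusCell ⊆ Metric.closedBall 0 10 := by
  intro x hx
  rw [mem_closedBall_zero_iff, EuclideanSpace.norm_eq, Fin.sum_univ_two]
  refine Real.sqrt_le_iff.2 ⟨by norm_num, ?_⟩
  have h0 := hx 0
  have h1 := hx 1
  have := Real.pi_lt_d2
  simp only [Real.norm_eq_abs, sq_abs]
  nlinarith [h0.1, h0.2, h1.1, h1.2]

lemma volume_torusCell_lt_top : volume torusCell < ⊤ :=
  (measure_mono torusCell_subset).trans_lt measure_closedBall_lt_top

lemma isAddFundamentalDomain_torusCell : IsAddFundamentalDomain periods torusCell volume :=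
  .mk' measurableSet_torusCell.nullMeasurableSet existsUnique_add_mem_torusCell

namespace IsPeriodic
variable {F : Plane → ℝ}

/-- A translate of a fundamental domain is again one, and integrals of periodic functions agree on
both. -/
lemma setIntegral_add (hF : IsPeriodic F) (v : Plane) :
    ∫ x in torusCell, F (x + v) = ∫ x in torusCell, F x := by
  have h1 := isAddFundamentalDomain_torusCell.vadd_of_comm v
  have hv : ∀ (g : periods) (x : Plane), F (g +ᵥ x) = F x := fun g x => by
    rw [AddSubgroup.vadd_def, vadd_eq_add, add_comm]; exact hF _ g.2 x
  rw [isAddFundamentalDomain_torusCell.setIntegral_eq h1 hv]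
  have := (measurePreserving_vadd v (volume : Measure Plane)).setIntegral_image_emb
    (measurableEmbedding_const_vadd v) F torusCell
  rw [Set.image_vadd] at this
  rw [this]
  simp [add_comm]

lemma exists_mem_torusCell (x : Plane) : ∃ ν ∈ periods, x + ν ∈ torusCell := by
  obtain ⟨g, hg, -⟩ := existsUnique_add_mem_torusCell x
  exact ⟨g, g.2, by simpa [AddSubgroup.vadd_def, add_comm] using hg⟩

lemma bounded (hF : IsPeriodic F) (hc : Continuous F) : ∃ C, ∀ x, ‖F x‖ ≤ C := by
  obtain ⟨C, hC⟩ := (isCompact_closedBall (0 : Plane) 10).exists_bound_of_continuousOn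
    hc.continuousOn
  refine ⟨C, fun x => ?_⟩
  obtain ⟨ν, h1, h2⟩ := exists_mem_torusCell x
  rw [← hF ν h1 x]
  exact hC _ (torusCell_subset h2)

lemma pd {φ : Plane → ℝ} (h : IsPeriodic φ) (j : Fin 2) : IsPeriodic (pd j φ) := by
  intro ν hν μ
  have : φ = fun x => φ (x + ν) := funext fun x => (h ν hν x).symm
  unfold _root_.pd
  conv_rhs => rw [this]
  rw [fderiv_comp_add_right]

lemma add {φ ψ : Plane → ℝ} (h : IsPeriodic φ) (h' : IsPeriodic ψ) :
    IsPeriodic fun x => φ x + ψ x := fun ν hν μ => by simp only [h ν hν, h' ν hν]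

lemma mul {φ ψ : Plane → ℝ} (h : IsPeriodic φ) (h' : IsPeriodic ψ) :
    IsPeriodic fun x => φ x * ψ x := fun ν hν μ => by simp only [h ν hν, h' ν hν]

end IsPeriodic

lemma integrableOn_torusCell {F : Plane → ℝ} (hF : Continuous F) : IntegrableOn F torusCell :=
  (hF.locallyIntegrable.integrableOn_isCompact (isCompact_closedBall 0 10)).mono_set
    torusCell_subset

lemma ContDiff.pd {φ : Plane → ℝ} (h : ContDiff ℝ ∞ φ) (j : Fin 2) : ContDiff ℝ ∞ (pd j φ) :=
  contDiff_iff_contDiffAt.2 fun _ => h.contDiffAt.pd j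

/-- No boundary terms are needed: the integral of P(x + t e) over the cell is constant in t, so its
derivative, taken under the integral sign, is 0. -/
lemma setIntegral_pd {P : Plane → ℝ} (hP : IsPeriodic P) (hs : ContDiff ℝ ∞ P) (j : Fin 2) :
    ∫ x in torusCell, pd j P x = 0 := by
  set e : Plane := EuclideanSpace.single j 1
  have hd : ∀ x (t : ℝ), HasDerivAt (fun t : ℝ => P (x + t • e)) (pd j P (x + t • e)) t := by
    intro x t
    have h1 : HasDerivAt (fun t : ℝ => x + t • e) e t := by
      simpa using ((hasDerivAt_id t).smul_const e).const_add x
    exact ((hs.differentiable (by norm_num) _).hasFDerivAt).comp_hasDerivAt t h1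
  obtain ⟨C, hC⟩ := (hP.pd j).bounded (hs.pd j).continuous
  have key := hasDerivAt_integral_of_dominated_loc_of_deriv_le (μ := volume.restrict torusCell)
    (F := fun (t : ℝ) x => P (x + t • e)) (F' := fun (t : ℝ) x => pd j P (x + t • e)) (x₀ := 0)
    (bound := fun _ => C) (s := univ) univ_mem
    (Eventually.of_forall fun t => (hs.continuous.comp
      (continuous_id.add continuous_const)).aestronglyMeasurable)
    (by simpa using (integrableOn_torusCell hs.continuous).integrable)
    ((hs.pd j).continuous.comp (continuous_id.add continuous_const)).aestronglyMeasurable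
    (Eventually.of_forall fun x t _ => hC _)
    (integrableOn_const (hs := volume_torusCell_lt_top.ne))
    (Eventually.of_forall fun x t _ => hd x t)
  have h2 : (fun t : ℝ => ∫ x in torusCell, P (x + t • e)) = fun _ => ∫ x in torusCell, P x :=
    funext fun t => hP.setIntegral_add _
  have h3 := key.2
  rw [h2] at h3
  simpa using h3.unique (hasDerivAt_const _ _)

/-- The flat Laplacian. -/
def lap (φ : Plane → ℝ) (x : Plane) : ℝ := pd 0 (pd 0 φ) x + pd 1 (pd 1 φ) x

lemma ContDiff.lap {φ : Plane → ℝ} (h : ContDiff ℝ ∞ φ) : ContDiff ℝ ∞ (lap φ) :=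
  ((h.pd 0).pd 0).add ((h.pd 1).pd 1)

lemma IsPeriodic.lap {φ : Plane → ℝ} (h : IsPeriodic φ) : IsPeriodic (lap φ) :=
  ((h.pd 0).pd 0).add ((h.pd 1).pd 1)

lemma cliffordJacobi_eq (φ : Plane → ℝ) (x : Plane) :
    cliffordJacobi φ x * (1 / 2) = lap φ x + 2 * φ x := by
  rw [cliffordJacobi, lap]; ring

/-- Green's formula on the torus. -/
lemma setIntegral_mul_lap {φ ψ : Plane → ℝ} (hφ : IsPeriodic φ) (hψ : IsPeriodic ψ)
    (sφ : ContDiff ℝ ∞ φ) (sψ : ContDiff ℝ ∞ ψ) :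
    ∫ x in torusCell, φ x * lap ψ x = ∫ x in torusCell, lap φ x * ψ x := by
  have D : ∀ {f : Plane → ℝ} (x : Plane), ContDiff ℝ ∞ f → DifferentiableAt ℝ f x :=
    fun x h => h.differentiable (by norm_num) x
  have h1 : ∀ j, ∫ x in torusCell, (φ x * pd j (pd j ψ) x - pd j (pd j φ) x * ψ x) = 0 := by
    intro j
    rw [← setIntegral_pd (P := fun x => φ x * pd j ψ x + -1 * (pd j φ x * ψ x))
      ((hφ.mul (hψ.pd j)).add (IsPeriodic.mul (fun _ _ _ => rfl) ((hφ.pd j).mul hψ)))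
      ((sφ.mul (sψ.pd j)).add (contDiff_const.mul ((sφ.pd j).mul sψ))) j]
    refine integral_congr_ae (Eventually.of_forall fun x => ?_)
    simp only
    rw [pd_add j (D x (sφ.mul (sψ.pd j))) (D x (contDiff_const.mul ((sφ.pd j).mul sψ))),
      pd_const_mul, pd_mul j (D x sφ) (D x (sψ.pd j)), pd_mul j (D x (sφ.pd j)) (D x sψ)]
    ring
  have i1 : ∀ j, IntegrableOn (fun x => φ x * pd j (pd j ψ) x - pd j (pd j φ) x * ψ x) torusCell :=
    fun j => integrableOn_torusCell ((sφ.continuous.mul ((sψ.pd j).pd j).continuous).sub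
      (((sφ.pd j).pd j).continuous.mul sψ.continuous))
  have h2 := integral_add (i1 0) (i1 1)
  rw [h1, h1, add_zero] at h2
  rw [← sub_eq_zero, ← integral_sub (integrableOn_torusCell (F := fun x => φ x * lap ψ x)
    (sφ.continuous.mul sψ.lap.continuous)) (integrableOn_torusCell (F := fun x => lap φ x * ψ x)
    (sφ.lap.continuous.mul sψ.continuous)), ← h2]
  refine integral_congr_ae (Eventually.of_forall fun x => ?_)
  simp only [lap]; ring

/-! ### Periodization -/

/-- The sum of the translates of a function by the points of `Λ`. -/
def periodization (Λ : Set Plane) (h : Plane → ℝ) (x : Plane) : ℝ := ∑ᶠ ν ∈ Λ, h (x - ν)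

lemma periodization_eq_sum {Λ : Set Plane} {h : Plane → ℝ} {R : ℝ}
    (hR : ∀ x, R < ‖x‖ → h x = 0) {A : Finset Plane} (hA : (A : Set Plane) ⊆ Λ) {x : Plane}
    (hx : ∀ ν ∈ Λ, ‖x - ν‖ ≤ R → ν ∈ A) : periodization Λ h x = ∑ ν ∈ A, h (x - ν) := by
  refine finsum_mem_eq_sum_of_inter_support_eq _ ?_
  ext ν
  simp only [mem_inter_iff, Function.mem_support, Finset.mem_coe]
  refine ⟨fun ⟨h1, h2⟩ => ⟨hx ν h1 ?_, h2⟩, fun ⟨h1, h2⟩ => ⟨hA h1, h2⟩⟩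
  by_contra h3
  exact h2 (hR _ (not_le.1 h3))

namespace IsPeriodLattice
variable {Λ : Set Plane} {r : ℝ}

lemma exists_finset (hΛ : IsPeriodLattice Λ r) (c : Plane) (R : ℝ) :
    ∃ A : Finset Plane, (A : Set Plane) ⊆ Λ ∧ ∀ ν ∈ Λ, ‖ν - c‖ ≤ R → ν ∈ A := by
  refine ⟨(hΛ.finite_inter_closedBall c R).toFinset, ?_, fun ν h1 h2 => ?_⟩
  · simp
  · simpa [dist_eq_norm] using ⟨h1, h2⟩

lemma periodization_eventuallyEq (hΛ : IsPeriodLattice Λ r) {h : Plane → ℝ} {R : ℝ}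
    (hR : ∀ x, R < ‖x‖ → h x = 0) (c : Plane) (T : ℝ) : ∃ A : Finset Plane, (A : Set Plane) ⊆ Λ ∧
      ∀ x ∈ Metric.closedBall c T, periodization Λ h x = ∑ ν ∈ A, h (x - ν) := by
  obtain ⟨A, h1, h2⟩ := hΛ.exists_finset c (R + T)
  refine ⟨A, h1, fun x hx => periodization_eq_sum hR h1 fun ν hν h3 => h2 ν hν ?_⟩
  have : ν - c = -(x - ν) + (x - c) := by abel
  rw [this]
  refine (norm_add_le _ _).trans (add_le_add (by rwa [norm_neg]) (by
    rwa [← dist_eq_norm]))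

lemma periodization_add (hΛ : IsPeriodLattice Λ r) (h : Plane → ℝ) {ν : Plane} (hν : ν ∈ Λ)
    (x : Plane) : periodization Λ h (x + ν) = periodization Λ h x := by
  unfold periodization
  refine finsum_mem_eq_of_bijOn (fun κ => κ - ν) ⟨fun κ hκ => hΛ.sub_mem hκ hν,
    fun a _ b _ hab => by simpa using hab, fun κ hκ => ⟨κ + ν, hΛ.add_mem _ hκ _ hν, by simp⟩⟩
    fun κ _ => ?_
  congr 1; abel

lemma isPeriodic_periodization (hΛ : IsPeriodLattice Λ r) (h : Plane → ℝ) :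
    IsPeriodic (periodization Λ h) :=
  fun _ hν => hΛ.periodization_add h (hΛ.periods_subset hν)

lemma periodization_neg (hΛ : IsPeriodLattice Λ r) {h : Plane → ℝ} (he : ∀ x, h (-x) = h x)
    (x : Plane) : periodization Λ h (-x) = periodization Λ h x := by
  unfold periodization
  refine finsum_mem_eq_of_bijOn (fun κ => -κ) ⟨fun κ hκ => hΛ.neg_mem _ hκ,
    fun a _ b _ hab => by simpa using hab, fun κ hκ => ⟨-κ, hΛ.neg_mem _ hκ, by simp⟩⟩
    fun κ _ => ?_
  rw [← he]; congr 1; abel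

lemma contDiffAt_periodization (hΛ : IsPeriodLattice Λ r) {h : Plane → ℝ} {R : ℝ}
    (hR : ∀ x, R < ‖x‖ → h x = 0) {x : Plane} (hs : ∀ ν ∈ Λ, ContDiffAt ℝ ∞ h (x - ν)) :
    ContDiffAt ℝ ∞ (periodization Λ h) x := by
  obtain ⟨A, hA, h1⟩ := hΛ.periodization_eventuallyEq hR x 1
  have : ContDiffAt ℝ ∞ (fun y => ∑ ν ∈ A, h (y - ν)) x := ContDiffAt.sum fun ν hν =>
    (hs ν (hA hν)).comp x (contDiffAt_id.sub contDiffAt_const)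
  refine this.congr_of_eventuallyEq ?_
  filter_upwards [Metric.closedBall_mem_nhds x one_pos] with y hy using h1 y hy

open Classical in
/-- Integrals against a periodization unfold. -/
theorem setIntegral_mul_periodization (hΛ : IsPeriodLattice Λ r) {w h : Plane → ℝ} {R : ℝ}
    (hw : IsPeriodic w) (hR : ∀ x, R < ‖x‖ → h x = 0)
    (hi : ∀ ν ∈ Λ, Integrable fun x => w x * h (x - ν)) :
    ∫ x in torusCell, w x * periodization Λ h x
      = ∑ᶠ p ∈ Λ ∩ torusCell, ∫ x, w x * h (x - p) := by
  obtain ⟨A, hA, h1⟩ := hΛ.exists_finset 0 (R + 10)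
  have hcell : ∀ x ∈ torusCell, ∀ ν ∈ Λ, h (x - ν) ≠ 0 → ν ∈ A := by
    intro x hx ν hν hne
    refine h1 ν hν ?_
    have h3 : ‖x - ν‖ ≤ R := by
      by_contra h4
      exact hne (hR _ (not_le.1 h4))
    have h4 := mem_closedBall_zero_iff.1 (torusCell_subset hx)
    have h5 : ν - 0 = x - (x - ν) := by abel
    rw [h5]
    exact (norm_sub_le _ _).trans (by linarith)
  have hfin : (Λ ∩ torusCell).Finite :=
    (hΛ.finite_inter_closedBall 0 10).subset (inter_subset_inter_right _ torusCell_subset)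
  set t : Plane → ℝ := fun ν => ∫ x in torusCell, w x * h (x - ν) with ht
  have t0 : ∀ ν ∈ Λ, ν ∉ A → t ν = 0 := by
    intro ν hν hνA
    rw [ht]
    simp only
    rw [setIntegral_congr_fun measurableSet_torusCell (g := fun _ => (0 : ℝ)), integral_zero]
    intro x hx
    have : h (x - ν) = 0 := by
      by_contra hne
      exact hνA (hcell x hx ν hν hne)
    simp [this]
  have lhs : ∫ x in torusCell, w x * periodization Λ h x = ∑ ν ∈ A, t ν := by
    rw [ht, ← integral_finsetSum _ fun ν hν => (hi ν (hA hν)).integrableOn]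
    refine setIntegral_congr_fun measurableSet_torusCell fun x hx => ?_
    rw [← Finset.mul_sum]
    congr 1
    refine finsum_mem_eq_sum_of_inter_support_eq _ ?_
    ext ν
    simp only [mem_inter_iff, Function.mem_support, Finset.mem_coe]
    exact ⟨fun ⟨a, b⟩ => ⟨hcell x hx ν a b, b⟩, fun ⟨a, b⟩ => ⟨hA a, b⟩⟩
  -- Cutting the plane into translates of the cell turns the integral for p into the sum of cell
  -- integrals over all lattice points congruent to p modulo 2πℤ².
  have rhs : ∀ p ∈ Λ, ∫ x, w x * h (x - p)
      = ∑ ν ∈ A, (if ν - p ∈ periods then t ν else 0) := by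
    intro p hp
    rw [isAddFundamentalDomain_torusCell.integral_eq_tsum' _ (hi p hp)]
    have e1 : ∀ g : periods, ∫ x in torusCell, w (-g +ᵥ x) * h ((-g +ᵥ x) - p)
        = (periods : Set Plane).indicator (fun v => t (v + p)) g := by
      intro g
      rw [indicator_of_mem g.2]
      refine integral_congr_ae (Eventually.of_forall fun x => ?_)
      simp only [AddSubgroup.vadd_def, vadd_eq_add]
      rw [add_comm, hw _ (-g).2 x]
      congr 2
      push_cast; abel
    refine (tsum_congr e1).trans ((tsum_subtype (periods : Set Plane)
      ((periods : Set Plane).indicator fun v => t (v + p))).trans ?_)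
    rw [indicator_indicator, inter_self, ← (Equiv.subRight p).tsum_eq, tsum_eq_sum (s := A)]
    · refine Finset.sum_congr rfl fun ν _ => ?_
      simp [indicator_apply]
    · intro ν hν
      by_cases h : ν - p ∈ (periods : Set Plane)
      · have : ν ∈ Λ := by
          have := hΛ.add_mem _ (hΛ.periods_subset h) _ hp
          simpa using this
        simp only [Equiv.subRight_apply]
        rw [indicator_of_mem h, sub_add_cancel, t0 ν this hν]
      · simp only [Equiv.subRight_apply]
        rw [indicator_of_notMem h]
  rw [lhs, finsum_mem_eq_finite_toFinset_sum _ hfin,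
    Finset.sum_congr rfl fun p hp => rhs p ((hfin.mem_toFinset.1 hp).1), Finset.sum_comm]
  refine Finset.sum_congr rfl fun ν hν => ?_
  -- After exchanging the sums, each ν of Λ is counted once: it is congruent to exactly one point of
  -- the cell.
  obtain ⟨g, hg, hu⟩ := existsUnique_add_mem_torusCell ν
  rw [Finset.sum_eq_single (g +ᵥ ν)]
  · rw [if_pos]
    simp only [AddSubgroup.vadd_def, vadd_eq_add, sub_add_cancel_right]
    exact periods.neg_mem g.2
  · intro p hp hne
    rw [if_neg]
    intro hmem
    have h5 := hu ⟨p - ν, by simpa using periods.neg_mem hmem⟩ (by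
      simpa [AddSubgroup.vadd_def] using (hfin.mem_toFinset.1 hp).2)
    exact hne (by rw [← h5]; simp [AddSubgroup.vadd_def])
  · intro hmem
    refine absurd (hfin.mem_toFinset.2 ⟨?_, hg⟩) hmem
    rw [AddSubgroup.vadd_def, vadd_eq_add]
    exact hΛ.add_mem _ (hΛ.periods_subset g.2) _ (hA hν)

end IsPeriodLattice

/-! ### Fourier series on the torus -/

/-- The phase `k₀ x₀ + k₁ x₁`. -/
def phase (k : Fin 2 → ℤ) (x : Plane) : ℝ := k 0 * x 0 + k 1 * x 1

/-- The square norm of a frequency. -/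
def freqSq (k : Fin 2 → ℤ) : ℝ := (k 0 : ℝ) ^ 2 + (k 1 : ℝ) ^ 2

lemma freqSq_nonneg (k : Fin 2 → ℤ) : 0 ≤ freqSq k := by unfold freqSq; positivity

lemma abs_freq_le (k : Fin 2 → ℤ) (j : Fin 2) : |(k j : ℝ)| ≤ 1 + freqSq k := by
  rw [abs_le, freqSq]
  fin_cases j <;> constructor <;> simp only [Fin.zero_eta, Fin.mk_one] <;>
    nlinarith [sq_nonneg ((k 0 : ℝ) - 1), sq_nonneg ((k 1 : ℝ) - 1), sq_nonneg ((k 0 : ℝ) + 1),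
      sq_nonneg ((k 1 : ℝ) + 1), sq_nonneg (k 0 : ℝ), sq_nonneg (k 1 : ℝ)]

lemma contDiff_phase (k : Fin 2 → ℤ) : ContDiff ℝ ∞ (phase k) :=
  (contDiff_const.mul (contDiff_coord 0)).add (contDiff_const.mul (contDiff_coord 1))

lemma pd_phase (k : Fin 2 → ℤ) (j : Fin 2) (x : Plane) : pd j (phase k) x = k j := by
  have h := pd_add j (q := x) ((differentiableAt_coord 0 x).const_mul (k 0 : ℝ))
    ((differentiableAt_coord 1 x).const_mul (k 1 : ℝ))
  unfold phase
  rw [h, pd_const_mul, pd_const_mul, pd_coord, pd_coord]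
  fin_cases j <;> simp

lemma phase_add_period (k : Fin 2 → ℤ) {ν : Plane} (hν : ν ∈ periods) (x : Plane) :
    ∃ n : ℤ, phase k (x + ν) = phase k x + n * (2 * Real.pi) := by
  obtain ⟨n, rfl⟩ := hν
  exact ⟨k 0 * n 0 + k 1 * n 1, by simp [phase]; ring⟩

lemma isPeriodic_cos_phase (k : Fin 2 → ℤ) : IsPeriodic fun x => Real.cos (phase k x) := by
  intro ν hν x
  obtain ⟨n, hn⟩ := phase_add_period k hν x
  simp only [hn, Real.cos_add_int_mul_two_pi]

lemma isPeriodic_sin_phase (k : Fin 2 → ℤ) : IsPeriodic fun x => Real.sin (phase k x) := by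
  intro ν hν x
  obtain ⟨n, hn⟩ := phase_add_period k hν x
  simp only [hn, Real.sin_add_int_mul_two_pi]

lemma pd_cos_phase (k : Fin 2 → ℤ) (j : Fin 2) :
    pd j (fun x => Real.cos (phase k x)) = fun x => -(k j : ℝ) * Real.sin (phase k x) := by
  ext x
  rw [pd_real_comp j (Real.hasDerivAt_cos _) ((contDiff_phase k).differentiable (by norm_num) x),
    pd_phase]
  ring

lemma pd_sin_phase (k : Fin 2 → ℤ) (j : Fin 2) :
    pd j (fun x => Real.sin (phase k x)) = fun x => (k j : ℝ) * Real.cos (phase k x) := by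
  ext x
  rw [pd_real_comp j (Real.hasDerivAt_sin _) ((contDiff_phase k).differentiable (by norm_num) x),
    pd_phase]
  ring

lemma lap_cos_phase (k : Fin 2 → ℤ) (x : Plane) :
    lap (fun x => Real.cos (phase k x)) x = -freqSq k * Real.cos (phase k x) := by
  simp only [lap, pd_cos_phase, pd_const_mul, pd_sin_phase, freqSq]; ring

lemma lap_sin_phase (k : Fin 2 → ℤ) (x : Plane) :
    lap (fun x => Real.sin (phase k x)) x = -freqSq k * Real.sin (phase k x) := by
  simp only [lap, pd_sin_phase, pd_const_mul, pd_cos_phase, freqSq]; ring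

/-! ### Rapidly decreasing coefficients and termwise differentiation. -/

/-- Rapidly decreasing coefficients. -/
def Rapid (α : (Fin 2 → ℤ) → ℝ) : Prop := ∀ m : ℕ, ∃ C, ∀ k, (1 + freqSq k) ^ m * |α k| ≤ C

/-- (1 + |k|²)² ≥ (1 + k₀²)(1 + k₁²), and the majorant is a product of two convergent series. -/
lemma summable_freqSq : Summable fun k : Fin 2 → ℤ => ((1 + freqSq k) ^ 2)⁻¹ := by
  have h1 : Summable fun n : ℤ => (1 + (n : ℝ) ^ 2)⁻¹ := by
    have h := (Real.summable_one_div_int_pow (p := 2)).2 (by norm_num)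
    refine Summable.of_norm_bounded_eventually h ?_
    have : ∀ᶠ n : ℤ in cofinite, n ≠ 0 := by
      simpa using (finite_singleton (0 : ℤ)).compl_mem_cofinite
    filter_upwards [this] with n hn
    have h2 : (0 : ℝ) < (n : ℝ) ^ 2 := by positivity
    rw [Real.norm_of_nonneg (by positivity), one_div]
    exact inv_anti₀ h2 (by linarith)
  have h2 := h1.mul_of_nonneg h1 (fun _ => by positivity) (fun _ => by positivity)
  have h3 := (finTwoArrowEquiv ℤ).summable_iff.2 h2
  refine Summable.of_nonneg_of_le (fun k => by have := freqSq_nonneg k; positivity) (fun k => ?_) h3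
  change _ ≤ (1 + (k 0 : ℝ) ^ 2)⁻¹ * (1 + (k 1 : ℝ) ^ 2)⁻¹
  rw [← mul_inv]
  refine inv_anti₀ (by positivity) ?_
  rw [freqSq]
  nlinarith [sq_nonneg (k 0 : ℝ), sq_nonneg (k 1 : ℝ), mul_nonneg (sq_nonneg (k 0 : ℝ)) (sq_nonneg (k 1 : ℝ))]

namespace Rapid
variable {α β : (Fin 2 → ℤ) → ℝ}

lemma mul {m : (Fin 2 → ℤ) → ℝ} (hα : Rapid α) {p : ℕ} {D : ℝ}
    (hm : ∀ k, |m k| ≤ D * (1 + freqSq k) ^ p) : Rapid fun k => m k * α k := by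
  intro q
  obtain ⟨C, hC⟩ := hα (q + p)
  have hD : 0 ≤ D := by
    have := (abs_nonneg _).trans (hm 0)
    simpa [freqSq] using this
  refine ⟨D * C, fun k => ?_⟩
  have h0 := freqSq_nonneg k
  rw [abs_mul]
  calc (1 + freqSq k) ^ q * (|m k| * |α k|)
      ≤ (1 + freqSq k) ^ q * (D * (1 + freqSq k) ^ p * |α k|) := by gcongr; exact hm k
    _ = D * ((1 + freqSq k) ^ (q + p) * |α k|) := by ring
    _ ≤ D * C := mul_le_mul_of_nonneg_left (hC k) hD

lemma freq_mul (hα : Rapid α) (j : Fin 2) : Rapid fun k => (k j : ℝ) * α k :=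
  hα.mul (p := 1) (D := 1) fun k => by simpa using abs_freq_le k j

lemma neg (hα : Rapid α) : Rapid fun k => -α k := by
  simpa [Rapid] using hα

lemma summable (hα : Rapid α) : Summable fun k => |α k| := by
  obtain ⟨C, hC⟩ := hα 2
  refine Summable.of_nonneg_of_le (fun k => abs_nonneg _) (fun k => ?_) (summable_freqSq.mul_left C)
  have h0 := freqSq_nonneg k
  rw [← div_eq_mul_inv, le_div_iff₀ (by positivity), mul_comm]
  exact hC k

end Rapid

/-- A real Fourier series. -/
def trigSeries (α β : (Fin 2 → ℤ) → ℝ) (x : Plane) : ℝ :=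
  ∑' k, (α k * Real.cos (phase k x) + β k * Real.sin (phase k x))

section trigSeries
variable {α β : (Fin 2 → ℤ) → ℝ}

lemma summable_trigSeries (hα : Rapid α) (hβ : Rapid β) (x : Plane) :
    Summable fun k => α k * Real.cos (phase k x) + β k * Real.sin (phase k x) := by
  refine Summable.of_norm_bounded (hα.summable.add hβ.summable) fun k => ?_
  refine (norm_add_le _ _).trans (add_le_add ?_ ?_)
  · rw [norm_mul, Real.norm_eq_abs]
    exact mul_le_of_le_one_right (abs_nonneg _) (Real.abs_cos_le_one _)
  · rw [norm_mul, Real.norm_eq_abs]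
    exact mul_le_of_le_one_right (abs_nonneg _) (Real.abs_sin_le_one _)

lemma isPeriodic_trigSeries : IsPeriodic (trigSeries α β) := by
  intro ν hν x
  refine tsum_congr fun k => ?_
  have h1 := isPeriodic_cos_phase k ν hν x
  have h2 := isPeriodic_sin_phase k ν hν x
  simp only at h1 h2
  rw [h1, h2]

lemma norm_le_of_pd {g : Plane →L[ℝ] ℝ} {a : ℝ}
    (h : ∀ j : Fin 2, |g (EuclideanSpace.single j 1)| ≤ a) : ‖g‖ ≤ 2 * a := by
  have ha : 0 ≤ a := (abs_nonneg _).trans (h 0)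
  refine g.opNorm_le_bound (by positivity) fun v => ?_
  have hv : v = v 0 • (EuclideanSpace.single 0 1 : Plane) + v 1 • EuclideanSpace.single 1 1 := by
    ext i; fin_cases i <;> simp
  conv_lhs => rw [hv]
  rw [map_add, map_smul, map_smul]
  refine (norm_add_le _ _).trans ?_
  rw [norm_smul, norm_smul, two_mul, add_mul, mul_comm a]
  exact add_le_add (mul_le_mul (abs_coord_le v 0) (h 0) (abs_nonneg _) (norm_nonneg _))
    (mul_le_mul (abs_coord_le v 1) (h 1) (abs_nonneg _) (norm_nonneg _))

/-- The differentiated terms have a summable bound independent of x. Differentiation exchanges the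
two coefficient sequences up to a factor ±k_j, which keeps them rapid, so it can be iterated. -/
lemma trigSeries_deriv (hα : Rapid α) (hβ : Rapid β) :
    Differentiable ℝ (trigSeries α β) ∧ ∀ j, pd j (trigSeries α β)
      = trigSeries (fun k => (k j : ℝ) * β k) (fun k => -((k j : ℝ) * α k)) := by
  set f : (Fin 2 → ℤ) → Plane → ℝ := fun k x =>
    α k * Real.cos (phase k x) + β k * Real.sin (phase k x) with hf
  have sf : ∀ k, ContDiff ℝ ∞ (f k) := fun k =>
    (contDiff_const.mul (contDiff_phase k).cos).add (contDiff_const.mul (contDiff_phase k).sin)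
  have df : ∀ k x, DifferentiableAt ℝ (f k) x := fun k => (sf k).differentiable (by norm_num)
  have pf : ∀ k j x, pd j (f k) x = (k j : ℝ) * β k * Real.cos (phase k x)
      + -((k j : ℝ) * α k) * Real.sin (phase k x) := by
    intro k j x
    have h := pd_add j (q := x)
      (((contDiff_phase k).cos.differentiable (by norm_num) x).const_mul (α k))
      (((contDiff_phase k).sin.differentiable (by norm_num) x).const_mul (β k))
    rw [hf]
    simp only
    rw [h, pd_const_mul, pd_const_mul, pd_cos_phase, pd_sin_phase]
    ring
  have w1 : ∀ {γ : (Fin 2 → ℤ) → ℝ}, Rapid γ → Summable fun k => (1 + freqSq k) * |γ k| := by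
    intro γ hγ
    have h1 : ∀ k, |1 + freqSq k| = 1 + freqSq k := fun k =>
      abs_of_nonneg (by have := freqSq_nonneg k; positivity)
    simpa [abs_mul, h1] using (hγ.mul (m := fun k => 1 + freqSq k) (p := 1) (D := 1)
      (fun k => by rw [h1]; simp)).summable
  have bd : ∀ k x, ‖fderiv ℝ (f k) x‖ ≤
      2 * ((1 + freqSq k) * |β k| + (1 + freqSq k) * |α k|) := by
    refine fun k x => norm_le_of_pd fun j => ?_
    change |pd j (f k) x| ≤ _
    rw [pf]
    have h1 := abs_freq_le k j
    refine (abs_add_le _ _).trans (add_le_add ?_ ?_)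
    · rw [abs_mul, abs_mul]
      exact (mul_le_of_le_one_right (by positivity) (Real.abs_cos_le_one _)).trans
        (mul_le_mul_of_nonneg_right h1 (abs_nonneg _))
    · rw [abs_mul, abs_neg, abs_mul]
      exact (mul_le_of_le_one_right (by positivity) (Real.abs_sin_le_one _)).trans
        (mul_le_mul_of_nonneg_right h1 (abs_nonneg _))
  have sm := ((w1 hβ).add (w1 hα)).mul_left 2
  have key : ∀ x, HasFDerivAt (trigSeries α β) (∑' k, fderiv ℝ (f k) x) x := fun x =>
    hasFDerivAt_tsum sm (fun k y => (df k y).hasFDerivAt) bd (summable_trigSeries hα hβ 0) x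
  have hsum : ∀ x, Summable fun k => fderiv ℝ (f k) x := fun x =>
    Summable.of_norm_bounded sm fun k => bd k x
  refine ⟨fun x => (key x).differentiableAt, fun j => funext fun x => ?_⟩
  rw [pd, (key x).fderiv, ← ContinuousLinearMap.apply_apply (EuclideanSpace.single j 1)
    (∑' k, fderiv ℝ (f k) x), ContinuousLinearMap.map_tsum _ (hsum x)]
  exact tsum_congr fun k => pf k j x

lemma contDiff_trigSeries (hα : Rapid α) (hβ : Rapid β) : ContDiff ℝ ∞ (trigSeries α β) := by
  rw [contDiff_infty]
  intro n
  induction n generalizing α β with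
  | zero => exact contDiff_zero.2 (trigSeries_deriv hα hβ).1.continuous
  | succ n ih =>
    obtain ⟨h1, h2⟩ := trigSeries_deriv hα hβ
    refine (contDiff_succ_iff_fderiv (n := n)).2 ⟨h1, by simp, ?_⟩
    have : fderiv ℝ (trigSeries α β) = fun x => ∑ j, pd j (trigSeries α β) x •
        (EuclideanSpace.proj j : Plane →L[ℝ] ℝ) := by
      ext x v
      rw [fderiv_eq_pd]
      simp [Fin.sum_univ_two, mul_comm]
    rw [this]
    refine ContDiff.sum fun j _ => ContDiff.fun_smul ?_ contDiff_const
    rw [h2]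
    exact ih (hβ.freq_mul j) (hα.freq_mul j).neg

lemma lap_trigSeries (hα : Rapid α) (hβ : Rapid β) (x : Plane) :
    lap (trigSeries α β) x = trigSeries (fun k => -freqSq k * α k) (fun k => -freqSq k * β k) x := by
  have h := fun j => (trigSeries_deriv (hβ.freq_mul j) (hα.freq_mul j).neg).2 j
  simp only [lap, (trigSeries_deriv hα hβ).2, h]
  have s := fun j => summable_trigSeries ((hα.freq_mul j).neg.freq_mul j)
    ((hβ.freq_mul j).freq_mul j).neg x
  unfold trigSeries
  rw [← (s 0).tsum_add (s 1)]
  refine tsum_congr fun k => ?_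
  simp only [freqSq]; ring

end trigSeries

/-- The Fourier coefficients with respect to real functions `e k`. -/
def torusCoeff (e : Plane → ℝ) (F : Plane → ℝ) : ℝ :=
  ((2 * Real.pi) ^ 2)⁻¹ * ∫ x in torusCell, F x * e x

/-- Applying 1 - Δ to F multiplies the coefficient by 1 + |k|², by Green's formula. Induction
reduces every power to the trivial bound for a bounded function. -/
lemma rapid_torusCoeff {e : (Fin 2 → ℤ) → Plane → ℝ} (he : ∀ k, IsPeriodic (e k))
    (se : ∀ k, ContDiff ℝ ∞ (e k)) (le : ∀ k x, lap (e k) x = -freqSq k * e k x)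
    (be : ∀ k x, |e k x| ≤ 1) {F : Plane → ℝ} (hF : IsPeriodic F) (sF : ContDiff ℝ ∞ F) :
    Rapid fun k => torusCoeff (e k) F := by
  intro m
  induction m generalizing F with
  | zero =>
    obtain ⟨C, hC⟩ := hF.bounded sF.continuous
    refine ⟨((2 * Real.pi) ^ 2)⁻¹ * (C * volume.real torusCell), fun k => ?_⟩
    simp only [torusCoeff]
    rw [pow_zero, one_mul, abs_mul, abs_of_nonneg (by positivity)]
    refine mul_le_mul_of_nonneg_left ?_ (by positivity)
    refine norm_setIntegral_le_of_norm_le_const (f := fun x => F x * e k x)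
      volume_torusCell_lt_top fun x _ => ?_
    rw [norm_mul]
    have h1 := be k x
    have h2 := hC x
    have h3 : ‖e k x‖ ≤ 1 := h1
    nlinarith [norm_nonneg (F x), norm_nonneg (e k x)]
  | succ m ih =>
    obtain ⟨C, hC⟩ := ih (F := fun x => F x + -1 * lap F x)
      (hF.add (IsPeriodic.mul (fun _ _ _ => rfl) hF.lap)) (sF.add (contDiff_const.mul sF.lap))
    refine ⟨C, fun k => ?_⟩
    have h1 : torusCoeff (e k) (fun x => F x + -1 * lap F x)
        = (1 + freqSq k) * torusCoeff (e k) F := by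
      have i1 : IntegrableOn (fun x => F x * e k x) torusCell :=
        integrableOn_torusCell (sF.continuous.mul (se k).continuous)
      have i2 : IntegrableOn (fun x => lap F x * e k x) torusCell :=
        integrableOn_torusCell (sF.lap.continuous.mul (se k).continuous)
      have h2 := setIntegral_mul_lap hF (he k) sF (se k)
      simp only [le] at h2
      have h3 : ∀ x, F x * (-freqSq k * e k x) = -freqSq k * (F x * e k x) := fun x => by ring
      simp only [h3] at h2
      rw [integral_const_mul] at h2
      have h4 : ∀ x, (F x + -1 * lap F x) * e k x = F x * e k x - lap F x * e k x := fun x => by ring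
      simp only [torusCoeff, h4]
      rw [integral_sub i1 i2, ← h2]
      ring
    have h2 := hC k
    simp only at h2 ⊢
    rw [h1, abs_mul, abs_of_nonneg (by have := freqSq_nonneg k; positivity : 0 ≤ 1 + freqSq k),
      ← mul_assoc, ← pow_succ] at h2
    exact h2

/-! ### Fourier inversion and the Poisson-type equation -/

/-- The covering of the torus. -/
def torusMk : C(Fin 2 → ℝ, UnitAddTorus (Fin 2)) where
  toFun y i := ((y i : ℝ) : UnitAddCircle)
  continuous_toFun := continuous_pi fun i =>
    (AddCircle.continuous_mk' (1 : ℝ)).comp (continuous_apply i)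

lemma isQuotientMap_torusMk : IsQuotientMap torusMk :=
  (IsOpenQuotientMap.piMap (f := fun (_ : Fin 2) (y : ℝ) => (y : UnitAddCircle))
    fun _ => QuotientAddGroup.isOpenQuotientMap_mk).isQuotientMap

lemma mFourier_coe (k : Fin 2 → ℤ) (x : Plane) :
    UnitAddTorus.mFourier k (torusMk fun i => -(2 * Real.pi)⁻¹ * x i)
      = Real.cos (phase k x) - Real.sin (phase k x) * Complex.I := by
  have h1 : UnitAddTorus.mFourier k (torusMk fun i => -(2 * Real.pi)⁻¹ * x i)
      = Complex.exp (((-phase k x : ℝ) : ℂ) * Complex.I) := by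
    simp only [UnitAddTorus.mFourier, ContinuousMap.coe_mk, torusMk, Fin.prod_univ_two, fourier_coe_apply]
    rw [← Complex.exp_add]
    congr 1
    have := Complex.ofReal_ne_zero.2 Real.pi_ne_zero
    simp only [phase]
    push_cast
    field_simp
    ring
  rw [h1, Complex.exp_mul_I, ← Complex.ofReal_cos, ← Complex.ofReal_sin, Real.cos_neg, Real.sin_neg]
  push_cast; ring

-- The scaling factor is negative so that the half-open cell [0, 2π)² is mapped onto (-1, 0]², the
-- type of cell used for integrals over the unit torus.
open scoped Pointwise in
lemma integral_torus (G : (Fin 2 → ℝ) → ℂ) :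
    ∫ y in {y : Fin 2 → ℝ | ∀ i, y i ∈ Ioc (-1 : ℝ) (-1 + 1)}, G y = (((2 * Real.pi) ^ 2)⁻¹ : ℝ) •
      ∫ x in torusCell, G fun i => -(2 * Real.pi)⁻¹ * x i := by
  have h1 := (PiLp.volume_preserving_ofLp (Fin 2)).setIntegral_preimage_emb
    (MeasurableEquiv.toLp 2 (Fin 2 → ℝ)).symm.measurableEmbedding G
    {y | ∀ i, y i ∈ Ioc (-1 : ℝ) (-1 + 1)}
  have hπ := Real.two_pi_pos
  have h2 := Measure.setIntegral_comp_smul (volume : Measure Plane) (fun x : Plane => G x.ofLp)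
    torusCell (R := -(2 * Real.pi)⁻¹) (by simp [Real.pi_ne_zero])
  have h3 : (-(2 * Real.pi)⁻¹) • torusCell
      = WithLp.ofLp ⁻¹' {y : Fin 2 → ℝ | ∀ i, y i ∈ Ioc (-1 : ℝ) (-1 + 1)} := by
    ext x
    rw [mem_smul_set_iff_inv_smul_mem₀ (by simp [Real.pi_ne_zero])]
    simp only [torusCell, mem_ofPred_eq, mem_preimage, PiLp.smul_apply, smul_eq_mul, mem_Ico,
      mem_Ioc, inv_neg, inv_inv]
    refine forall_congr' fun i => ?_
    constructor <;> rintro ⟨a, b⟩ <;> constructor <;> nlinarith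
  rw [← h1, ← h3]
  simp only [finrank_euclideanSpace, Fintype.card_fin] at h2
  have h4 : ∀ x : Plane, G (-(2 * Real.pi)⁻¹ • x).ofLp = G fun i => -(2 * Real.pi)⁻¹ * x i :=
    fun x => rfl
  simp only [h4] at h2
  rw [h2, smul_smul, abs_of_nonneg (by positivity)]
  have : ((2 * Real.pi) ^ 2)⁻¹ * ((-(2 * Real.pi)⁻¹) ^ 2)⁻¹ = 1 := by field_simp
  rw [this, one_smul]

/-- A smooth periodic function is the sum of its Fourier series. -/
theorem eq_trigSeries {F : Plane → ℝ} (hF : IsPeriodic F) (sF : ContDiff ℝ ∞ F) (x : Plane) :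
    F x = trigSeries (fun k => torusCoeff (fun y => Real.cos (phase k y)) F)
      (fun k => torusCoeff (fun y => Real.sin (phase k y)) F) x := by
  have ra := rapid_torusCoeff isPeriodic_cos_phase (fun k => (contDiff_phase k).cos) lap_cos_phase
    (fun k x => Real.abs_cos_le_one _) hF sF
  have rb := rapid_torusCoeff isPeriodic_sin_phase (fun k => (contDiff_phase k).sin) lap_sin_phase
    (fun k x => Real.abs_sin_le_one _) hF sF
  set a := fun k => torusCoeff (fun y => Real.cos (phase k y)) F with ha
  set b := fun k => torusCoeff (fun y => Real.sin (phase k y)) F with hb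
  have hc : Continuous fun y : Fin 2 → ℝ =>
      (F (WithLp.toLp 2 fun i => -(2 * Real.pi) * y i) : ℂ) :=
    Complex.continuous_ofReal.comp (sF.continuous.comp
      ((PiLp.continuous_toLp 2 _).comp (by fun_prop)))
  -- Points of the plane with the same image in the unit torus differ by integers, which correspond
  -- to periods of F.
  have hfac : Function.FactorsThrough (⟨_, hc⟩ : C(Fin 2 → ℝ, ℂ)) torusMk := by
    intro y z hyz
    have h1 : ∀ i, ∃ n : ℤ, (n : ℝ) = y i - z i := fun i => by
      have h2 : ((y i - z i : ℝ) : UnitAddCircle) = 0 := by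
        rw [AddCircle.coe_sub, sub_eq_zero]; exact congrFun hyz i
      simpa using (AddCircle.coe_eq_zero_iff (1 : ℝ)).1 h2
    choose n hn using h1
    have h2 : (WithLp.toLp 2 fun i => -(2 * Real.pi) * z i : Plane)
        = (WithLp.toLp 2 fun i => -(2 * Real.pi) * y i) + periodVec n := by
      ext i
      simp only [PiLp.add_apply, periodVec_apply, hn]; ring
    simp only [ContinuousMap.coe_mk]
    rw [h2, hF _ ⟨n, rfl⟩]
  set Ft : C(UnitAddTorus (Fin 2), ℂ) := isQuotientMap_torusMk.lift ⟨_, hc⟩ hfac with hFt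
  have hFy : ∀ y, Ft (torusMk y) = F (WithLp.toLp 2 fun i => -(2 * Real.pi) * y i) := fun y =>
    congrArg (fun f : C(Fin 2 → ℝ, ℂ) => f y)
      (isQuotientMap_torusMk.lift_comp (g := ⟨_, hc⟩) (h := hfac))
  have hFx : ∀ x : Plane, Ft (torusMk fun i => -(2 * Real.pi)⁻¹ * x i) = F x := by
    intro x
    rw [hFy]
    congr 2
    ext i
    have := Real.pi_ne_zero
    simp only
    field_simp
  -- Because of the negative scaling the complex coefficient is a + ib. The real part of (a +
  -- ib)(cos - i sin) is the real term a cos + b sin.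
  have hcoef : ∀ k, UnitAddTorus.mFourierCoeff Ft k = a k + b k * Complex.I := by
    intro k
    have h1 : UnitAddTorus.mFourierCoeff Ft k = _ :=
      UnitAddTorus.mFourierCoeff_eq_integral Ft k (fun _ => -1)
    have h2 := integral_torus fun y => UnitAddTorus.mFourier (-k) (torusMk y) • Ft (torusMk y)
    rw [h1]
    refine h2.trans ?_
    have h3 : ∀ x : Plane, UnitAddTorus.mFourier (-k) (torusMk fun i => -(2 * Real.pi)⁻¹ * x i) •
        Ft (torusMk fun i => -(2 * Real.pi)⁻¹ * x i)
        = ((F x * Real.cos (phase k x) : ℝ) : ℂ) + ((F x * Real.sin (phase k x) : ℝ) : ℂ) * Complex.I := by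
      intro x
      have h4 : phase (-k) x = -phase k x := by simp [phase]; ring
      rw [hFx, mFourier_coe, h4, Real.cos_neg, Real.sin_neg]
      push_cast
      rw [smul_eq_mul]; ring
    have i1 : IntegrableOn (fun x => F x * Real.cos (phase k x)) torusCell :=
      integrableOn_torusCell (sF.continuous.mul (contDiff_phase k).cos.continuous)
    have i2 : IntegrableOn (fun x => F x * Real.sin (phase k x)) torusCell :=
      integrableOn_torusCell (sF.continuous.mul (contDiff_phase k).sin.continuous)
    simp only [h3]
    rw [integral_add i1.ofReal (i2.ofReal.mul_const _), integral_mul_const, integral_complex_ofReal,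
      integral_complex_ofReal, ha, hb]
    simp only [torusCoeff, Complex.real_smul]
    push_cast; ring
  have hs : Summable (UnitAddTorus.mFourierCoeff Ft) := by
    refine Summable.of_norm_bounded (ra.summable.add rb.summable) fun k => ?_
    rw [hcoef]
    refine (norm_add_le _ _).trans ?_
    simp
  have h5 := (Complex.hasSum_re (UnitAddTorus.hasSum_mFourier_series_apply_of_summable hs
    (torusMk fun i => -(2 * Real.pi)⁻¹ * x i))).tsum_eq
  rw [hFx, Complex.ofReal_re] at h5
  rw [← h5]
  refine tsum_congr fun k => ?_
  rw [hcoef, mFourier_coe]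
  simp [Complex.cos_ofReal_re, Complex.sin_ofReal_re]

/-! ### Inverting Δ + 2 away from the resonant frequencies. -/

/-- The multiplier `(2 - |k|²)⁻¹`, with the resonant frequencies left out. -/
def jacobiMult (k : Fin 2 → ℤ) : ℝ := if freqSq k = 2 then 0 else (2 - freqSq k)⁻¹

/-- The resonant part of a sequence of coefficients. -/
def resonant (α : (Fin 2 → ℤ) → ℝ) (k : Fin 2 → ℤ) : ℝ := if freqSq k = 2 then α k else 0

/-- |k|² is an integer, so |2 - |k|²| ≥ 1 unless k is resonant: there are no small divisors. -/
lemma abs_jacobiMult_le (k : Fin 2 → ℤ) : |jacobiMult k| ≤ 1 := by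
  unfold jacobiMult
  split_ifs with h
  · simp
  · rw [abs_inv]
    refine inv_le_one_of_one_le₀ ?_
    have h1 : freqSq k = ((k 0 ^ 2 + k 1 ^ 2 : ℤ) : ℝ) := by push_cast; rfl
    rw [h1] at h ⊢
    have h2 : (2 : ℤ) - (k 0 ^ 2 + k 1 ^ 2) ≠ 0 := fun h3 => h (by
      have : k 0 ^ 2 + k 1 ^ 2 = 2 := by linarith
      rw [this]; norm_num)
    exact_mod_cast Int.one_le_abs h2

lemma Rapid.jacobiMult {α : (Fin 2 → ℤ) → ℝ} (hα : Rapid α) :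
    Rapid fun k => jacobiMult k * α k :=
  hα.mul (p := 0) (D := 1) fun k => by simpa using abs_jacobiMult_le k

lemma Rapid.resonant {α : (Fin 2 → ℤ) → ℝ} (hα : Rapid α) : Rapid (resonant α) := by
  have h := hα.mul (m := fun k => if freqSq k = 2 then 1 else 0) (p := 0) (D := 1) fun k => by
    split_ifs <;> simp
  convert h using 2 with k
  simp [_root_.resonant]

lemma lap_trigSeries_jacobiMult {α β : (Fin 2 → ℤ) → ℝ} (hα : Rapid α) (hβ : Rapid β)
    (x : Plane) :
    lap (trigSeries (fun k => jacobiMult k * α k) fun k => jacobiMult k * β k) x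
      + 2 * trigSeries (fun k => jacobiMult k * α k) (fun k => jacobiMult k * β k) x
      + trigSeries (resonant α) (resonant β) x = trigSeries α β x := by
  have h1 : ∀ k, |(-freqSq k)| ≤ 1 * (1 + freqSq k) ^ 1 := fun k => by
    rw [abs_neg, abs_of_nonneg (freqSq_nonneg k)]; linarith
  rw [lap_trigSeries hα.jacobiMult hβ.jacobiMult]
  unfold trigSeries
  rw [← tsum_mul_left, ← Summable.tsum_add (summable_trigSeries (hα.jacobiMult.mul h1)
      (hβ.jacobiMult.mul h1) x) ((summable_trigSeries hα.jacobiMult hβ.jacobiMult x).mul_left 2),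
    ← Summable.tsum_add ((summable_trigSeries (hα.jacobiMult.mul h1) (hβ.jacobiMult.mul h1) x).add
      ((summable_trigSeries hα.jacobiMult hβ.jacobiMult x).mul_left 2))
      (summable_trigSeries hα.resonant hβ.resonant x)]
  refine tsum_congr fun k => ?_
  unfold jacobiMult resonant
  split_ifs with h
  · ring
  · have : 2 - freqSq k ≠ 0 := sub_ne_zero.2 (Ne.symm h)
    field_simp
    ring

/-- |k|² = 2 forces |k_i| ≤ 1, so the resonant part is finite and can be integrated term by term. -/
lemma trigSeries_resonant_eq_sum (α β : (Fin 2 → ℤ) → ℝ) :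
    ∃ A : Finset (Fin 2 → ℤ), (∀ k ∈ A, freqSq k = 2) ∧ ∀ x, trigSeries (resonant α) (resonant β) x
      = ∑ k ∈ A, (α k * Real.cos (phase k x) + β k * Real.sin (phase k x)) := by
  classical
  refine ⟨(Fintype.piFinset fun _ => Finset.Icc (-1) 1).filter fun k => freqSq k = 2,
    fun k hk => (Finset.mem_filter.1 hk).2, fun x => ?_⟩
  unfold trigSeries
  rw [tsum_eq_sum (s := (Fintype.piFinset fun _ => Finset.Icc (-1) 1).filter
    fun k => freqSq k = 2)]
  · refine Finset.sum_congr rfl fun k hk => ?_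
    simp [resonant, (Finset.mem_filter.1 hk).2]
  · intro k hk
    have h2 : freqSq k ≠ 2 := by
      intro h2
      refine hk (Finset.mem_filter.2 ⟨?_, h2⟩)
      rw [Fintype.mem_piFinset]
      have h3 : k 0 ^ 2 + k 1 ^ 2 = 2 := by
        rw [freqSq] at h2; exact_mod_cast h2
      intro i
      rw [Finset.mem_Icc]
      fin_cases i <;> constructor <;> simp only [Fin.zero_eta, Fin.mk_one] <;> nlinarith [sq_nonneg (k 0), sq_nonneg (k 1)]
    simp [resonant, h2]

lemma phase_add (k : Fin 2 → ℤ) (x y : Plane) : phase k (x + y) = phase k x + phase k y := by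
  simp [phase]; ring

lemma phase_neg (k : Fin 2 → ℤ) (x : Plane) : phase k (-x) = -phase k x := by
  simp [phase]; ring

/-- Fourier coefficients of functions with an additional period. -/
lemma setIntegral_mul_phase_eq_zero {w : Plane → ℝ} (hw : IsPeriodic w)
    (hi : IntegrableOn w torusCell) {τ : Plane} (hτ : ∀ x, w (x + τ) = w x) {k : Fin 2 → ℤ}
    (hk : Real.cos (phase k τ) ≠ 1) :
    ∫ x in torusCell, w x * Real.cos (phase k x) = 0 ∧
      ∫ x in torusCell, w x * Real.sin (phase k x) = 0 := by
  have iC : IntegrableOn (fun x => w x * Real.cos (phase k x)) torusCell :=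
    hi.mul_bdd (c := 1) (contDiff_phase k).cos.continuous.aestronglyMeasurable
      (Eventually.of_forall fun x => Real.abs_cos_le_one _)
  have iS : IntegrableOn (fun x => w x * Real.sin (phase k x)) torusCell :=
    hi.mul_bdd (c := 1) (contDiff_phase k).sin.continuous.aestronglyMeasurable
      (Eventually.of_forall fun x => Real.abs_sin_le_one _)
  have tC := (hw.mul (isPeriodic_cos_phase k)).setIntegral_add τ
  have tS := (hw.mul (isPeriodic_sin_phase k)).setIntegral_add τ
  simp only [hτ, phase_add, Real.cos_add, Real.sin_add] at tC tS
  have e1 : ∀ x, w x * (Real.cos (phase k x) * Real.cos (phase k τ)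
      - Real.sin (phase k x) * Real.sin (phase k τ)) = w x * Real.cos (phase k x) *
      Real.cos (phase k τ) - w x * Real.sin (phase k x) * Real.sin (phase k τ) := fun x => by ring
  have e2 : ∀ x, w x * (Real.sin (phase k x) * Real.cos (phase k τ)
      + Real.cos (phase k x) * Real.sin (phase k τ)) = w x * Real.sin (phase k x) *
      Real.cos (phase k τ) + w x * Real.cos (phase k x) * Real.sin (phase k τ) := fun x => by ring
  simp only [e1] at tC
  simp only [e2] at tS
  rw [integral_sub (iC.mul_const _) (iS.mul_const _), integral_mul_const, integral_mul_const] at tC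
  rw [integral_add (iS.mul_const _) (iC.mul_const _), integral_mul_const, integral_mul_const] at tS
  set I := ∫ x in torusCell, w x * Real.cos (phase k x)
  set J := ∫ x in torusCell, w x * Real.sin (phase k x)
  have h1 := Real.sin_sq_add_cos_sq (phase k τ)
  -- Translation by τ gives a linear system for the two integrals whose matrix is a rotation minus
  -- the identity, of determinant 2(1 - cos).
  have h2 : 2 * (1 - Real.cos (phase k τ)) ≠ 0 :=
    mul_ne_zero two_ne_zero (sub_ne_zero.2 (Ne.symm hk))
  constructor
  · refine (mul_eq_zero.1 ?_).resolve_left h2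
    linear_combination -(1 - Real.cos (phase k τ)) * tC + Real.sin (phase k τ) * tS - I * h1
  · refine (mul_eq_zero.1 ?_).resolve_left h2
    linear_combination -(1 - Real.cos (phase k τ)) * tS - Real.sin (phase k τ) * tC - J * h1

/-- No resonant exponential is `Λ`-periodic. -/
def NonResonant (Λ : Set Plane) : Prop :=
  ∀ k, freqSq k = 2 → ∃ τ ∈ Λ, Real.cos (phase k τ) ≠ 1

/-- The resonant frequencies are (±1, ±1), so the phases are ±(μ₀ + μ₁) and ±(μ₀ - μ₁). Each
hypothesis supplies a lattice point at which one pair is not a multiple of 2π. -/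
lemma nonResonant_of {Λ : Set Plane} (hplus : ¬ Λ ⊆ {μ | ∃ k : ℤ, μ 0 + μ 1 = 2 * Real.pi * k})
    (hminus : ¬ Λ ⊆ {μ | ∃ k : ℤ, μ 0 - μ 1 = 2 * Real.pi * k}) : NonResonant Λ := by
  intro k hk
  have h3 : k 0 ^ 2 + k 1 ^ 2 = 2 := by
    rw [freqSq] at hk; exact_mod_cast hk
  have b : ∀ i, k i = 1 ∨ k i = -1 := by
    intro i
    have h1 : -1 ≤ k i ∧ k i ≤ 1 := by
      fin_cases i <;> constructor <;> simp only [Fin.zero_eta, Fin.mk_one] <;>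
        nlinarith [sq_nonneg (k 0), sq_nonneg (k 1)]
    have h2 : k i ≠ 0 := by
      intro h0
      fin_cases i <;> simp only [Fin.zero_eta, Fin.mk_one] at h0 <;> rw [h0] at h3
      · have : -1 ≤ k 1 ∧ k 1 ≤ 1 := by constructor <;> nlinarith
        nlinarith
      · have : -1 ≤ k 0 ∧ k 0 ≤ 1 := by constructor <;> nlinarith
        nlinarith
    omega
  rw [not_subset] at hplus hminus
  obtain ⟨p, hp, hp'⟩ := hplus
  obtain ⟨m, hm, hm'⟩ := hminus
  have key : ∀ (s : ℝ) (y : ℝ), (s = 1 ∨ s = -1) → (¬ ∃ n : ℤ, y = 2 * Real.pi * n) →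
      Real.cos (s * y) ≠ 1 := by
    intro s y hs hy h1
    have h2 : Real.cos y = 1 := by
      rcases hs with rfl | rfl
      · simpa using h1
      · simpa using h1
    obtain ⟨n, hn⟩ := (Real.cos_eq_one_iff _).1 h2
    exact hy ⟨n, by rw [← hn]; ring⟩
  rcases b 0 with h0 | h0 <;> rcases b 1 with h1 | h1
  · exact ⟨p, hp, by simpa [phase, h0, h1] using key 1 _ (Or.inl rfl) hp'⟩
  · exact ⟨m, hm, by simpa [phase, h0, h1, sub_eq_add_neg] using key 1 _ (Or.inl rfl) hm'⟩
  · refine ⟨m, hm, ?_⟩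
    have := key (-1) _ (Or.inr rfl) hm'
    rwa [show -1 * (m 0 - m 1) = phase k m by simp [phase, h0, h1]; ring] at this
  · refine ⟨p, hp, ?_⟩
    have := key (-1) _ (Or.inr rfl) hp'
    rwa [show -1 * (p 0 + p 1) = phase k p by simp [phase, h0, h1]; ring] at this

/-- Solution of the equation `Δu + 2u = F` for smooth even `Λ`-periodic `F`. -/
theorem exists_lap_add_eq {Λ : Set Plane} {r : ℝ} (hΛ : IsPeriodLattice Λ r) (hn : NonResonant Λ)
    {F : Plane → ℝ} (hF : ∀ ν ∈ Λ, ∀ x, F (x + ν) = F x) (sF : ContDiff ℝ ∞ F)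
    (eF : ∀ x, F (-x) = F x) : ∃ u : Plane → ℝ, ContDiff ℝ ∞ u ∧
      (∀ ν ∈ Λ, ∀ x, u (x + ν) = u x) ∧ (∀ x, u (-x) = u x) ∧ ∀ x, lap u x + 2 * u x = F x := by
  have pF : IsPeriodic F := fun ν hν => hF ν (hΛ.periods_subset hν)
  have ra := rapid_torusCoeff isPeriodic_cos_phase (fun k => (contDiff_phase k).cos) lap_cos_phase
    (fun k x => Real.abs_cos_le_one _) pF sF
  have rb := rapid_torusCoeff isPeriodic_sin_phase (fun k => (contDiff_phase k).sin) lap_sin_phase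
    (fun k x => Real.abs_sin_le_one _) pF sF
  have hser := eq_trigSeries pF sF
  have hz : ∀ k, (∃ τ ∈ Λ, Real.cos (phase k τ) ≠ 1) →
      torusCoeff (fun y => Real.cos (phase k y)) F = 0 := by
    rintro k ⟨τ, hτ, hk⟩
    rw [torusCoeff, (setIntegral_mul_phase_eq_zero pF (integrableOn_torusCell sF.continuous)
      (hF τ hτ) hk).1, mul_zero]
  set a := fun k => torusCoeff (fun y => Real.cos (phase k y)) F with ha
  set b := fun k => torusCoeff (fun y => Real.sin (phase k y)) F with hb
  have r0 : Rapid fun _ => 0 := fun m => ⟨0, by simp⟩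
  -- Averaging the series at x and -x removes the sine part, as F is even.
  have hser' : ∀ x, F x = trigSeries a (fun _ => 0) x := by
    intro x
    have h1 := hser x
    have h2 := hser (-x)
    rw [eF] at h2
    have h3 : F x + F x = 2 * trigSeries a (fun _ => 0) x := by
      conv_lhs => rw [h1]
      rw [← h1]
      nth_rewrite 1 [h1]
      rw [h2]
      unfold trigSeries
      rw [← (summable_trigSeries ra rb x).tsum_add (summable_trigSeries ra rb (-x)), ← tsum_mul_left]
      refine tsum_congr fun k => ?_
      rw [phase_neg, Real.cos_neg, Real.sin_neg]
      ring
    linarith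
  have m0 : (fun _ : Fin 2 → ℤ => (0 : ℝ)) = fun k => jacobiMult k * (fun _ => 0) k := by simp
  refine ⟨trigSeries (fun k => jacobiMult k * a k) (fun _ => 0),
    contDiff_trigSeries ra.jacobiMult r0, fun ν hν x => tsum_congr fun k => ?_, fun x => ?_,
    fun x => ?_⟩
  -- A coefficient of F vanishes unless the corresponding exponential is Λ-periodic, so the solution
  -- inherits the periods of F term by term.
  · by_cases h : Real.cos (phase k ν) = 1
    · have h2 : Real.sin (phase k ν) = 0 := by
        have := Real.sin_sq_add_cos_sq (phase k ν)
        rw [h] at this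
        nlinarith
      rw [phase_add, Real.cos_add, h, h2]
      ring
    · have := hz k ⟨ν, hν, h⟩
      rw [ha]
      simp only
      rw [this]
      ring
  · refine tsum_congr fun k => ?_
    rw [phase_neg, Real.cos_neg]
    ring
  · have h1 := lap_trigSeries_jacobiMult ra r0 x
    rw [← m0] at h1
    obtain ⟨A, hA, h2⟩ := trigSeries_resonant_eq_sum a fun _ => 0
    have h3 : trigSeries (resonant a) (resonant fun _ => 0) x = 0 := by
      rw [h2]
      refine Finset.sum_eq_zero fun k hk => ?_
      rw [ha]
      simp only
      rw [hz k (hn k (hA k hk))]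
      ring
    rw [h3, add_zero, ← hser'] at h1
    exact h1

/-! ### Uniqueness of the Green function, by duality. -/

/-- Green functions are unique off the lattice. -/
theorem IsGreenFunction.eq_of_notMem {Λ : Set Plane} {r : ℝ} (hΛ : IsPeriodLattice Λ r)
    (hn : NonResonant Λ) {Γ Γ' : Plane → ℝ} (h : IsGreenFunction Λ Γ) (h' : IsGreenFunction Λ Γ')
    {x : Plane} (hx : x ∉ Λ) : Γ x = Γ' x := by
  set w : Plane → ℝ := fun x => Γ x - Γ' x with hw
  have wΛ : ∀ ν ∈ Λ, ∀ x, w (x + ν) = w x := fun ν hν x => by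
    rw [hw]; simp only [h.periodic ν hν, h'.periodic ν hν]
  have pw : IsPeriodic w := fun ν hν => wΛ ν (hΛ.periods_subset hν)
  have iw : IntegrableOn w torusCell := h.integrableOn.sub h'.integrableOn
  have cw : ContinuousOn w Λᶜ := h.continuousOn.sub h'.continuousOn
  have bdd : ∀ {Γ φ : Plane → ℝ}, IntegrableOn Γ torusCell → IsPeriodic φ → Continuous φ →
      IntegrableOn (fun x => Γ x * φ x) torusCell := by
    intro Γ φ hΓ hφ cφ
    obtain ⟨C, hC⟩ := hφ.bounded cφ
    exact hΓ.mul_bdd (c := C) cφ.aestronglyMeasurable (Eventually.of_forall hC)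
  have weak : ∀ φ : Plane → ℝ, ContDiff ℝ ∞ φ → IsPeriodic φ →
      ∫ x in torusCell, w x * (lap φ x + 2 * φ x) = 0 := by
    intro φ sφ pφ
    have e1 := h.weak_equation φ sφ fun i μ => pφ _ (single_mem_periods i) μ
    rw [← h'.weak_equation φ sφ fun i μ => pφ _ (single_mem_periods i) μ] at e1
    simp only [mul_assoc, cliffordJacobi_eq] at e1
    have c : Continuous fun x => lap φ x + 2 * φ x :=
      sφ.lap.continuous.add (continuous_const.mul sφ.continuous)
    have p : IsPeriodic fun x => lap φ x + 2 * φ x :=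
      pφ.lap.add (IsPeriodic.mul (fun _ _ _ => rfl) pφ)
    rw [← sub_eq_zero, ← integral_sub (bdd h.integrableOn p c) (bdd h'.integrableOn p c)] at e1
    simpa only [hw, sub_mul] using e1
  -- The weak equation only allows periodic test functions of the form (Δ + 2)φ. A bump g is first
  -- periodized by 2πℤ², and the resulting F is then written in this form up to its resonant part.
  have test : ∀ g : Plane → ℝ, ContDiff ℝ ∞ g → HasCompactSupport g → tsupport g ⊆ Λᶜ →
      ∫ x, g x • w x = 0 := by
    intro g sg cg tg
    obtain ⟨R, hR⟩ := cg.isCompact.isBounded.subset_closedBall 0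
    have gR : ∀ x, R < ‖x‖ → g x = 0 := fun x hx => by
      by_contra hne
      have := mem_closedBall_zero_iff.1 (hR (subset_tsupport _ hne))
      linarith
    have per := isPeriodLattice_periods
    set F := periodization periods g with hFdef
    have pF : IsPeriodic F := per.isPeriodic_periodization g
    have sF : ContDiff ℝ ∞ F := contDiff_iff_contDiffAt.2 fun x =>
      per.contDiffAt_periodization gR fun ν _ => sg.contDiffAt
    have igw : ∀ ν ∈ (periods : Set Plane), Integrable fun x => w x * g (x - ν) := by
      intro ν hν
      have h1 : Integrable fun x => w x * g x := by
        have h2 : IntegrableOn (fun x => w x * g x) (tsupport g) :=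
          ((cw.mono tg).mul sg.continuous.continuousOn).integrableOn_compact cg.isCompact
        refine (integrableOn_iff_integrable_of_support_subset fun x hx => ?_).1 h2
        exact subset_tsupport _ (right_ne_zero_of_mul hx)
      have h3 := h1.comp_sub_right ν
      refine h3.congr (Eventually.of_forall fun x => ?_)
      have := pw ν hν (x - ν)
      simp only [sub_add_cancel] at this
      simp only [this]
    have e1 := per.setIntegral_mul_periodization pw gR igw
    -- The cell contains a single period, so the unfolding formula has one term, the integral of w g
    -- over the plane.
    have e2 : (periods : Set Plane) ∩ torusCell = {0} := by
      have z : (0 : Plane) ∈ torusCell := fun i => by simp [Real.pi_pos]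
      ext v
      simp only [mem_inter_iff, mem_singleton_iff]
      refine ⟨fun ⟨h1, h2⟩ => ?_, fun h0 => h0 ▸ ⟨periods.zero_mem, z⟩⟩
      have h3 := (existsUnique_add_mem_torusCell 0).unique (y₁ := ⟨v, h1⟩) (y₂ := 0)
        (by simpa [AddSubgroup.vadd_def] using h2) (by simpa using z)
      simpa using congrArg Subtype.val h3
    rw [e2, finsum_mem_singleton] at e1
    simp only [sub_zero] at e1
    simp only [smul_eq_mul, mul_comm (g _)]
    rw [← e1]
    have ra := rapid_torusCoeff isPeriodic_cos_phase (fun k => (contDiff_phase k).cos)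
      lap_cos_phase (fun k x => Real.abs_cos_le_one _) pF sF
    have rb := rapid_torusCoeff isPeriodic_sin_phase (fun k => (contDiff_phase k).sin)
      lap_sin_phase (fun k x => Real.abs_sin_le_one _) pF sF
    obtain ⟨A, hA, hAx⟩ := trigSeries_resonant_eq_sum
      (fun k => torusCoeff (fun y => Real.cos (phase k y)) F)
      (fun k => torusCoeff (fun y => Real.sin (phase k y)) F)
    have sol := lap_trigSeries_jacobiMult ra rb
    have su := contDiff_trigSeries ra.jacobiMult rb.jacobiMult
    set u := trigSeries (fun k => jacobiMult k * torusCoeff (fun y => Real.cos (phase k y)) F)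
      (fun k => jacobiMult k * torusCoeff (fun y => Real.sin (phase k y)) F) with hu
    have pu : IsPeriodic u := isPeriodic_trigSeries
    -- The first part integrates to 0 by the weak equation, the resonant part because w has a
    -- Λ-period which is not a period of the exponential.
    have e3 : ∀ x, w x * F x = w x * (lap u x + 2 * u x)
        + ∑ k ∈ A, (w x * Real.cos (phase k x) * torusCoeff (fun y => Real.cos (phase k y)) F
          + w x * Real.sin (phase k x) * torusCoeff (fun y => Real.sin (phase k y)) F) := by
      intro x
      rw [eq_trigSeries pF sF x, ← sol x, hAx x, mul_add, Finset.mul_sum]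
      congr 1
      exact Finset.sum_congr rfl fun k _ => by ring
    have iC : ∀ k, IntegrableOn (fun x => w x * Real.cos (phase k x)) torusCell := fun k =>
      bdd iw (isPeriodic_cos_phase k) (contDiff_phase k).cos.continuous
    have iS : ∀ k, IntegrableOn (fun x => w x * Real.sin (phase k x)) torusCell := fun k =>
      bdd iw (isPeriodic_sin_phase k) (contDiff_phase k).sin.continuous
    refine (integral_congr_ae (Eventually.of_forall e3)).trans ?_
    rw [integral_add, weak u su pu, integral_finsetSum, zero_add]
    · refine Finset.sum_eq_zero fun k hk => ?_
      obtain ⟨τ, hτ, hk'⟩ := hn k (hA k hk)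
      obtain ⟨z1, z2⟩ := setIntegral_mul_phase_eq_zero pw iw (wΛ τ hτ) hk'
      rw [integral_add ((iC k).mul_const _) ((iS k).mul_const _), integral_mul_const,
        integral_mul_const, z1, z2]
      ring
    · exact fun k _ => ((iC k).mul_const _).add ((iS k).mul_const _)
    · exact bdd iw (pu.lap.add (IsPeriodic.mul (fun _ _ _ => rfl) pu))
        (su.lap.continuous.add (continuous_const.mul su.continuous))
    · exact integrable_finsetSum _ fun k _ => ((iC k).mul_const _).add ((iS k).mul_const _)
  have hU : IsOpen Λᶜ := hΛ.isClosed.isOpen_compl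
  -- The fundamental lemma of the calculus of variations gives equality almost everywhere on the
  -- complement of Λ, which continuity upgrades to every point.
  have ae := hU.ae_eq_zero_of_integral_contDiff_smul_eq_zero
    (cw.locallyIntegrableOn hU.measurableSet) test
  have ae' : w =ᵐ[volume.restrict Λᶜ] fun _ => 0 :=
    (ae_restrict_iff' hU.measurableSet).2 ae
  have := Measure.eqOn_open_of_ae_eq ae' hU cw continuousOn_const hx
  exact sub_eq_zero.1 this

/-! ### Power series with factorial decay -/

/-- Sums of power series. -/
def powSum (a : ℕ → ℝ) (z : ℝ) : ℝ := ∑' j, a j * z ^ j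

/-- The factorial bound makes the differentiated series uniformly summable on every ball. The bound
survives differentiation (`shift_le`), so smoothness follows by induction. -/
lemma hasDerivAt_powSum {a : ℕ → ℝ} (ha : ∀ j, |a j| ≤ 1 / j.factorial) (z : ℝ) :
    HasDerivAt (powSum a) (powSum (fun j => (j + 1) * a (j + 1)) z) z := by
  set R := |z| + 1 with hR
  have hR0 : 0 ≤ R := by positivity
  have hu : Summable fun j : ℕ => (1 / j.factorial : ℝ) * (j * R ^ (j - 1)) := by
    refine (summable_nat_add_iff 1).1 ((Real.summable_pow_div_factorial R).congr fun j => ?_)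
    rw [Nat.factorial_succ, Nat.add_sub_cancel]
    push_cast
    field_simp
  have hf0 : Summable fun j : ℕ => a j * (0 : ℝ) ^ j :=
    summable_of_ne_finset_zero (s := {0}) fun j hj => by
      rw [zero_pow (by simpa using hj), mul_zero]
  have hs : Summable fun j : ℕ => a j * (j * z ^ (j - 1)) := by
    refine Summable.of_norm_bounded hu fun j => ?_
    rw [norm_mul, norm_mul, norm_pow, Real.norm_eq_abs, Real.norm_eq_abs, Real.norm_eq_abs,
      Nat.abs_cast]
    gcongr
    · exact ha j
    · linarith
  have key := hasDerivAt_tsum_of_isPreconnected (g := fun (j : ℕ) (z : ℝ) => a j * z ^ j)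
    (g' := fun j z => a j * (j * z ^ (j - 1))) (t := Metric.ball 0 R) (y := z) (y₀ := 0) hu
    Metric.isOpen_ball (convex_ball _ _).isPreconnected
    (fun j y _ => (hasDerivAt_pow j y).const_mul (a j))
    (fun j y hy => by
      rw [norm_mul, norm_mul, norm_pow, Real.norm_eq_abs, Real.norm_eq_abs, Nat.abs_cast]
      have : ‖y‖ ≤ R := (mem_ball_zero_iff.1 hy).le
      gcongr
      exact ha j)
    (Metric.mem_ball_self (by positivity)) hf0 (mem_ball_zero_iff.2 (by
      rw [Real.norm_eq_abs]; linarith))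
  refine key.congr_deriv ?_
  unfold powSum
  rw [hs.tsum_eq_zero_add]
  simp only [Nat.cast_zero, zero_mul, mul_zero, zero_add, Nat.add_sub_cancel]
  exact tsum_congr fun j => by push_cast; ring

lemma shift_le {a : ℕ → ℝ} (ha : ∀ j, |a j| ≤ 1 / j.factorial) (j : ℕ) :
    |((j : ℝ) + 1) * a (j + 1)| ≤ 1 / j.factorial := by
  rw [abs_mul, abs_of_nonneg (by positivity)]
  refine (mul_le_mul_of_nonneg_left (ha (j + 1)) (by positivity)).trans (le_of_eq ?_)
  rw [Nat.factorial_succ]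
  push_cast
  field_simp

lemma contDiff_powSum {a : ℕ → ℝ} (ha : ∀ j, |a j| ≤ 1 / j.factorial) :
    ContDiff ℝ ∞ (powSum a) := by
  rw [contDiff_infty]
  intro n
  induction n generalizing a with
  | zero => exact contDiff_zero.2 (Differentiable.continuous (𝕜 := ℝ)
      fun z => (hasDerivAt_powSum ha z).differentiableAt)
  | succ n ih =>
    refine (contDiff_succ_iff_deriv (n := n)).2
      ⟨fun z => (hasDerivAt_powSum ha z).differentiableAt, by simp, ?_⟩
    rw [show deriv (powSum a) = _ from funext fun z => (hasDerivAt_powSum ha z).deriv]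
    exact ih (shift_le ha)

lemma summable_powSum {a : ℕ → ℝ} (ha : ∀ j, |a j| ≤ 1 / j.factorial) (z : ℝ) :
    Summable fun j => a j * z ^ j := by
  refine Summable.of_norm_bounded (Real.summable_pow_div_factorial |z|) fun j => ?_
  rw [norm_mul, norm_pow, Real.norm_eq_abs, Real.norm_eq_abs, div_eq_mul_one_div, mul_comm]
  exact mul_le_mul_of_nonneg_left (ha j) (by positivity)

/-- The coefficients of the entire function `z ↦ J₀(√(2z))`. -/
def besselCoeff (j : ℕ) : ℝ := (-1 / 2) ^ j / (j.factorial : ℝ) ^ 2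

lemma abs_besselCoeff_le (j : ℕ) : |besselCoeff j| ≤ 1 / j.factorial := by
  have h1 : (1 : ℝ) ≤ j.factorial := by exact_mod_cast j.factorial_pos
  rw [besselCoeff, abs_div, abs_pow, abs_of_nonneg (by positivity : (0 : ℝ) ≤ (j.factorial : ℝ) ^ 2)]
  refine div_le_div₀ zero_le_one (pow_le_one₀ (abs_nonneg _) ?_) (by positivity) ?_
  · rw [abs_div]; norm_num
  · nlinarith

/-- The smooth function `A` with `4 z A'' + 4 A' + 2 A = 0` and `A 0 = 1`. -/
def bessel : ℝ → ℝ := powSum besselCoeff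

lemma contDiff_bessel : ContDiff ℝ ∞ bessel := contDiff_powSum abs_besselCoeff_le

lemma bessel_zero : bessel 0 = 1 := by
  rw [bessel, powSum, tsum_eq_single 0 fun j hj => by rw [zero_pow hj, mul_zero]]
  simp [besselCoeff]

/-- Comparison of coefficients: 4(j + 1)² a_{j+1} + 2 a_j = 0. By `lap_radial` this is the equation
(Δ + 2) A(|x|²) = 0. -/
lemma bessel_ode (z : ℝ) : 4 * z * deriv (deriv bessel) z + 4 * deriv bessel z + 2 * bessel z = 0 := by
  have h1 := abs_besselCoeff_le
  have h2 := shift_le h1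
  have h3 := shift_le h2
  have e1 : deriv bessel = _ := funext fun z => (hasDerivAt_powSum h1 z).deriv
  rw [e1, (hasDerivAt_powSum h2 z).deriv, bessel]
  have s1 := summable_powSum h1 z
  have s2 := summable_powSum h2 z
  have s3 := summable_powSum h3 z
  have e3 : z * powSum (fun j => (j + 1) * (((j + 1 : ℕ) : ℝ) + 1) * besselCoeff (j + 1 + 1)) z
      = ∑' j : ℕ, (j * (j + 1) * besselCoeff (j + 1)) * z ^ j := by
    have h4 : Summable fun j : ℕ => (j * (j + 1) * besselCoeff (j + 1)) * z ^ j := by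
      refine (summable_nat_add_iff 1).1 ((s3.mul_left z).congr fun j => ?_)
      push_cast; ring
    rw [h4.tsum_eq_zero_add, powSum, ← tsum_mul_left]
    simp only [Nat.cast_zero, zero_mul, zero_add]
    exact tsum_congr fun j => by push_cast; ring
  have e3' : powSum (fun j => ((j : ℝ) + 1) * ((((j + 1 : ℕ) : ℝ) + 1) * besselCoeff (j + 1 + 1))) z
      = powSum (fun j => (j + 1) * (((j + 1 : ℕ) : ℝ) + 1) * besselCoeff (j + 1 + 1)) z := by
    congr 1; ext j; ring
  rw [e3', mul_assoc, e3]
  have h4 : Summable fun j : ℕ => (j * (j + 1) * besselCoeff (j + 1)) * z ^ j := by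
    refine (summable_nat_add_iff 1).1 ((s3.mul_left z).congr fun j => ?_)
    push_cast; ring
  unfold powSum
  rw [← tsum_mul_left, ← tsum_mul_left, ← tsum_mul_left, ← (h4.mul_left 4).tsum_add (s2.mul_left 4),
    ← ((h4.mul_left 4).add (s2.mul_left 4)).tsum_add (s1.mul_left 2)]
  refine (tsum_congr fun j => ?_).trans tsum_zero
  simp only [besselCoeff, Nat.factorial_succ, pow_succ]
  have : (j.factorial : ℝ) ≠ 0 := by exact_mod_cast j.factorial_ne_zero
  push_cast
  field_simp
  ring

/-! ### Radial functions -/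

lemma norm_sq_plane (x : Plane) : ‖x‖ ^ 2 = x 0 ^ 2 + x 1 ^ 2 := by
  rw [EuclideanSpace.norm_sq_eq, Fin.sum_univ_two]; simp

lemma contDiff_norm_sq_plane : ContDiff ℝ ∞ fun x : Plane => ‖x‖ ^ 2 := contDiff_norm_sq ℝ

lemma contDiffAt_radial {p : ℝ → ℝ} {x : Plane} (hp : ContDiffAt ℝ ∞ p (‖x‖ ^ 2)) :
    ContDiffAt ℝ ∞ (fun x : Plane => p (‖x‖ ^ 2)) x :=
  ContDiffAt.comp (g := p) x hp contDiff_norm_sq_plane.contDiffAt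

lemma pd_norm_sq (j : Fin 2) (x : Plane) : pd j (fun x : Plane => ‖x‖ ^ 2) x = 2 * x j := by
  have : (fun x : Plane => ‖x‖ ^ 2) = fun x => x 0 * x 0 + x 1 * x 1 := by
    ext x; rw [norm_sq_plane]; ring
  have d := fun i => differentiableAt_coord i x
  rw [this, pd_add j ((d 0).fun_mul (d 0)) ((d 1).fun_mul (d 1)), pd_mul j (d 0) (d 0),
    pd_mul j (d 1) (d 1), pd_coord, pd_coord]
  fin_cases j <;> simp <;> ring

lemma pd_radial {p : ℝ → ℝ} (j : Fin 2) {x : Plane} (hp : DifferentiableAt ℝ p (‖x‖ ^ 2)) :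
    pd j (fun x => p (‖x‖ ^ 2)) x = 2 * x j * deriv p (‖x‖ ^ 2) := by
  rw [pd_real_comp j hp.hasDerivAt (contDiff_norm_sq_plane.differentiable (by norm_num) x),
    pd_norm_sq]
  ring

lemma lap_radial {p : ℝ → ℝ} {x : Plane} (hp : ContDiffAt ℝ 2 p (‖x‖ ^ 2)) :
    lap (fun x => p (‖x‖ ^ 2)) x
      = 4 * ‖x‖ ^ 2 * deriv (deriv p) (‖x‖ ^ 2) + 4 * deriv p (‖x‖ ^ 2) := by
  have ev : ∀ᶠ y in 𝓝 x, DifferentiableAt ℝ p (‖y‖ ^ 2) :=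
    ((contDiff_norm_sq_plane.continuous.tendsto x).eventually (hp.eventually (by norm_num))).mono
      fun y hy => hy.differentiableAt (by norm_num)
  have hd : DifferentiableAt ℝ (deriv p) (‖x‖ ^ 2) :=
    ((hp.fderiv_right (m := 1) (by norm_num)).clm_apply contDiffAt_const).differentiableAt
      (by norm_num)
  have hd' : DifferentiableAt ℝ (fun y : Plane => deriv p (‖y‖ ^ 2)) x :=
    DifferentiableAt.comp (g := deriv p) (f := fun y : Plane => ‖y‖ ^ 2) x hd (contDiff_norm_sq_plane.differentiable (by norm_num) x)
  have key : ∀ j, pd j (pd j fun x => p (‖x‖ ^ 2)) x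
      = 2 * deriv p (‖x‖ ^ 2) + 4 * x j ^ 2 * deriv (deriv p) (‖x‖ ^ 2) := by
    intro j
    rw [((show pd j (fun x => p (‖x‖ ^ 2)) =ᶠ[𝓝 x] _ from
      ev.mono fun y hy => pd_radial j hy).pd j).eq_of_nhds,
      pd_mul j ((differentiableAt_coord j x).const_mul 2) hd', pd_const_mul, pd_coord,
      pd_radial j hd]
    simp; ring
  rw [lap, key, key, norm_sq_plane]; ring

lemma lap_mul {φ ψ : Plane → ℝ} {x : Plane} (hφ : ContDiffAt ℝ 2 φ x) (hψ : ContDiffAt ℝ 2 ψ x) :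
    lap (fun y => φ y * ψ y) x = lap φ x * ψ x + φ x * lap ψ x
      + 2 * (pd 0 φ x * pd 0 ψ x + pd 1 φ x * pd 1 ψ x) := by
  have d1 := hφ.differentiableAt (by norm_num)
  have d2 := hψ.differentiableAt (by norm_num)
  have dp : ∀ {f : Plane → ℝ} (j : Fin 2), ContDiffAt ℝ 2 f x → DifferentiableAt ℝ (pd j f) x :=
    fun j h => (h.pd_of_two j).differentiableAt (by norm_num)
  have ev : ∀ᶠ y in 𝓝 x, DifferentiableAt ℝ φ y ∧ DifferentiableAt ℝ ψ y :=
    ((hφ.eventually (by norm_num)).and (hψ.eventually (by norm_num))).mono fun y hy =>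
      ⟨hy.1.differentiableAt (by norm_num), hy.2.differentiableAt (by norm_num)⟩
  have key : ∀ j, pd j (pd j fun y => φ y * ψ y) x = pd j (pd j φ) x * ψ x
      + φ x * pd j (pd j ψ) x + 2 * (pd j φ x * pd j ψ x) := by
    intro j
    rw [((show pd j (fun y => φ y * ψ y) =ᶠ[𝓝 x] _ from
      ev.mono fun y hy => pd_mul j hy.1 hy.2).pd j).eq_of_nhds,
      pd_add j ((dp j hφ).fun_mul d2) (d1.fun_mul (dp j hψ)), pd_mul j (dp j hφ) d2, pd_mul j d1 (dp j hψ)]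
    ring
  simp only [lap, key]; ring

lemma lap_congr {φ ψ : Plane → ℝ} {x : Plane} (h : φ =ᶠ[𝓝 x] ψ) : lap φ x = lap ψ x := by
  simp only [lap, ((h.pd 0).pd 0).eq_of_nhds, ((h.pd 1).pd 1).eq_of_nhds]

/-! ### The logarithm as a fundamental solution -/

/-- The regularized logarithm `-½ log (|x|² + δ²)` with `δ = 1/c`. -/
def regLog (c : ℝ) (x : Plane) : ℝ := -(1 / 2) * Real.log (‖x‖ ^ 2 + (c⁻¹) ^ 2)

lemma hasCompactSupport_pd {u : Plane → ℝ} (hu : HasCompactSupport u) (j : Fin 2) :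
    HasCompactSupport (pd j u) := hu.fderiv_apply ℝ _

lemma hasCompactSupport_lap {u : Plane → ℝ} (hu : HasCompactSupport u) :
    HasCompactSupport (lap u) :=
  (hasCompactSupport_pd (hasCompactSupport_pd hu 0) 0).add
    (hasCompactSupport_pd (hasCompactSupport_pd hu 1) 1)

lemma integral_mul_lap {u φ : Plane → ℝ} (hu : HasCompactSupport u) (su : ContDiff ℝ ∞ u)
    (sφ : ContDiff ℝ ∞ φ) : ∫ x, u x * lap φ x = ∫ x, lap u x * φ x := by
  have I : ∀ {f g : Plane → ℝ}, HasCompactSupport f → Continuous f → Continuous g →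
      Integrable fun x => f x * g x := fun h c c' =>
    (c.mul c').integrable_of_hasCompactSupport h.mul_right
  have part : ∀ (j : Fin 2) {f g : Plane → ℝ}, HasCompactSupport f → ContDiff ℝ ∞ f →
      ContDiff ℝ ∞ g → ∫ x, f x * pd j g x = -∫ x, pd j f x * g x := by
    intro j f g hf sf sg
    exact integral_mul_fderiv_eq_neg_fderiv_mul_of_integrable
      (I (hasCompactSupport_pd hf j) (sf.pd j).continuous sg.continuous)
      (I hf sf.continuous (sg.pd j).continuous) (I hf sf.continuous sg.continuous)
      (fun x _ => sf.differentiable (by norm_num) x) (fun x _ => sg.differentiable (by norm_num) x)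
  have two : ∀ j, ∫ x, u x * pd j (pd j φ) x = ∫ x, pd j (pd j u) x * φ x := fun j => by
    rw [part j hu su (sφ.pd j), part j (hasCompactSupport_pd hu j) (su.pd j) sφ, neg_neg]
  simp only [lap, mul_add, add_mul]
  rw [integral_add (I hu su.continuous ((sφ.pd 0).pd 0).continuous)
      (I hu su.continuous ((sφ.pd 1).pd 1).continuous), two, two,
    integral_add (I (hasCompactSupport_pd (hasCompactSupport_pd hu 0) 0)
      ((su.pd 0).pd 0).continuous sφ.continuous)
      (I (hasCompactSupport_pd (hasCompactSupport_pd hu 1) 1)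
      ((su.pd 1).pd 1).continuous sφ.continuous)]

section regLog
variable {c : ℝ}

lemma regLog_pos (hc : 0 < c) (z : ℝ) (hz : 0 ≤ z) : 0 < z + (c⁻¹) ^ 2 := by positivity

lemma contDiffAt_regLog_aux {δ z : ℝ} (hz : 0 < z + δ) :
    ContDiffAt ℝ ∞ (fun z => -(1 / 2) * Real.log (z + δ)) z :=
  contDiffAt_const.mul ((contDiffAt_id.add contDiffAt_const).log hz.ne')

lemma deriv_regLog_aux {δ z : ℝ} (hz : 0 < z + δ) :
    deriv (fun z => -(1 / 2) * Real.log (z + δ)) z = -(1 / 2) / (z + δ) ∧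
    deriv (deriv fun z => -(1 / 2) * Real.log (z + δ)) z = 1 / 2 / (z + δ) ^ 2 := by
  have h1 : ∀ y, 0 < y + δ →
      deriv (fun z => -(1 / 2) * Real.log (z + δ)) y = -(1 / 2) * (y + δ)⁻¹ := by
    intro y hy
    have : HasDerivAt (fun z => -(1 / 2) * Real.log (z + δ)) _ y :=
      (((hasDerivAt_id y).add_const δ).log hy.ne').const_mul (-(1 / 2))
    rw [this.deriv]; simp
  refine ⟨(h1 z hz).trans (div_eq_mul_inv _ _).symm, ?_⟩
  have ev : ∀ᶠ y in 𝓝 z, 0 < y + δ :=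
    (continuous_id.add continuous_const).tendsto z |>.eventually (lt_mem_nhds hz)
  rw [Filter.EventuallyEq.deriv_eq (ev.mono h1)]
  have h2 : HasDerivAt (fun y => -(1 / 2) * (y + δ)⁻¹) (-(1 / 2) * (-1 / (z + δ) ^ 2)) z :=
    (((hasDerivAt_id z).add_const δ).inv hz.ne').const_mul (-(1 / 2))
  rw [h2.deriv]; ring

lemma contDiff_regLog (hc : 0 < c) : ContDiff ℝ ∞ (regLog c) :=
  contDiff_iff_contDiffAt.2 fun x => contDiffAt_radial
    (contDiffAt_regLog_aux (regLog_pos hc _ (sq_nonneg ‖x‖)))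

lemma pd_regLog (hc : 0 < c) (j : Fin 2) (x : Plane) :
    pd j (regLog c) x = -x j / (‖x‖ ^ 2 + (c⁻¹) ^ 2) := by
  have hz := regLog_pos hc _ (sq_nonneg ‖x‖)
  have := pd_radial (p := fun z => -(1 / 2) * Real.log (z + (c⁻¹) ^ 2)) j (x := x)
    ((contDiffAt_regLog_aux hz).differentiableAt (by norm_num))
  refine this.trans ?_
  rw [(deriv_regLog_aux hz).1]; ring

lemma lap_regLog (hc : 0 < c) (x : Plane) :
    lap (regLog c) x = -(2 * (c⁻¹) ^ 2 / (‖x‖ ^ 2 + (c⁻¹) ^ 2) ^ 2) := by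
  have hz := regLog_pos hc _ (sq_nonneg ‖x‖)
  have := lap_radial (p := fun z => -(1 / 2) * Real.log (z + (c⁻¹) ^ 2)) (x := x)
    ((contDiffAt_regLog_aux hz).of_le two_le_infty)
  refine this.trans ?_
  rw [(deriv_regLog_aux hz).1, (deriv_regLog_aux hz).2]
  field_simp
  ring

end regLog

lemma log_norm_eq (x : Plane) : -Real.log ‖x‖ = -(1 / 2) * Real.log (‖x‖ ^ 2 + 0) := by
  rw [add_zero, Real.log_pow]; push_cast; ring

lemma contDiffAt_log_norm {x : Plane} (hx : x ≠ 0) : ContDiffAt ℝ ∞ (fun x : Plane => -Real.log ‖x‖) x := by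
  have hz : 0 < ‖x‖ ^ 2 + 0 := by have := norm_pos_iff.2 hx; positivity
  simp only [log_norm_eq]
  exact contDiffAt_radial (contDiffAt_regLog_aux hz)

lemma pd_log_norm {x : Plane} (hx : x ≠ 0) (j : Fin 2) :
    pd j (fun x : Plane => -Real.log ‖x‖) x = -x j / ‖x‖ ^ 2 := by
  have hz : 0 < ‖x‖ ^ 2 + 0 := by have := norm_pos_iff.2 hx; positivity
  simp only [log_norm_eq]
  rw [pd_radial (p := fun z => -(1 / 2) * Real.log (z + 0)) j
    ((contDiffAt_regLog_aux hz).differentiableAt (by norm_num)), (deriv_regLog_aux hz).1, add_zero]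
  ring

lemma lap_log_norm {x : Plane} (hx : x ≠ 0) : lap (fun x : Plane => -Real.log ‖x‖) x = 0 := by
  have hz : 0 < ‖x‖ ^ 2 + 0 := by have := norm_pos_iff.2 hx; positivity
  simp only [log_norm_eq]
  rw [lap_radial (p := fun z => -(1 / 2) * Real.log (z + 0))
    ((contDiffAt_regLog_aux hz).of_le two_le_infty), (deriv_regLog_aux hz).1,
    (deriv_regLog_aux hz).2, add_zero]
  have : ‖x‖ ≠ 0 := norm_ne_zero_iff.2 hx
  field_simp
  ring

lemma integrableOn_log_norm (R : ℝ) :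
    IntegrableOn (fun x : Plane => Real.log ‖x‖) (Metric.ball 0 R) := by
  rw [integrableOn_fun_norm_addHaar]
  simp only [finrank_euclideanSpace, Fintype.card_fin, smul_eq_mul]
  have : Continuous fun y : ℝ => y ^ (2 - 1) * Real.log y := by
    simpa using Real.continuous_mul_log
  exact (this.locallyIntegrable.integrableOn_isCompact isCompact_Icc).mono_set Ioo_subset_Icc_self

/-- Convergence of integrals against the regularized logarithms. -/
lemma tendsto_integral_regLog {h : Plane → ℝ} (hc : Continuous h) (hs : HasCompactSupport h) :
    Integrable (fun x => -Real.log ‖x‖ * h x) ∧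
    Tendsto (fun c => ∫ x, regLog c x * h x) atTop (𝓝 (∫ x, -Real.log ‖x‖ * h x)) := by
  obtain ⟨R, hR⟩ := hs.isCompact.isBounded.subset_ball 0
  have hR' : ∀ x, h x ≠ 0 → ‖x‖ < R := fun x hx =>
    mem_ball_zero_iff.1 (hR (subset_tsupport _ hx))
  obtain ⟨B, hB⟩ := hs.exists_bound_of_continuous hc
  have i1 : Integrable fun x => Real.log ‖x‖ * h x := by
    have h1 : IntegrableOn (fun x => Real.log ‖x‖ * h x) (Metric.ball 0 R) :=
      (integrableOn_log_norm R).mul_bdd (c := B) hc.aestronglyMeasurable (Eventually.of_forall hB)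
    exact (integrableOn_iff_integrable_of_support_subset fun x hx =>
      mem_ball_zero_iff.2 (hR' x (right_ne_zero_of_mul hx))).1 h1
  refine ⟨by simpa using i1.neg, ?_⟩
  set M := (1 / 2) * |Real.log (R ^ 2 + 1)| with hM
  refine tendsto_integral_filter_of_dominated_convergence
    (fun x => |Real.log ‖x‖ * h x| + M * |h x|) ?_ ?_ ?_ ?_
  · filter_upwards [eventually_gt_atTop 0] with c hc0
    exact ((contDiff_regLog hc0).continuous.mul hc).aestronglyMeasurable
  -- For c ≥ 1 and |x| < R the regularized logarithm lies between log |x|² and log(R² + 1), both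
  -- integrable against h.
  · filter_upwards [eventually_ge_atTop 1] with c hc1
    have ae : ∀ᵐ x : Plane, x ≠ 0 := by simp [ae_iff]
    filter_upwards [ae] with x hx
    by_cases hx0 : h x = 0
    · simp [hx0]
    · have h0 := norm_pos_iff.2 hx
      have h1 := hR' x hx0
      have hd : 0 < c⁻¹ ^ 2 := by positivity
      have hd1 : c⁻¹ ^ 2 ≤ 1 := pow_le_one₀ (by positivity) (inv_le_one_of_one_le₀ hc1)
      have l1 : 2 * Real.log ‖x‖ ≤ Real.log (‖x‖ ^ 2 + c⁻¹ ^ 2) := by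
        rw [show 2 * Real.log ‖x‖ = Real.log (‖x‖ ^ 2) by rw [Real.log_pow]; push_cast; ring]
        exact Real.log_le_log (by positivity) (by linarith)
      have l2 : Real.log (‖x‖ ^ 2 + c⁻¹ ^ 2) ≤ Real.log (R ^ 2 + 1) :=
        Real.log_le_log (by positivity) (by nlinarith)
      rw [norm_mul, regLog, abs_mul, ← add_mul]
      refine mul_le_mul_of_nonneg_right ?_ (abs_nonneg _)
      rw [Real.norm_eq_abs, abs_mul, abs_neg, abs_of_pos (by norm_num : (0 : ℝ) < 1 / 2), hM,
        ← sub_nonneg]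
      rcases abs_cases (Real.log (‖x‖ ^ 2 + c⁻¹ ^ 2)) with ⟨e, -⟩ | ⟨e, -⟩ <;> rw [e] <;>
        nlinarith [neg_abs_le (Real.log ‖x‖), le_abs_self (Real.log (R ^ 2 + 1)),
          abs_nonneg (Real.log ‖x‖), abs_nonneg (Real.log (R ^ 2 + 1))]
  · exact i1.abs.add ((hc.abs.integrable_of_hasCompactSupport hs.abs).const_mul M)
  · have ae : ∀ᵐ x : Plane, x ≠ 0 := by simp [ae_iff]
    filter_upwards [ae] with x hx
    have h0 := norm_pos_iff.2 hx
    refine Tendsto.mul_const _ ?_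
    rw [log_norm_eq]
    refine Tendsto.const_mul _ (Tendsto.log ?_ (by positivity))
    have := (tendsto_inv_atTop_zero (𝕜 := ℝ)).pow 2
    simpa using this.const_add (‖x‖ ^ 2)

/-- In polar coordinates the integrand has the elementary primitive -1/(2π(y² + 1)). Rescalings of
this kernel are the Laplacians of `regLog`, up to the factor -2π. -/
lemma integral_bubble : ∫ x : Plane, Real.pi⁻¹ * (1 / (‖x‖ ^ 2 + 1) ^ 2) = 1 := by
  rw [integral_fun_norm_addHaar volume fun r => Real.pi⁻¹ * (1 / (r ^ 2 + 1) ^ 2)]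
  have h1 : volume.real (Metric.ball (0 : Plane) 1) = Real.pi := by
    rw [measureReal_def, EuclideanSpace.volume_ball_fin_two]
    simp [Real.pi_pos.le]
  have hd : ∀ y ∈ Ici (0 : ℝ), HasDerivAt (fun y : ℝ => -(1 / 2) * Real.pi⁻¹ * (y ^ 2 + 1)⁻¹)
      (y ^ (2 - 1) • (Real.pi⁻¹ * (1 / (y ^ 2 + 1) ^ 2))) y := by
    intro y _
    have h2 : y ^ 2 + 1 ≠ 0 := by positivity
    have := (((hasDerivAt_pow 2 y).add_const 1).fun_inv h2).const_mul (-(1 / 2) * Real.pi⁻¹)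
    refine this.congr_deriv ?_
    simp only [smul_eq_mul]
    push_cast
    field_simp
  have ht : Tendsto (fun y : ℝ => -(1 / 2) * Real.pi⁻¹ * (y ^ 2 + 1)⁻¹) atTop
      (𝓝 (-(1 / 2) * Real.pi⁻¹ * 0)) :=
    (tendsto_inv_atTop_zero.comp (tendsto_atTop_add_const_right _ 1
      (tendsto_pow_atTop two_ne_zero))).const_mul _
  have h3 := integral_Ioi_of_hasDerivAt_of_nonneg' hd
    (fun y hy => by have : (0 : ℝ) < y := hy; rw [smul_eq_mul]; positivity) ht
  rw [finrank_euclideanSpace, Fintype.card_fin, h3, h1]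
  have := Real.pi_ne_zero
  simp
  field_simp

/-- The Laplacians of the regularized logarithms approach the Dirac mass. -/
lemma tendsto_integral_lap_regLog {h : Plane → ℝ} (hc : Continuous h) (hs : HasCompactSupport h) :
    Tendsto (fun c => ∫ x, lap (regLog c) x * h x) atTop (𝓝 (-(2 * Real.pi) * h 0)) := by
  -- The rescaled kernels c² φ(cx) form an approximate identity; the side condition |x|² φ(x) → 0 is
  -- checked at the end.
  have key := tendsto_integral_comp_smul_smul_of_integrable (μ := (volume : Measure Plane))
    (φ := fun x => Real.pi⁻¹ * (1 / (‖x‖ ^ 2 + 1) ^ 2))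
    (fun x => by positivity) integral_bubble ?_ (hc.integrable_of_hasCompactSupport hs)
    hc.continuousAt
  · refine (key.const_mul (-(2 * Real.pi))).congr' ?_
    filter_upwards [eventually_gt_atTop 0] with c hc0
    rw [← integral_const_mul]
    refine integral_congr_ae (Eventually.of_forall fun x => ?_)
    have hz := regLog_pos hc0 _ (sq_nonneg ‖x‖)
    simp only [finrank_euclideanSpace, Fintype.card_fin, smul_eq_mul]
    rw [lap_regLog hc0, norm_smul, Real.norm_of_nonneg hc0.le]
    have := Real.pi_ne_zero
    have h1 : (c * ‖x‖) ^ 2 + 1 = c ^ 2 * (‖x‖ ^ 2 + c⁻¹ ^ 2) := by field_simp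
    rw [h1]
    field_simp
  · simp only [finrank_euclideanSpace, Fintype.card_fin]
    have h1 : Tendsto (fun x : Plane => Real.pi⁻¹ * (‖x‖ ^ 2 + 1)⁻¹) (Bornology.cobounded Plane)
        (𝓝 (Real.pi⁻¹ * 0)) :=
      (tendsto_inv_atTop_zero.comp (tendsto_atTop_add_const_right _ 1
        ((tendsto_pow_atTop two_ne_zero).comp tendsto_norm_cobounded_atTop))).const_mul _
    rw [mul_zero] at h1
    refine squeeze_zero (fun x => by positivity) (fun x => ?_) h1
    rw [mul_left_comm]
    refine mul_le_mul_of_nonneg_left ?_ (by positivity)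
    rw [mul_one_div, div_le_iff₀ (by positivity)]
    have : 0 < ‖x‖ ^ 2 + 1 := by positivity
    field_simp
    linarith

/-! ### Construction of the Green function -/

lemma pd_comp_sub {φ : Plane → ℝ} (j : Fin 2) (v x : Plane) :
    pd j (fun y => φ (y - v)) x = pd j φ (x - v) := by
  unfold pd; rw [fderiv_comp_sub]

lemma lap_comp_sub (φ : Plane → ℝ) (v x : Plane) : lap (fun y => φ (y - v)) x = lap φ (x - v) := by
  simp only [lap, show ∀ j, pd j (fun y => φ (y - v)) = fun y => pd j φ (y - v) from
    fun j => funext (pd_comp_sub j v), pd_comp_sub]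

lemma pd_comp_neg (φ : Plane → ℝ) (j : Fin 2) (x : Plane) :
    pd j (fun y => φ (-y)) x = -pd j φ (-x) := by
  have h := fderiv_comp_smul (-1 : ℝ) (f := φ) (x := x)
  simp only [neg_smul, one_smul] at h
  unfold pd; rw [h]; rfl

lemma lap_comp_neg (φ : Plane → ℝ) (x : Plane) : lap (fun y => φ (-y)) x = lap φ (-x) := by
  simp only [lap, show ∀ j, pd j (fun y => φ (-y)) = fun y => -pd j φ (-y) from
    fun j => funext (pd_comp_neg φ j), pd_neg, pd_comp_neg, neg_neg]

lemma lap_add {φ ψ : Plane → ℝ} {x : Plane} (hφ : ContDiffAt ℝ 2 φ x) (hψ : ContDiffAt ℝ 2 ψ x) :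
    lap (fun y => φ y + ψ y) x = lap φ x + lap ψ x := by
  have dp : ∀ {f : Plane → ℝ} (j : Fin 2), ContDiffAt ℝ 2 f x → DifferentiableAt ℝ (pd j f) x :=
    fun j h => (h.pd_of_two j).differentiableAt (by norm_num)
  have ev : ∀ᶠ y in 𝓝 x, DifferentiableAt ℝ φ y ∧ DifferentiableAt ℝ ψ y :=
    ((hφ.eventually (by norm_num)).and (hψ.eventually (by norm_num))).mono fun y hy =>
      ⟨hy.1.differentiableAt (by norm_num), hy.2.differentiableAt (by norm_num)⟩
  have key : ∀ j, pd j (pd j fun y => φ y + ψ y) x = pd j (pd j φ) x + pd j (pd j ψ) x := by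
    intro j
    rw [((show pd j (fun y => φ y + ψ y) =ᶠ[𝓝 x] _ from
      ev.mono fun y hy => pd_add j hy.1 hy.2).pd j).eq_of_nhds, pd_add j (dp j hφ) (dp j hψ)]
  simp only [lap, key]; ring

lemma lap_sum {ι : Type*} (A : Finset ι) {φ : ι → Plane → ℝ} {x : Plane}
    (h : ∀ i ∈ A, ContDiffAt ℝ 2 (φ i) x) :
    lap (fun y => ∑ i ∈ A, φ i y) x = ∑ i ∈ A, lap (φ i) x := by
  classical
  induction A using Finset.induction_on with
  | empty =>
    have h0 : ∀ j : Fin 2, pd j (fun _ : Plane => (0 : ℝ)) = fun _ => 0 := fun j =>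
      funext fun _ => pd_const j 0
    simp [lap, h0]
  | insert i A hi ih =>
    simp only [Finset.sum_insert hi]
    rw [lap_add (h i (Finset.mem_insert_self _ _))
      (ContDiffAt.sum fun k hk => h k (Finset.mem_insert_of_mem hk)),
      ih fun k hk => h k (Finset.mem_insert_of_mem hk)]

/-- `(A z - 1) / z` for the entire function `A`. -/
def besselTail : ℝ → ℝ := powSum fun j => besselCoeff (j + 1)

lemma abs_besselCoeff_succ_le (j : ℕ) : |besselCoeff (j + 1)| ≤ 1 / j.factorial :=
  (abs_besselCoeff_le (j + 1)).trans (one_div_le_one_div_of_le (by positivity)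
    (by exact_mod_cast Nat.factorial_le (Nat.le_succ j)))

lemma contDiff_besselTail : ContDiff ℝ ∞ besselTail := contDiff_powSum abs_besselCoeff_succ_le

lemma bessel_eq (z : ℝ) : bessel z = 1 + z * besselTail z := by
  rw [bessel, powSum, (summable_powSum abs_besselCoeff_le z).tsum_eq_zero_add, besselTail, powSum,
    ← tsum_mul_left]
  congr 1
  · simp [besselCoeff]
  · exact tsum_congr fun j => by ring

section singular
variable (χ : ContDiffBump (0 : Plane))

/-- The cut off entire factor of the singular part of the Green function. -/
def cutBessel (x : Plane) : ℝ := χ x * bessel (‖x‖ ^ 2)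

/-- The singular part of the Green function. -/
def singularPart (x : Plane) : ℝ := -Real.log ‖x‖ * cutBessel χ x

/-- The smooth function `-2 ⟨x, ∇a⟩ / |x|²`, where `a` is the cut off entire factor. -/
def crossTerm (x : Plane) : ℝ := if x = 0 then -4 * deriv bessel 0 else
  -2 * (x 0 * pd 0 (cutBessel χ) x + x 1 * pd 1 (cutBessel χ) x) / ‖x‖ ^ 2

/-- `(Δ + 2)` of the cut off entire factor. -/
def cutDefect (x : Plane) : ℝ := lap (cutBessel χ) x + 2 * cutBessel χ x

/-- `(Δ + 2)` of the singular part, off the origin. -/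
def smoothSource (x : Plane) : ℝ := -Real.log ‖x‖ * cutDefect χ x + crossTerm χ x

lemma contDiff_cutBessel : ContDiff ℝ ∞ (cutBessel χ) :=
  χ.contDiff.mul (contDiff_iff_contDiffAt.2 fun _ => contDiffAt_radial contDiff_bessel.contDiffAt)

lemma hasCompactSupport_cutBessel : HasCompactSupport (cutBessel χ) :=
  χ.hasCompactSupport.mul_right

lemma cutBessel_eventuallyEq {x : Plane} (hx : ‖x‖ < χ.rIn) :
    cutBessel χ =ᶠ[𝓝 x] fun y => bessel (‖y‖ ^ 2) := by
  filter_upwards [Metric.isOpen_ball.mem_nhds (mem_ball_zero_iff.2 hx)] with y hy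
  rw [cutBessel, χ.one_of_mem_closedBall (Metric.ball_subset_closedBall hy), one_mul]

lemma cutBessel_eventuallyEq_zero {x : Plane} (hx : χ.rOut < ‖x‖) : cutBessel χ =ᶠ[𝓝 x] 0 := by
  filter_upwards [(isOpen_lt continuous_const continuous_norm).mem_nhds hx] with y hy
  rw [cutBessel, χ.zero_of_le_dist (by rw [dist_zero_right]; exact le_of_lt hy), zero_mul,
    Pi.zero_apply]

/-- Near 0 the cut-off is 1 and the entire factor solves (Δ + 2)A = 0. -/
lemma cutDefect_eq_zero {x : Plane} (hx : ‖x‖ < χ.rIn) : cutDefect χ x = 0 := by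
  have h := cutBessel_eventuallyEq χ hx
  rw [cutDefect, lap_congr h, h.eq_of_nhds,
    lap_radial (contDiff_bessel.contDiffAt.of_le two_le_infty), bessel_ode]

/-- For a radial factor, ⟨x, ∇a⟩ is 2|x|² A', so the division by |x|² leaves a smooth function; this
dictates the value assigned at 0. -/
lemma crossTerm_eq {x : Plane} (hx : ‖x‖ < χ.rIn) :
    crossTerm χ x = -4 * deriv bessel (‖x‖ ^ 2) := by
  rw [crossTerm]
  split_ifs with h
  · simp [h]
  · have e := cutBessel_eventuallyEq χ hx
    have d := contDiff_bessel.differentiable (by norm_num) (‖x‖ ^ 2)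
    rw [(e.pd 0).eq_of_nhds, (e.pd 1).eq_of_nhds, pd_radial 0 d, pd_radial 1 d]
    have h2 : ‖x‖ ≠ 0 := norm_ne_zero_iff.2 h
    rw [div_eq_iff (by positivity)]
    rw [norm_sq_plane]; ring

lemma contDiff_cutDefect : ContDiff ℝ ∞ (cutDefect χ) :=
  (contDiff_cutBessel χ).lap.add (contDiff_const.mul (contDiff_cutBessel χ))

lemma ball_mem_nhds_zero : ∀ᶠ x in 𝓝 (0 : Plane), ‖x‖ < χ.rIn :=
  (continuous_norm.tendsto' (0 : Plane) 0 norm_zero).eventually (gt_mem_nhds χ.rIn_pos)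

lemma contDiff_crossTerm : ContDiff ℝ ∞ (crossTerm χ) := by
  refine contDiff_iff_contDiffAt.2 fun x => ?_
  by_cases hx : x = 0
  · rw [hx]
    have h1 : ContDiff ℝ ∞ (deriv bessel) := by
      have := contDiff_bessel.iterate_deriv 1
      simpa using this
    refine (contDiffAt_const.mul (contDiffAt_radial h1.contDiffAt)).congr_of_eventuallyEq
      ((ball_mem_nhds_zero χ).mono fun y hy => crossTerm_eq χ hy)
  · have h1 : ∀ i : Fin 2, ContDiff ℝ ∞ fun y : Plane => y i * pd i (cutBessel χ) y := fun i =>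
      (contDiff_coord i).mul ((contDiff_cutBessel χ).pd i)
    refine (((contDiff_const (c := (-2 : ℝ))).mul ((h1 0).add (h1 1))).contDiffAt.fun_div
      contDiff_norm_sq_plane.contDiffAt
      (by have := norm_pos_iff.2 hx; positivity)).congr_of_eventuallyEq ?_
    filter_upwards [isOpen_ne.mem_nhds hx] with y hy
    rw [crossTerm, if_neg hy]

/-- The reason for the factor A: the coefficient of log|x| vanishes identically near 0. A bare
logarithm would leave the non-smooth source -2 log|x|. -/
lemma contDiff_smoothSource : ContDiff ℝ ∞ (smoothSource χ) := by
  refine ContDiff.add (contDiff_iff_contDiffAt.2 fun x => ?_) (contDiff_crossTerm χ)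
  by_cases hx : x = 0
  · rw [hx]
    refine (contDiffAt_const (c := (0 : ℝ))).congr_of_eventuallyEq
      ((ball_mem_nhds_zero χ).mono fun y hy => ?_)
    simp only [cutDefect_eq_zero χ hy, mul_zero]
  · exact (contDiffAt_log_norm hx).mul (contDiff_cutDefect χ).contDiffAt

lemma contDiffAt_singularPart {x : Plane} (hx : x ≠ 0) : ContDiffAt ℝ ∞ (singularPart χ) x :=
  (contDiffAt_log_norm hx).mul (contDiff_cutBessel χ).contDiffAt

lemma lap_singularPart {x : Plane} (hx : x ≠ 0) :
    lap (singularPart χ) x + 2 * singularPart χ x = smoothSource χ x := by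
  unfold singularPart
  rw [lap_mul ((contDiffAt_log_norm hx).of_le two_le_infty)
    ((contDiff_cutBessel χ).contDiffAt.of_le two_le_infty), lap_log_norm hx, pd_log_norm hx,
    pd_log_norm hx, smoothSource, cutDefect, crossTerm, if_neg hx]
  ring

lemma singularPart_eq_zero {x : Plane} (hx : χ.rOut < ‖x‖) : singularPart χ x = 0 := by
  rw [singularPart, (cutBessel_eventuallyEq_zero χ hx).eq_of_nhds, Pi.zero_apply, mul_zero]

lemma crossTerm_eq_zero {x : Plane} (hx : χ.rOut < ‖x‖) : crossTerm χ x = 0 := by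
  have h := cutBessel_eventuallyEq_zero χ hx
  have h0 : ∀ j, pd j (0 : Plane → ℝ) x = 0 := fun j => pd_const j 0
  rw [crossTerm, if_neg (norm_pos_iff.1 (χ.rOut_pos.trans hx)), (h.pd 0).eq_of_nhds,
    (h.pd 1).eq_of_nhds, h0, h0]
  simp

lemma smoothSource_eq_zero {x : Plane} (hx : χ.rOut < ‖x‖) : smoothSource χ x = 0 := by
  have h := cutBessel_eventuallyEq_zero χ hx
  have h0 : lap (0 : Plane → ℝ) x = 0 := by
    have : ∀ j : Fin 2, pd j (0 : Plane → ℝ) = 0 := fun j => funext fun y => pd_const j 0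
    simp [lap, this]
  rw [smoothSource, crossTerm_eq_zero χ hx, cutDefect, lap_congr h, h.eq_of_nhds, h0]
  simp

lemma cutBessel_neg (x : Plane) : cutBessel χ (-x) = cutBessel χ x := by
  rw [cutBessel, χ.neg, norm_neg, cutBessel]

lemma smoothSource_neg (x : Plane) : smoothSource χ (-x) = smoothSource χ x := by
  have e : (fun y => cutBessel χ (-y)) = cutBessel χ := funext (cutBessel_neg χ)
  have h1 := lap_comp_neg (cutBessel χ) x
  have h2 := fun j => pd_comp_neg (cutBessel χ) j x
  rw [e] at h1 h2
  simp only [smoothSource, crossTerm, cutDefect, ← h1, cutBessel_neg, norm_neg, neg_eq_zero, h2,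
    PiLp.neg_apply, neg_mul, mul_neg]

/-- The equation of the singular part in the sense of distributions. -/
lemma integral_singularPart {φ : Plane → ℝ} (sφ : ContDiff ℝ ∞ φ) :
    ∫ x, singularPart χ x * (lap φ x + 2 * φ x)
      = -(2 * Real.pi) * φ 0 + ∫ x, smoothSource χ x * φ x := by
  have sa := contDiff_cutBessel χ
  have ca := hasCompactSupport_cutBessel χ
  have cD : HasCompactSupport (cutDefect χ) :=
    (hasCompactSupport_lap ca).add (ca.mul_left (f := fun _ => (2 : ℝ)))
  have cq : HasCompactSupport (crossTerm χ) :=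
    HasCompactSupport.intro (isCompact_closedBall 0 χ.rOut) fun x hx => crossTerm_eq_zero χ (by
      simpa using hx)
  have cψ : Continuous fun x => lap φ x + 2 * φ x :=
    sφ.lap.continuous.add (continuous_const.mul sφ.continuous)
  have t0 := tendsto_integral_regLog (h := fun x => cutBessel χ x * (lap φ x + 2 * φ x))
    (sa.continuous.mul cψ) ca.mul_right
  have t1 := tendsto_integral_lap_regLog (h := fun x => cutBessel χ x * φ x)
    (sa.continuous.mul sφ.continuous) ca.mul_right
  have t2 := tendsto_integral_regLog (h := fun x => cutDefect χ x * φ x)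
    ((contDiff_cutDefect χ).continuous.mul sφ.continuous) cD.mul_right
  set X : ℝ → Plane → ℝ := fun c x => 2 * (pd 0 (regLog c) x * pd 0 (cutBessel χ) x
    + pd 1 (regLog c) x * pd 1 (cutBessel χ) x) * φ x with hX
  have sX : ∀ c, 0 < c → Continuous (X c) := fun c hc => (continuous_const.mul
    ((((contDiff_regLog hc).pd 0).continuous.mul (sa.pd 0).continuous).add
    (((contDiff_regLog hc).pd 1).continuous.mul (sa.pd 1).continuous))).mul sφ.continuous
  have Xeq : ∀ c, 0 < c → ∀ x, X c x = -2 * (x 0 * pd 0 (cutBessel χ) x + x 1 * pd 1 (cutBessel χ) x)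
      / (‖x‖ ^ 2 + c⁻¹ ^ 2) * φ x := by
    intro c hc x
    rw [hX]; simp only
    rw [pd_regLog hc, pd_regLog hc]; ring
  have ae : ∀ᵐ x : Plane, x ≠ 0 := by simp [ae_iff]
  have iq : Integrable fun x => crossTerm χ x * φ x :=
    ((contDiff_crossTerm χ).continuous.mul sφ.continuous).integrable_of_hasCompactSupport cq.mul_right
  -- Regularization only enlarges the denominator |x|², so the limit itself dominates.
  have t3 : Tendsto (fun c => ∫ x, X c x) atTop (𝓝 (∫ x, crossTerm χ x * φ x)) := by
    refine tendsto_integral_filter_of_dominated_convergence (fun x => |crossTerm χ x * φ x|) ?_ ?_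
      iq.abs ?_
    · filter_upwards [eventually_gt_atTop 0] with c hc using (sX c hc).aestronglyMeasurable
    · filter_upwards [eventually_gt_atTop 0] with c hc
      filter_upwards [ae] with x hx
      have h0 := norm_pos_iff.2 hx
      rw [Xeq c hc, Real.norm_eq_abs, abs_mul, abs_mul, crossTerm, if_neg hx, abs_div, abs_div,
        abs_of_pos (by positivity : 0 < ‖x‖ ^ 2), abs_of_pos (by positivity : 0 < ‖x‖ ^ 2 + c⁻¹ ^ 2)]
      gcongr
      exact le_add_of_nonneg_right (sq_nonneg _)
    · filter_upwards [ae] with x hx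
      have h0 := norm_pos_iff.2 hx
      have h1 : Tendsto (fun c : ℝ => ‖x‖ ^ 2 + c⁻¹ ^ 2) atTop (𝓝 (‖x‖ ^ 2)) := by
        have := (tendsto_inv_atTop_zero (𝕜 := ℝ)).pow 2
        simpa using this.const_add (‖x‖ ^ 2)
      have h2 : crossTerm χ x * φ x = -2 * (x 0 * pd 0 (cutBessel χ) x + x 1 * pd 1 (cutBessel χ) x)
          / ‖x‖ ^ 2 * φ x := by rw [crossTerm, if_neg hx]
      rw [h2]
      refine Tendsto.congr' ?_ ((tendsto_const_nhds.div h1 (by positivity)).mul_const _)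
      filter_upwards [eventually_gt_atTop 0] with c hc using (Xeq c hc x).symm
  -- Integration by parts for the smooth product regLog · a, expanded by Leibniz: a Dirac term, a
  -- logarithmic term with the cut-off defect, and the cross term.
  have e : ∀ᶠ c in atTop, ∫ x, regLog c x * (cutBessel χ x * (lap φ x + 2 * φ x))
      = (∫ x, lap (regLog c) x * (cutBessel χ x * φ x)) + (∫ x, regLog c x * (cutDefect χ x * φ x))
        + ∫ x, X c x := by
    filter_upwards [eventually_gt_atTop 0] with c hc
    have sL := contDiff_regLog hc
    have cu : HasCompactSupport fun x => regLog c x * cutBessel χ x := ca.mul_left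
    have h1 := integral_mul_lap cu (sL.mul sa) sφ
    have I : ∀ {f g : Plane → ℝ}, HasCompactSupport g → Continuous f → Continuous g →
      Integrable fun x => f x * g x := fun h c c' =>
      (c.mul c').integrable_of_hasCompactSupport h.mul_left
    have i1 := I (g := fun x => cutBessel χ x * φ x) ca.mul_right sL.lap.continuous (sa.continuous.mul sφ.continuous)
    have i2 := I (g := fun x => cutDefect χ x * φ x) cD.mul_right sL.continuous
      ((contDiff_cutDefect χ).continuous.mul sφ.continuous)
    have i3 : Integrable (X c) := (sX c hc).integrable_of_hasCompactSupport (HasCompactSupport.intro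
      (isCompact_closedBall 0 χ.rOut) fun x hx => by
        have h := cutBessel_eventuallyEq_zero χ (x := x) (by simpa using hx)
        have h0 : ∀ j, pd j (0 : Plane → ℝ) x = 0 := fun j => pd_const j 0
        rw [hX]; simp only
        rw [(h.pd 0).eq_of_nhds, (h.pd 1).eq_of_nhds, h0, h0]
        ring)
    have i4 := I (g := fun x => cutBessel χ x * lap φ x) ca.mul_right sL.continuous (sa.continuous.mul sφ.lap.continuous)
    have i5 := I (f := fun x => 2 * regLog c x) (g := fun x => cutBessel χ x * φ x) ca.mul_right
      (continuous_const.mul sL.continuous) (sa.continuous.mul sφ.continuous)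
    have i6 : Integrable fun x => lap (fun y => regLog c y * cutBessel χ y) x * φ x :=
      ((sL.mul sa).lap.continuous.mul sφ.continuous).integrable_of_hasCompactSupport
        (hasCompactSupport_lap cu).mul_right
    have i12 : Integrable fun x => lap (regLog c) x * (cutBessel χ x * φ x)
        + regLog c x * (cutDefect χ x * φ x) := i1.add i2
    simp only [mul_assoc] at h1
    rw [← integral_add i1 i2, ← integral_add i12 i3]
    calc ∫ x, regLog c x * (cutBessel χ x * (lap φ x + 2 * φ x))
        = ∫ x, (regLog c x * (cutBessel χ x * lap φ x) + 2 * regLog c x * (cutBessel χ x * φ x)) :=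
          integral_congr_ae (Eventually.of_forall fun x => by simp only; ring)
      _ = (∫ x, lap (fun y => regLog c y * cutBessel χ y) x * φ x)
          + ∫ x, 2 * regLog c x * (cutBessel χ x * φ x) := by rw [integral_add i4 i5, h1]
      _ = _ := by
          rw [← integral_add i6 i5]
          refine integral_congr_ae (Eventually.of_forall fun x => ?_)
          simp only [hX]
          rw [lap_mul (sL.contDiffAt.of_le two_le_infty) (sa.contDiffAt.of_le two_le_infty), cutDefect]
          ring
  have lim := tendsto_nhds_unique (t0.2.congr' e) ((t1.add t2.2).add t3)
  have h0 : cutBessel χ 0 = 1 := by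
    rw [(cutBessel_eventuallyEq χ (x := 0) (by simpa using χ.rIn_pos)).eq_of_nhds]
    simp [bessel_zero]
  calc ∫ x, singularPart χ x * (lap φ x + 2 * φ x)
      = ∫ x, -Real.log ‖x‖ * (cutBessel χ x * (lap φ x + 2 * φ x)) :=
        integral_congr_ae (Eventually.of_forall fun x => by simp only [singularPart]; ring)
    _ = _ := lim
    _ = _ := by
        rw [h0, one_mul, add_assoc, ← integral_add t2.1 iq]
        congr 1
        exact integral_congr_ae (Eventually.of_forall fun x => by simp only [smoothSource]; ring)

end singular

/-! ### Assembling the Green function by periodization. -/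

section green
variable {Λ : Set Plane} {r : ℝ} (χ : ContDiffBump (0 : Plane))

lemma integrable_mul_singularPart {φ : Plane → ℝ} (hφ : Continuous φ) :
    Integrable fun x => φ x * singularPart χ x := by
  have h := (tendsto_integral_regLog (h := fun x => cutBessel χ x * φ x)
    ((contDiff_cutBessel χ).continuous.mul hφ) (hasCompactSupport_cutBessel χ).mul_right).1
  refine h.congr (Eventually.of_forall fun x => ?_)
  simp only [singularPart]; ring

lemma integrable_mul_smoothSource {φ : Plane → ℝ} (hφ : Continuous φ) :
    Integrable fun x => φ x * smoothSource χ x :=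
  (hφ.mul (contDiff_smoothSource χ).continuous).integrable_of_hasCompactSupport
    (HasCompactSupport.intro (isCompact_closedBall 0 χ.rOut) fun x hx => by
      rw [Pi.mul_apply, smoothSource_eq_zero χ (by simpa using hx), mul_zero])

lemma IsPeriodLattice.contDiff_periodization_smoothSource (hΛ : IsPeriodLattice Λ r) :
    ContDiff ℝ ∞ (periodization Λ (smoothSource χ)) :=
  contDiff_iff_contDiffAt.2 fun _ => hΛ.contDiffAt_periodization
    (fun _ => smoothSource_eq_zero χ) fun _ _ => (contDiff_smoothSource χ).contDiffAt

lemma IsPeriodLattice.contDiffAt_periodization_singularPart (hΛ : IsPeriodLattice Λ r) {x : Plane}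
    (hx : x ∉ Λ) : ContDiffAt ℝ ∞ (periodization Λ (singularPart χ)) x :=
  hΛ.contDiffAt_periodization (fun _ => singularPart_eq_zero χ) fun _ hν =>
    contDiffAt_singularPart χ (sub_ne_zero.2 fun h => hx (h ▸ hν))

lemma IsPeriodLattice.lap_periodization_singularPart (hΛ : IsPeriodLattice Λ r) {x : Plane}
    (hx : x ∉ Λ) : lap (periodization Λ (singularPart χ)) x
      + 2 * periodization Λ (singularPart χ) x = periodization Λ (smoothSource χ) x := by
  obtain ⟨A, hA, h1⟩ := hΛ.exists_finset x (χ.rOut + 1)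
  have h2 : ∀ y ∈ Metric.ball x 1, ∀ ν ∈ Λ, ‖y - ν‖ ≤ χ.rOut → ν ∈ A := fun y hy ν hν h =>
    h1 ν hν (by
      have e : ν - x = -(y - ν) + (y - x) := by abel
      rw [e]
      refine (norm_add_le _ _).trans (add_le_add (by rwa [norm_neg]) ?_)
      rw [← dist_eq_norm]; exact (Metric.mem_ball.1 hy).le)
  have h3 : ∀ {f : Plane → ℝ}, (∀ z, χ.rOut < ‖z‖ → f z = 0) →
      periodization Λ f =ᶠ[𝓝 x] fun y => ∑ ν ∈ A, f (y - ν) := fun hf =>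
    (Filter.eventually_of_mem (Metric.ball_mem_nhds x one_pos)) fun y hy => periodization_eq_sum hf hA (h2 y hy)
  have hg := h3 (f := singularPart χ) fun _ => singularPart_eq_zero χ
  have hs := h3 (f := smoothSource χ) fun _ => smoothSource_eq_zero χ
  have hne : ∀ ν ∈ A, x - ν ≠ 0 := fun ν hν => sub_ne_zero.2 fun h => hx (h ▸ hA hν)
  rw [lap_congr hg, hg.eq_of_nhds, hs.eq_of_nhds, lap_sum A (φ := fun ν y => singularPart χ (y - ν)) fun ν hν =>
    ((contDiffAt_singularPart χ (hne ν hν)).of_le two_le_infty).comp (g := singularPart χ) x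
      (contDiffAt_id.sub contDiffAt_const), Finset.mul_sum, ← Finset.sum_add_distrib]
  refine Finset.sum_congr rfl fun ν hν => ?_
  rw [lap_comp_sub, lap_singularPart χ (hne ν hν)]

/-- The periodized singular part has the right Dirac masses but also a smooth source; u is the
correction that cancels it. -/
theorem IsPeriodLattice.isGreenFunction (hΛ : IsPeriodLattice Λ r) {u : Plane → ℝ}
    (hu : ContDiff ℝ ∞ u) (pu : ∀ ν ∈ Λ, ∀ x, u (x + ν) = u x) (eu : ∀ x, u (-x) = u x)
    (lu : ∀ x, lap u x + 2 * u x = -periodization Λ (smoothSource χ) x) :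
    IsGreenFunction Λ fun x => periodization Λ (singularPart χ) x + u x where
  periodic ν hν μ := by simp only [hΛ.periodization_add _ hν, pu ν hν]
  even μ := by
    simp only [hΛ.periodization_neg (h := singularPart χ) fun x => by
      rw [singularPart, cutBessel_neg, norm_neg, singularPart], eu]
  continuousOn := fun x hx => ((hΛ.contDiffAt_periodization_singularPart χ hx).continuousAt.add
    hu.continuous.continuousAt).continuousWithinAt
  integrableOn := by
    refine IntegrableOn.add ?_ (integrableOn_torusCell hu.continuous)
    obtain ⟨A, -, h1⟩ := hΛ.periodization_eventuallyEq (fun _ => singularPart_eq_zero χ) 0 10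
    refine IntegrableOn.congr_fun (f := fun x => ∑ ν ∈ A, singularPart χ (x - ν)) ?_
      (fun x hx => (h1 x (torusCell_subset hx)).symm) measurableSet_torusCell
    refine (integrable_finsetSum A fun ν _ => ?_).integrableOn
    have := integrable_mul_singularPart χ (φ := fun _ => 1) continuous_const
    simp only [one_mul] at this
    exact this.comp_sub_right ν
  weak_equation φ sφ hφ := by
    have pφ : IsPeriodic φ := isPeriodic_of_single hφ
    have pu' : IsPeriodic u := fun ν hν => pu ν (hΛ.periods_subset hν)
    have sψ : ContDiff ℝ ∞ fun x => lap φ x + 2 * φ x := sφ.lap.add (contDiff_const.mul sφ)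
    have pψ : IsPeriodic fun x => lap φ x + 2 * φ x :=
      pφ.lap.add (IsPeriodic.mul (φ := fun _ => (2 : ℝ)) (fun _ _ _ => rfl) pφ)
    have i1 : ∀ ν ∈ Λ, Integrable fun x => (lap φ x + 2 * φ x) * singularPart χ (x - ν) :=
      fun ν _ => by
        have := (integrable_mul_singularPart χ (φ := fun x => lap φ (x + ν) + 2 * φ (x + ν))
          (sψ.continuous.comp (continuous_id.add continuous_const))).comp_sub_right ν
        simpa using this
    have i2 : ∀ ν ∈ Λ, Integrable fun x => φ x * smoothSource χ (x - ν) :=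
      fun ν _ => by
        have := (integrable_mul_smoothSource χ (φ := fun x => φ (x + ν))
          (sφ.continuous.comp (continuous_id.add continuous_const))).comp_sub_right ν
        simpa using this
    have t : ∀ ν, ∫ x, (lap φ x + 2 * φ x) * singularPart χ (x - ν)
        = -(2 * Real.pi) * φ ν + ∫ x, φ x * smoothSource χ (x - ν) := by
      intro ν
      have h := integral_singularPart χ (φ := fun x => φ (x + ν))
        (sφ.comp (contDiff_id.add contDiff_const))
      have e : ∀ x, lap (fun y => φ (y + ν)) x = lap φ (x + ν) := fun x => by
        simpa using lap_comp_sub φ (-ν) x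
      simp only [e, zero_add] at h
      rw [← integral_add_right_eq_self _ ν,
        ← integral_add_right_eq_self (fun x => φ x * smoothSource χ (x - ν)) ν]
      simp only [add_sub_cancel_right]
      simpa only [mul_comm] using h
    have fin : (Λ ∩ torusCell).Finite := (hΛ.finite_inter_closedBall 0 10).subset
      (inter_subset_inter_right _ torusCell_subset)
    have p1 := hΛ.setIntegral_mul_periodization pψ (fun _ => singularPart_eq_zero χ) i1
    have p2 := hΛ.setIntegral_mul_periodization pφ (fun _ => smoothSource_eq_zero χ) i2
    have ic : ∀ {f g : Plane → ℝ}, Continuous f → Continuous g →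
        IntegrableOn (fun x => f x * g x) torusCell := fun hf hg =>
      integrableOn_torusCell (hf.mul hg)
    -- Paired with the test function, u contributes minus the smooth source, which cancels against
    -- the unfolded integrals `p2`.
    have p3 : ∫ x in torusCell, u x * (lap φ x + 2 * φ x)
        = -∫ x in torusCell, φ x * periodization Λ (smoothSource χ) x := by
      have h := setIntegral_mul_lap pu' pφ hu sφ
      have j1 := ic hu.continuous sφ.lap.continuous
      have j2 := ic (f := fun x => 2 * u x) (continuous_const.mul hu.continuous) sφ.continuous
      have j3 := ic hu.lap.continuous sφ.continuous
      calc ∫ x in torusCell, u x * (lap φ x + 2 * φ x)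
          = ∫ x in torusCell, (u x * lap φ x + 2 * u x * φ x) := by congr 1; ext x; ring
        _ = ∫ x in torusCell, (lap u x * φ x + 2 * u x * φ x) := by
            rw [integral_add j1 j2, h, ← integral_add j3 j2]
        _ = _ := by
            rw [← integral_neg]; congr 1; ext x
            linear_combination φ x * lu x
    have j4 : IntegrableOn (fun x => (lap φ x + 2 * φ x) * periodization Λ (singularPart χ) x)
        torusCell := by
      obtain ⟨A, hA, h1⟩ := hΛ.periodization_eventuallyEq (fun _ => singularPart_eq_zero χ) 0 10
      refine IntegrableOn.congr_fun
        (f := fun x => ∑ ν ∈ A, (lap φ x + 2 * φ x) * singularPart χ (x - ν)) ?_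
        (fun x hx => by simp only [h1 x (torusCell_subset hx), Finset.mul_sum])
        measurableSet_torusCell
      exact (integrable_finsetSum A fun ν hν => i1 ν (hA hν)).integrableOn
    have j5 := ic hu.continuous sψ.continuous
    calc ∫ x in torusCell, (periodization Λ (singularPart χ) x + u x) * cliffordJacobi φ x * (1 / 2)
        = ∫ x in torusCell, ((lap φ x + 2 * φ x) * periodization Λ (singularPart χ) x
            + u x * (lap φ x + 2 * φ x)) := by
          congr 1; ext x; rw [mul_assoc, cliffordJacobi_eq]; ring
      _ = _ := by
          rw [integral_add j4 j5, p1, p3, p2]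
          simp only [t]
          rw [finsum_mem_add_distrib fin, mul_finsum_mem]
          ring

/-- The Green function: existence, regularity, and its expansion at the lattice points. -/
theorem greenFunction_spec (hΛ : IsPeriodLattice Λ r) (hn : NonResonant Λ) :
    ∃ W : Plane → ℝ, ContDiff ℝ ∞ W ∧ (∀ x, W (-x) = W x) ∧
      (∀ ν ∈ Λ, ∀ x, greenFunction Λ (x + ν) = greenFunction Λ x) ∧
      (∀ x ∉ Λ, ContDiffAt ℝ ∞ (greenFunction Λ) x ∧
        lap (greenFunction Λ) x + 2 * greenFunction Λ x = 0) ∧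
      (∀ x, 0 < ‖x‖ → ‖x‖ < r / 8 →
        greenFunction Λ x = -Real.log ‖x‖ * bessel (‖x‖ ^ 2) + W x) ∧
      greenConstant Λ = W 0 := by
  have hr := hΛ.pos
  -- With outer radius r/4 only the lattice point 0 contributes on the ball of radius r/8, where
  -- moreover χ = 1. There the expansion is exact.
  let χ : ContDiffBump (0 : Plane) := ⟨r / 8, r / 4, by positivity, by linarith⟩
  have pneg := hΛ.periodization_neg (smoothSource_neg χ)
  obtain ⟨u, hu, pu, eu, lu⟩ := exists_lap_add_eq hΛ hn
    (F := fun x => -periodization Λ (smoothSource χ) x)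
    (fun ν hν x => by simp only [hΛ.periodization_add _ hν])
    (hΛ.contDiff_periodization_smoothSource χ).neg (fun x => by simp only [pneg])
  have hΓ := hΛ.isGreenFunction χ hu pu eu lu
  -- The chosen Green function is a genuine one since one exists. Uniqueness then transfers the
  -- explicit formula to it.
  have hG : IsGreenFunction Λ (greenFunction Λ) := Classical.epsilon_spec ⟨_, hΓ⟩
  have hEq : ∀ x ∉ Λ, greenFunction Λ x = periodization Λ (singularPart χ) x + u x :=
    fun x hx => hG.eq_of_notMem hΛ hn hΓ hx
  have hEq' : ∀ x ∉ Λ, greenFunction Λ =ᶠ[𝓝 x] fun y => periodization Λ (singularPart χ) y + u y :=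
    fun x hx => Filter.eventually_of_mem (hΛ.isClosed.isOpen_compl.mem_nhds hx) fun y hy => hEq y hy
  have hloc : ∀ x, 0 < ‖x‖ → ‖x‖ < r / 8 →
      greenFunction Λ x = -Real.log ‖x‖ * bessel (‖x‖ ^ 2) + u x := by
    intro x h0 h1
    have hmem : ∀ ν ∈ Λ, ‖x - ν‖ ≤ r / 4 → ν = 0 := fun ν hν h =>
      (hΛ.eq_of_norm_sub_lt (μ := x) hΛ.zero_mem hν (by rw [sub_zero]; linarith)
        (by linarith)).symm
    have hx : x ∉ Λ := fun h => by
      have := hmem x h (by simp; positivity)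
      simp [this] at h0
    rw [hEq x hx, periodization_eq_sum (A := {0}) (R := r / 4)
      (fun _ => singularPart_eq_zero χ) (by simpa using hΛ.zero_mem)
      (fun ν hν h => by simpa using hmem ν hν h), Finset.sum_singleton, sub_zero, singularPart,
      (cutBessel_eventuallyEq χ (x := x) h1).eq_of_nhds]
  refine ⟨u, hu, eu, hG.periodic, fun x hx => ⟨?_, ?_⟩, hloc, ?_⟩
  · exact ((hΛ.contDiffAt_periodization_singularPart χ hx).add hu.contDiffAt).congr_of_eventuallyEq
      (hEq' x hx)
  · rw [lap_congr (hEq' x hx), hEq x hx, lap_add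
      ((hΛ.contDiffAt_periodization_singularPart χ hx).of_le two_le_infty)
      (hu.contDiffAt.of_le two_le_infty)]
    linear_combination hΛ.lap_periodization_singularPart χ hx + lu x
  -- The remainder log|x| (A(|x|²) - 1) is |x| · (|x| log|x|) times a continuous function, hence
  -- tends to 0, so the constant is W(0).
  · have h1 : Tendsto (fun x : Plane => ‖x‖ * (Real.log ‖x‖ * ‖x‖) * -besselTail (‖x‖ ^ 2) + u x)
        (𝓝[≠] 0) (𝓝 (u 0)) := by
      have c1 : Continuous fun x : Plane => Real.log ‖x‖ * ‖x‖ := by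
        have := Real.continuous_mul_log.comp (continuous_norm (E := Plane))
        simpa [Function.comp_def, mul_comm] using this
      have c2 : Continuous fun x : Plane => -besselTail (‖x‖ ^ 2) :=
        (contDiff_besselTail.continuous.comp (continuous_norm.pow 2)).neg
      have := (((continuous_norm.mul c1).mul c2).add hu.continuous).tendsto (0 : Plane)
      simp only [Pi.add_apply, Pi.mul_apply, norm_zero, zero_mul, zero_add] at this
      exact this.mono_left nhdsWithin_le_nhds
    refine Tendsto.limUnder_eq (h1.congr' ?_)
    have h2 : ∀ᶠ x in 𝓝[≠] (0 : Plane), ‖x‖ < r / 8 := nhdsWithin_le_nhds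
      ((continuous_norm.tendsto' (0 : Plane) 0 norm_zero).eventually (gt_mem_nhds (by positivity)))
    filter_upwards [h2, self_mem_nhdsWithin] with x hx h0
    rw [hloc x (norm_pos_iff.2 h0) hx, bessel_eq]
    ring

end green

/-! ### Weighted bounds for the building blocks of the approximate solution -/

/-- Separates the logarithmic asymptote from a function of v⁻² that is smooth near 0 and vanishes
there. -/
lemma Real.arcosh_eq_log_add {v : ℝ} (hv : 1 ≤ v) :
    Real.arcosh v = Real.log (2 * v) + Real.log ((1 + Real.sqrt (1 - (v ^ 2)⁻¹)) / 2) := by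
  have h0 : 0 < v := by linarith
  have h1 : Real.sqrt (v ^ 2 - 1) = v * Real.sqrt (1 - (v ^ 2)⁻¹) := by
    rw [← Real.sqrt_sq h0.le, ← Real.sqrt_mul (sq_nonneg _), Real.sqrt_sq h0.le]
    congr 1; field_simp
  have h2 := Real.sqrt_nonneg (1 - (v ^ 2)⁻¹)
  rw [Real.arcosh, h1, ← Real.log_mul (by positivity) (by positivity)]
  congr 1; ring

namespace UB
variable {ι : Type*} {s : Set ι} {x : ι → Plane} {ρ : ι → ℝ} {n : ℕ}

lemma norm_sq (hρ : ∀ i ∈ s, 0 < ρ i) (hx : ∀ i ∈ s, ‖x i‖ = ρ i) :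
    UB s x ρ n (fun i => ρ i ^ 2) fun _ y => ‖y‖ ^ 2 := by
  have hc : ∀ k, UB s x ρ n ρ fun _ y => y k := fun k => by
    have := coord (n := n) hρ (fun _ => (0 : Plane)) k ⟨1, fun i hi => by
      simpa [← hx i hi] using abs_coord_le (x i) k⟩
    simpa using this
  have h0 : ∀ i ∈ s, 0 ≤ ρ i := fun i hi => (hρ i hi).le
  have hm : ∀ k, UB s x ρ n (fun i => ρ i ^ 2) fun _ y => y k * y k := fun k =>
    mul_to hρ h0 h0 (hc k) (hc k) ⟨1, fun i _ => le_of_eq (by ring)⟩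
  refine (add_same (fun i hi => sq_nonneg (ρ i)) hρ (hm 0) (hm 1)).congr fun i _ =>
    Eventually.of_forall fun y => ?_
  simp only [norm_sq_plane]; ring

/-- Dividing by the value at the base point gives a function equal to 1 there. Logarithms and
inverses then need only the compact set {1}, uniformly over all scales ρ. -/
lemma norm_sq_div (hρ : ∀ i ∈ s, 0 < ρ i) (hx : ∀ i ∈ s, ‖x i‖ = ρ i) :
    UB s x ρ n (fun _ => 1) fun i y => (ρ i ^ 2)⁻¹ * ‖y‖ ^ 2 :=
  mul_to hρ (fun i hi => by have := hρ i hi; positivity) (fun i _ => sq_nonneg (ρ i))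
    (const_self fun i hi => by have := hρ i hi; positivity) (norm_sq hρ hx)
    ⟨1, fun i hi => by have := hρ i hi; field_simp; exact le_refl _⟩

lemma norm_sq_div_self (hρ : ∀ i ∈ s, 0 < ρ i) (hx : ∀ i ∈ s, ‖x i‖ = ρ i) :
    ∀ i ∈ s, (ρ i ^ 2)⁻¹ * ‖x i‖ ^ 2 ∈ ({1} : Set ℝ) := fun i hi => by
  have := hρ i hi
  rw [hx i hi, mem_singleton_iff]; field_simp

lemma log_norm (hρ : ∀ i ∈ s, 0 < ρ i) (hx : ∀ i ∈ s, ‖x i‖ = ρ i) :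
    UB s x ρ n (fun _ => 1) fun i y => Real.log ‖y‖ - Real.log (ρ i) := by
  refine ((comp_one hρ (fun _ _ => zero_le_one) isCompact_singleton (h := Real.log)
    (fun z hz => by rw [mem_singleton_iff.1 hz]; exact Real.contDiffAt_log.2 one_ne_zero)
    (norm_sq_div_self hρ hx) (norm_sq_div hρ hx) ⟨1, fun _ _ => le_refl _⟩).const_mul
    (1 / 2)).congr fun i hi => ?_
  have h0 : x i ≠ 0 := norm_pos_iff.1 (hx i hi ▸ hρ i hi)
  filter_upwards [isOpen_ne.mem_nhds h0] with y hy
  have := norm_pos_iff.2 hy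
  have := hρ i hi
  rw [Real.log_mul (by positivity) (by positivity), Real.log_inv, Real.log_pow, Real.log_pow]
  push_cast; ring

lemma inv_norm_sq (hρ : ∀ i ∈ s, 0 < ρ i) (hx : ∀ i ∈ s, ‖x i‖ = ρ i) :
    UB s x ρ n (fun i => (ρ i ^ 2)⁻¹) fun _ y => (‖y‖ ^ 2)⁻¹ := by
  have h0 : ∀ i ∈ s, 0 ≤ (ρ i ^ 2)⁻¹ := fun i hi => by have := hρ i hi; positivity
  have h1 := comp_one (n := n) hρ (fun _ _ => zero_le_one) isCompact_singleton (h := fun z => z⁻¹)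
    (fun z hz => by rw [mem_singleton_iff.1 hz]; exact contDiffAt_inv ℝ one_ne_zero)
    (norm_sq_div_self hρ hx) (norm_sq_div hρ hx) ⟨1, fun _ _ => le_refl _⟩
  refine (mul_one_left hρ h0 h1 (const_self h0)).congr fun i hi => Eventually.of_forall fun y => ?_
  have := hρ i hi
  simp only [mul_inv, inv_inv]; field_simp

/-- The second term in the expansion of the Green function. -/
lemma log_mul_tail (hρ : ∀ i ∈ s, 0 < ρ i) (hρ1 : ∀ i ∈ s, ρ i ≤ 1) (hx : ∀ i ∈ s, ‖x i‖ = ρ i) :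
    UB s x ρ n (fun i => ρ i ^ 2 * (1 + |Real.log (ρ i)|))
      fun _ y => Real.log ‖y‖ * (‖y‖ ^ 2 * besselTail (‖y‖ ^ 2)) := by
  have w0 : ∀ i ∈ s, 0 ≤ ρ i ^ 2 := fun i _ => sq_nonneg _
  have h1 : UB s x ρ n (fun _ => 1) fun _ y => besselTail (‖y‖ ^ 2) :=
    comp_one hρ w0 (isCompact_Icc (a := (0 : ℝ)) (b := 1))
      (fun z _ => contDiff_besselTail.contDiffAt)
      (fun i hi => ⟨by positivity, by rw [hx i hi]; exact pow_le_one₀ (hρ i hi).le (hρ1 i hi)⟩)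
      (norm_sq hρ hx) ⟨1, fun i hi => pow_le_one₀ (hρ i hi).le (hρ1 i hi)⟩
  have h2 : UB s x ρ n (fun i => 1 + |Real.log (ρ i)|) fun _ y => Real.log ‖y‖ := by
    refine (add (v := fun i => |Real.log (ρ i)|) (g := fun i _ => Real.log (ρ i))
      (fun _ _ => zero_le_one) (fun _ _ => abs_nonneg _) hρ (log_norm hρ hx)
      (of_const ⟨1, fun i _ => by simp⟩)).congr fun i _ => Eventually.of_forall fun y => ?_
    simp
  refine mul_to hρ (fun i _ => by positivity) w0 h2 (mul_to hρ w0 (fun _ _ => zero_le_one)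
    (norm_sq hρ hx) h1 ⟨1, fun i _ => le_of_eq (by ring)⟩) ⟨1, fun i _ => le_of_eq (by ring)⟩

lemma fixed (hρ : ∀ i ∈ s, 0 < ρ i) {R : ℝ} (hρR : ∀ i ∈ s, ρ i ≤ R) {K : Set Plane}
    (hK : IsCompact K) (hx : ∀ i ∈ s, x i ∈ K) {θ : Plane → ℝ} (hθ : ∀ z ∈ K, ContDiffAt ℝ ∞ θ z) :
    UB s x ρ n (fun _ => 1) fun _ => θ := by
  have := scaled (n := n) hρ hK hθ (fun _ => 0) (fun _ => 1) (fun i hi => by simpa using hx i hi)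
    ⟨R, fun i hi => by
      have := hρ i hi
      rw [abs_one, mul_one_div, le_div_iff₀ this, _root_.one_mul]; exact hρR i hi⟩
  simpa using this

/-- An even function agrees with its value at the origin to second order. -/
lemma even_sub (hρ : ∀ i ∈ s, 0 < ρ i) {R : ℝ} (hρR : ∀ i ∈ s, ρ i ≤ R) (hx : ∀ i ∈ s, ‖x i‖ = ρ i)
    {W : Plane → ℝ} (hW : ContDiff ℝ ∞ W) (he : ∀ y, W (-y) = W y) :
    UB s x ρ (n + 2) (fun i => ρ i ^ 2) fun _ y => W y - W 0 := by
  have hK := isCompact_closedBall (0 : Plane) R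
  have hxK : ∀ i ∈ s, x i ∈ Metric.closedBall (0 : Plane) R := fun i hi => by
    simpa [hx i hi] using hρR i hi
  have mv : ∀ {θ : Plane → ℝ} {i : ι} {B : ℝ}, ContDiff ℝ ∞ θ → i ∈ s →
      (∀ y ∈ Metric.closedBall (0 : Plane) (ρ i), ‖fderiv ℝ θ y‖ ≤ B) →
      |θ (x i) - θ 0| ≤ B * ρ i := by
    intro θ i B hθ hi hB
    have := (convex_closedBall (0 : Plane) (ρ i)).norm_image_sub_le_of_norm_fderiv_le (f := θ)
      (fun y _ => hθ.differentiable (by norm_num) y) hB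
      (Metric.mem_closedBall_self (hρ i hi).le) (show x i ∈ _ by simp [hx i hi])
    rwa [sub_zero, hx i hi, Real.norm_eq_abs] at this
  have z1 : ∀ j, pd j W 0 = 0 := fun j => by
    have h := pd_comp_neg W j 0
    rw [show (fun y => W (-y)) = W from funext he, neg_zero] at h
    linarith
  have z2 : fderiv ℝ W 0 = 0 := by
    ext v
    rw [fderiv_eq_pd, z1, z1]; simp
  have c2 : ContDiff ℝ ∞ (fderiv ℝ W) := hW.fderiv_right (m := ∞) (by simp)
  obtain ⟨B, hB⟩ := hK.exists_bound_of_continuousOn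
    (c2.fderiv_right (m := ∞) (by simp)).continuous.continuousOn
  have hB' : ∀ i ∈ s, ∀ y ∈ Metric.closedBall (0 : Plane) (ρ i), ‖fderiv ℝ W y‖ ≤ B * ρ i := by
    intro i hi y hy
    have hsub := Metric.closedBall_subset_closedBall (x := (0 : Plane)) (hρR i hi)
    have := (convex_closedBall (0 : Plane) (ρ i)).norm_image_sub_le_of_norm_fderiv_le
      (f := fderiv ℝ W) (fun y _ => c2.differentiable (by norm_num) y)
      (fun z hz => hB z (hsub hz)) (Metric.mem_closedBall_self (hρ i hi).le) hy
    rw [z2, sub_zero, sub_zero] at this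
    exact this.trans (mul_le_mul_of_nonneg_left (mem_closedBall_zero_iff.1 hy)
      ((norm_nonneg _).trans (hB y (hsub hy))))
  have hpd : ∀ j, (fun _ : ι => pd j fun y => W y - W 0) = fun _ => pd j W := fun j => by
    ext i y
    rw [pd_sub j (hW.differentiable (by norm_num) y) (differentiableAt_const _), pd_const, sub_zero]
  refine succ_iff.2 ⟨⟨fun i _ => (hW.sub contDiff_const).contDiffAt, B, fun i hi => ?_⟩, fun j => ?_⟩
  · calc |W (x i) - W 0| ≤ B * ρ i * ρ i := mv hW hi (hB' i hi)
      _ = B * ρ i ^ 2 := by ring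
  rw [hpd]
  refine succ_iff.2 ⟨⟨fun i _ => (hW.pd j).contDiffAt, ?_⟩, fun k => ?_⟩
  · obtain ⟨D, hD⟩ := hK.exists_bound_of_continuousOn
      ((hW.pd j).fderiv_right (m := ∞) (by simp)).continuous.continuousOn
    refine ⟨D, fun i hi => ?_⟩
    have := mv (hW.pd j) hi fun y hy => hD y (Metric.closedBall_subset_closedBall (hρR i hi) hy)
    rw [z1, sub_zero] at this
    refine this.trans_eq ?_
    have := hρ i hi
    field_simp
  -- From the second derivative on, the weight ρ²/ρ² is 1 and nothing is left to gain.
  · refine (fixed hρ hρR hK hxK (fun z _ => ((hW.pd j).pd k).contDiffAt)).mono hρ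
      (fun _ _ => zero_le_one) ⟨1, fun i hi => le_of_eq ?_⟩
    have := hρ i hi
    field_simp

/-- The deviation of the catenoid from its logarithmic asymptote. -/
lemma arcosh_sub_log {ε : ι → ℝ} (hρ : ∀ i ∈ s, 0 < ρ i) (hx : ∀ i ∈ s, ‖x i‖ = ρ i)
    (hε : ∀ i ∈ s, 0 < ε i) (h2 : ∀ i ∈ s, ε i ^ 2 / ρ i ^ 2 ≤ 1 / 2) :
    UB s x ρ n (fun i => ε i ^ 2 / ρ i ^ 2)
      fun i y => Real.arcosh (‖y‖ / ε i) - Real.log (2 * (‖y‖ / ε i)) := by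
  have w0 : ∀ i ∈ s, 0 ≤ ε i ^ 2 / ρ i ^ 2 := fun i _ => by positivity
  have h1 : UB s x ρ n (fun i => ε i ^ 2 / ρ i ^ 2) fun i y => ε i ^ 2 * (‖y‖ ^ 2)⁻¹ :=
    mul hρ (fun i _ => sq_nonneg (ε i)) (fun i hi => by have := hρ i hi; positivity)
      (const_self fun i _ => sq_nonneg (ε i)) (inv_norm_sq hρ hx)
  refine (comp_zero hρ w0 (le_refl 0) (by norm_num : (0 : ℝ) ≤ 1 / 2)
    (h := fun z => Real.log ((1 + Real.sqrt (1 - z)) / 2)) (fun z hz => ?_) (by simp)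
    (fun i hi => ⟨by positivity, by rw [hx i hi]; exact h2 i hi⟩) h1 ⟨1 / 2, h2⟩).congr
    fun i hi => ?_
  · have h3 : ContDiffAt ℝ ∞ (fun z : ℝ => Real.sqrt (1 - z)) z :=
      (contDiffAt_const.sub contDiffAt_id).sqrt (by simp only [id]; linarith [hz.2])
    exact ((contDiffAt_const.add h3).div_const 2).log (by positivity)
  · have h3 := hε i hi
    have h4 : ε i < ‖x i‖ := by
      rw [hx i hi]
      have h5 := h2 i hi
      rw [div_le_iff₀ (pow_pos (hρ i hi) 2)] at h5
      nlinarith [hρ i hi]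
    filter_upwards [(isOpen_lt continuous_const continuous_norm).mem_nhds h4] with y hy
    rw [Real.arcosh_eq_log_add ((one_le_div h3).2 (le_of_lt hy)), add_sub_cancel_left, div_pow,
      inv_div, div_eq_mul_inv (ε i ^ 2)]

end UB

/-! ### Bounds for the glued graph -/

/-- The properties of the Green function that are used below. -/
structure GreenExpansion (Λ : Set Plane) (r : ℝ) (W : Plane → ℝ) : Prop where
  smooth : ContDiff ℝ ∞ W
  even : ∀ x, W (-x) = W x
  periodic : ∀ ν ∈ Λ, ∀ x, greenFunction Λ (x + ν) = greenFunction Λ x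
  regular : ∀ x ∉ Λ, ContDiffAt ℝ ∞ (greenFunction Λ) x ∧
    lap (greenFunction Λ) x + 2 * greenFunction Λ x = 0
  expansion : ∀ x, 0 < ‖x‖ → ‖x‖ < r / 8 →
    greenFunction Λ x = -Real.log ‖x‖ * bessel (‖x‖ ^ 2) + W x
  const : greenConstant Λ = W 0

/-- The difference of the glued graph and the torus graph near the origin. -/
def gluingTerm (Λ : Set Plane) (η : Plane → ℝ) (a : ℝ) (x : Plane) : ℝ :=
  (1 - η ((Real.sqrt (neckSize Λ a))⁻¹ • x)) * (catenoidGraph Λ a x - torusGraph Λ a x)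

/-- The parameters `a < a₀` together with the points of the punctured plane, at distance at least
`√ε_a / 2` from `Λ`, which have the origin as a nearest point of `Λ`. -/
def gluedIndex (Λ : Set Plane) (a₀ : ℝ) : Set (ℝ × Plane) :=
  {i | 0 < i.1 ∧ i.1 < a₀ ∧ Metric.infDist i.2 Λ = ‖i.2‖ ∧
    Real.sqrt (neckSize Λ i.1) / 2 ≤ ‖i.2‖}

/-- Smallness of the neck size, relative to the separation `r` of the lattice. -/
structure SmallNeck (Λ : Set Plane) (r a : ℝ) : Prop where
  pos : 0 < neckSize Λ a
  lt_one : a < 1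
  small : neckSize Λ a < 1 / 16
  sqrt_lt : 16 * Real.sqrt (neckSize Λ a) < min r 1
  height_eq : cliffordHeight a
    = neckSize Λ a * (Real.log (1 / neckSize Λ a) + (greenConstant Λ + Real.log 2))

namespace IsPeriodLattice
variable {Λ : Set Plane} {r : ℝ} {η : Plane → ℝ} {a : ℝ} {W : Plane → ℝ}

lemma exists_smallNeck (hΛ : IsPeriodLattice Λ r) {δ : ℝ} (hδ : 0 < δ) :
    ∃ a₀ > 0, ∀ a, 0 < a → a < a₀ → SmallNeck Λ r a ∧ neckSize Λ a < δ := by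
  have hm : 0 < min r 1 := lt_min hΛ.pos one_pos
  obtain ⟨a₀, h0, h1⟩ := neckSize_spec Λ
    (lt_min hδ (lt_min (by norm_num : (0 : ℝ) < 1 / 16) (pow_pos (div_pos hm (by norm_num : (0 : ℝ) < 16)) 2)))
  refine ⟨a₀, h0, fun a ha ha' => ?_⟩
  obtain ⟨h2, h3, h4, h5⟩ := h1 a ha ha'
  rw [lt_min_iff, lt_min_iff] at h3
  refine ⟨⟨h2, h5, h3.2.1, ?_, ?_⟩, h3.1⟩
  · have := (Real.sqrt_lt_sqrt h2.le h3.2.2).trans_eq (Real.sqrt_sq (by positivity))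
    linarith
  · rw [h4, neckEq, one_div, Real.log_inv]; ring

lemma infDist_le_ten (hΛ : IsPeriodLattice Λ r) (x : Plane) : Metric.infDist x Λ ≤ 10 := by
  obtain ⟨ν, h1, -⟩ := existsUnique_add_mem_torusCell x
  have h2 := torusCell_subset h1
  rw [AddSubgroup.vadd_def, vadd_eq_add, add_comm, mem_closedBall_zero_iff] at h2
  rw [← hΛ.infDist_add (hΛ.periods_subset ν.2)]
  refine (Metric.infDist_le_dist_of_mem hΛ.zero_mem).trans ?_
  rwa [dist_zero_right]

end IsPeriodLattice

/-! ### Locality of the gluing, and inequalities between ε and log(1/ε). -/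

namespace SmallNeck
variable {Λ : Set Plane} {r : ℝ} {η : Plane → ℝ} {a : ℝ} {W : Plane → ℝ}

lemma sqrt_pos (h : SmallNeck Λ r a) : 0 < Real.sqrt (neckSize Λ a) := Real.sqrt_pos.2 h.pos

lemma gluingTerm_eq_zero (h : SmallNeck Λ r a) (hη : IsCutoff η) {x : Plane}
    (hx : 2 * Real.sqrt (neckSize Λ a) ≤ ‖x‖) : gluingTerm Λ η a x = 0 := by
  have h0 := h.sqrt_pos
  rw [gluingTerm, hη.eq_one _ (by
    rw [norm_smul, norm_inv, Real.norm_of_nonneg h0.le, inv_mul_eq_div, le_div_iff₀ h0]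
    exact hx), sub_self, zero_mul]

/-- The torus graph is Λ-periodic, so the gluing sum is a periodization of a single local term. -/
lemma gluedGraph_eq (hG : GreenExpansion Λ r W) (μ : Plane) :
    gluedGraph Λ η a μ = torusGraph Λ a μ + periodization Λ (gluingTerm Λ η a) μ := by
  unfold gluedGraph periodization gluingTerm
  congr 1
  refine finsum_congr fun ν => finsum_congr fun hν => ?_
  have : torusGraph Λ a (μ - ν) = torusGraph Λ a μ := by
    have := hG.periodic ν hν (μ - ν)
    rw [sub_add_cancel] at this
    rw [torusGraph, torusGraph, this]
  rw [this]

lemma gluedGraph_add (hΛ : IsPeriodLattice Λ r) (hG : GreenExpansion Λ r W) {ν : Plane} (hν : ν ∈ Λ)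
    (μ : Plane) : gluedGraph Λ η a (μ + ν) = gluedGraph Λ η a μ := by
  rw [gluedGraph_eq hG, gluedGraph_eq hG, hΛ.periodization_add _ hν, torusGraph, torusGraph,
    hG.periodic ν hν]

lemma gluedGraph_of_norm_lt (h : SmallNeck Λ r a) (hΛ : IsPeriodLattice Λ r)
    (hG : GreenExpansion Λ r W) (hη : IsCutoff η) {x : Plane} (hx : ‖x‖ < r / 2) :
    gluedGraph Λ η a x = torusGraph Λ a x + gluingTerm Λ η a x := by
  have h1 := h.sqrt_lt.trans_le (min_le_left _ _)
  have h0 := h.sqrt_pos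
  rw [gluedGraph_eq hG, periodization_eq_sum (A := {0}) (R := 2 * Real.sqrt (neckSize Λ a))
    (fun y hy => h.gluingTerm_eq_zero hη hy.le) (by simpa using hΛ.zero_mem) (fun ν hν h2 => ?_),
    Finset.sum_singleton, sub_zero]
  have := hΛ.eq_of_norm_sub_lt (μ := x) hΛ.zero_mem hν (by rwa [sub_zero]) (by linarith)
  simp [← this]

lemma gluedGraph_of_lt_infDist (h : SmallNeck Λ r a)
    (hG : GreenExpansion Λ r W) (hη : IsCutoff η) {x : Plane}
    (hx : 2 * Real.sqrt (neckSize Λ a) ≤ Metric.infDist x Λ) :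
    gluedGraph Λ η a x = torusGraph Λ a x := by
  rw [gluedGraph_eq hG, periodization, finsum_mem_eq_zero_of_forall_eq_zero fun ν hν =>
    h.gluingTerm_eq_zero hη (hx.trans ?_), add_zero]
  rw [← dist_eq_norm]; exact Metric.infDist_le_dist_of_mem hν

lemma one_le_log (h : SmallNeck Λ r a) : 1 ≤ Real.log (1 / neckSize Λ a) := by
  rw [Real.le_log_iff_exp_le (one_div_pos.2 h.pos)]
  have h1 := Real.exp_one_lt_d9
  have h2 : (16 : ℝ) ≤ 1 / neckSize Λ a := by
    rw [le_div_iff₀ h.pos]; have := h.small; linarith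
  linarith

/-- |√ε log √ε| ≤ 1, squared; log √ε is half of log ε, hence the 4. -/
lemma mul_log_sq_le (h : SmallNeck Λ r a) :
    neckSize Λ a * Real.log (1 / neckSize Λ a) ^ 2 ≤ 4 := by
  have h0 := h.pos
  have h1 := (Real.abs_log_mul_self_lt _ h.sqrt_pos (Real.sqrt_le_one.2 (by
    have := h.small; linarith))).le
  rw [Real.log_sqrt h0.le] at h1
  have h2 : (Real.log (neckSize Λ a) / 2 * Real.sqrt (neckSize Λ a)) ^ 2 ≤ 1 := by
    rw [← sq_abs]; exact pow_le_one₀ (abs_nonneg _) h1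
  rw [mul_pow, Real.sq_sqrt h0.le] at h2
  rw [one_div, Real.log_inv]
  nlinarith

lemma mul_log_le (h : SmallNeck Λ r a) :
    neckSize Λ a * Real.log (1 / neckSize Λ a) ≤ 1 := by
  have h0 := h.pos
  have := Real.log_le_sub_one_of_pos (one_div_pos.2 h0)
  have h2 : neckSize Λ a * (1 / neckSize Λ a) = 1 := by field_simp
  nlinarith

end SmallNeck

section bounds
variable {Λ : Set Plane} {r a₀ : ℝ} {η W : Plane → ℝ}

lemma gluedIndex_pos (hs : ∀ a, 0 < a → a < a₀ → SmallNeck Λ r a) :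
    ∀ i ∈ gluedIndex Λ a₀, 0 < ‖i.2‖ := fun i hi =>
  (half_pos (hs i.1 hi.1 hi.2.1).sqrt_pos).trans_le hi.2.2.2

lemma gluedIndex_le (hΛ : IsPeriodLattice Λ r) : ∀ i ∈ gluedIndex Λ a₀, ‖i.2‖ ≤ 10 :=
  fun i hi => hi.2.2.1 ▸ hΛ.infDist_le_ten i.2

lemma notMem_of_infDist_pos {x : Plane} (h : 0 < Metric.infDist x Λ) : x ∉ Λ := fun hx => by
  rw [Metric.infDist_zero_of_mem hx] at h; exact h.false

lemma gluedIndex_notMem (hs : ∀ a, 0 < a → a < a₀ → SmallNeck Λ r a) :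
    ∀ i ∈ gluedIndex Λ a₀, i.2 ∉ Λ := fun i hi =>
  notMem_of_infDist_pos (by rw [hi.2.2.1]; exact gluedIndex_pos hs i hi)

lemma GreenExpansion.eventuallyEq (hG : GreenExpansion Λ r W) {x : Plane} (h0 : 0 < ‖x‖)
    (h1 : ‖x‖ < r / 8) : greenFunction Λ =ᶠ[𝓝 x] fun y =>
      W y - (Real.log ‖y‖ + Real.log ‖y‖ * (‖y‖ ^ 2 * besselTail (‖y‖ ^ 2))) := by
  filter_upwards [(isOpen_lt continuous_const continuous_norm).mem_nhds h0,
    (isOpen_lt continuous_norm continuous_const).mem_nhds h1] with y h2 h3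
  rw [hG.expansion y h2 h3, bessel_eq]; ring

/-- Γ is not bounded near Λ, but becomes so after adding the constant log|x_i| at each base point;
its derivatives have weight ρ⁻ᵏ. Close to 0 the expansion shows this, farther away compactness does.
-/
lemma UB.green (hΛ : IsPeriodLattice Λ r) (hG : GreenExpansion Λ r W)
    (hs : ∀ a, 0 < a → a < a₀ → SmallNeck Λ r a) (n : ℕ) :
    UB (gluedIndex Λ a₀) Prod.snd (fun i => ‖i.2‖) n (fun _ => 1)
      fun i y => greenFunction Λ y + Real.log ‖i.2‖ := by
  have hm : 0 < min r 1 := lt_min hΛ.pos one_pos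
  set r₀ := min r 1 / 16 with hr₀
  have hr : 0 < r₀ := by positivity
  have hρ := gluedIndex_pos hs
  have h1 : UB (gluedIndex Λ a₀ ∩ {i | ‖i.2‖ ≤ r₀}) Prod.snd (fun i => ‖i.2‖) n (fun _ => 1)
      fun i y => greenFunction Λ y + Real.log ‖i.2‖ := by
    have hρ' : ∀ i ∈ gluedIndex Λ a₀ ∩ {i | ‖i.2‖ ≤ r₀}, 0 < ‖i.2‖ := fun i hi => hρ i hi.1
    have hle : ∀ i ∈ gluedIndex Λ a₀ ∩ {i | ‖i.2‖ ≤ r₀}, ‖i.2‖ ≤ 1 := fun i hi =>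
      (show ‖i.2‖ ≤ r₀ from hi.2).trans (by have := min_le_right r 1; rw [hr₀]; linarith)
    have e1 := UB.fixed (n := n) hρ' hle (isCompact_closedBall (0 : Plane) 1)
      (fun i hi => by simpa using hle i hi) (fun z _ => hG.smooth.contDiffAt)
    have e2 := UB.log_norm (n := n) (x := Prod.snd) hρ' fun _ _ => rfl
    have e3 := (UB.log_mul_tail (n := n) (x := Prod.snd) hρ' hle fun _ _ => rfl).mono hρ'
      (fun i hi => by positivity) (v := fun _ => 1) ⟨2, fun i hi => by
        have h0 := hρ' i hi
        have h2 := hle i hi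
        have h3 := (Real.abs_log_mul_self_lt _ h0 h2).le
        rw [abs_mul, abs_of_pos h0] at h3
        nlinarith⟩
    refine (UB.one_sub hρ' e1 (UB.one_add hρ' e2 e3)).congr fun i hi => ?_
    filter_upwards [hG.eventuallyEq (hρ' i hi) ((show ‖i.2‖ ≤ r₀ from hi.2).trans_lt (by
      have := min_le_left r 1; have := hΛ.pos; rw [hr₀]; linarith))] with y hy
    rw [hy]; ring
  have h2 : UB (gluedIndex Λ a₀ ∩ {i | r₀ ≤ ‖i.2‖}) Prod.snd (fun i => ‖i.2‖) n (fun _ => 1)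
      fun i y => greenFunction Λ y + Real.log ‖i.2‖ := by
    have hρ' : ∀ i ∈ gluedIndex Λ a₀ ∩ {i | r₀ ≤ ‖i.2‖}, 0 < ‖i.2‖ := fun i hi => hρ i hi.1
    have hle : ∀ i ∈ gluedIndex Λ a₀ ∩ {i | r₀ ≤ ‖i.2‖}, ‖i.2‖ ≤ 10 := fun i hi =>
      gluedIndex_le hΛ i hi.1
    have hK : IsCompact (Metric.closedBall (0 : Plane) 10 ∩ {z | r₀ ≤ Metric.infDist z Λ}) :=
      (isCompact_closedBall _ _).inter_right
        (isClosed_le continuous_const (Metric.continuous_infDist_pt Λ))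
    obtain ⟨C, hC⟩ := (isCompact_Icc (a := r₀) (b := 10)).exists_bound_of_continuousOn
      (f := Real.log) fun t ht => (Real.continuousAt_log
        (hr.trans_le ht.1).ne').continuousWithinAt
    exact UB.one_add hρ' (UB.fixed hρ' hle hK
      (fun i hi => ⟨by simpa using hle i hi, by
        rw [mem_ofPred_eq, hi.1.2.2.1]; exact hi.2⟩)
      (fun z hz => (hG.regular z (notMem_of_infDist_pos (hr.trans_le hz.2))).1))
      (UB.of_const ⟨C, fun i hi => by simpa using hC ‖i.2‖ ⟨hi.2, hle i hi⟩⟩)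
  refine (UB.union (fun _ _ => zero_le_one) ?_ h1 h2).subset fun i hi => ?_
  · rintro i (hi | hi) <;> exact hρ i hi.1
  · exact (le_total ‖i.2‖ r₀).imp (fun h => ⟨hi, h⟩) fun h => ⟨hi, h⟩

/-- By the equation for ε, the terms log|y| and all constants cancel between the catenoid and the
torus graph. There remain the deviation of arcosh from its asymptote, O(ε²/ρ²), the next term ρ² log
ρ of Γ, and W - W(0) = O(ρ²). On the annulus ρ² is comparable to ε, so all are O(ε log(1/ε)). The
cut-off has weight 1 because it lives at scale √ε. -/
lemma UB.gluing (hG : GreenExpansion Λ r W) (hη : IsCutoff η)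
    (hs : ∀ a, 0 < a → a < a₀ → SmallNeck Λ r a) (n : ℕ) :
    UB (gluedIndex Λ a₀ ∩ {i | ‖i.2‖ ≤ 2 * Real.sqrt (neckSize Λ i.1)}) Prod.snd (fun i => ‖i.2‖)
      (n + 2) (fun i => neckSize Λ i.1 * Real.log (1 / neckSize Λ i.1))
      fun i y => (neckSize Λ i.1)⁻¹ * gluingTerm Λ η i.1 y := by
  set s := gluedIndex Λ a₀ ∩ {i | ‖i.2‖ ≤ 2 * Real.sqrt (neckSize Λ i.1)} with hsdef
  have hn : ∀ i ∈ s, SmallNeck Λ r i.1 := fun i hi => hs i.1 hi.1.1 hi.1.2.1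
  have hρ : ∀ i ∈ s, 0 < ‖i.2‖ := fun i hi => gluedIndex_pos hs i hi.1
  have hle : ∀ i ∈ s, ‖i.2‖ ≤ 2 * Real.sqrt (neckSize Λ i.1) := fun i hi => hi.2
  have hge : ∀ i ∈ s, Real.sqrt (neckSize Λ i.1) / 2 ≤ ‖i.2‖ := fun i hi => hi.1.2.2.2
  have hsq : ∀ i ∈ s, ‖i.2‖ ^ 2 ≤ 4 * neckSize Λ i.1 ∧ neckSize Λ i.1 ≤ 4 * ‖i.2‖ ^ 2 := by
    intro i hi
    have h0 := Real.sq_sqrt (hn i hi).pos.le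
    have h1 := (hn i hi).sqrt_pos
    have h2 := hle i hi
    have h3 := hge i hi
    have h4 := hρ i hi
    constructor <;> nlinarith
  have hle1 : ∀ i ∈ s, ‖i.2‖ ≤ 1 := fun i hi => by
    have h1 := (hn i hi).sqrt_lt.trans_le (min_le_right _ _)
    have := hle i hi
    linarith
  have wL : ∀ i ∈ s, 0 ≤ neckSize Λ i.1 * Real.log (1 / neckSize Λ i.1) := fun i hi => by
    have := (hn i hi).pos; have := (hn i hi).one_le_log; positivity
  have hεL : ∀ i ∈ s, neckSize Λ i.1 ≤ neckSize Λ i.1 * Real.log (1 / neckSize Λ i.1) :=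
    fun i hi => le_mul_of_one_le_right (hn i hi).pos.le (hn i hi).one_le_log
  have hdiv : ∀ i ∈ s, neckSize Λ i.1 ^ 2 / ‖i.2‖ ^ 2 ≤ 4 * neckSize Λ i.1 := fun i hi => by
    rw [div_le_iff₀ (pow_pos (hρ i hi) 2)]
    have := (hsq i hi).2; have := (hn i hi).pos
    nlinarith
  have e1 := (UB.arcosh_sub_log (n := n + 2) (x := Prod.snd) (ε := fun i => neckSize Λ i.1) hρ
    (fun _ _ => rfl) (fun i hi => (hn i hi).pos) fun i hi => (hdiv i hi).trans (by
      have := (hn i hi).small; linarith)).mono hρ (fun i hi => by positivity)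
      (v := fun i => neckSize Λ i.1 * Real.log (1 / neckSize Λ i.1)) ⟨4, fun i hi => (hdiv i hi).trans (by have := hεL i hi; linarith)⟩
  have e2 := (UB.log_mul_tail (n := n + 2) (x := Prod.snd) hρ hle1 fun _ _ => rfl).mono hρ
    (fun i hi => by positivity)
    (v := fun i => neckSize Λ i.1 * Real.log (1 / neckSize Λ i.1)) ⟨12, fun i hi => by
      have h0 := (hn i hi).pos
      have h1 := (hn i hi).one_le_log
      have h2 : |Real.log ‖i.2‖| ≤ 2 * Real.log (1 / neckSize Λ i.1) := by
        have h3 : Real.log (neckSize Λ i.1) ≤ Real.log ‖i.2‖ := by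
          refine Real.log_le_log h0 ((?_ : _ ≤ _).trans (hge i hi))
          have h4 := Real.sq_sqrt h0.le
          have h5 := (hn i hi).sqrt_lt.trans_le (min_le_right _ _)
          nlinarith [(hn i hi).sqrt_pos]
        rw [abs_of_nonpos (Real.log_nonpos (norm_nonneg _) (hle1 i hi))]
        rw [one_div, Real.log_inv] at h1 ⊢
        linarith
      calc ‖i.2‖ ^ 2 * (1 + |Real.log ‖i.2‖|)
          ≤ 4 * neckSize Λ i.1 * (3 * Real.log (1 / neckSize Λ i.1)) :=
            mul_le_mul (hsq i hi).1 (by linarith) (by positivity) (by positivity)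
        _ = _ := by ring⟩
  have e3 := (UB.even_sub (n := n) (x := Prod.snd) hρ hle1 (fun _ _ => rfl) hG.smooth hG.even).mono
    hρ (fun i _ => sq_nonneg _)
    (v := fun i => neckSize Λ i.1 * Real.log (1 / neckSize Λ i.1)) ⟨4, fun i hi =>
      ((hsq i hi).1).trans (by have := hεL i hi; linarith)⟩
  have e4 : UB s Prod.snd (fun i => ‖i.2‖) (n + 2) (fun _ => 1)
      fun i y => η ((Real.sqrt (neckSize Λ i.1))⁻¹ • (y - 0)) :=
    UB.scaled hρ (isCompact_closedBall (0 : Plane) 2) (fun z _ => hη.smooth.contDiffAt)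
      (fun _ => 0) (fun i => (Real.sqrt (neckSize Λ i.1))⁻¹) (fun i hi => by
        have h0 := (hn i hi).sqrt_pos
        rw [sub_zero, mem_closedBall_zero_iff, norm_smul, norm_inv, Real.norm_of_nonneg h0.le,
          inv_mul_eq_div, div_le_iff₀ h0]
        exact hle i hi) ⟨2, fun i hi => by
        have h0 := (hn i hi).sqrt_pos
        rw [abs_of_pos (inv_pos.2 h0), inv_eq_one_div, mul_one_div, div_le_div_iff₀ h0 (hρ i hi)]
        linarith [hle i hi]⟩
  simp only [sub_zero] at e4
  refine (UB.mul_one_left hρ wL (UB.one_sub hρ (UB.const_one 1) e4)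
    (UB.add_same wL hρ (UB.sub_same wL hρ e1 e2) e3)).congr fun i hi => ?_
  have h0 := (hn i hi).pos
  filter_upwards [hG.eventuallyEq (hρ i hi) (by
      have h1 := (hn i hi).sqrt_lt.trans_le (min_le_left _ _)
      have := hle i hi; have := (hn i hi).sqrt_pos; linarith),
    isOpen_ne.mem_nhds (norm_pos_iff.1 (hρ i hi))] with y hy hy0
  have hy1 := norm_pos_iff.2 hy0
  rw [gluingTerm, catenoidGraph, torusGraph, (hn i hi).height_eq, hy, hG.const,
    Real.log_mul two_ne_zero (by positivity), Real.log_div hy1.ne' h0.ne', one_div, Real.log_inv]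
  field_simp
  ring

end bounds

lemma pd_const_add_mul (j : Fin 2) (c k : ℝ) (f : Plane → ℝ) :
    pd j (fun y => c + k * f y) = fun y => k * pd j f y := by
  ext y
  rw [← pd_const_mul, pd, pd, fderiv_const_add]

lemma lap_const_add_mul (c k : ℝ) (f : Plane → ℝ) (y : Plane) :
    lap (fun y => c + k * f y) y = k * lap f y := by
  simp only [lap, pd_const_add_mul, pd_const_mul]; ring

section bounds
variable {Λ : Set Plane} {r a₀ : ℝ} {η W : Plane → ℝ}

/-- Beyond 2√ε the difference vanishes identically, so the annulus bound extends to the whole index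
set. -/
lemma UB.gluing_extend (hΛ : IsPeriodLattice Λ r) (hG : GreenExpansion Λ r W) (hη : IsCutoff η)
    (hs : ∀ a, 0 < a → a < a₀ → SmallNeck Λ r a) :
    UB (gluedIndex Λ a₀) Prod.snd (fun i => ‖i.2‖) 3
      (fun i => neckSize Λ i.1 * Real.log (1 / neckSize Λ i.1))
      fun i y => (neckSize Λ i.1)⁻¹ * (gluedGraph Λ η i.1 y - torusGraph Λ i.1 y) := by
  have hn : ∀ i ∈ gluedIndex Λ a₀, SmallNeck Λ r i.1 := fun i hi => hs i.1 hi.1 hi.2.1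
  have h1 := (UB.gluing hG hη hs 1).congr (g := fun i y =>
      (neckSize Λ i.1)⁻¹ * (gluedGraph Λ η i.1 y - torusGraph Λ i.1 y)) fun i hi => by
    have h2 := (hn i hi.1).sqrt_lt.trans_le (min_le_left _ _)
    have h3 : ‖i.2‖ < r / 2 := by
      have : ‖i.2‖ ≤ 2 * Real.sqrt (neckSize Λ i.1) := hi.2
      have := (hn i hi.1).sqrt_pos
      linarith
    filter_upwards [(isOpen_lt continuous_norm continuous_const).mem_nhds h3] with y hy
    rw [(hn i hi.1).gluedGraph_of_norm_lt hΛ hG hη hy, add_sub_cancel_left]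
  have h2 : UB (gluedIndex Λ a₀ ∩ {i | 2 * Real.sqrt (neckSize Λ i.1) < ‖i.2‖}) Prod.snd
      (fun i => ‖i.2‖) 3 (fun i => neckSize Λ i.1 * Real.log (1 / neckSize Λ i.1))
      fun i y => (neckSize Λ i.1)⁻¹ * (gluedGraph Λ η i.1 y - torusGraph Λ i.1 y) := by
    refine (UB.of_const (c := fun _ => (0 : ℝ)) ⟨0, fun i _ => by simp⟩).congr fun i hi => ?_
    have h3 : 2 * Real.sqrt (neckSize Λ i.1) < Metric.infDist i.2 Λ := by
      rw [hi.1.2.2.1]; exact hi.2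
    filter_upwards [(isOpen_lt continuous_const (Metric.continuous_infDist_pt Λ)).mem_nhds h3]
      with y hy
    rw [(hn i hi.1).gluedGraph_of_lt_infDist hG hη (le_of_lt hy), sub_self, mul_zero]
  refine (UB.union ?_ ?_ h1 h2).subset fun i hi => ?_
  · rintro i hi
    have h3 := hn i (hi.elim And.left And.left)
    have := h3.pos; have := h3.one_le_log; positivity
  · rintro i (hi | hi) <;> exact gluedIndex_pos hs i hi.1
  · exact (le_or_gt ‖i.2‖ _).imp (fun h => ⟨hi, h⟩) fun h => ⟨hi, h⟩

/-- The mean curvature of the graph of `u` in toroidal coordinates. -/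
def graphCurvature (u : Plane → ℝ) (y : Plane) : ℝ :=
  Real.sqrt 2 * graphNum u y / Real.sqrt (graphDet u y) ^ 3

/-- From √ε/2 ≤ |x| ≤ 10, using log 10 ≤ 4 log 2 < 3 and log(1/ε) ≥ 1. The sharper lower bound is
what makes the graph positive. -/
lemma abs_log_norm_le (hΛ : IsPeriodLattice Λ r) (hs : ∀ a, 0 < a → a < a₀ → SmallNeck Λ r a) :
    ∀ i ∈ gluedIndex Λ a₀, |Real.log ‖i.2‖| ≤ 3 * Real.log (1 / neckSize Λ i.1) ∧
      -(Real.log (1 / neckSize Λ i.1) / 2 + Real.log 2) ≤ Real.log ‖i.2‖ := by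
  intro i hi
  have hn := hs i.1 hi.1 hi.2.1
  have h0 := hn.pos
  have h1 := hn.one_le_log
  have h2 : -(Real.log (1 / neckSize Λ i.1) / 2 + Real.log 2) ≤ Real.log ‖i.2‖ := by
    refine (le_of_eq ?_).trans (Real.log_le_log (half_pos hn.sqrt_pos) hi.2.2.2)
    rw [Real.log_div hn.sqrt_pos.ne' two_ne_zero, Real.log_sqrt h0.le, one_div, Real.log_inv]; ring
  have h3 : Real.log ‖i.2‖ ≤ 3 := by
    refine (Real.log_le_log (gluedIndex_pos hs i hi) (gluedIndex_le hΛ i hi)).trans ?_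
    have h4 : Real.log 10 ≤ Real.log 16 := Real.log_le_log (by norm_num) (by norm_num)
    have h5 : Real.log 16 = 4 * Real.log 2 := by
      rw [show (16 : ℝ) = 2 ^ 4 by norm_num, Real.log_pow]; norm_num
    have := Real.log_two_lt_d9
    linarith
  have := Real.log_two_lt_d9
  exact ⟨abs_le.2 ⟨by linarith, by linarith⟩, h2⟩

set_option maxHeartbeats 400000 in
/-- Uniform bounds for the glued graph. -/
theorem gluedGraph_bounds (hΛ : IsPeriodLattice Λ r) (hG : GreenExpansion Λ r W) (hη : IsCutoff η) :
    ∃ C > 0, ∃ a₀ > 0, (∀ a, 0 < a → a < a₀ → SmallNeck Λ r a ∧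
      |2 * Real.sqrt 2 * cliffordHeight a - cliffordH a|
        ≤ C * (neckSize Λ a ^ 2 * Real.log (1 / neckSize Λ a)) ∧
      cliffordHeight a ≤ C * (neckSize Λ a * Real.log (1 / neckSize Λ a))) ∧
      ∀ i ∈ gluedIndex Λ a₀, ContDiffAt ℝ ∞ (gluedGraph Λ η i.1) i.2 ∧
        0 < gluedGraph Λ η i.1 i.2 ∧ gluedGraph Λ η i.1 i.2 ≤ 1 / 4 ∧
        ∀ σ : ℝ, σ = 1 ∨ σ = -1 →
        |graphCurvature (fun y => σ * gluedGraph Λ η i.1 y) i.2 - σ * cliffordH i.1|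
          ≤ C * (neckSize Λ i.1 ^ 2 * Real.log (1 / neckSize Λ i.1) / ‖i.2‖ ^ 2) ∧
        DifferentiableAt ℝ (graphCurvature fun y => σ * gluedGraph Λ η i.1 y) i.2 ∧
        ∀ j, |pd j (graphCurvature fun y => σ * gluedGraph Λ η i.1 y) i.2|
          ≤ C * (neckSize Λ i.1 ^ 2 * Real.log (1 / neckSize Λ i.1) / ‖i.2‖ ^ 2 / ‖i.2‖) := by
  obtain ⟨a₁, ha₁, hs₁⟩ := hΛ.exists_smallNeck one_pos
  have hs₁' := fun a h h' => (hs₁ a h h').1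
  set κ := greenConstant Λ + Real.log 2 with hκ
  have P₁ := UB.gluing_extend hΛ hG hη hs₁'
  have g₁ : UB (gluedIndex Λ a₁) Prod.snd (fun i => ‖i.2‖) 3 (fun _ => 1) fun i y =>
      (neckSize Λ i.1)⁻¹ * (gluedGraph Λ η i.1 y - torusGraph Λ i.1 y)
        - (greenFunction Λ y + Real.log ‖i.2‖) :=
    UB.one_sub (gluedIndex_pos hs₁') (P₁.mono (gluedIndex_pos hs₁')
      (fun i hi => by
        have h3 := hs₁' i.1 hi.1 hi.2.1
        have := h3.pos; have := h3.one_le_log; positivity)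
      ⟨1, fun i hi => by simpa using (hs₁' i.1 hi.1 hi.2.1).mul_log_le⟩) (UB.green hΛ hG hs₁' 3)
  obtain ⟨B, hB⟩ := g₁.bound
  -- The height is at most (4 + |κ| + |B|) ε log(1/ε), so M ε log(1/ε) ≤ 1 keeps it below 1/8.
  set M := 8 * (4 + |κ| + |B|) with hM
  have hM0 : 0 < M := by positivity
  -- The first threshold makes log(1/ε)/2 exceed the constants, so the graph is positive. The second
  -- gives M ε log(1/ε) ≤ 1, because (ε log(1/ε))² ≤ 4ε.
  obtain ⟨a₂, ha₂, hs₂⟩ := hΛ.exists_smallNeck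
    (lt_min (Real.exp_pos (-(2 * (|B| - κ + Real.log 2)))) (by positivity : 0 < (1 / M) ^ 2 / 4))
  set a₀ := min a₁ a₂ with ha₀
  have hs : ∀ a, 0 < a → a < a₀ → SmallNeck Λ r a := fun a h h' =>
    hs₁' a h (h'.trans_le (min_le_left _ _))
  have hδ : ∀ a, 0 < a → a < a₀ → 2 * (|B| - κ + Real.log 2) < Real.log (1 / neckSize Λ a) ∧
      M * (neckSize Λ a * Real.log (1 / neckSize Λ a)) ≤ 1 := by
    intro a h h'
    have h2 := lt_min_iff.1 (hs₂ a h (h'.trans_le (min_le_right _ _))).2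
    have hn := hs a h h'
    refine ⟨?_, ?_⟩
    · have := Real.log_lt_log hn.pos h2.1
      rw [Real.log_exp] at this
      rw [one_div, Real.log_inv]; linarith
    · have h3 := hn.mul_log_sq_le
      have h4 : (neckSize Λ a * Real.log (1 / neckSize Λ a)) ^ 2 ≤ (1 / M) ^ 2 := by
        have := hn.pos
        calc _ = neckSize Λ a * (neckSize Λ a * Real.log (1 / neckSize Λ a) ^ 2) := by ring
          _ ≤ neckSize Λ a * 4 := by gcongr
          _ ≤ _ := by linarith [h2.2]
      have h5 := abs_le_of_sq_le_sq' h4 (by positivity)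
      have h6 := mul_le_mul_of_nonneg_left h5.2 hM0.le
      rwa [mul_one_div_cancel hM0.ne'] at h6
  have hsub : gluedIndex Λ a₀ ⊆ gluedIndex Λ a₁ := fun i hi =>
    ⟨hi.1, hi.2.1.trans_le (min_le_left _ _), hi.2.2⟩
  have P := P₁.subset hsub
  have g := g₁.subset hsub
  have hρ := gluedIndex_pos hs
  have hn : ∀ i ∈ gluedIndex Λ a₀, SmallNeck Λ r i.1 := fun i hi => hs i.1 hi.1 hi.2.1
  have hta : ∀ a, 0 < a → a < a₀ → |cliffordHeight a|
      ≤ (1 + |κ|) * (neckSize Λ a * Real.log (1 / neckSize Λ a)) := by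
    intro a h h'
    have hn := hs a h h'
    have := hn.pos
    have h1 := hn.one_le_log
    rw [hn.height_eq, abs_mul, abs_of_pos hn.pos]
    have := (abs_add_le (Real.log (1 / neckSize Λ a)) κ)
    rw [abs_of_nonneg (by linarith : (0 : ℝ) ≤ Real.log (1 / neckSize Λ a))] at this
    calc neckSize Λ a * |Real.log (1 / neckSize Λ a) + κ|
        ≤ neckSize Λ a * (Real.log (1 / neckSize Λ a) + |κ| * Real.log (1 / neckSize Λ a)) := by
          gcongr
          exact this.trans (by gcongr; exact le_mul_of_one_le_right (abs_nonneg _) h1)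
      _ = _ := by ring
  have hHa : ∀ a, 0 < a → a < a₀ → |2 * Real.sqrt 2 * cliffordHeight a - cliffordH a|
      ≤ 32 * (1 + |κ|) ^ 3 * (neckSize Λ a ^ 2 * Real.log (1 / neckSize Λ a)) := by
    intro a h h'
    have hn := hs a h h'
    have h0 := hn.pos
    have h1 := hn.one_le_log
    have h2 := hta a h h'
    have h3 := (hδ a h h').2
    have h4 := cliffordHeight_pos h
    rw [abs_of_pos h4] at h2
    have h5 : 0 ≤ neckSize Λ a * Real.log (1 / neckSize Λ a) := by positivity
    refine (abs_cliffordH_sub_le h hn.lt_one ?_).trans ?_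
    · refine h2.trans ?_
      rw [hM] at h3
      nlinarith [abs_nonneg κ, abs_nonneg B]
    · calc 8 * cliffordHeight a ^ 3
          ≤ 8 * ((1 + |κ|) * (neckSize Λ a * Real.log (1 / neckSize Λ a))) ^ 3 := by gcongr
        _ = 8 * (1 + |κ|) ^ 3 * (neckSize Λ a ^ 2 * Real.log (1 / neckSize Λ a))
            * (neckSize Λ a * Real.log (1 / neckSize Λ a) ^ 2) := by ring
        _ ≤ 8 * (1 + |κ|) ^ 3 * (neckSize Λ a ^ 2 * Real.log (1 / neckSize Λ a)) * 4 := by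
            gcongr; exact hn.mul_log_sq_le
        _ = _ := by ring
  -- A constant plus ε times a function of weight 1. The logarithm sits in the constant, so the
  -- derivatives are O(ε/ρᵏ) without a factor log(1/ε).
  have hform : ∀ i ∈ gluedIndex Λ a₀, gluedGraph Λ η i.1 = fun y =>
      (cliffordHeight i.1 + neckSize Λ i.1 * Real.log ‖i.2‖) + neckSize Λ i.1 *
      ((neckSize Λ i.1)⁻¹ * (gluedGraph Λ η i.1 y - torusGraph Λ i.1 y)
        - (greenFunction Λ y + Real.log ‖i.2‖)) := by
    intro i hi
    ext y
    have := (hn i hi).pos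
    rw [torusGraph]; field_simp; ring
  -- Separates the part killed by Δ + 2, up to the constant 2 t_a, from the gluing correction, which
  -- alone enters the linear error.
  have hform' : ∀ i ∈ gluedIndex Λ a₀, gluedGraph Λ η i.1 = fun y =>
      (cliffordHeight i.1 + -neckSize Λ i.1 * greenFunction Λ y) + (0 + neckSize Λ i.1 *
      ((neckSize Λ i.1)⁻¹ * (gluedGraph Λ η i.1 y - torusGraph Λ i.1 y))) := by
    intro i hi
    ext y
    have := (hn i hi).pos
    rw [torusGraph]; field_simp; ring
  have hval : ∀ i ∈ gluedIndex Λ a₀, 0 < gluedGraph Λ η i.1 i.2 ∧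
      gluedGraph Λ η i.1 i.2 ≤ 1 / 4 := by
    intro i hi
    have h0 := (hn i hi).pos
    have h1 := (hn i hi).one_le_log
    have h2 := hB i (hsub hi)
    rw [mul_one] at h2
    obtain ⟨h3, h4⟩ := abs_log_norm_le hΛ hs i hi
    obtain ⟨h5, h6⟩ := hδ i.1 hi.1 hi.2.1
    rw [congrFun (hform i hi) i.2]
    rw [(hn i hi).height_eq]
    set g₀ := (neckSize Λ i.1)⁻¹ * (gluedGraph Λ η i.1 i.2 - torusGraph Λ i.1 i.2)
        - (greenFunction Λ i.2 + Real.log ‖i.2‖)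
    have h7 := abs_le.1 (h2.trans (le_abs_self B))
    have h8 := abs_le.1 h3
    rw [← hκ, ← mul_add, ← mul_add]
    refine ⟨mul_pos h0 (by linarith), ?_⟩
    calc _ ≤ neckSize Λ i.1 * ((4 + |κ| + |B|) * Real.log (1 / neckSize Λ i.1)) := by
          gcongr
          nlinarith [le_abs_self κ, abs_nonneg κ, abs_nonneg B]
      _ ≤ _ := by rw [hM] at h6; linarith
  have wg : ∀ i ∈ gluedIndex Λ a₀, 0 ≤ neckSize Λ i.1 := fun i hi => (hn i hi).pos.le
  have wL : ∀ i ∈ gluedIndex Λ a₀, 0 ≤ neckSize Λ i.1 * Real.log (1 / neckSize Λ i.1) :=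
    fun i hi => by have := (hn i hi).pos; have := (hn i hi).one_le_log; positivity
  have hq : ∀ i ∈ gluedIndex Λ a₀, neckSize Λ i.1 / ‖i.2‖ ^ 2 ≤ 10 := by
    intro i hi
    rw [div_le_iff₀ (pow_pos (hρ i hi) 2)]
    have h1 := Real.sq_sqrt (wg i hi)
    have h2 := hi.2.2.2
    have := (hn i hi).sqrt_pos
    nlinarith
  have pd1 : ∀ i ∈ gluedIndex Λ a₀, ∀ j, pd j (gluedGraph Λ η i.1) = fun y => neckSize Λ i.1 *
      pd j (fun y => (neckSize Λ i.1)⁻¹ * (gluedGraph Λ η i.1 y - torusGraph Λ i.1 y)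
        - (greenFunction Λ y + Real.log ‖i.2‖)) y := by
    intro i hi j
    conv_lhs => rw [hform i hi]
    exact pd_const_add_mul j _ _ _
  have hw : ∀ i ∈ gluedIndex Λ a₀,
      0 ≤ neckSize Λ i.1 ^ 2 * Real.log (1 / neckSize Λ i.1) / ‖i.2‖ ^ 2 := fun i hi => by
    have := (hn i hi).one_le_log; positivity
  have cε : ∀ n, UB (gluedIndex Λ a₀) Prod.snd (fun i => ‖i.2‖) n (fun i => neckSize Λ i.1)
      fun i _ => neckSize Λ i.1 := fun n => UB.const_self wg
  have hu : UB (gluedIndex Λ a₀) Prod.snd (fun i => ‖i.2‖) 3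
      (fun i => neckSize Λ i.1 * Real.log (1 / neckSize Λ i.1)) fun i => gluedGraph Λ η i.1 := by
    refine (UB.add_same wL hρ (UB.of_const
      (c := fun i => cliffordHeight i.1 + neckSize Λ i.1 * Real.log ‖i.2‖) ⟨4 + |κ|, fun i hi => ?_⟩)
      (UB.mul_to hρ wg (fun _ _ => zero_le_one) (cε 3) g ⟨1, fun i hi => ?_⟩)).congr
      fun i hi => Eventually.of_forall fun y => congrFun (hform i hi) y
    · refine (abs_add_le _ _).trans ?_
      rw [abs_mul, abs_of_pos (hn i hi).pos]
      have h1 := hta i.1 hi.1 hi.2.1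
      have h2 := mul_le_mul_of_nonneg_left (abs_log_norm_le hΛ hs i hi).1 (wg i hi)
      linarith
    · rw [mul_one, one_mul]
      exact le_mul_of_one_le_right (wg i hi) (hn i hi).one_le_log
  have hlap : UB (gluedIndex Λ a₀) Prod.snd (fun i => ‖i.2‖) 1
      (fun i => neckSize Λ i.1 ^ 2 * Real.log (1 / neckSize Λ i.1) / ‖i.2‖ ^ 2)
      fun i y => pd 0 (pd 0 (gluedGraph Λ η i.1)) y + pd 1 (pd 1 (gluedGraph Λ η i.1)) y
        + 2 * gluedGraph Λ η i.1 y - 2 * cliffordHeight i.1 := by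
    have w2 : ∀ i ∈ gluedIndex Λ a₀,
        0 ≤ neckSize Λ i.1 * Real.log (1 / neckSize Λ i.1) / ‖i.2‖ / ‖i.2‖ := fun i hi =>
      div_nonneg (div_nonneg (wL i hi) (norm_nonneg _)) (norm_nonneg _)
    -- Undifferentiated terms also fit the weight with 1/ρ², as ρ ≤ 10.
    have e1 := UB.add_same w2 hρ
      (UB.add_same w2 hρ ((P.2 0).2 0) ((P.2 1).2 1)) (((P.of_le (m := 1) (by norm_num)).mono hρ wL
      ⟨100, fun i hi => by
        rw [div_div, ← mul_div_assoc, le_div_iff₀ (by have := hρ i hi; positivity)]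
        have h3 := gluedIndex_le hΛ i hi
        have h4 := hρ i hi
        have h5 := wL i hi
        have h6 : ‖i.2‖ * ‖i.2‖ ≤ 100 := by nlinarith
        nlinarith⟩).const_mul 2)
    refine (UB.mul_to hρ wg w2 (cε 1) e1 ⟨1, fun i hi => le_of_eq (by ring)⟩).congr fun i hi => ?_
    have s1 := ((P.smooth i hi).of_le two_le_infty).eventually (by norm_num)
    have s2 := (((hG.regular _ (gluedIndex_notMem hs i hi)).1).of_le two_le_infty).eventually
      (by norm_num)
    filter_upwards [s1, s2, hΛ.isClosed.isOpen_compl.mem_nhds (gluedIndex_notMem hs i hi)]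
      with y h1 h2 h3
    have e2 := congrArg (fun u => lap u y) (hform' i hi)
    rw [lap_add (contDiffAt_const.add (contDiffAt_const.mul h2))
      (contDiffAt_const.add (contDiffAt_const.mul h1)), lap_const_add_mul, lap_const_add_mul] at e2
    have e3 := (hG.regular y h3).2
    have e4 := congrFun (hform' i hi) y
    simp only [lap] at e2 e3 ⊢
    linear_combination e2 + 2 * e4 - neckSize Λ i.1 * e3
  have hu1 : ∀ j, UB (gluedIndex Λ a₀) Prod.snd (fun i => ‖i.2‖) 1
      (fun i => neckSize Λ i.1 / ‖i.2‖) fun i => pd j (gluedGraph Λ η i.1) := fun j =>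
    (UB.mul_to hρ wg (fun i _ => by positivity) (cε 1) ((g.2 j).of_le (by norm_num))
      ⟨1, fun i _ => le_of_eq (by ring)⟩).congr fun i hi => by rw [pd1 i hi j]
  have hu2 : ∀ j k, UB (gluedIndex Λ a₀) Prod.snd (fun i => ‖i.2‖) 1
      (fun i => neckSize Λ i.1 / ‖i.2‖ ^ 2) fun i => pd j (pd k (gluedGraph Λ η i.1)) := fun j k =>
    (UB.mul_to hρ wg (fun i _ => by positivity) (cε 1) ((g.2 k).2 j)
      ⟨1, fun i _ => le_of_eq (by ring)⟩).congr fun i hi => by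
        rw [pd1 i hi k]
        exact Eventually.of_forall fun y => pd_const_mul j _ _
  have hHa' : ∃ C, ∀ i ∈ gluedIndex Λ a₀, |2 * Real.sqrt 2 * cliffordHeight i.1 - cliffordH i.1|
      ≤ C * (neckSize Λ i.1 ^ 2 * Real.log (1 / neckSize Λ i.1) / ‖i.2‖ ^ 2) := by
    refine ⟨32 * (1 + |κ|) ^ 3 * 100, fun i hi => (hHa i.1 hi.1 hi.2.1).trans ?_⟩
    rw [mul_assoc _ (100 : ℝ)]
    refine mul_le_mul_of_nonneg_left ?_ (by positivity)
    rw [← mul_div_assoc, le_div_iff₀ (pow_pos (hρ i hi) 2), mul_comm (100 : ℝ)]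
    refine mul_le_mul_of_nonneg_left ?_ (by have := (hn i hi).one_le_log; positivity)
    have h3 := gluedIndex_le hΛ i hi
    nlinarith [hρ i hi]
  -- The lower sheet t = -T_a is treated as another graph, compared with -t_a and -H_a.
  have main : ∀ σ : ℝ, |σ| = 1 → UB (gluedIndex Λ a₀) Prod.snd (fun i => ‖i.2‖) 1
      (fun i => neckSize Λ i.1 ^ 2 * Real.log (1 / neckSize Λ i.1) / ‖i.2‖ ^ 2
        + neckSize Λ i.1 ^ 2 * Real.log (1 / neckSize Λ i.1) / ‖i.2‖ ^ 2)
      fun i y => graphCurvature (fun z => σ * gluedGraph Λ η i.1 z) y - σ * cliffordH i.1 := by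
    intro σ hσ
    have e : ∀ {u : Plane → ℝ} j, (pd j fun z => σ * u z) = fun z => σ * pd j u z := fun j =>
      funext fun z => pd_const_mul j σ _
    refine UB.graph (ta := fun i => σ * cliffordHeight i.1) (R := 10) hρ
      (fun i hi => (hn i hi).pos) (fun i hi => (hn i hi).one_le_log)
      (gluedIndex_le hΛ) hq (fun i hi => (hn i hi).mul_log_sq_le.trans (by norm_num))
      ((hu.of_le (by norm_num)).const_mul σ) (fun j => ?_) (fun j k => ?_) hw ?_
      (fun i hi => ?_) ?_
    · simp only [e]; exact (hu1 j).const_mul σ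
    · simp only [e]; exact (hu2 j k).const_mul σ
    · refine (hlap.const_mul σ).congr fun i _ => Eventually.of_forall fun y => ?_
      simp only [e]; ring
    · rw [abs_mul, hσ, one_mul, abs_of_pos (hval i hi).1]; exact (hval i hi).2
    · obtain ⟨K, hK⟩ := hHa'
      refine ⟨K, fun i hi => ?_⟩
      rw [show 2 * Real.sqrt 2 * (σ * cliffordHeight i.1) - σ * cliffordH i.1
        = σ * (2 * Real.sqrt 2 * cliffordHeight i.1 - cliffordH i.1) by ring, abs_mul, hσ, one_mul]
      exact hK i hi
  have fin : ∀ σ : ℝ, |σ| = 1 → ∃ C > 0, ∀ i ∈ gluedIndex Λ a₀,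
      |graphCurvature (fun y => σ * gluedGraph Λ η i.1 y) i.2 - σ * cliffordH i.1|
        ≤ C * (neckSize Λ i.1 ^ 2 * Real.log (1 / neckSize Λ i.1) / ‖i.2‖ ^ 2) ∧
      DifferentiableAt ℝ (graphCurvature fun y => σ * gluedGraph Λ η i.1 y) i.2 ∧
      ∀ j, |pd j (graphCurvature fun y => σ * gluedGraph Λ η i.1 y) i.2|
        ≤ C * (neckSize Λ i.1 ^ 2 * Real.log (1 / neckSize Λ i.1) / ‖i.2‖ ^ 2 / ‖i.2‖) := by
    intro σ hσ
    obtain ⟨C₁, h₁⟩ := (main σ hσ).bound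
    have h₂ := fun j => ((main σ hσ).2 j).bound
    choose C₂ h₂ using h₂
    have big : ∀ {A B D v : ℝ}, A ≤ B * (v + v) → 2 * |B| ≤ D → 0 ≤ v → A ≤ D * v := by
      intro A B D v h1 h2 h3
      nlinarith [le_abs_self B]
    have := abs_nonneg C₁
    have := abs_nonneg (C₂ 0)
    have := abs_nonneg (C₂ 1)
    refine ⟨2 * |C₁| + 2 * |C₂ 0| + 2 * |C₂ 1| + 1, by positivity, fun i hi => ⟨?_, ?_, fun j => ?_⟩⟩
    · exact big (h₁ i hi) (by linarith) (hw i hi)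
    · have := ((main σ hσ).smooth i hi).differentiableAt (by norm_num)
      simpa using this.add_const (σ * cliffordH i.1)
    · have h3 := h₂ j i hi
      have h4 : pd j (fun y => graphCurvature (fun z => σ * gluedGraph Λ η i.1 z) y
          - σ * cliffordH i.1) i.2
          = pd j (graphCurvature fun z => σ * gluedGraph Λ η i.1 z) i.2 := by
        rw [pd, fderiv_sub_const]; rfl
      rw [h4] at h3
      refine big (h3.trans_eq (congrArg (C₂ j * ·) (add_div _ _ _))) ?_
        (div_nonneg (hw i hi) (norm_nonneg _))
      fin_cases j <;> simp <;> linarith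
  obtain ⟨C₁, hC₁, h₁⟩ := fin 1 abs_one
  obtain ⟨C₂, hC₂, h₂⟩ := fin (-1) (by simp)
  have hκ0 : 1 ≤ 1 + |κ| := le_add_of_nonneg_right (abs_nonneg κ)
  have hκ3 : 1 + |κ| ≤ (1 + |κ|) ^ 3 := le_self_pow₀ hκ0 (by norm_num)
  refine ⟨C₁ + C₂ + 32 * (1 + |κ|) ^ 3, by positivity, a₀, lt_min ha₁ ha₂,
    fun a h h' => ⟨hs a h h', ?_, ?_⟩,
    fun i hi => ⟨hu.smooth i hi, (hval i hi).1, (hval i hi).2, fun σ hσ => ?_⟩⟩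
  · refine (hHa a h h').trans (mul_le_mul_of_nonneg_right (by linarith) ?_)
    have := (hs a h h').one_le_log; positivity
  · refine (le_abs_self _).trans ((hta a h h').trans (mul_le_mul_of_nonneg_right (by linarith) ?_))
    have := (hs a h h').one_le_log; have := (hs a h h').pos; positivity
  · have up : ∀ {K v A : ℝ}, K ≤ C₁ + C₂ + 32 * (1 + |κ|) ^ 3 → 0 ≤ v → A ≤ K * v →
        A ≤ (C₁ + C₂ + 32 * (1 + |κ|) ^ 3) * v := fun h3 h4 h5 =>
      h5.trans (mul_le_mul_of_nonneg_right h3 h4)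
    have hv := div_nonneg (hw i hi) (norm_nonneg i.2)
    rcases hσ with rfl | rfl
    · obtain ⟨h4, h5, h6⟩ := h₁ i hi
      exact ⟨up (by linarith) (hw i hi) h4, h5, fun j => up (by linarith) hv (h6 j)⟩
    · obtain ⟨h4, h5, h6⟩ := h₂ i hi
      exact ⟨up (by linarith) (hw i hi) h4, h5, fun j => up (by linarith) hv (h6 j)⟩

end bounds

/-! ### Summary of the estimates -/

/-- The mean curvature of the neck. -/
def neckCurvature (ε : ℝ) (y : Plane) : ℝ :=
  2 * Real.sqrt 2 * (Real.cosh (y 0) * neckNum ε y) / (ε * Real.sqrt (neckDet ε y) ^ 3)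

/-- What the estimates provide for a given parameter `a`. -/
structure GoodParameter (Λ : Set Plane) (r : ℝ) (W η : Plane → ℝ) (C a : ℝ) : Prop where
  lattice : IsPeriodLattice Λ r
  green : GreenExpansion Λ r W
  cutoff : IsCutoff η
  neck : SmallNeck Λ r a
  smooth : ∀ μ, Real.sqrt (neckSize Λ a) / 2 ≤ Metric.infDist μ Λ →
    ContDiffAt ℝ ∞ (gluedGraph Λ η a) μ
  pos : ∀ μ, Real.sqrt (neckSize Λ a) / 2 ≤ Metric.infDist μ Λ → 0 < gluedGraph Λ η a μ
  le : ∀ μ, Real.sqrt (neckSize Λ a) / 2 ≤ Metric.infDist μ Λ → gluedGraph Λ η a μ ≤ 1 / 4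
  graph_curvature : ∀ μ, Real.sqrt (neckSize Λ a) / 2 ≤ Metric.infDist μ Λ →
    ∀ σ : ℝ, σ = 1 ∨ σ = -1 →
    |graphCurvature (fun y => σ * gluedGraph Λ η a y) μ - σ * cliffordH a|
      ≤ C * (neckSize Λ a ^ 2 * Real.log (1 / neckSize Λ a) / Metric.infDist μ Λ ^ 2) ∧
    DifferentiableAt ℝ (graphCurvature fun y => σ * gluedGraph Λ η a y) μ ∧
    ∀ j, |pd j (graphCurvature fun y => σ * gluedGraph Λ η a y) μ|
      ≤ C * (neckSize Λ a ^ 2 * Real.log (1 / neckSize Λ a) / Metric.infDist μ Λ ^ 2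
        / Metric.infDist μ Λ)
  neck_curvature : ∀ q : Plane, neckSize Λ a * Real.cosh (q 0) ≤ Real.sqrt (neckSize Λ a) →
    |neckCurvature (neckSize Λ a) q - cliffordH a|
      ≤ C * (Real.log (1 / neckSize Λ a) / Real.cosh (q 0) ^ 2) ∧
    DifferentiableAt ℝ (neckCurvature (neckSize Λ a)) q ∧
    ∀ j, |pd j (neckCurvature (neckSize Λ a)) q|
      ≤ C * (Real.log (1 / neckSize Λ a) / Real.cosh (q 0) ^ 2)

lemma pd_add_period {u : Plane → ℝ} {ν : Plane} (h : ∀ y, u (y + ν) = u y) (j : Fin 2) (y : Plane) :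
    pd j u (y + ν) = pd j u y := by
  rw [pd, pd, ← fderiv_comp_add_right, funext h]

lemma graphCurvature_add_period {u : Plane → ℝ} {ν : Plane} (h : ∀ y, u (y + ν) = u y) (y : Plane) :
    graphCurvature u (y + ν) = graphCurvature u y := by
  simp only [graphCurvature, graphNum, graphDet, h, pd_add_period h,
    pd_add_period (pd_add_period h _)]

namespace SmallNeck
variable {Λ : Set Plane} {r a : ℝ}

lemma mul_log_le_quarter (h : SmallNeck Λ r a) :
    neckSize Λ a * Real.log (1 / neckSize Λ a) ≤ 1 / 4 := by
  have h1 := h.mul_log_sq_le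
  have h2 := h.sqrt_lt.trans_le (min_le_right _ _)
  have h3 := Real.sq_sqrt h.pos.le
  have h4 : (neckSize Λ a * Real.log (1 / neckSize Λ a)) ^ 2 ≤ (1 / 4) ^ 2 := by
    have h5 : neckSize Λ a ≤ 1 / 256 := by nlinarith [h.sqrt_pos]
    have h6 := h.pos
    calc _ = neckSize Λ a * (neckSize Λ a * Real.log (1 / neckSize Λ a) ^ 2) := by ring
      _ ≤ 1 / 256 * 4 := by gcongr
      _ ≤ _ := by norm_num
  exact (abs_le_of_sq_le_sq' h4 (by norm_num)).2

lemma abs_le_log (h : SmallNeck Λ r a) {s : ℝ}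
    (hs : neckSize Λ a * Real.cosh s ≤ Real.sqrt (neckSize Λ a)) :
    |s| ≤ Real.log (1 / neckSize Λ a) := by
  have h0 := h.pos
  rw [Real.le_log_iff_exp_le (one_div_pos.2 h0), le_div_iff₀ h0]
  have h1 : Real.exp |s| ≤ 2 * Real.cosh s := by
    rw [← Real.cosh_abs, Real.cosh_eq]; linarith [Real.exp_pos (-|s|)]
  have h2 := h.sqrt_lt.trans_le (min_le_right _ _)
  nlinarith

lemma mul_cosh_sq_le (h : SmallNeck Λ r a) {s : ℝ}
    (hs : neckSize Λ a * Real.cosh s ≤ Real.sqrt (neckSize Λ a)) :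
    neckSize Λ a * Real.cosh s ^ 2 ≤ 1 := by
  have h0 := h.pos
  have h1 := Real.sq_sqrt h0.le
  have h2 : (neckSize Λ a * Real.cosh s) ^ 2 ≤ neckSize Λ a := by
    rw [← h1]; exact pow_le_pow_left₀ (by have := Real.cosh_pos s; positivity) (by rwa [h1]) 2
  nlinarith

end SmallNeck

/-- The graph bounds were proved at points whose nearest lattice point is 0; Λ-periodicity moves
them everywhere. For the necks, |H_a| = O(ε log(1/ε)) follows from H_a ≈ 2√2 t_a and 2√2 ≤ 3. -/
theorem exists_goodParameter {Λ : Set Plane} {r : ℝ} {η W : Plane → ℝ} (hΛ : IsPeriodLattice Λ r)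
    (hG : GreenExpansion Λ r W) (hη : IsCutoff η) :
    ∃ C > 0, ∃ a₀ > 0, ∀ a, 0 < a → a < a₀ → GoodParameter Λ r W η C a := by
  obtain ⟨C, hC, a₀, ha₀, h1, h2⟩ := gluedGraph_bounds hΛ hG hη
  have hn := UB.neck (s := {i : ℝ × Plane | 0 < i.1 ∧ i.1 < a₀ ∧
      neckSize Λ i.1 * Real.cosh (i.2 0) ≤ Real.sqrt (neckSize Λ i.1)}) (x := Prod.snd)
    (ε := fun i => neckSize Λ i.1) (L := fun i => Real.log (1 / neckSize Λ i.1))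
    (Ha := fun i => cliffordH i.1) (R := C + 3 * C) (fun i hi => (h1 i.1 hi.1 hi.2.1).1.pos)
    (fun i hi => (h1 i.1 hi.1 hi.2.1).1.one_le_log)
    (fun i hi => (h1 i.1 hi.1 hi.2.1).1.abs_le_log hi.2.2)
    (fun i hi => (h1 i.1 hi.1 hi.2.1).1.mul_log_le_quarter)
    (fun i hi => (h1 i.1 hi.1 hi.2.1).1.mul_cosh_sq_le hi.2.2) fun i hi => by
      obtain ⟨h3, h4, h5⟩ := h1 i.1 hi.1 hi.2.1
      have h6 := cliffordHeight_pos hi.1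
      have h7 := h3.pos
      have h8 := h3.one_le_log
      have h9 : neckSize Λ i.1 ^ 2 * Real.log (1 / neckSize Λ i.1)
          ≤ neckSize Λ i.1 * Real.log (1 / neckSize Λ i.1) := by
        have := h3.small
        rw [sq, mul_assoc]
        exact mul_le_of_le_one_left (by positivity) (by linarith)
      have h10 : 2 * Real.sqrt 2 * cliffordHeight i.1 ≤ 3 * cliffordHeight i.1 :=
        mul_le_mul_of_nonneg_right (by linarith [sqrt_two_lt]) h6.le
      have h11 := abs_le.1 h4
      have h12 := mul_le_mul_of_nonneg_left h9 hC.le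
      have h13 : 0 ≤ 2 * Real.sqrt 2 * cliffordHeight i.1 := by positivity
      have h14 : 0 ≤ C * (neckSize Λ i.1 * Real.log (1 / neckSize Λ i.1)) := by positivity
      rw [abs_le]
      constructor <;> nlinarith
  obtain ⟨K, hK⟩ := hn.bound
  have h3 := fun j => (hn.2 j).bound
  choose K' hK' using h3
  have a1 := abs_nonneg K
  have a2 := abs_nonneg (K' 0)
  have a3 := abs_nonneg (K' 1)
  refine ⟨C + |K| + |K' 0| + |K' 1|, by positivity, a₀, ha₀, fun a ha ha' => ?_⟩
  have sn := (h1 a ha ha').1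
  have hL := sn.one_le_log
  have tr : ∀ μ, Real.sqrt (neckSize Λ a) / 2 ≤ Metric.infDist μ Λ → ∃ ν ∈ Λ,
      (a, μ - ν) ∈ gluedIndex Λ a₀ ∧ Metric.infDist μ Λ = ‖μ - ν‖ := by
    intro μ hμ
    obtain ⟨ν, hν, h3⟩ := hΛ.exists_dist_eq μ
    have h4 : Metric.infDist (μ - ν) Λ = Metric.infDist μ Λ := by
      rw [sub_eq_add_neg, hΛ.infDist_add (hΛ.neg_mem _ hν)]
    exact ⟨ν, hν, ⟨ha, ha', by rw [h4, h3], by rw [← h3]; exact hμ⟩, h3⟩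
  have per : ∀ ν ∈ Λ, ∀ y, gluedGraph Λ η a (y + ν) = gluedGraph Λ η a y := fun ν hν y =>
    SmallNeck.gluedGraph_add hΛ hG hν y
  refine ⟨hΛ, hG, hη, sn, fun μ hμ => ?_, fun μ hμ => ?_, fun μ hμ => ?_, fun μ hμ σ hσ => ?_,
    fun q hq => ⟨?_, ?_, fun j => ?_⟩⟩
  · obtain ⟨ν, hν, h3, -⟩ := tr μ hμ
    have h4 : gluedGraph Λ η a = gluedGraph Λ η a ∘ fun y => y - ν := by
      ext y; rw [Function.comp, ← per ν hν (y - ν), sub_add_cancel]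
    rw [h4]
    exact (h2 _ h3).1.comp μ (contDiffAt_id.sub contDiffAt_const)
  · obtain ⟨ν, hν, h3, -⟩ := tr μ hμ
    have := (h2 _ h3).2.1
    rwa [← per ν hν (μ - ν), sub_add_cancel] at this
  · obtain ⟨ν, hν, h3, -⟩ := tr μ hμ
    have := (h2 _ h3).2.2.1
    rwa [← per ν hν (μ - ν), sub_add_cancel] at this
  · obtain ⟨ν, hν, h3, h4⟩ := tr μ hμ
    have pσ : ∀ y, σ * gluedGraph Λ η a (y + ν) = σ * gluedGraph Λ η a y := fun y => by
      rw [per ν hν]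
    have pg := graphCurvature_add_period (u := fun y => σ * gluedGraph Λ η a y) pσ
    obtain ⟨h5, h6, h7⟩ := (h2 _ h3).2.2.2 σ hσ
    have up : ∀ {v A : ℝ}, 0 ≤ v → A ≤ C * v → A ≤ (C + |K| + |K' 0| + |K' 1|) * v := fun h8 h9 =>
      h9.trans (mul_le_mul_of_nonneg_right (by linarith) h8)
    have w1 : 0 ≤ neckSize Λ a ^ 2 * Real.log (1 / neckSize Λ a) / Metric.infDist μ Λ ^ 2 := by
      positivity
    simp only [← h4] at h5 h6 h7
    refine ⟨up w1 ?_, ?_, fun j => up (div_nonneg w1 Metric.infDist_nonneg) ?_⟩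
    · rwa [← pg (μ - ν), sub_add_cancel] at h5
    · have h8 : (graphCurvature fun y => σ * gluedGraph Λ η a y)
          = (graphCurvature fun y => σ * gluedGraph Λ η a y) ∘ fun y => y - ν := by
        ext y; rw [Function.comp, ← pg (y - ν), sub_add_cancel]
      rw [h8]
      exact DifferentiableAt.comp μ h6 (differentiableAt_id.sub_const ν)
    · have := h7 j
      rwa [← pd_add_period pg j (μ - ν), sub_add_cancel] at this
  all_goals have w2 : 0 ≤ Real.log (1 / neckSize Λ a) / Real.cosh (q 0) ^ 2 := by positivity
  · exact (hK (a, q) ⟨ha, ha', hq⟩).trans (mul_le_mul_of_nonneg_right (by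
      linarith [le_abs_self K]) w2)
  · have := (hn.smooth (a, q) ⟨ha, ha', hq⟩).differentiableAt (by norm_num)
    have h4 := this.add_const (cliffordH a)
    simp only [sub_add_cancel] at h4
    exact h4
  · have h4 := hK' j (a, q) ⟨ha, ha', hq⟩
    have h5 : pd j (fun y => 2 * Real.sqrt 2 * (Real.cosh (y 0) * neckNum (neckSize Λ a) y)
        / (neckSize Λ a * Real.sqrt (neckDet (neckSize Λ a) y) ^ 3) - cliffordH a) q
        = pd j (neckCurvature (neckSize Λ a)) q := by
      rw [pd, fderiv_sub_const]; rfl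
    simp only [h5, div_one] at h4
    refine h4.trans (mul_le_mul_of_nonneg_right ?_ w2)
    fin_cases j
    · simp only [Fin.zero_eta]; linarith [le_abs_self (K' 0)]
    · simp only [Fin.mk_one]; linarith [le_abs_self (K' 1)]

/-! ### Toroidal coordinates as a covering -/

/-- The angle of the point `(x, y)` of the plane in the branch around `m`. -/
def angleLift (m x y : ℝ) : ℝ :=
  m + Complex.arg ⟨x * Real.cos m + y * Real.sin m, y * Real.cos m - x * Real.sin m⟩

lemma angleLift_polar {ρ : ℝ} (hρ : 0 < ρ) (m α : ℝ) :
    ∃ k : ℤ, angleLift m (ρ * Real.cos α) (ρ * Real.sin α) = α + k * (2 * Real.pi) := by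
  have e : (⟨ρ * Real.cos α * Real.cos m + ρ * Real.sin α * Real.sin m,
      ρ * Real.sin α * Real.cos m - ρ * Real.cos α * Real.sin m⟩ : ℂ)
      = (ρ : ℂ) * Complex.exp ((α - m : ℝ) * Complex.I) := by
    rw [Complex.exp_mul_I, ← Complex.ofReal_cos, ← Complex.ofReal_sin]
    apply Complex.ext
    · simp only [Complex.re_ofReal_mul, Complex.add_re, Complex.ofReal_re, Complex.mul_I_re,
        Complex.ofReal_im, Real.cos_sub]
      ring
    · simp only [Complex.im_ofReal_mul, Complex.add_im, Complex.ofReal_re, Complex.mul_I_im,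
        Complex.ofReal_im, Real.sin_sub]
      ring
  refine ⟨-toIocDiv Real.two_pi_pos (-Real.pi) (α - m), ?_⟩
  rw [angleLift, e, Complex.arg_real_mul _ hρ, Complex.arg_exp_mul_I, toIocMod, zsmul_eq_mul]
  push_cast
  ring

lemma angleLift_self {ρ : ℝ} (hρ : 0 < ρ) (m : ℝ) :
    angleLift m (ρ * Real.cos m) (ρ * Real.sin m) = m := by
  have e : (⟨ρ * Real.cos m * Real.cos m + ρ * Real.sin m * Real.sin m,
      ρ * Real.sin m * Real.cos m - ρ * Real.cos m * Real.sin m⟩ : ℂ) = (ρ : ℂ) := by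
    apply Complex.ext
    · simp only [Complex.ofReal_re]; linear_combination ρ * Real.sin_sq_add_cos_sq m
    · simp only [Complex.ofReal_im]; ring
  rw [angleLift, e, Complex.arg_ofReal_of_nonneg hρ.le, add_zero]

/-- The base point is rotated onto the positive real axis, away from the branch cut of the argument.
-/
lemma continuousAt_angleLift {ι : Type*} [TopologicalSpace ι] {f g : ι → ℝ} {i : ι} {ρ m : ℝ}
    (hρ : 0 < ρ) (hf : ContinuousAt f i) (hg : ContinuousAt g i) (hfi : f i = ρ * Real.cos m)
    (hgi : g i = ρ * Real.sin m) : ContinuousAt (fun j => angleLift m (f j) (g j)) i := by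
  have hc : ContinuousAt (fun j => (⟨f j * Real.cos m + g j * Real.sin m,
      g j * Real.cos m - f j * Real.sin m⟩ : ℂ)) i :=
    Complex.equivRealProdCLM.symm.continuous.continuousAt.comp
      (f := fun j => (f j * Real.cos m + g j * Real.sin m, g j * Real.cos m - f j * Real.sin m))
      (((hf.mul_const _).add (hg.mul_const _)).prodMk ((hg.mul_const _).sub (hf.mul_const _)))
  refine continuousAt_const.add (ContinuousAt.comp (g := Complex.arg)
    (Complex.continuousAt_arg (Or.inl ?_)) hc)
  simp only [hfi, hgi]
  nlinarith [Real.sin_sq_add_cos_sq m]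

lemma continuous_height : Continuous height := by
  have h : ∀ k, Continuous fun x : Space4 => x k := fun k =>
    (EuclideanSpace.proj (𝕜 := ℝ) k).continuous
  exact ((((h 0).pow 2).add ((h 1).pow 2)).sub ((h 2).pow 2)).sub ((h 3).pow 2)

lemma height_torusPoint (m₀ m₁ t : ℝ) :
    height (torusPoint m₀ m₁ t) = Real.sin (Real.sqrt 2 * t) := by
  have h1 := sq_cos_toroidal t
  have h2 := sq_sin_toroidal t
  simp only [height, torusPoint]
  simp
  linear_combination Real.cos (Real.pi / 4 - t / Real.sqrt 2) ^ 2 * Real.sin_sq_add_cos_sq m₀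
    - Real.sin (Real.pi / 4 - t / Real.sqrt 2) ^ 2 * Real.sin_sq_add_cos_sq m₁ + h1 - h2

lemma cliffordHeight_height {μ : Plane} {t : ℝ} (ht : |t| ≤ 1) :
    cliffordHeight (height (toroidal μ t)) = t := by
  have h := abs_lt.1 (abs_sqrt_two_mul_lt ht)
  rw [toroidal_eq_torusPoint ht, height_torusPoint, cliffordHeight, Real.arcsin_sin h.1.le h.2.le]
  field_simp

/-- The angles of a point of the sphere, in the branch around `μ₀`. -/
def torusLift (μ₀ : Plane) (x : Space4) : Plane :=
  !₂[angleLift (μ₀ 0) (x 0) (x 1), angleLift (μ₀ 1) (x 2) (x 3)]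

lemma torusLift_toroidal (μ₀ μ : Plane) {t : ℝ} (ht : |t| ≤ 1) :
    ∃ ν ∈ periods, torusLift μ₀ (toroidal μ t) = μ + ν := by
  obtain ⟨k, hk⟩ := angleLift_polar (cos_toroidal_pos ht) (μ₀ 0) (μ 0)
  obtain ⟨l, hl⟩ := angleLift_polar (sin_toroidal_pos ht) (μ₀ 1) (μ 1)
  refine ⟨periodVec ![k, l], ⟨_, rfl⟩, ?_⟩
  rw [toroidal_eq_torusPoint ht]
  ext i
  fin_cases i
  · simpa [torusLift, torusPoint, periodVec] using hk
  · simpa [torusLift, torusPoint, periodVec] using hl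

lemma torusLift_self (μ₀ : Plane) {t : ℝ} (ht : |t| ≤ 1) :
    torusLift μ₀ (toroidal μ₀ t) = μ₀ := by
  rw [toroidal_eq_torusPoint ht]
  ext i
  fin_cases i
  · simpa [torusLift, torusPoint] using angleLift_self (cos_toroidal_pos ht) (μ₀ 0)
  · simpa [torusLift, torusPoint] using angleLift_self (sin_toroidal_pos ht) (μ₀ 1)

lemma continuousAt_torusLift (μ₀ : Plane) {t : ℝ} (ht : |t| ≤ 1) :
    ContinuousAt (torusLift μ₀) (toroidal μ₀ t) := by
  have h : ∀ k, ContinuousAt (fun x : Space4 => x k) (toroidal μ₀ t) := fun k =>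
    (EuclideanSpace.proj (𝕜 := ℝ) k).continuous.continuousAt
  have h2 : ContinuousAt (fun x i => (torusLift μ₀ x).ofLp i) (toroidal μ₀ t) := by
    rw [continuousAt_pi]
    intro i
    fin_cases i
    · exact continuousAt_angleLift (cos_toroidal_pos ht) (h 0) (h 1)
        (by rw [toroidal_eq_torusPoint ht]; simp [torusPoint])
        (by rw [toroidal_eq_torusPoint ht]; simp [torusPoint])
    · exact continuousAt_angleLift (sin_toroidal_pos ht) (h 2) (h 3)
        (by rw [toroidal_eq_torusPoint ht]; simp [torusPoint])
        (by rw [toroidal_eq_torusPoint ht]; simp [torusPoint])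
  exact (PiLp.continuous_toLp 2 _).continuousAt.comp h2

lemma toroidal_add_period (μ : Plane) (t : ℝ) {ν : Plane} (hν : ν ∈ periods) :
    toroidal (μ + ν) t = toroidal μ t := by
  obtain ⟨n, rfl⟩ := hν
  simp only [toroidal, periodVec, PiLp.add_apply, Real.cos_add_int_mul_two_pi,
    Real.sin_add_int_mul_two_pi]

/-- A local parametrization in toroidal coordinates with a continuous left inverse is a
homeomorphism onto a neighbourhood in the surface. -/
theorem map_nhds_eq_nhdsWithin {P : Set (Plane × ℝ)} (hP : ∀ z ∈ P, |z.2| ≤ 1)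
    (hper : ∀ z ∈ P, ∀ ν ∈ periods, (z.1 + ν, z.2) ∈ P) {X : Plane → Space4} {p μ₀ : Plane} {t₀ : ℝ}
    (hX : ContinuousAt X p) (hXp : X p = toroidal μ₀ t₀) (ht₀ : |t₀| ≤ 1)
    (hXP : ∀ᶠ q in 𝓝 p, ∃ z ∈ P, X q = toroidal z.1 z.2) {l : Plane × ℝ → Plane}
    (hl : ContinuousAt l (μ₀, t₀)) (hlp : l (μ₀, t₀) = p)
    (hinv : ∀ᶠ z in 𝓝 (μ₀, t₀), z ∈ P → X (l z) = toroidal z.1 z.2) :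
    map X (𝓝 p) = 𝓝[{x | ∃ z ∈ P, x = toroidal z.1 z.2}] (X p) := by
  refine le_antisymm (tendsto_nhdsWithin_iff.2 ⟨hX, hXP⟩) fun U hU => ?_
  set ψ : Space4 → Plane × ℝ := fun x => (torusLift μ₀ x, cliffordHeight (height x)) with hψ
  have c1 : ContinuousAt ψ (X p) := by
    rw [hXp]
    exact (continuousAt_torusLift μ₀ ht₀).prodMk
      ((Real.continuous_arcsin.comp continuous_height).div_const _).continuousAt
  have e1 : ψ (X p) = (μ₀, t₀) := by
    simp only [hψ, hXp, torusLift_self μ₀ ht₀, cliffordHeight_height ht₀]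
  have c2 : ContinuousAt (fun x => l (ψ x)) (X p) :=
    ContinuousAt.comp (g := l) (by rw [e1]; exact hl) c1
  have h1 : ∀ᶠ x in 𝓝 (X p), X (l (ψ x)) ∈ U := by
    refine c2.eventually (p := fun q => X q ∈ U) ?_
    show ∀ᶠ y in 𝓝 (l (ψ (X p))), X y ∈ U
    rw [e1, hlp]; exact hU
  have h2 : ∀ᶠ x in 𝓝 (X p), ψ x ∈ P → X (l (ψ x)) = toroidal (ψ x).1 (ψ x).2 := by
    refine c1.eventually (p := fun z => z ∈ P → X (l z) = toroidal z.1 z.2) ?_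
    rw [e1]; exact hinv
  -- The map ψ recovers (μ, t) up to a period. Since P and the toroidal map are invariant under
  -- periods, the ambiguity is harmless, and each nearby point of the surface is X of a parameter
  -- near p.
  filter_upwards [nhdsWithin_le_nhds h1, nhdsWithin_le_nhds h2, self_mem_nhdsWithin]
    with x h3 h4 ⟨z, hz, hx⟩
  obtain ⟨ν, hν, h5⟩ := torusLift_toroidal μ₀ z.1 (hP z hz)
  have h6 : ψ x = (z.1 + ν, z.2) := by
    simp only [hψ, hx, h5, cliffordHeight_height (hP z hz)]
  rw [h6] at h3 h4
  rw [h4 (hper z hz ν hν), toroidal_add_period _ _ hν, ← hx] at h3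
  exact h3

/-! ### Oriented charts in toroidal coordinates -/

lemma fderiv_height (x w : Space4) :
    fderiv ℝ height x w = 2 * (x 0 * w 0 + x 1 * w 1 - x 2 * w 2 - x 3 * w 3) := by
  have h : ∀ k, HasFDerivAt (fun x : Space4 => x k)
      (EuclideanSpace.proj (𝕜 := ℝ) k : Space4 →L[ℝ] ℝ) x := fun k =>
    (EuclideanSpace.proj (𝕜 := ℝ) k : Space4 →L[ℝ] ℝ).hasFDerivAt
  have e : HasFDerivAt height _ x :=
    ((((h 0).pow 2).fun_add ((h 1).pow 2)).fun_sub ((h 2).pow 2)).fun_sub ((h 3).pow 2)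
  rw [e.fderiv]
  simp
  ring

section
variable {m₀ m₁ t : Plane → ℝ} {q : Plane}

/-- In the rotating frame the gradient of the height is (2c, 0, -2s, 0). Its component along the
normal is therefore the Jacobian of the angle map times a positive factor, which reduces orientation
to a sign. -/
lemma fderiv_height_normalVector_torusParam (h₀ : DifferentiableAt ℝ m₀ q)
    (h₁ : DifferentiableAt ℝ m₁ q) (ht : DifferentiableAt ℝ t q) :
    fderiv ℝ height (torusParam m₀ m₁ t q) (normalVector (torusParam m₀ m₁ t) q)
      = Real.cos (Real.sqrt 2 * t q) ^ 2 * (pd 0 m₀ q * pd 1 m₁ q - pd 1 m₀ q * pd 0 m₁ q) := by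
  set c := Real.cos (Real.pi / 4 - t q / Real.sqrt 2) with hc
  set s := Real.sin (Real.pi / 4 - t q / Real.sqrt 2) with hs
  have e : ∀ w : Space4, fderiv ℝ height (torusParam m₀ m₁ t q) w
      = inner ℝ w (rot (m₀ q) (m₁ q) ![2 * c, 0, -(2 * s), 0]) := by
    intro w
    rw [fderiv_height, inner_space4, torusParam_eq_rot]
    simp [rot]
    ring
  rw [e, inner_normalVector, pd_torusParam h₀ h₁ ht, pd_torusParam h₀ h₁ ht, torusParam_eq_rot,
    vol4_rot, vol4_eq, ← hc, ← hs]
  have hcs : c * s = Real.cos (Real.sqrt 2 * t q) / 2 := cos_mul_sin_toroidal (t q)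
  simp
  linear_combination (pd 0 m₀ q * pd 1 m₁ q - pd 1 m₀ q * pd 0 m₁ q) *
    (4 * (c * s) + 2 * Real.cos (Real.sqrt 2 * t q)) * hcs

lemma height_mul_fderiv_unitNormal_pos (h₀ : DifferentiableAt ℝ m₀ q)
    (h₁ : DifferentiableAt ℝ m₁ q) (ht : DifferentiableAt ℝ t q) (ht1 : |t q| ≤ 1)
    (hJ : 0 < Real.sin (Real.sqrt 2 * t q) * (pd 0 m₀ q * pd 1 m₁ q - pd 1 m₀ q * pd 0 m₁ q)) :
    0 < height (torusParam m₀ m₁ t q) *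
      fderiv ℝ height (torusParam m₀ m₁ t q) (unitNormal (torusParam m₀ m₁ t) q) := by
  have hc : 0 < Real.cos (Real.sqrt 2 * t q) :=
    Real.cos_pos_of_mem_Ioo (abs_lt.1 (abs_sqrt_two_mul_lt ht1))
  have e := fderiv_height_normalVector_torusParam h₀ h₁ ht
  have h2 : 0 < height (torusParam m₀ m₁ t q) *
      fderiv ℝ height (torusParam m₀ m₁ t q) (normalVector (torusParam m₀ m₁ t) q) := by
    rw [e, torusParam, height_torusPoint]
    have := mul_pos (pow_pos hc 2) hJ
    nlinarith
  have hn : normalVector (torusParam m₀ m₁ t) q ≠ 0 := by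
    intro h; rw [h, map_zero, mul_zero] at h2; exact h2.false
  rw [unitNormal, map_smul, smul_eq_mul, mul_left_comm]
  exact mul_pos (inv_pos.2 (norm_pos_iff.2 hn)) h2

/-- Reduces an oriented chart to data in toroidal coordinates: a left inverse l on P, continuous at
the base point, and agreement of the sign of the angle Jacobian with the sign of t. -/
theorem isOrientedChart_torusParam {P : Set (Plane × ℝ)} (hP : ∀ z ∈ P, |z.2| ≤ 1)
    (hper : ∀ z ∈ P, ∀ ν ∈ periods, (z.1 + ν, z.2) ∈ P) {p : Plane}
    (h₀ : ContDiffAt ℝ ∞ m₀ p) (h₁ : ContDiffAt ℝ ∞ m₁ p) (ht : ContDiffAt ℝ ∞ t p)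
    (hdet : (firstForm (torusParam m₀ m₁ t) p).det ≠ 0)
    (hXP : ∀ᶠ q in 𝓝 p, (!₂[m₀ q, m₁ q], t q) ∈ P) {l : Plane × ℝ → Plane}
    (hl : ContinuousAt l (!₂[m₀ p, m₁ p], t p)) (hlp : l (!₂[m₀ p, m₁ p], t p) = p)
    (hinv : ∀ᶠ z in 𝓝 (!₂[m₀ p, m₁ p], t p), z ∈ P →
      m₀ (l z) = z.1 0 ∧ m₁ (l z) = z.1 1 ∧ t (l z) = z.2)
    (hJ : ∀ᶠ q in 𝓝 p, Real.sin (Real.sqrt 2 * t q) ≠ 0 →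
      0 < Real.sin (Real.sqrt 2 * t q) * (pd 0 m₀ q * pd 1 m₁ q - pd 1 m₀ q * pd 0 m₁ q)) :
    IsOrientedChart {x | ∃ z ∈ P, x = toroidal z.1 z.2} (torusParam m₀ m₁ t) p where
  smooth := contDiffAt_torusParam h₀ h₁ ht
  immersion := injective_fderiv_of_det hdet
  onto_nhds := by
    have e : ∀ q, |t q| ≤ 1 → torusParam m₀ m₁ t q = toroidal !₂[m₀ q, m₁ q] (t q) := by
      intro q hq; rw [toroidal_eq_torusPoint hq]; simp [torusParam]
    have htp := hP _ hXP.self_of_nhds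
    refine map_nhds_eq_nhdsWithin hP hper (contDiffAt_torusParam h₀ h₁ ht).continuousAt
      (e p htp) htp ?_ hl hlp ?_
    · exact hXP.mono fun q hq => ⟨_, hq, e q (hP _ hq)⟩
    · filter_upwards [hinv] with z hz hzP
      obtain ⟨h1, h2, h3⟩ := hz hzP
      rw [e _ (by rw [h3]; exact hP z hzP), h1, h2, h3]
      congr 1
      ext i; fin_cases i <;> rfl
  orientation := by
    have d : ∀ {f : Plane → ℝ}, ContDiffAt ℝ ∞ f p → ∀ᶠ q in 𝓝 p, DifferentiableAt ℝ f q :=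
      fun hf => ((hf.of_le (m := 1) (by exact_mod_cast le_top)).eventually (by norm_num)).mono
        fun q hq => hq.differentiableAt (by norm_num)
    filter_upwards [d h₀, d h₁, d ht, hXP, hJ] with q d0 d1 dt hqP hqJ hne
    rw [torusParam, height_torusPoint] at hne
    exact height_mul_fderiv_unitNormal_pos d0 d1 dt (hP _ hqP) (hqJ hne)

end

/-! ### The approximate solution as a double graph -/

lemma exists_polar (x : Plane) : ∃ θ : ℝ, x = ‖x‖ • !₂[Real.cos θ, Real.sin θ] := by
  have e : ‖(⟨x 0, x 1⟩ : ℂ)‖ = ‖x‖ := by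
    rw [Complex.norm_def, Complex.normSq_mk, EuclideanSpace.norm_eq, Fin.sum_univ_two]
    simp [sq]
  refine ⟨Complex.arg ⟨x 0, x 1⟩, ?_⟩
  have h1 := Complex.norm_mul_cos_arg ⟨x 0, x 1⟩
  have h2 := Complex.norm_mul_sin_arg ⟨x 0, x 1⟩
  rw [e] at h1 h2
  ext i
  fin_cases i
  · simpa using h1.symm
  · simpa using h2.symm

lemma norm_circle (θ : ℝ) : ‖(!₂[Real.cos θ, Real.sin θ] : Plane)‖ = 1 := by
  simp [EuclideanSpace.norm_eq, Fin.sum_univ_two]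

lemma IsCutoff.eq_zero_of_norm_le {η : Plane → ℝ} (hη : IsCutoff η) {x : Plane}
    (hx : ‖x‖ ≤ 1 / 2) : η x = 0 := by
  have h : closure (Metric.ball (0 : Plane) (1 / 2)) ⊆ {y | η y = 0} :=
    closure_minimal (fun y hy => hη.eq_zero y (by simpa using hy))
      (isClosed_eq hη.smooth.continuous continuous_const)
  rw [closure_ball _ (by norm_num)] at h
  exact h (by simpa using hx)

/-- The points `(μ, t)` of the approximate solution, in toroidal coordinates. -/
def profile (Λ : Set Plane) (η : Plane → ℝ) (a : ℝ) : Set (Plane × ℝ) :=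
  {z | neckSize Λ a ≤ Metric.infDist z.1 Λ ∧ |z.2| = gluedGraph Λ η a z.1}

namespace GoodParameter
variable {Λ : Set Plane} {r C a : ℝ} {W η : Plane → ℝ}

lemma neckSize_lt (h : GoodParameter Λ r W η C a) : neckSize Λ a < Real.sqrt (neckSize Λ a) / 2 := by
  have h1 := Real.sq_sqrt h.neck.pos.le
  have h2 := h.neck.sqrt_lt.trans_le (min_le_right _ _)
  nlinarith [h.neck.sqrt_pos]

/-- Within √ε/2 of ν the cut-off vanishes and the glued graph is the catenoid; for |μ - ν| ≥ ε this
describes its upper half. -/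
lemma gluedGraph_neck (h : GoodParameter Λ r W η C a) {ν μ : Plane} (hν : ν ∈ Λ)
    (hμ : ‖μ - ν‖ ≤ Real.sqrt (neckSize Λ a) / 2) :
    gluedGraph Λ η a μ = neckSize Λ a * Real.arcosh (‖μ - ν‖ / neckSize Λ a) := by
  have h1 := h.neck.sqrt_lt.trans_le (min_le_left _ _)
  have h0 := h.neck.sqrt_pos
  have e : gluedGraph Λ η a μ = gluedGraph Λ η a (μ - ν) := by
    rw [← SmallNeck.gluedGraph_add h.lattice h.green hν (μ - ν), sub_add_cancel]
  rw [e, h.neck.gluedGraph_of_norm_lt h.lattice h.green h.cutoff (by linarith), gluingTerm,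
    h.cutoff.eq_zero_of_norm_le]
  · rw [catenoidGraph]; ring
  · rw [norm_smul, norm_inv, Real.norm_of_nonneg h0.le, inv_mul_eq_div, div_le_iff₀ h0]
    linarith

lemma neck_coordinate (h : GoodParameter Λ r W η C a) {z : Plane × ℝ} {ν : Plane} (hν : ν ∈ Λ)
    (hz : ‖z.1 - ν‖ ≤ Real.sqrt (neckSize Λ a) / 2) (hzP : z ∈ profile Λ η a) :
    neckSize Λ a * Real.cosh (z.2 / neckSize Λ a) = ‖z.1 - ν‖ := by
  have h0 := h.neck.pos
  have h1 : |z.2 / neckSize Λ a| = Real.arcosh (‖z.1 - ν‖ / neckSize Λ a) := by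
    rw [abs_div, abs_of_pos h0, hzP.2, h.gluedGraph_neck hν hz]
    field_simp
  have h2 := hzP.1.trans (Metric.infDist_le_dist_of_mem hν)
  rw [dist_eq_norm] at h2
  rw [← Real.cosh_abs, h1, Real.cosh_arcosh ((one_le_div h0).2 h2)]
  field_simp

lemma abs_le_one (h : GoodParameter Λ r W η C a) {z : Plane × ℝ} (hz : z ∈ profile Λ η a) :
    |z.2| ≤ 1 := by
  rcases le_or_gt (Real.sqrt (neckSize Λ a) / 2) (Metric.infDist z.1 Λ) with h1 | h1
  · rw [hz.2]; linarith [h.le _ h1]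
  · have h0 := h.neck.pos
    obtain ⟨ν, hν, h2⟩ := h.lattice.exists_dist_eq z.1
    have h3 := h.neck_coordinate hν (h2 ▸ h1.le) hz
    have h4 := h.neck.abs_le_log (s := z.2 / neckSize Λ a) (by linarith [h.neck.sqrt_pos])
    rw [abs_div, abs_of_pos h0, div_le_iff₀ h0] at h4
    linarith [h.neck.mul_log_le_quarter]

lemma profile_add (h : GoodParameter Λ r W η C a) {z : Plane × ℝ} (hz : z ∈ profile Λ η a)
    {ν : Plane} (hν : ν ∈ Λ) : (z.1 + ν, z.2) ∈ profile Λ η a := by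
  show neckSize Λ a ≤ Metric.infDist (z.1 + ν) Λ ∧ |z.2| = gluedGraph Λ η a (z.1 + ν)
  rw [h.lattice.infDist_add hν, SmallNeck.gluedGraph_add h.lattice h.green hν]
  exact hz

lemma norm_neckBase_sub (h : GoodParameter Λ r W η C a) (ν : Plane) (s θ : ℝ) :
    ‖neckBase Λ a ν s θ - ν‖ = neckSize Λ a * Real.cosh s := by
  have := mul_pos h.neck.pos (Real.cosh_pos s)
  rw [neckBase, add_sub_cancel_left, norm_smul, norm_circle, mul_one, Real.norm_of_nonneg this.le]

lemma infDist_neckBase (h : GoodParameter Λ r W η C a) {ν : Plane} (hν : ν ∈ Λ) {s : ℝ} (θ : ℝ)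
    (hs : neckSize Λ a * Real.cosh s ≤ Real.sqrt (neckSize Λ a)) :
    Metric.infDist (neckBase Λ a ν s θ) Λ = neckSize Λ a * Real.cosh s := by
  have h1 := h.neck.sqrt_lt.trans_le (min_le_left _ _)
  rw [h.lattice.infDist_eq hν, h.norm_neckBase_sub]
  rw [h.norm_neckBase_sub]
  linarith [h.neck.sqrt_pos]

lemma neckBase_mem_profile (h : GoodParameter Λ r W η C a) {ν : Plane} (hν : ν ∈ Λ) {s : ℝ} (θ : ℝ)
    (hs : neckSize Λ a * Real.cosh s ≤ Real.sqrt (neckSize Λ a) / 2) :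
    (neckBase Λ a ν s θ, neckSize Λ a * s) ∈ profile Λ η a := by
  have h0 := h.neck.pos
  refine ⟨?_, ?_⟩
  · rw [h.infDist_neckBase hν θ (by linarith [h.neck.sqrt_pos])]
    exact le_mul_of_one_le_right h0.le (Real.one_le_cosh s)
  · simp only
    rw [h.gluedGraph_neck hν (by rwa [h.norm_neckBase_sub]), h.norm_neckBase_sub,
      mul_div_cancel_left₀ _ h0.ne', ← Real.cosh_abs s, Real.arcosh_cosh (abs_nonneg s), abs_mul,
      abs_of_pos h0]

/-- Solving |μ - ν| = ε cosh s for s gives |t| = ε arcosh(|μ - ν|/ε), which is the glued graph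
there. Both halves of a neck and both sheets thus satisfy the same equation |t| = T_a(μ). -/
lemma approxSolution_eq (h : GoodParameter Λ r W η C a) :
    approxSolution Λ η a = {x | ∃ z ∈ profile Λ η a, x = toroidal z.1 z.2} := by
  have h0 := h.neck.pos
  apply Subset.antisymm
  · rintro x (⟨μ, t, h1, h2, rfl⟩ | ⟨ν, hν, s, θ, h1, rfl⟩)
    · refine ⟨(μ, t), ⟨h.neckSize_lt.le.trans h1, ?_⟩, rfl⟩
      rcases h2 with rfl | rfl
      · exact abs_of_pos (h.pos μ h1)
      · simp only [abs_neg, abs_of_pos (h.pos μ h1)]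
    · exact ⟨_, h.neckBase_mem_profile hν θ h1, rfl⟩
  · rintro x ⟨⟨μ, t⟩, hz, rfl⟩
    rcases le_or_gt (Real.sqrt (neckSize Λ a) / 2) (Metric.infDist μ Λ) with h1 | h1
    · exact Or.inl ⟨μ, t, h1, eq_or_eq_neg_of_abs_eq hz.2, rfl⟩
    · obtain ⟨ν, hν, h2⟩ := h.lattice.exists_dist_eq μ
      obtain ⟨θ, hθ⟩ := exists_polar (μ - ν)
      have h3 := h.neck_coordinate hν (h2 ▸ h1.le) hz
      refine Or.inr ⟨ν, hν, t / neckSize Λ a, θ, ?_, ?_⟩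
      · simp only at h3; rw [h3, ← h2]; exact h1.le
      · simp only at h3
        simp only [neckBase, h3]
        rw [← hθ, add_sub_cancel, mul_div_cancel₀ _ h0.ne']

end GoodParameter

/-! ### Reference charts -/

/-- There is an oriented chart around the point `toroidal z.1 z.2` which computes the mean curvature,
with an estimate. -/
def HasReferenceChart (Λ : Set Plane) (η : Plane → ℝ) (K a : ℝ) (z : Plane × ℝ) : Prop :=
  ∃ Y q, IsOrientedChart (approxSolution Λ η a) Y q ∧ Y q = toroidal z.1 z.2 ∧
    (∃ᶠ y in 𝓝 q, height (Y y) ≠ 0) ∧ DifferentiableAt ℝ (meanCurvature Y) q ∧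
    |meanCurvature Y q - cliffordH a| + Metric.infDist z.1 Λ * meanCurvatureGradNorm Y q
      ≤ K * (neckSize Λ a ^ 2 * Real.log (1 / neckSize Λ a) / Metric.infDist z.1 Λ ^ 2)

lemma abs_sin_sqrt_two_mul_le {t : ℝ} (ht : |t| ≤ 1 / 4) : |Real.sin (Real.sqrt 2 * t)| ≤ 3 / 8 := by
  refine Real.abs_sin_le_abs.trans ?_
  rw [abs_mul, abs_of_nonneg (Real.sqrt_nonneg _)]
  nlinarith [sqrt_two_lt, abs_nonneg t]

lemma sin_sqrt_two_mul_pos {t : ℝ} (h0 : 0 < t) (ht : t ≤ 1) : 0 < Real.sin (Real.sqrt 2 * t) := by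
  have h1 := (abs_lt.1 (abs_sqrt_two_mul_lt (abs_le.2 ⟨by linarith, ht⟩))).2
  exact Real.sin_pos_of_pos_of_lt_pi (by positivity) (by linarith [Real.pi_pos])

/-- The neck metric dominates (ε cosh s / 2)² times the flat metric, since |σ| ≤ 3/8. The strict
determinant inequality also yields nondegeneracy. -/
lemma neckForm_bounds {ε c t σ κ τ : ℝ} (hε : 0 < ε) (hc0 : 0 < c) (hc : c ^ 2 = t ^ 2 + 1)
    (hσ : |σ| ≤ 3 / 8) (hk : |κ| ≤ 1) (hs : τ ^ 2 + κ ^ 2 = 1) :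
    (ε * c / 2) ^ 2 ≤ ε ^ 2 / 2 * (c ^ 2 + σ * t ^ 2 * κ) ∧
    (ε * c / 2) ^ 2 ≤ ε ^ 2 / 2 * (c ^ 2 * (1 - σ * κ)) ∧
    (ε ^ 2 / 2 * -(σ * t * c * τ)) ^ 2 < (ε ^ 2 / 2 * (c ^ 2 + σ * t ^ 2 * κ) - (ε * c / 2) ^ 2)
      * (ε ^ 2 / 2 * (c ^ 2 * (1 - σ * κ)) - (ε * c / 2) ^ 2) := by
  have hσκ := abs_le.1 (show |σ * κ| ≤ 3 / 8 by
    rw [abs_mul]; exact (mul_le_of_le_one_right (abs_nonneg σ) hk).trans hσ)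
  have hσ2 : σ ^ 2 ≤ 9 / 64 := by
    rw [← sq_abs]; exact (pow_le_pow_left₀ (abs_nonneg σ) hσ 2).trans (by norm_num)
  have ht := sq_nonneg t
  have h1 : 0 ≤ c ^ 2 / 2 + σ * κ * t ^ 2 := by
    have := mul_le_mul_of_nonneg_right hσκ.1 ht
    linarith
  have h2 : 0 ≤ 1 / 2 - σ * κ := by linarith
  refine ⟨?_, ?_, ?_⟩
  · have : 0 ≤ ε ^ 2 / 2 * (c ^ 2 / 2 + σ * κ * t ^ 2) := by positivity
    linarith
  · have : 0 ≤ ε ^ 2 / 2 * (c ^ 2 * (1 / 2 - σ * κ)) := by positivity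
    linarith
  · have e : (ε ^ 2 / 2 * (c ^ 2 + σ * t ^ 2 * κ) - (ε * c / 2) ^ 2)
        * (ε ^ 2 / 2 * (c ^ 2 * (1 - σ * κ)) - (ε * c / 2) ^ 2)
        - (ε ^ 2 / 2 * -(σ * t * c * τ)) ^ 2
        = ε ^ 4 / 4 * c ^ 2 * (1 / 4 - σ * κ / 2 + t ^ 2 * (1 / 4 - σ ^ 2)) := by
      linear_combination (-(ε ^ 4 / 4 * σ ^ 2 * t ^ 2 * c ^ 2)) * hs
        + (ε ^ 4 / 4 * c ^ 2 * (1 / 4 - σ * κ / 2)) * hc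
    have h3 := mul_nonneg ht (show 0 ≤ 1 / 4 - σ ^ 2 by linarith)
    have h4 : 0 < 1 / 4 - σ * κ / 2 + t ^ 2 * (1 / 4 - σ ^ 2) := by linarith
    have : 0 < ε ^ 4 / 4 * c ^ 2 * (1 / 4 - σ * κ / 2 + t ^ 2 * (1 / 4 - σ ^ 2)) := by positivity
    linarith

lemma firstForm_neckChart_bounds {ν q : Plane} {ε : ℝ} (hε : 0 < ε)
    (hσ : |Real.sin (Real.sqrt 2 * (ε * q 0))| ≤ 3 / 8) :
    (ε * Real.cosh (q 0) / 2) ^ 2 ≤ firstForm (neckChart ν ε) q 0 0 ∧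
    (ε * Real.cosh (q 0) / 2) ^ 2 ≤ firstForm (neckChart ν ε) q 1 1 ∧
    firstForm (neckChart ν ε) q 0 1 ^ 2
      < (firstForm (neckChart ν ε) q 0 0 - (ε * Real.cosh (q 0) / 2) ^ 2)
        * (firstForm (neckChart ν ε) q 1 1 - (ε * Real.cosh (q 0) / 2) ^ 2) := by
  obtain ⟨g0, g01, g1⟩ := firstForm_neckChart (ν := ν) (ε := ε) (q := q)
  rw [g0, g01, g1]
  exact neckForm_bounds hε (Real.cosh_pos _) (Real.cosh_sq _) hσ (Real.abs_cos_le_one _)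
    (Real.sin_sq_add_cos_sq _)

lemma det_firstForm_pos {X : Plane → Space4} {q : Plane} {l : ℝ} (h0 : l ^ 2 ≤ firstForm X q 0 0)
    (h1 : l ^ 2 ≤ firstForm X q 1 1)
    (h : firstForm X q 0 1 ^ 2 < (firstForm X q 0 0 - l ^ 2) * (firstForm X q 1 1 - l ^ 2)) :
    0 < (firstForm X q).det := by
  have hs : firstForm X q 1 0 = firstForm X q 0 1 := by simp [firstForm, real_inner_comm]
  rw [Matrix.det_fin_two, hs]
  nlinarith [sq_nonneg l]

lemma angleLift_coord (x : Plane) (hx : x ≠ 0) (θ : ℝ) :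
    ‖x‖ * Real.cos (angleLift θ (x 0) (x 1)) = x 0 ∧
    ‖x‖ * Real.sin (angleLift θ (x 0) (x 1)) = x 1 := by
  obtain ⟨α, hα⟩ := exists_polar x
  have e0 : x 0 = ‖x‖ * Real.cos α := congrArg (fun y : Plane => y 0) hα
  have e1 : x 1 = ‖x‖ * Real.sin α := congrArg (fun y : Plane => y 1) hα
  obtain ⟨k, hk⟩ := angleLift_polar (norm_pos_iff.2 hx) θ α
  rw [← e0, ← e1] at hk
  rw [hk, Real.cos_add_int_mul_two_pi, Real.sin_add_int_mul_two_pi]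
  exact ⟨e0.symm, e1.symm⟩

lemma sin_mul_sinh_pos {ε s : ℝ} (hε : 0 < ε) (hs : s ≠ 0) (h1 : |ε * s| ≤ 1) :
    0 < Real.sin (Real.sqrt 2 * (ε * s)) * Real.sinh s := by
  rcases lt_or_gt_of_ne hs with h3 | h3
  · have h4 := sin_sqrt_two_mul_pos (t := -(ε * s)) (by nlinarith) (by linarith [abs_le.1 h1])
    rw [mul_neg, Real.sin_neg] at h4
    exact mul_pos_of_neg_of_neg (by linarith) (Real.sinh_neg_iff.2 h3)
  · exact mul_pos (sin_sqrt_two_mul_pos (by positivity) (abs_le.1 h1).2) (Real.sinh_pos_iff.2 h3)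

lemma frequently_coord_ne_zero (q : Plane) : ∃ᶠ y : Plane in 𝓝 q, y 0 ≠ 0 := by
  have h1 : Dense {y : Plane | y 0 ≠ 0} :=
    (dense_compl_singleton (0 : ℝ)).preimage
      (ContinuousLinearMap.isOpenMap (EuclideanSpace.proj (𝕜 := ℝ) (0 : Fin 2)) fun c =>
        ⟨EuclideanSpace.single 0 c, by simp⟩)
  exact mem_closure_iff_frequently.1 (h1 q)

lemma neckBase_eq (Λ : Set Plane) (a : ℝ) (ν y : Plane) :
    (!₂[ν 0 + neckSize Λ a * (Real.cosh (y 0) * Real.cos (y 1)),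
      ν 1 + neckSize Λ a * (Real.cosh (y 0) * Real.sin (y 1))] : Plane)
      = neckBase Λ a ν (y 0) (y 1) := by
  ext i; fin_cases i <;> simp [neckBase] <;> ring

namespace GoodParameter
variable {Λ : Set Plane} {r C a : ℝ} {W η : Plane → ℝ}

lemma eventually_neckBase_mem (h : GoodParameter Λ r W η C a) {ν q : Plane} (hν : ν ∈ Λ)
    (hq : neckSize Λ a * Real.cosh (q 0) < Real.sqrt (neckSize Λ a) / 2) :
    ∀ᶠ y : Plane in 𝓝 q, (neckBase Λ a ν (y 0) (y 1), neckSize Λ a * y 0) ∈ profile Λ η a := by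
  have hcc : ContinuousAt (fun y : Plane => neckSize Λ a * Real.cosh (y 0)) q :=
    continuousAt_const.mul (Real.continuous_cosh.continuousAt.comp
      (differentiableAt_coord 0 q).continuousAt)
  filter_upwards [hcc.eventually_lt continuousAt_const hq] with y hy
  exact h.neckBase_mem_profile hν _ hy.le

/-- The inverse is s = t/ε together with the lifted angle. The angle Jacobian is ε² cosh s sinh s,
of the sign of s and hence of t, so one chart is correctly oriented across the waist s = 0, where
the surface is not a graph. -/
lemma isOrientedChart_neckChart (h : GoodParameter Λ r W η C a) {ν q : Plane} (hν : ν ∈ Λ)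
    (hq : neckSize Λ a * Real.cosh (q 0) < Real.sqrt (neckSize Λ a) / 2)
    (hdet : (firstForm (neckChart ν (neckSize Λ a)) q).det ≠ 0) :
    IsOrientedChart (approxSolution Λ η a) (neckChart ν (neckSize Λ a)) q := by
  obtain ⟨c0, c1, c2⟩ := contDiff_neck ν (neckSize Λ a) (n := ∞)
  have hP := h.eventually_neckBase_mem hν hq
  have hbs := h.norm_neckBase_sub ν (q 0) (q 1)
  have hbc : ∀ i, (neckBase Λ a ν (q 0) (q 1) - ν) i
      = (neckSize Λ a * Real.cosh (q 0)) * !₂[Real.cos (q 1), Real.sin (q 1)] i := by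
    intro i; rw [neckBase, add_sub_cancel_left]; rfl
  have h0 := h.neck.pos
  have hρ : 0 < neckSize Λ a * Real.cosh (q 0) := mul_pos h0 (Real.cosh_pos _)
  rw [h.approxSolution_eq, neckChart]
  refine isOrientedChart_torusParam (fun w hw => h.abs_le_one hw)
    (fun w hw ν' hν' => h.profile_add hw (h.lattice.periods_subset hν'))
    c0.contDiffAt c1.contDiffAt c2.contDiffAt hdet (by simpa only [neckBase_eq] using hP)
    (l := fun w => !₂[w.2 / neckSize Λ a, angleLift (q 1) ((w.1 - ν) 0) ((w.1 - ν) 1)]) ?_ ?_ ?_ ?_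
  · rw [neckBase_eq]
    have hcoord : ∀ i, ContinuousAt (fun w : Plane × ℝ => (w.1 - ν) i)
        (neckBase Λ a ν (q 0) (q 1), neckSize Λ a * q 0) := fun i =>
      (EuclideanSpace.proj (𝕜 := ℝ) i).continuous.continuousAt.comp
        (f := fun w : Plane × ℝ => w.1 - ν) (continuousAt_fst.sub continuousAt_const)
    have : ContinuousAt (fun (w : Plane × ℝ) (i : Fin 2) =>
        ![w.2 / neckSize Λ a, angleLift (q 1) ((w.1 - ν) 0) ((w.1 - ν) 1)] i)
        (neckBase Λ a ν (q 0) (q 1), neckSize Λ a * q 0) := by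
      rw [continuousAt_pi]
      intro i
      fin_cases i
      · exact continuousAt_snd.div_const _
      · exact continuousAt_angleLift hρ (hcoord 0) (hcoord 1) (hbc 0) (hbc 1)
    exact (PiLp.continuous_toLp 2 _).continuousAt.comp this
  · rw [neckBase_eq]
    simp only [hbc]
    ext i
    fin_cases i
    · simp [h0.ne']
    · simpa using angleLift_self hρ (q 1)
  · rw [neckBase_eq]
    have hnear : ∀ᶠ w : Plane × ℝ in 𝓝 (neckBase Λ a ν (q 0) (q 1), neckSize Λ a * q 0),
        ‖w.1 - ν‖ < Real.sqrt (neckSize Λ a) / 2 :=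
      ((continuousAt_fst.sub continuousAt_const).norm).eventually_lt continuousAt_const
        (by show ‖neckBase Λ a ν (q 0) (q 1) - ν‖ < _; rw [hbs]; exact hq)
    filter_upwards [hnear] with w hw hwP
    have hw1 := h.neck_coordinate hν hw.le hwP
    have hw0 : w.1 - ν ≠ 0 := by
      rw [← norm_pos_iff, ← hw1]; exact mul_pos h0 (Real.cosh_pos _)
    obtain ⟨e0, e1⟩ := angleLift_coord (w.1 - ν) hw0 (q 1)
    simp only [Matrix.cons_val_zero, Matrix.cons_val_one]
    rw [← mul_assoc, ← mul_assoc, hw1, e0, e1]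
    refine ⟨by simp, by simp, by field_simp⟩
  · filter_upwards [hP] with y hy hne
    obtain ⟨a0, a1, b0, b1, -, -⟩ := pd_neck ν (neckSize Λ a)
    rw [a0, a1, b0, b1]
    have hy0 : y 0 ≠ 0 := by rintro h3; simp [h3] at hne
    have h4 := mul_pos (mul_pos (pow_pos h0 2) (Real.cosh_pos (y 0)))
      (sin_mul_sinh_pos h0 hy0 (h.abs_le_one hy))
    refine h4.trans_eq ?_
    simp only [zero_add]
    linear_combination (-(neckSize Λ a ^ 2 * Real.cosh (y 0) * Real.sinh (y 0)) *
      Real.sin (Real.sqrt 2 * (neckSize Λ a * y 0))) * Real.sin_sq_add_cos_sq (y 1)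

lemma frequently_height_neckChart (h : GoodParameter Λ r W η C a) {ν q : Plane} (hν : ν ∈ Λ)
    (hq : neckSize Λ a * Real.cosh (q 0) < Real.sqrt (neckSize Λ a) / 2) :
    ∃ᶠ y in 𝓝 q, height (neckChart ν (neckSize Λ a) y) ≠ 0 := by
  refine ((frequently_coord_ne_zero q).and_eventually (h.eventually_neckBase_mem hν hq)).mono
    fun y ⟨hy0, hy⟩ => ?_
  rw [neckChart, torusParam, height_torusPoint]
  exact (left_ne_zero_of_mul (sin_mul_sinh_pos h.neck.pos hy0 (h.abs_le_one hy)).ne')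

lemma hasReferenceChart_neck (h : GoodParameter Λ r W η C a) (hC : 0 < C) {z : Plane × ℝ}
    (hz : z ∈ profile Λ η a) (hd : Metric.infDist z.1 Λ < Real.sqrt (neckSize Λ a) / 2) :
    HasReferenceChart Λ η (5 * C) a z := by
  obtain ⟨ν, hν, hdν⟩ := h.lattice.exists_dist_eq z.1
  obtain ⟨θ, hθ⟩ := exists_polar (z.1 - ν)
  set ε := neckSize Λ a with hε
  have h0 : 0 < ε := h.neck.pos
  have hsq := h.neck.sqrt_pos
  have hcosh := h.neck_coordinate hν (hdν ▸ hd.le) hz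
  rw [← hε] at hcosh
  set q : Plane := !₂[z.2 / ε, θ] with hq
  have q0 : q 0 = z.2 / ε := rfl
  have q1 : q 1 = θ := rfl
  have hdc : Metric.infDist z.1 Λ = ε * Real.cosh (q 0) := by rw [q0, hcosh, hdν]
  have hεs : ε * q 0 = z.2 := by rw [q0]; field_simp
  have hbz : neckBase Λ a ν (q 0) (q 1) = z.1 := by
    rw [neckBase, ← hε, q0, hcosh, q1, ← hθ, add_sub_cancel]
  have hqq : neckChart ν ε q = toroidal z.1 z.2 := by
    have e : toroidal (neckBase Λ a ν (q 0) (q 1)) (ε * q 0) = neckChart ν ε q := by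
      rw [toroidal_eq_torusPoint (by rw [hεs]; exact h.abs_le_one hz), ← neckBase_eq]; rfl
    rw [← e, hbz, hεs]
  have hsle : |z.2| ≤ 1 / 4 := by
    have h4 := h.neck.abs_le_log (s := z.2 / ε) (by rw [← hε, hcosh, ← hdν]; linarith)
    rw [abs_div, abs_of_pos h0, div_le_iff₀ h0] at h4
    linarith [h.neck.mul_log_le_quarter]
  have hσ : |Real.sin (Real.sqrt 2 * (ε * q 0))| ≤ 3 / 8 := by
    rw [hεs]; exact abs_sin_sqrt_two_mul_le hsle
  have hmet := firstForm_neckChart_bounds (ν := ν) h0 hσ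
  have hl : 0 < ε * Real.cosh (q 0) / 2 := by have := Real.cosh_pos (q 0); positivity
  refine ⟨neckChart ν ε, q, h.isOrientedChart_neckChart hν (hdc ▸ hd)
    (det_firstForm_pos hmet.1 hmet.2.1 hmet.2.2).ne', hqq,
    h.frequently_height_neckChart hν (hdc ▸ hd), ?_, ?_⟩
  all_goals
    have hH : meanCurvature (neckChart ν ε) = neckCurvature ε :=
      funext fun y => meanCurvature_neckChart h0
    obtain ⟨b1, b2, b3⟩ := h.neck_curvature q (by rw [← hε, ← hdc]; linarith)
    rw [← hε] at b1 b2 b3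
  · rw [hH]; exact b2
  · have hB : 0 ≤ C * (Real.log (1 / ε) / Real.cosh (q 0) ^ 2) := (abs_nonneg _).trans b1
    have hg := meanCurvatureGradNorm_le hl hB hmet.1 hmet.2.1 hmet.2.2.le
      (fun i => by rw [hH]; exact b3 i)
    rw [hdc, hH]
    -- The metric scale is l = d/2 with d = ε cosh s, so the gradient term is at most 4 times the
    -- coordinate bound; with the value of H this gives 5C.
    have hch := Real.cosh_pos (q 0)
    have e1 : ε ^ 2 * Real.log (1 / ε) / (ε * Real.cosh (q 0)) ^ 2
        = Real.log (1 / ε) / Real.cosh (q 0) ^ 2 := by field_simp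
    have e2 := mul_le_mul_of_nonneg_left hg (show 0 ≤ ε * Real.cosh (q 0) by positivity)
    have e3 : ε * Real.cosh (q 0) * (2 * (C * (Real.log (1 / ε) / Real.cosh (q 0) ^ 2))
        / (ε * Real.cosh (q 0) / 2)) = 4 * (C * (Real.log (1 / ε) / Real.cosh (q 0) ^ 2)) := by
      field_simp; ring
    rw [e1]
    linarith

end GoodParameter

/-! ### Reference charts on the graphs -/

/-- The scaling of the second coordinate by `σ`. -/
def scaleSnd (σ : ℝ) (q : Plane) : Plane := !₂[q 0, σ * q 1]

lemma scaleSnd_scaleSnd {σ : ℝ} (hσ : σ * σ = 1) (q : Plane) : scaleSnd σ (scaleSnd σ q) = q := by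
  ext i; fin_cases i
  · simp [scaleSnd]
  · simp [scaleSnd, ← mul_assoc, hσ]

lemma contDiff_scaleSnd (σ : ℝ) {n : WithTop ℕ∞} : ContDiff ℝ n (scaleSnd σ) := by
  refine contDiff_euclidean.2 fun i => ?_
  fin_cases i
  · exact contDiff_coord 0
  · exact contDiff_const.mul (contDiff_coord 1)

lemma jac_scaleSnd (σ : ℝ) (q : Plane) : jac (scaleSnd σ) q = !![1, 0; 0, σ] := by
  have d : DifferentiableAt ℝ (scaleSnd σ) q :=
    ((contDiff_scaleSnd σ (n := 1)).contDiffAt).differentiableAt (by norm_num)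
  ext k i
  rw [jac, Matrix.of_apply, pd_apply_coord d]
  fin_cases k
  · have e : pd i (fun x : Plane => x 0) q = if i = 0 then 1 else 0 := pd_coord i 0
    show pd i (fun x : Plane => x 0) q = _
    rw [e]; fin_cases i <;> simp
  · show pd i (fun x : Plane => σ * x 1) q = _
    rw [pd_const_mul, pd_coord]; fin_cases i <;> simp

lemma firstForm_graphChart_scaleSnd {u : Plane → ℝ} {σ : ℝ} (hσ : σ = 1 ∨ σ = -1) {q : Plane}
    (hu : ContDiffAt ℝ 1 u (scaleSnd σ q)) (h : |u (scaleSnd σ q)| ≤ 1 / 4) :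
    (1 / 2) ^ 2 ≤ firstForm (graphChart u ∘ scaleSnd σ) q 0 0 ∧
    (1 / 2) ^ 2 ≤ firstForm (graphChart u ∘ scaleSnd σ) q 1 1 ∧
    firstForm (graphChart u ∘ scaleSnd σ) q 0 1 ^ 2 < (firstForm (graphChart u ∘ scaleSnd σ) q 0 0 - (1 / 2) ^ 2)
      * (firstForm (graphChart u ∘ scaleSnd σ) q 1 1 - (1 / 2) ^ 2) := by
  have d : DifferentiableAt ℝ (scaleSnd σ) q :=
    ((contDiff_scaleSnd σ (n := 1)).contDiffAt).differentiableAt (by norm_num)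
  have dX : DifferentiableAt ℝ (graphChart u) (scaleSnd σ q) :=
    (contDiffAt_torusParam (contDiff_coord 0).contDiffAt
      (contDiff_coord 1).contDiffAt hu).differentiableAt (by norm_num)
  have hσ2 : σ * σ = 1 := by rcases hσ with rfl | rfl <;> norm_num
  obtain ⟨g0, g01, g1⟩ := firstForm_graphChart (hu.differentiableAt (by norm_num))
  have e := firstForm_comp dX d
  rw [jac_scaleSnd] at e
  have e0 : firstForm (graphChart u ∘ scaleSnd σ) q 0 0 = firstForm (graphChart u) (scaleSnd σ q) 0 0 := by
    rw [e]; simp [Matrix.mul_apply, Fin.sum_univ_two]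
  have e01 : firstForm (graphChart u ∘ scaleSnd σ) q 0 1
      = σ * firstForm (graphChart u) (scaleSnd σ q) 0 1 := by
    rw [e]; simp [Matrix.mul_apply, Fin.sum_univ_two]; ring
  have e1 : firstForm (graphChart u ∘ scaleSnd σ) q 1 1 = firstForm (graphChart u) (scaleSnd σ q) 1 1 := by
    rw [e]; simp [Matrix.mul_apply, Fin.sum_univ_two]
    linear_combination (firstForm (graphChart u) (scaleSnd σ q) 1 1) * hσ2
  rw [e0, e01, e1, g0, g01, g1]
  have hs := abs_le.1 (abs_sin_sqrt_two_mul_le h)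
  generalize Real.sin (Real.sqrt 2 * u (scaleSnd σ q)) = s at hs
  generalize pd 0 u (scaleSnd σ q) = x
  generalize pd 1 u (scaleSnd σ q) = y
  refine ⟨by nlinarith, by nlinarith, ?_⟩
  have e2 : (σ * (x * y / 2)) ^ 2 = x ^ 2 * y ^ 2 / 4 := by
    linear_combination (x ^ 2 * y ^ 2 / 4) * hσ2
  have h1 : 0 < 1 / 2 + s := by linarith
  have h2 : 0 < 1 / 2 - s := by linarith
  rw [e2]
  nlinarith [mul_pos h1 h2, mul_nonneg (sq_nonneg x) h2.le, mul_nonneg (sq_nonneg y) h1.le]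

namespace GoodParameter
variable {Λ : Set Plane} {r C a : ℝ} {W η : Plane → ℝ}

/-- On the lower sheet the orientation must be reversed for the normal to point away from C₀;
reflecting the second coordinate does this. The sign of t selects the sheet near the base point. -/
lemma isOrientedChart_graphChart (h : GoodParameter Λ r W η C a) {σ : ℝ} (hσ : σ = 1 ∨ σ = -1)
    {q : Plane} (hq : Real.sqrt (neckSize Λ a) / 2 ≤ Metric.infDist (scaleSnd σ q) Λ)
    (hdet : (firstForm (graphChart (fun y => σ * gluedGraph Λ η a y) ∘ scaleSnd σ) q).det ≠ 0) :
    IsOrientedChart (approxSolution Λ η a)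
      (graphChart (fun y => σ * gluedGraph Λ η a y) ∘ scaleSnd σ) q ∧
    ∀ᶠ y in 𝓝 q, height ((graphChart (fun y => σ * gluedGraph Λ η a y) ∘ scaleSnd σ) y) ≠ 0 := by
  have hσ2 : σ * σ = 1 := by rcases hσ with rfl | rfl <;> norm_num
  have hσa : |σ| = 1 := by rcases hσ with rfl | rfl <;> norm_num
  have cf : ContDiffAt ℝ ∞ (scaleSnd σ) q := (contDiff_scaleSnd σ).contDiffAt
  have cT : ContDiffAt ℝ ∞ (fun y => σ * gluedGraph Λ η a (scaleSnd σ y)) q :=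
    contDiffAt_const.mul (ContDiffAt.comp (g := gluedGraph Λ η a) q (h.smooth _ hq) cf)
  have hpos : ∀ᶠ y in 𝓝 q, 0 < gluedGraph Λ η a (scaleSnd σ y) :=
    continuousAt_const.eventually_lt
      (ContinuousAt.comp (g := gluedGraph Λ η a) (h.smooth _ hq).continuousAt cf.continuousAt)
      (h.pos _ hq)
  have hdist : ∀ᶠ y in 𝓝 q, neckSize Λ a < Metric.infDist (scaleSnd σ y) Λ :=
    continuousAt_const.eventually_lt
      (ContinuousAt.comp (g := fun x => Metric.infDist x Λ)
        (Metric.continuous_infDist_pt Λ).continuousAt cf.continuousAt)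
      (h.neckSize_lt.trans_le hq)
  have hP : ∀ᶠ y in 𝓝 q, (!₂[y 0, σ * y 1], σ * gluedGraph Λ η a (scaleSnd σ y)) ∈ profile Λ η a := by
    filter_upwards [hpos, hdist] with y h1 h2
    refine ⟨h2.le, ?_⟩
    simp only
    rw [abs_mul, hσa, one_mul, abs_of_pos h1]; rfl
  have hsin : ∀ᶠ y in 𝓝 q, 0 < Real.sin (Real.sqrt 2 * (σ * gluedGraph Λ η a (scaleSnd σ y))) * σ := by
    filter_upwards [hpos, hP] with y h1 h2
    have h3 := h.abs_le_one h2
    simp only at h3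
    rw [abs_mul, hσa, one_mul] at h3
    have h4 := sin_sqrt_two_mul_pos h1 (le_of_abs_le h3)
    rcases hσ with rfl | rfl
    · simpa using h4
    · simpa using h4
  refine ⟨?_, ?_⟩
  · rw [h.approxSolution_eq]
    refine isOrientedChart_torusParam (m₀ := fun y => y 0) (m₁ := fun y => σ * y 1)
      (t := fun y => σ * gluedGraph Λ η a (scaleSnd σ y)) (fun w hw => h.abs_le_one hw)
      (fun w hw ν' hν' => h.profile_add hw (h.lattice.periods_subset hν'))
      (contDiff_coord 0).contDiffAt (contDiff_const.mul (contDiff_coord 1)).contDiffAt cT hdet hP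
      (l := fun w => scaleSnd σ w.1)
      (ContinuousAt.comp (g := scaleSnd σ) (contDiff_scaleSnd σ (n := 1)).continuous.continuousAt
        continuousAt_fst) (scaleSnd_scaleSnd hσ2 q) ?_ ?_
    · have hnear : ∀ᶠ w : Plane × ℝ in 𝓝 (!₂[q 0, σ * q 1], σ * gluedGraph Λ η a (scaleSnd σ q)),
          0 < σ * w.2 := by
        refine continuousAt_const.eventually_lt (continuousAt_const.mul continuousAt_snd) ?_
        show 0 < σ * (σ * gluedGraph Λ η a (scaleSnd σ q))
        rw [← mul_assoc, hσ2, one_mul]; exact h.pos _ hq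
      filter_upwards [hnear] with w hw hwP
      refine ⟨rfl, ?_, ?_⟩
      · simp only [scaleSnd]; simp [← mul_assoc, hσ2]
      · simp only [scaleSnd_scaleSnd hσ2]
        rw [← hwP.2, ← one_mul |w.2|, ← hσa, ← abs_mul, abs_of_pos hw, ← mul_assoc, hσ2, one_mul]
    · filter_upwards [hsin] with y hy _
      rw [pd_const_mul, pd_const_mul, pd_coord, pd_coord, pd_coord, pd_coord]
      simpa using hy
  · filter_upwards [hsin] with y hy
    show height (torusPoint _ _ (σ * gluedGraph Λ η a (scaleSnd σ y))) ≠ 0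
    rw [height_torusPoint]
    exact left_ne_zero_of_mul hy.ne'

lemma hasReferenceChart_graph (h : GoodParameter Λ r W η C a) (hC : 0 < C) {z : Plane × ℝ}
    (hz : z ∈ profile Λ η a) (hd : Real.sqrt (neckSize Λ a) / 2 ≤ Metric.infDist z.1 Λ) :
    HasReferenceChart Λ η (5 * C) a z := by
  obtain ⟨σ, hσ, hzσ⟩ : ∃ σ : ℝ, (σ = 1 ∨ σ = -1) ∧ z.2 = σ * gluedGraph Λ η a z.1 := by
    rcases eq_or_eq_neg_of_abs_eq hz.2 with e | e
    · exact ⟨1, Or.inl rfl, by rw [e, one_mul]⟩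
    · exact ⟨-1, Or.inr rfl, by rw [e, neg_one_mul]⟩
  have hσ2 : σ * σ = 1 := by rcases hσ with rfl | rfl <;> norm_num
  have hσa : |σ| = 1 := by rcases hσ with rfl | rfl <;> norm_num
  set u : Plane → ℝ := fun y => σ * gluedGraph Λ η a y with hu
  set q := scaleSnd σ z.1 with hq
  have hqz : scaleSnd σ q = z.1 := scaleSnd_scaleSnd hσ2 z.1
  have cu : ContDiffAt ℝ ∞ u (scaleSnd σ q) := by
    rw [hqz]; exact contDiffAt_const.mul (h.smooth _ hd)
  have hu4 : |u (scaleSnd σ q)| ≤ 1 / 4 := by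
    rw [hqz, hu]; simp only
    rw [abs_mul, hσa, one_mul, abs_of_pos (h.pos _ hd)]; exact h.le _ hd
  have hmet := firstForm_graphChart_scaleSnd hσ (cu.of_le (by exact_mod_cast le_top)) hu4
  obtain ⟨hchart, hne⟩ := h.isOrientedChart_graphChart hσ (hqz.symm ▸ hd)
    (det_firstForm_pos hmet.1 hmet.2.1 hmet.2.2).ne'
  have hval : (graphChart u ∘ scaleSnd σ) q = toroidal z.1 z.2 := by
    rw [toroidal_eq_torusPoint (h.abs_le_one hz), hzσ, Function.comp, hqz]; rfl
  have hH : meanCurvature (graphChart u ∘ scaleSnd σ) =ᶠ[𝓝 q]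
      fun y => σ * graphCurvature u (scaleSnd σ y) := by
    have c1 : ∀ᶠ y in 𝓝 q, ContDiffAt ℝ 2 u (scaleSnd σ y) :=
      (contDiff_scaleSnd σ (n := 1)).continuous.continuousAt.eventually
        (p := fun x => ContDiffAt ℝ 2 u x)
        ((cu.of_le two_le_infty).eventually (by norm_num))
    filter_upwards [c1] with y hy
    have hdet : (jac (scaleSnd σ) y).det = σ := by rw [jac_scaleSnd, Matrix.det_fin_two]; simp
    have hsg : ((SignType.sign σ : SignType) : ℝ) = σ := by
      rcases hσ with rfl | rfl <;> simp
    rw [meanCurvature_comp (Y := graphChart u) (contDiffAt_torusParam (contDiff_coord 0).contDiffAt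
      (contDiff_coord 1).contDiffAt hy) (contDiff_scaleSnd σ).contDiffAt
      (by rw [hdet]; rcases hσ with rfl | rfl <;> norm_num), hdet, hsg]
    exact congrArg (σ * ·) (meanCurvature_graphChart hy)
  obtain ⟨b1, b2, b3⟩ := h.graph_curvature z.1 hd σ hσ
  have d2 : DifferentiableAt ℝ (scaleSnd σ) q :=
    ((contDiff_scaleSnd σ (n := 1)).contDiffAt).differentiableAt (by norm_num)
  have b2' : DifferentiableAt ℝ (graphCurvature u) (scaleSnd σ q) := by rw [hqz]; exact b2
  have hd0 : 0 < Metric.infDist z.1 Λ := by linarith [h.neck.sqrt_pos]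
  have hdH : DifferentiableAt ℝ (fun y => σ * graphCurvature u (scaleSnd σ y)) q :=
    (b2'.comp q d2).const_mul σ
  refine ⟨graphChart u ∘ scaleSnd σ, q, hchart, hval, hne.frequently, hH.differentiableAt_iff.2 hdH, ?_⟩
  set B := C * (neckSize Λ a ^ 2 * Real.log (1 / neckSize Λ a) / Metric.infDist z.1 Λ ^ 2
        / Metric.infDist z.1 Λ) with hB
  have hB0 : 0 ≤ B := (abs_nonneg _).trans (b3 0)
  have hg := meanCurvatureGradNorm_le (l := 1 / 2) (by norm_num) hB0 hmet.1 hmet.2.1 hmet.2.2.le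
    (fun i => by
      rw [(hH.pd i).self_of_nhds, pd_const_mul,
        show (fun y => graphCurvature u (scaleSnd σ y)) = graphCurvature u ∘ scaleSnd σ from rfl,
        pd_comp b2' d2, jac_scaleSnd, hqz, abs_mul, hσa, one_mul]
      fin_cases i
      · simpa using b3 0
      · simpa [abs_mul, hσa] using b3 1)
  -- The reflection multiplies H by σ, which turns the comparison of the lower sheet with -H_a into
  -- the comparison with H_a.
  have e1 : |meanCurvature (graphChart u ∘ scaleSnd σ) q - cliffordH a|
      = |graphCurvature u z.1 - σ * cliffordH a| := by
    rw [hH.self_of_nhds]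
    show |σ * graphCurvature u (scaleSnd σ q) - cliffordH a| = _
    rw [hqz, ← one_mul |graphCurvature u z.1 - _|, ← hσa, ← abs_mul, mul_sub,
      ← mul_assoc, hσ2, one_mul]
  have e2 := mul_le_mul_of_nonneg_left hg hd0.le
  have e3 : Metric.infDist z.1 Λ * (2 * B / (1 / 2)) = 4 * (C * (neckSize Λ a ^ 2 *
      Real.log (1 / neckSize Λ a) / Metric.infDist z.1 Λ ^ 2)) := by
    rw [hB]; field_simp; ring
  rw [e1]
  linarith

end GoodParameter

/-! ### The estimate in an arbitrary oriented chart -/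

/-- No bound on t is assumed, so its radii are known only to be nonnegative. Equality with a point
with |t'| ≤ 1, whose radii are positive, shows that neither vanishes, and then the angles are
determined modulo 2π. -/
lemma exists_period_of_toroidal_eq {μ μ' : Plane} {t t' : ℝ} (ht' : |t'| ≤ 1)
    (h : toroidal μ t = toroidal μ' t') : ∃ ν ∈ periods, μ = μ' + ν := by
  obtain ⟨ν, hν, e⟩ := torusLift_toroidal μ μ' ht'
  refine ⟨ν, hν, ?_⟩
  rw [← e]
  have hx : ∀ k, toroidal μ t k = torusPoint (μ' 0) (μ' 1) t' k := fun k => by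
    rw [h, toroidal_eq_torusPoint ht']
  have pos : ∀ {R ρ m m' : ℝ}, 0 ≤ R → 0 < ρ → R * Real.cos m = ρ * Real.cos m' →
      R * Real.sin m = ρ * Real.sin m' → 0 < R := by
    intro R ρ m m' hR hρ h1 h2
    refine hR.lt_of_ne' fun h0 => ?_
    rw [h0, zero_mul] at h1 h2
    have h3 := Real.sin_sq_add_cos_sq m'
    rw [(mul_eq_zero.1 h1.symm).resolve_left hρ.ne', (mul_eq_zero.1 h2.symm).resolve_left hρ.ne'] at h3
    norm_num at h3
  have h0 := pos (Real.sqrt_nonneg _) (cos_toroidal_pos ht') (hx 0) (hx 1)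
  have h1 := pos (Real.sqrt_nonneg _) (sin_toroidal_pos ht') (hx 2) (hx 3)
  rw [← h]
  ext i
  fin_cases i
  · exact (angleLift_self h0 (μ 0)).symm
  · exact (angleLift_self h1 (μ 1)).symm

namespace GoodParameter
variable {Λ : Set Plane} {r C a : ℝ} {W η : Plane → ℝ}

lemma hasReferenceChart (h : GoodParameter Λ r W η C a) (hC : 0 < C) {z : Plane × ℝ}
    (hz : z ∈ profile Λ η a) : HasReferenceChart Λ η (5 * C) a z :=
  (lt_or_ge (Metric.infDist z.1 Λ) (Real.sqrt (neckSize Λ a) / 2)).elim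
    (h.hasReferenceChart_neck hC hz) (h.hasReferenceChart_graph hC hz)

/-- The chart X is arbitrary. Its base point lies in S because the neighbourhood filters agree;
there the reference chart has the same H and ‖∇H‖, and d is invariant under periods. -/
theorem meanCurvature_bound (h : GoodParameter Λ r W η C a) (hC : 0 < C) {X : Plane → Space4}
    {p μ : Plane} {t : ℝ} (hX : IsOrientedChart (approxSolution Λ η a) X p)
    (hXp : X p = toroidal μ t) :
    |meanCurvature X p - cliffordH a| + Metric.infDist μ Λ * meanCurvatureGradNorm X p
      ≤ 5 * C * (neckSize Λ a ^ 2 * Real.log (1 / neckSize Λ a) / Metric.infDist μ Λ ^ 2) := by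
  have hmem : X p ∈ approxSolution Λ η a := by
    have h1 : pure (X p) ≤ 𝓝[approxSolution Λ η a] (X p) := by
      rw [← hX.onto_nhds, ← map_pure]; exact map_mono (pure_le_nhds p)
    exact h1 self_mem_nhdsWithin
  rw [h.approxSolution_eq] at hmem
  obtain ⟨z, hz, e⟩ := hmem
  obtain ⟨ν, hν, rfl⟩ := exists_period_of_toroidal_eq (h.abs_le_one hz) (hXp.symm.trans e)
  rw [h.lattice.infDist_add (h.lattice.periods_subset hν)]
  obtain ⟨Y, q, hY, hYq, hne, hd, hb⟩ := h.hasReferenceChart hC hz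
  obtain ⟨h1, h2⟩ := hX.meanCurvature_congr hY (e.trans hYq.symm) hne hd
  rw [h1, h2]
  exact hb

end GoodParameter

end

theorem mainTheorem3 (τ₁ τ₂ : Plane)
    (hperiod : ∀ i, EuclideanSpace.single i (2 * Real.pi) ∈ planeLattice τ₁ τ₂)
    (hplus : ¬ planeLattice τ₁ τ₂ ⊆ {μ | ∃ k : ℤ, μ 0 + μ 1 = 2 * Real.pi * k})
    (hminus : ¬ planeLattice τ₁ τ₂ ⊆ {μ | ∃ k : ℤ, μ 0 - μ 1 = 2 * Real.pi * k})
    (η : Plane → ℝ) (hη : IsCutoff η) :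
    ∃ C > 0, ∃ a₀ > 0, ∀ a : ℝ, 0 < a → a < a₀ →
      let Λ := planeLattice τ₁ τ₂
      let ε := neckSize Λ a
      let S := approxSolution Λ η a
      -- the surface has an oriented smooth local parametrization at each of its points
      (∀ x ∈ S, ∃ X p, IsOrientedChart S X p ∧ X p = x) ∧
      ∀ X p, IsOrientedChart S X p →
        -- on the torus pieces
        (∀ μ t, X p = toroidal μ t → Real.sqrt ε ≤ Metric.infDist μ Λ →
          |meanCurvature X p - cliffordH a|
              + Metric.infDist μ Λ * meanCurvatureGradNorm X p
            ≤ C * (ε ^ 2 * Real.log (1 / ε) * (Metric.infDist μ Λ ^ 2)⁻¹)) ∧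
        -- on the transition annuli
        (∀ μ t, X p = toroidal μ t → Real.sqrt ε / 2 ≤ Metric.infDist μ Λ →
          Metric.infDist μ Λ ≤ 2 * Real.sqrt ε →
          |meanCurvature X p - cliffordH a|
              + Metric.infDist μ Λ * meanCurvatureGradNorm X p
            ≤ C * ε * Real.log (1 / ε)) ∧
        -- on the necks
        (∀ ν ∈ Λ, ∀ s θ t : ℝ, X p = toroidal (neckBase Λ a ν s θ) t →
          ε * Real.cosh s ≤ Real.sqrt ε →
          |meanCurvature X p - cliffordH a|
              + ε * Real.cosh s * meanCurvatureGradNorm X p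
            ≤ C * Real.log (1 / ε) * (Real.cosh s ^ 2)⁻¹) := by
  obtain ⟨r, hΛ⟩ := isPeriodLattice_planeLattice hperiod
  obtain ⟨W, hW⟩ := greenFunction_spec hΛ (nonResonant_of hplus hminus)
  have hG : GreenExpansion (planeLattice τ₁ τ₂) r W := by
    obtain ⟨w1, w2, w3, w4, w5, w6⟩ := hW
    exact ⟨w1, w2, w3, w4, w5, w6⟩
  obtain ⟨C, hC, a₀, ha₀, hgood⟩ := exists_goodParameter hΛ hG hη
  -- The general constant is 5C; on the annuli d² ≥ ε/4 costs a further factor 4.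
  refine ⟨20 * C, by positivity, a₀, ha₀, fun a ha ha' => ?_⟩
  have h := hgood a ha ha'
  have h0 := h.neck.pos
  have hL := h.neck.one_le_log
  refine ⟨fun x hx => ?_, fun X p hX => ⟨fun μ t hXp hd => ?_, fun μ t hXp hd _ => ?_,
    fun ν hν s θ t hXp hs => ?_⟩⟩
  · rw [h.approxSolution_eq] at hx
    obtain ⟨z, hz, rfl⟩ := hx
    obtain ⟨Y, q, hY, hYq, -⟩ := h.hasReferenceChart hC hz
    exact ⟨Y, q, hY, hYq⟩
  · refine (h.meanCurvature_bound hC hX hXp).trans ?_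
    rw [← div_eq_mul_inv]
    gcongr
    norm_num
  · refine (h.meanCurvature_bound hC hX hXp).trans ?_
    have h1 := pow_le_pow_left₀ (by positivity) hd 2
    rw [div_pow, Real.sq_sqrt h0.le] at h1
    have h2 : neckSize (planeLattice τ₁ τ₂) a ^ 2 * Real.log (1 / neckSize (planeLattice τ₁ τ₂) a)
        / Metric.infDist μ (planeLattice τ₁ τ₂) ^ 2
        ≤ 4 * (neckSize (planeLattice τ₁ τ₂) a * Real.log (1 / neckSize (planeLattice τ₁ τ₂) a)) := by
      refine (div_le_div_of_nonneg_left (by positivity) (by positivity) h1).trans_eq ?_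
      field_simp
      norm_num
    calc _ ≤ 5 * C * (4 * (neckSize (planeLattice τ₁ τ₂) a *
          Real.log (1 / neckSize (planeLattice τ₁ τ₂) a))) := by gcongr
      _ = _ := by ring
  · have h1 := h.meanCurvature_bound hC hX hXp
    rw [h.infDist_neckBase hν θ hs] at h1
    refine h1.trans ?_
    have hc := Real.cosh_pos s
    rw [← div_eq_mul_inv, mul_pow, mul_div_mul_left _ _ (pow_ne_zero 2 h0.ne'), mul_div_assoc]
    gcongr
    norm_num
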